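/- Let $n\in\{2,3\}$, let $\Omega\subset\mathbb R^n$ be a bounded convex polygonal (polyhedral) domain, let $\zeta\in W^{1,\infty}(\Omega)^n$ (with its representative continuous on $\overline\Omega$) and $0\le\gamma\in W^{1,\infty}(\Omega)$ satisfy $\gamma-\tfrac12\nabla\cdot\zeta\ge\gamma_0>0$ a.e. in $\Omega$, and let $k\ge 0$ be an integer. For $\beta>0$ and $f,g\in L_2(\Omega)$ let $(\boldsymbol q,y)$, $(\boldsymbol p,p)$ solve $$\boldsymbol p+\nabla p=0,\qquad \beta^{1/2}\big(\nabla\cdot\boldsymbol p-\nabla\cdot(\zeta p)+\gamma p\big)+y=f,\qquad \boldsymbol q+\nabla y=0,\qquad \beta^{1/2}\big(\nabla\cdot\boldsymbol q+\zeta\cdot\nabla y+\gamma y\big)-p=g\quad\text{in }\Omega,$$ $p=y=0$ on $\partial\Omega$, and assume that the solution is smooth enough that $y,p\in C(\overline\Omega)\cap H^{k+1}(\Omega)$ and $\boldsymbol q,\boldsymbol p\in H^{k+1}(\Omega)^n$. Let $\mathcal T_h$ be a quasi-uniform, shape-regular, conforming simplicial triangulation of $\overline\Omega$, $h=\max_K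 \operatorname{diam} K$. Let $\boldsymbol V_h$, $W_h$ be the spaces of elementwise polynomial vector fields and functions of degree $\le k$, and $\Lambda_h^0$ the space of functions on the skeleton that are polynomials of degree $\le k$ on each edge/face and vanish on $\partial\Omega$. Write $(\cdot,\cdot)_{\mathcal T_h}=\sum_K\int_K$ and $\langle\cdot,\cdot\rangle_{\partial\mathcal T_h}=\sum_K\int_{\partial K}$, with $\boldsymbol n$ the outward unit normal of $K$. Let the stabilizers $\tau_1,\tau_2$ satisfy, with positive constants $C_1,C^*,c_0$: * $\tau_1$ is a positive constant on each face of each element (it may differ on the two sides of a face), and $\tau_1\le C_1$; * $\tau_1=\tau_2+\zeta\cdot\boldsymbol n$ on $\partial\mathcal T_h$; * $\inf_{x\in e}(\tau_1-\tfrac12\zeta\cdot\boldsymbol n)\ge C^*\max_{x\in e}|\zeta\cdot\boldsymbol n|$ and $\inf_{x\in e}(\tau_1-\tfrac12\zeta\cdot\boldsymbol n)\ge c_0$ for every face $e\subset\partial K$ and every $K\in\mathcal T_h$. Let $(\boldsymbol q_h,y_h,\widehat y_h),(\boldsymbol p_h,p_h,\widehat p_h)\in\boldsymbol V_h\times W_h\times\Lambda_h^0$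 be the HDG solution, i.e. for all $\boldsymbol r\in\boldsymbol V_h$, $w\in W_h$, $\mu\in\Lambda_h^0$, $$\begin{aligned} &\beta^{1/2}\big[(\boldsymbol q_h,\boldsymbol r)_{\mathcal T_h}-(y_h,\nabla\cdot\boldsymbol r)_{\mathcal T_h}+\langle\widehat y_h,\boldsymbol r\cdot\boldsymbol n\rangle_{\partial\mathcal T_h}\big]=0,\qquad \beta^{1/2}\big[(\boldsymbol p_h,\boldsymbol r)_{\mathcal T_h}-(p_h,\nabla\cdot\boldsymbol r)_{\mathcal T_h}+\langle\widehat p_h,\boldsymbol r\cdot\boldsymbol n\rangle_{\partial\mathcal T_h}\big]=0,\\ &\beta^{1/2}\big[(\nabla\cdot\boldsymbol q_h,w)_{\mathcal T_h}-(y_h,\zeta\cdot\nabla w)_{\mathcal T_h}+((\gamma-\nabla\cdot\zeta)y_h,w)_{\mathcal T_h}+\langle\tau_1y_h+(\zeta\cdot\boldsymbol n-\tau_1)\widehat y_h,w\rangle_{\partial\mathcal T_h}\big]-(p_h,w)_{\mathcal T_h}=(g,w)_{\mathcal T_h},\\ &\beta^{1/2}\big[(\nabla\cdot\boldsymbol p_h,w)_{\mathcal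 T_h}+(p_h,\zeta\cdot\nabla w)_{\mathcal T_h}+(\gamma p_h,w)_{\mathcal T_h}+\langle\tau_2p_h-(\tau_2+\zeta\cdot\boldsymbol n)\widehat p_h,w\rangle_{\partial\mathcal T_h}\big]+(y_h,w)_{\mathcal T_h}=(f,w)_{\mathcal T_h},\\ &-\beta^{1/2}\langle\boldsymbol q_h\cdot\boldsymbol n+\tau_1y_h+(\zeta\cdot\boldsymbol n-\tau_1)\widehat y_h,\mu\rangle_{\partial\mathcal T_h}=0,\qquad -\beta^{1/2}\langle\boldsymbol p_h\cdot\boldsymbol n+\tau_2p_h-(\zeta\cdot\boldsymbol n+\tau_2)\widehat p_h,\mu\rangle_{\partial\mathcal T_h}=0. \end{aligned}$$ Define $$\|(\boldsymbol r,w,\mu)\|_{1,\beta}^2=\beta^{1/2}\Big(\|\boldsymbol r\|_{\mathcal T_h}^2+\|w\|_{\mathcal T_h}^2+\big\||\tau_1-\tfrac12\zeta\cdot\boldsymbol n|^{1/2}(w-\mu)\big\|_{\partial\mathcal T_h}^2\Big)+\|w\|_{\mathcal T_h}^2 .$$ Then $$\|(\boldsymbol q-\boldsymbol q_h,y-y_h,y-\widehat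 y_h)\|_{1,\beta}+\|(\boldsymbol p-\boldsymbol p_h,p-p_h,p-\widehat p_h)\|_{1,\beta}\le C\big(\beta^{1/4}h^{k+1/2}+h^{k+1}\big)\big(|p|_{k+1}+|\boldsymbol p|_{k+1}+|y|_{k+1}+|\boldsymbol q|_{k+1}\big),$$ where $|\cdot|_{k+1}$ is the $H^{k+1}(\Omega)$ seminorm and the constant $C>0$ is independent of $h$, of the mesh and of $\beta$: it depends only on $n,\Omega,k,\zeta,\gamma,\gamma_0$, on the shape-regularity and quasi-uniformity constants, and on $C_1,C^*,c_0$ (not on the particular $\tau_1,\tau_2$, $f,g$ or the solutions). -/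

import Mathlib

open MeasureTheory
open scoped ENNReal ContDiff RealInnerProductSpace

noncomputable section

namespace HDG

/-- The Euclidean space `ℝⁿ`. -/
abbrev Pt (n : ℕ) : Type := EuclideanSpace ℝ (Fin n)

/-- The `i`-th standard basis vector of `ℝⁿ`. -/
def unitVec {n : ℕ} (i : Fin n) : Pt n := EuclideanSpace.single i (1 : ℝ)

/-! ### Weak derivatives and Sobolev spaces on an open set -/

/-- Test functions: smooth functions with compact support contained in `Ω`. -/
structure IsTestFunction {n : ℕ} (Ω : Set (Pt n)) (φ : Pt n → ℝ) : Prop where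
  smooth : ContDiff ℝ ∞ φ
  compactSupport : HasCompactSupport φ
  support_subset : tsupport φ ⊆ Ω

/-- `v` is the weak derivative `∂_{α 0} ⋯ ∂_{α (m-1)} u` on `Ω`. -/
structure HasWeakDeriv {n : ℕ} (Ω : Set (Pt n)) {m : ℕ} (α : Fin m → Fin n)
    (u v : Pt n → ℝ) : Prop where
  locInt : LocallyIntegrableOn u Ω volume
  locInt_deriv : LocallyIntegrableOn v Ω volume
  integral_eq : ∀ φ : Pt n → ℝ, IsTestFunction Ω φ →
    ∫ x in Ω, u x * iteratedFDeriv ℝ m φ x (fun j => unitVec (α j))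
      = (-1) ^ m * ∫ x in Ω, v x * φ x

/-- `G` is the weak gradient of `u` on `Ω`. -/
def HasWeakGradient {n : ℕ} (Ω : Set (Pt n)) (u : Pt n → ℝ) (G : Pt n → Pt n) : Prop :=
  ∀ i : Fin n, HasWeakDeriv Ω ![i] u (fun x => G x i)

/-- `d` is the weak divergence of the vector field `V` on `Ω`. -/
structure HasWeakDiv {n : ℕ} (Ω : Set (Pt n)) (V : Pt n → Pt n) (d : Pt n → ℝ) : Prop where
  locInt : LocallyIntegrableOn V Ω volume
  locInt_div : LocallyIntegrableOn d Ω volume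
  integral_eq : ∀ φ : Pt n → ℝ, IsTestFunction Ω φ →
    ∫ x in Ω, fderiv ℝ φ x (V x) = - ∫ x in Ω, d x * φ x

/-- The Sobolev space `H^m(Ω)`. -/
def MemH {n : ℕ} (Ω : Set (Pt n)) (m : ℕ) (u : Pt n → ℝ) : Prop :=
  MemLp u 2 (volume.restrict Ω) ∧
    ∀ j ≤ m, ∀ α : Fin j → Fin n,
      ∃ v : Pt n → ℝ, MemLp v 2 (volume.restrict Ω) ∧ HasWeakDeriv Ω α u v

/-- The Sobolev space `H^m(Ω)ⁿ` of vector fields. -/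
def MemHVec {n : ℕ} (Ω : Set (Pt n)) (m : ℕ) (V : Pt n → Pt n) : Prop :=
  ∀ i : Fin n, MemH Ω m (fun x => V x i)

/-- The Sobolev space `W^{1,∞}(Ω)`. -/
def MemW1inf {n : ℕ} (Ω : Set (Pt n)) (u : Pt n → ℝ) : Prop :=
  MemLp u ∞ (volume.restrict Ω) ∧
    ∀ i : Fin n, ∃ v : Pt n → ℝ, MemLp v ∞ (volume.restrict Ω) ∧ HasWeakDeriv Ω ![i] u v

open Classical in
/-- The weak derivative `∂_{α 0} ⋯ ∂_{α (m-1)} u` on `Ω`, determined up to a null set; it is `0`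
when there is none. -/
def weakDeriv {n : ℕ} (Ω : Set (Pt n)) {m : ℕ} (α : Fin m → Fin n) (u : Pt n → ℝ) :
    Pt n → ℝ :=
  if h : ∃ v : Pt n → ℝ, HasWeakDeriv Ω α u v then h.choose else 0

/-- The square `|u|²_{H^m(Ω)}` of the Sobolev seminorm: the integral over `Ω` of the squared
Euclidean (Frobenius) norm of the tensor `D^m u` of all weak derivatives of order `m`. -/
def seminormSq {n : ℕ} (Ω : Set (Pt n)) (m : ℕ) (u : Pt n → ℝ) : ℝ :=
  ∑ α : Fin m → Fin n, ∫ x in Ω, weakDeriv Ω α u x ^ 2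

/-- The Sobolev seminorm `|u|_{H^m(Ω)}`. -/
def seminormH {n : ℕ} (Ω : Set (Pt n)) (m : ℕ) (u : Pt n → ℝ) : ℝ :=
  Real.sqrt (seminormSq Ω m u)

/-- The Sobolev seminorm `|V|_{H^m(Ω)}` of a vector field. -/
def seminormHVec {n : ℕ} (Ω : Set (Pt n)) (m : ℕ) (V : Pt n → Pt n) : ℝ :=
  Real.sqrt (∑ i : Fin n, seminormSq Ω m (fun x => V x i))

/-! ### The continuous problem -/

/-- Bounded convex polygonal (polyhedral) domains. -/
structure IsConvexPolytopeDomain {n : ℕ} (Ω : Set (Pt n)) : Prop where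
  isOpen : IsOpen Ω
  nonempty : Ω.Nonempty
  convex : Convex ℝ Ω
  polytope : ∃ V : Finset (Pt n), closure Ω = convexHull ℝ (V : Set (Pt n))

/-- The first-order optimality system for the state `(qv, y)` and the adjoint state `(pv, p)`:
`pv + ∇p = 0`, `β^{1/2} (∇·pv - ∇·(ζ p) + γ p) + y = f`, `p = 0` on `∂Ω`,
`qv + ∇y = 0`, `β^{1/2} (∇·qv + ζ·∇y + γ y) - p = g`, `y = 0` on `∂Ω`.
The differential operators are weak ones and the equations hold almost everywhere in `Ω`;
`y` and `p` are the representatives that are continuous up to the boundary. -/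
structure SolvesOptimalitySystem {n : ℕ} (Ω : Set (Pt n)) (β : ℝ) (ζ : Pt n → Pt n)
    (γ f g : Pt n → ℝ) (qv : Pt n → Pt n) (y : Pt n → ℝ) (pv : Pt n → Pt n) (p : Pt n → ℝ) :
    Prop where
  adjoint_continuous : ContinuousOn p (closure Ω)
  adjoint_flux : ∃ Gp : Pt n → Pt n, HasWeakGradient Ω p Gp ∧
    ∀ᵐ x ∂volume.restrict Ω, pv x + Gp x = 0
  adjoint_eq : ∃ dp dζp : Pt n → ℝ, HasWeakDiv Ω pv dp ∧
    HasWeakDiv Ω (fun x => p x • ζ x) dζp ∧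
    ∀ᵐ x ∂volume.restrict Ω, Real.sqrt β * (dp x - dζp x + γ x * p x) + y x = f x
  adjoint_boundary : ∀ x ∈ frontier Ω, p x = 0
  state_continuous : ContinuousOn y (closure Ω)
  state_eq : ∃ (Gy : Pt n → Pt n) (dq : Pt n → ℝ), HasWeakGradient Ω y Gy ∧
    HasWeakDiv Ω qv dq ∧
    (∀ᵐ x ∂volume.restrict Ω, qv x + Gy x = 0) ∧
    ∀ᵐ x ∂volume.restrict Ω, Real.sqrt β * (dq x + ⟪ζ x, Gy x⟫ + γ x * y x) - p x = g x
  state_boundary : ∀ x ∈ frontier Ω, y x = 0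

/-! ### Triangulations -/

/-- A (conforming) simplicial triangulation of the closure of `Ω`. -/
structure Triangulation {n : ℕ} (Ω : Set (Pt n)) where
  complex : Geometry.SimplicialComplex ℝ (Pt n)
  finite_faces : complex.faces.Finite
  space_eq : complex.space = closure Ω

namespace Triangulation

variable {n : ℕ} {Ω : Set (Pt n)}

/-- The elements `K ∈ 𝒯_h`, each given by its `n + 1` vertices. -/
def Cell (T : Triangulation Ω) : Type :=
  {s : Finset (Pt n) // s ∈ T.complex.faces ∧ s.card = n + 1}

/-- The edges (faces) `e ∈ ℰ_h`, each given by its `n` vertices. -/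
def Face (T : Triangulation Ω) : Type :=
  {e : Finset (Pt n) // e ∈ T.complex.faces ∧ e.card = n}

/-- The pairs `(K, e)` of an element `K` and a face `e` of `K`, that is, the disjoint union of the
boundaries of all elements. -/
def HalfFace (T : Triangulation Ω) : Type :=
  {P : T.Cell × T.Face // P.2.1 ⊆ P.1.1}

theorem finite_cell (T : Triangulation Ω) : Finite T.Cell :=
  Set.Finite.to_subtype (s := {s | s ∈ T.complex.faces ∧ s.card = n + 1})
    (T.finite_faces.subset fun _ hs => hs.1)

theorem finite_face (T : Triangulation Ω) : Finite T.Face :=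
  Set.Finite.to_subtype (s := {s | s ∈ T.complex.faces ∧ s.card = n})
    (T.finite_faces.subset fun _ hs => hs.1)

theorem finite_halfFace (T : Triangulation Ω) : Finite T.HalfFace :=
  haveI := T.finite_cell
  haveI := T.finite_face
  Subtype.finite

instance (T : Triangulation Ω) : Fintype T.Cell := @Fintype.ofFinite _ T.finite_cell

instance (T : Triangulation Ω) : Fintype T.HalfFace := @Fintype.ofFinite _ T.finite_halfFace

/-- The closed simplex `K` as a set of points. -/
def Cell.carrier {T : Triangulation Ω} (K : T.Cell) : Set (Pt n) :=
  convexHull ℝ (K.1 : Set (Pt n))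

/-- The closed face `e` as a set of points. -/
def Face.carrier {T : Triangulation Ω} (e : T.Face) : Set (Pt n) :=
  convexHull ℝ (e.1 : Set (Pt n))

/-- The element `K` of a pair `(K, e)`. -/
def HalfFace.cell {T : Triangulation Ω} (F : T.HalfFace) : T.Cell := F.1.1

/-- The face `e` of a pair `(K, e)`. -/
def HalfFace.face {T : Triangulation Ω} (F : T.HalfFace) : T.Face := F.1.2

/-- A vector normal to `e` that points out of `K`: the component orthogonal to `e` of the vector
from the barycentre of `K` to the barycentre of `e`. -/
def HalfFace.outwardVec {T : Triangulation Ω} (F : T.HalfFace) : Pt n :=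
  (vectorSpan ℝ (F.face.1 : Set (Pt n)))ᗮ.starProjection
    (F.face.1.centroid ℝ id - F.cell.1.centroid ℝ id)

/-- The outward unit normal `n` of `K` on `e`. -/
def HalfFace.normal {T : Triangulation Ω} (F : T.HalfFace) : Pt n :=
  ‖F.outwardVec‖⁻¹ • F.outwardVec

/-- The mesh diameter `h = max_K h_K`. -/
def meshSize (T : Triangulation Ω) : ℝ := ⨆ K : T.Cell, Metric.diam K.carrier

/-- Shape regularity with constant `σ`: every `K` contains a ball of radius `σ h_K`. -/
def ShapeRegular (T : Triangulation Ω) (σ : ℝ) : Prop :=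
  ∀ K : T.Cell, ∃ c : Pt n, Metric.closedBall c (σ * Metric.diam K.carrier) ⊆ K.carrier

/-- Quasi-uniformity with constant `ρ`: `ρ h ≤ h_K` for every `K`. -/
def QuasiUniform (T : Triangulation Ω) (ρ : ℝ) : Prop :=
  ∀ K : T.Cell, ρ * T.meshSize ≤ Metric.diam K.carrier

/-! ### Discrete spaces -/

/-- A function on `ℝⁿ` that is a polynomial of total degree at most `k`. -/
def _root_.HDG.IsPoly (k : ℕ) (u : Pt n → ℝ) : Prop :=
  ∃ P : MvPolynomial (Fin n) ℝ, P.totalDegree ≤ k ∧ ∀ x, u x = MvPolynomial.eval (fun i => x i) P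

/-- The space `V_h`: a polynomial vector field of degree at most `k` for every element `K`, its
value on `K`. -/
def MemV (T : Triangulation Ω) (k : ℕ) (r : T.Cell → Pt n → Pt n) : Prop :=
  ∀ K, ∀ i : Fin n, IsPoly k (fun x => r K x i)

/-- The space `W_h`: a polynomial of degree at most `k` for every element `K`, its value on `K`. -/
def MemW (T : Triangulation Ω) (k : ℕ) (w : T.Cell → Pt n → ℝ) : Prop :=
  ∀ K, IsPoly k (w K)

/-- The space `Λ_h^0`: a polynomial of degree at most `k` for every face `e`, whose restriction to
`e` is the value on `e`, and which vanishes on the faces that lie on `∂Ω`. -/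
def MemLambda0 (T : Triangulation Ω) (k : ℕ) (μ : T.Face → Pt n → ℝ) : Prop :=
  (∀ e, IsPoly k (μ e)) ∧ ∀ e : T.Face, e.carrier ⊆ frontier Ω → ∀ x ∈ e.carrier, μ e x = 0

/-- The product `(η, ξ)_{𝒯_h}` of scalar functions. -/
def innerCell (T : Triangulation Ω) (η ξ : T.Cell → Pt n → ℝ) : ℝ :=
  ∑ K : T.Cell, ∫ x in K.carrier, η K x * ξ K x

/-- The product `(η, ξ)_{𝒯_h}` of vector fields. -/
def innerCellVec (T : Triangulation Ω) (η ξ : T.Cell → Pt n → Pt n) : ℝ :=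
  ∑ K : T.Cell, ∫ x in K.carrier, ⟪η K x, ξ K x⟫

/-- The product `⟨η, ξ⟩_{∂𝒯_h}`, the integrals over the faces being with respect to the surface
measure, that is, the normalized `(n-1)`-dimensional Hausdorff measure. -/
def innerBdry (T : Triangulation Ω) (η ξ : T.HalfFace → Pt n → ℝ) : ℝ :=
  ∑ F : T.HalfFace, ∫ x in F.face.carrier, η F x * ξ F x ∂(μHE[n - 1] : Measure (Pt n))

/-- The traces on the boundaries of the elements of a function given element by element. -/
def cellTrace {T : Triangulation Ω} (w : T.Cell → Pt n → ℝ) : T.HalfFace → Pt n → ℝ :=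
  fun F => w F.cell

/-- The values on the boundaries of the elements of a function given face by face. -/
def faceTrace {T : Triangulation Ω} (μ : T.Face → Pt n → ℝ) : T.HalfFace → Pt n → ℝ :=
  fun F => μ F.face

/-- The normal component `r · n` on the boundaries of the elements. -/
def normalTrace {T : Triangulation Ω} (r : T.Cell → Pt n → Pt n) : T.HalfFace → Pt n → ℝ :=
  fun F x => ⟪r F.cell x, F.normal⟫

/-- The normal component `ζ · n` on the boundaries of the elements. -/
def zetaN (T : Triangulation Ω) (ζ : Pt n → Pt n) : T.HalfFace → Pt n → ℝ :=
  fun F x => ⟪ζ x, F.normal⟫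

/-- The elementwise divergence `∇ · r`. -/
def divCell {T : Triangulation Ω} (r : T.Cell → Pt n → Pt n) : T.Cell → Pt n → ℝ :=
  fun K x => ∑ i : Fin n, fderiv ℝ (r K) x (unitVec i) i

/-- The elementwise directional derivative `ζ · ∇w`. -/
def zetaGrad {T : Triangulation Ω} (ζ : Pt n → Pt n) (w : T.Cell → Pt n → ℝ) :
    T.Cell → Pt n → ℝ :=
  fun K x => fderiv ℝ (w K) x (ζ x)

/-! ### The method -/

/-- The assumptions on the stabilizers, with constants `C₁` and `Cstar`. On every face of every
element `τ₁` is a positive constant, possibly a different one from the two sides of a face. -/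
structure StabilizerAssumption (T : Triangulation Ω) (ζ : Pt n → Pt n) (C₁ Cstar : ℝ)
    (τ₁ : T.HalfFace → ℝ) (τ₂ : T.HalfFace → Pt n → ℝ) : Prop where
  pos : ∀ F, 0 < τ₁ F
  le : ∀ F, τ₁ F ≤ C₁
  rel : ∀ F, ∀ x ∈ F.face.carrier, τ₁ F = τ₂ F x + T.zetaN ζ F x
  lower : ∀ F, ∀ x ∈ F.face.carrier, ∀ x' ∈ F.face.carrier,
    Cstar * |T.zetaN ζ F x'| ≤ τ₁ F - 1 / 2 * T.zetaN ζ F x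

/-- `((qh, yh, yhat), (ph, sh, phat))` solves the HDG equations: `qh`, `ph` are the discrete fluxes
and `yh`, `sh` the discrete state and adjoint state. Here `divζ` is the divergence of `ζ`. -/
structure IsHDGSolution (T : Triangulation Ω) (k : ℕ) (β : ℝ) (ζ : Pt n → Pt n)
    (divζ γ f g : Pt n → ℝ) (τ₁ : T.HalfFace → ℝ) (τ₂ : T.HalfFace → Pt n → ℝ)
    (qh : T.Cell → Pt n → Pt n) (yh : T.Cell → Pt n → ℝ) (yhat : T.Face → Pt n → ℝ)
    (ph : T.Cell → Pt n → Pt n) (sh : T.Cell → Pt n → ℝ) (phat : T.Face → Pt n → ℝ) :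
    Prop where
  mem_qh : T.MemV k qh
  mem_yh : T.MemW k yh
  mem_yhat : T.MemLambda0 k yhat
  mem_ph : T.MemV k ph
  mem_sh : T.MemW k sh
  mem_phat : T.MemLambda0 k phat
  eq_q : ∀ r, T.MemV k r →
    Real.sqrt β * T.innerCellVec qh r - Real.sqrt β * T.innerCell yh (divCell r)
      + Real.sqrt β * T.innerBdry (faceTrace yhat) (normalTrace r) = 0
  eq_p : ∀ r, T.MemV k r →
    Real.sqrt β * T.innerCellVec ph r - Real.sqrt β * T.innerCell sh (divCell r)
      + Real.sqrt β * T.innerBdry (faceTrace phat) (normalTrace r) = 0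
  eq_state : ∀ w, T.MemW k w →
    Real.sqrt β * T.innerCell (divCell qh) w - Real.sqrt β * T.innerCell yh (zetaGrad ζ w)
      + Real.sqrt β * T.innerCell (fun K x => (γ x - divζ x) * yh K x) w
      - T.innerCell sh w
      + Real.sqrt β * T.innerBdry (fun F x => τ₁ F * cellTrace yh F x) (cellTrace w)
      + Real.sqrt β * T.innerBdry
          (fun F x => (T.zetaN ζ F x - τ₁ F) * faceTrace yhat F x) (cellTrace w)
      = T.innerCell (fun _ x => g x) w
  eq_adjoint : ∀ w, T.MemW k w →
    Real.sqrt β * T.innerCell (divCell ph) w + Real.sqrt β * T.innerCell sh (zetaGrad ζ w)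
      + Real.sqrt β * T.innerCell (fun K x => γ x * sh K x) w
      + T.innerCell yh w
      + Real.sqrt β * T.innerBdry (fun F x => τ₂ F x * cellTrace sh F x) (cellTrace w)
      - Real.sqrt β * T.innerBdry
          (fun F x => (τ₂ F x + T.zetaN ζ F x) * faceTrace phat F x) (cellTrace w)
      = T.innerCell (fun _ x => f x) w
  eq_yhat : ∀ μ, T.MemLambda0 k μ →
    - (Real.sqrt β * T.innerBdry (normalTrace qh) (faceTrace μ))
      - Real.sqrt β * T.innerBdry (fun F x => τ₁ F * cellTrace yh F x) (faceTrace μ)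
      - Real.sqrt β * T.innerBdry
          (fun F x => (T.zetaN ζ F x - τ₁ F) * faceTrace yhat F x) (faceTrace μ) = 0
  eq_phat : ∀ μ, T.MemLambda0 k μ →
    - (Real.sqrt β * T.innerBdry (normalTrace ph) (faceTrace μ))
      - Real.sqrt β * T.innerBdry (fun F x => τ₂ F x * cellTrace sh F x) (faceTrace μ)
      + Real.sqrt β * T.innerBdry
          (fun F x => (T.zetaN ζ F x + τ₂ F x) * faceTrace phat F x) (faceTrace μ) = 0

/-- The scaled energy norm `‖(r, w, μ)‖_{1,β}` of a vector field `r` and a function `w` given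
element by element and a function `μ` given face by face. -/
def energyNorm (T : Triangulation Ω) (β : ℝ) (ζ : Pt n → Pt n) (τ₁ : T.HalfFace → ℝ)
    (r : T.Cell → Pt n → Pt n) (w : T.Cell → Pt n → ℝ) (μ : T.Face → Pt n → ℝ) : ℝ :=
  Real.sqrt
    (Real.sqrt β *
        (T.innerCellVec r r + T.innerCell w w +
          T.innerBdry (fun F x => |τ₁ F - 1 / 2 * T.zetaN ζ F x|
              * (cellTrace w F x - faceTrace μ F x))
            (fun F x => cellTrace w F x - faceTrace μ F x))
      + T.innerCell w w)

end Triangulation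

end HDG

end

/-! The discrete solution is compared with the L² projections of the exact solution onto the
discrete spaces, on elements and on faces. Let a and a* be the bilinear forms of the discrete state
and adjoint equations (`stateForm`, `adjointForm`), tested with pairs (w, μ) from W_h × Λ_h^0. Since
div r and r · n are polynomials of degree at most k for every r in V_h, the projections satisfy the
first two discrete equations exactly (`fluxRelation_proj`). For the projected errors e_y of the
state and e_p of the adjoint state, the remaining equations therefore read √β a(e_y; w, μ) - (e_p,
w) = -√β R_y(w, μ) and √β a*(e_p; w, μ) + (e_y, w) = -√β R_p(w, μ), where the residuals contain
projection errors only (`state_error_eq`, `adjoint_error_eq`).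

Two choices of test functions suffice. Testing each equation with its own error and adding cancels
the coupling terms. What remains on the left is √β times the energies of both errors: the squared
fluxes, the scalar errors weighted with γ - 1/2 div ζ, and the jumps on faces weighted with τ₁ - 1/2
ζ · n (`stateForm_self`, `adjointForm_self`). By coercivity they are bounded by the residuals,
without any β. Testing each equation with the error of the other and subtracting cancels the forms,
because a*(e_p; e_y) = a(e_y; e_p) (`adjointForm_eq_stateForm`). This leaves ‖e_y‖² + ‖e_p‖² equal
to √β times residuals, so the unweighted L² terms inherit the factor √β. The elementary conclusion
is `energy_add_le_of_residual_le`.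

The residuals satisfy R(w, μ)² ≤ C h^(2k+1) (‖w‖² + ‖w - μ‖²) with squared seminorms of the solution
in the constant. For the fluxes, only (q - Πq) · n tested with w - μ is left, because the normal
flux of q cancels between neighbouring elements (`exists_fluxDefect_sq_le`). In the convective
volume term, orthogonality allows ζ to be replaced by its deviation from a constant on each element;
this deviation is of order h and compensates the inverse inequality for the gradient of w
(`exists_scalarDefect_sq_le`). Traces of projection errors are of order h^(k+1/2), which together
with √β gives β^(1/4) h^(k+1/2); the term h^(k+1) is the unweighted L² error of the projection
itself.

The analytic ingredients are derived from scratch. The divergence theorem on a simplex follows from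
radial fields on cones (`integral_cone_radial`, `integral_cell_fderiv`), and it yields the trace
inequality and the cancellation of normals on interior faces (`sum_normal_eq_zero`). The
Bramble–Hilbert estimate comes from Taylor polynomials with a well chosen base point
(`exists_isPoly_approx`), the inverse inequality from finite dimensionality and scaling. Everything
is proved first for smooth functions. It passes to Sobolev functions by a smoothing operator that
contracts the convex domain towards an interior point and mollifies; it commutes with weak
derivatives up to a factor tending to 1, up to the boundary. The fluxes are not assumed to be
continuous, so their traces are avoided by estimating the smooth approximations and passing to the
limit in volume terms only. -/

namespace HDG

/-! ### Polynomial functions -/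

section Polynomials

variable {n k : ℕ}

/-- Evaluation of polynomials as a linear map into functions on `ℝⁿ`. -/
noncomputable def evalFun (n : ℕ) : MvPolynomial (Fin n) ℝ →ₗ[ℝ] (Pt n → ℝ) where
  toFun P x := MvPolynomial.eval (fun i => x i) P
  map_add' P Q := by ext x; simp
  map_smul' c P := by ext x; simp [MvPolynomial.smul_eval]

/-- The space of polynomial functions of degree at most `k`. -/
noncomputable def polySpace (n k : ℕ) : Submodule ℝ (Pt n → ℝ) :=
  (MvPolynomial.restrictTotalDegree (Fin n) ℝ k).map (evalFun n)

theorem mem_polySpace {u : Pt n → ℝ} : u ∈ polySpace n k ↔ IsPoly k u := by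
  constructor
  · rintro ⟨P, hP, rfl⟩
    exact ⟨P, (MvPolynomial.mem_restrictTotalDegree _ _ _).1 hP, fun x => rfl⟩
  · rintro ⟨P, hP, h⟩
    exact ⟨P, (MvPolynomial.mem_restrictTotalDegree _ _ _).2 hP, (funext h).symm⟩

instance : FiniteDimensional ℝ (polySpace n k) := by
  unfold polySpace; infer_instance

theorem IsPoly.add {u v : Pt n → ℝ} (hu : IsPoly k u) (hv : IsPoly k v) :
    IsPoly k (fun x => u x + v x) :=
  mem_polySpace.1 ((polySpace n k).add_mem (mem_polySpace.2 hu) (mem_polySpace.2 hv))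

theorem IsPoly.sub {u v : Pt n → ℝ} (hu : IsPoly k u) (hv : IsPoly k v) :
    IsPoly k (fun x => u x - v x) :=
  mem_polySpace.1 ((polySpace n k).sub_mem (mem_polySpace.2 hu) (mem_polySpace.2 hv))

theorem IsPoly.const_mul {u : Pt n → ℝ} (c : ℝ) (hu : IsPoly k u) :
    IsPoly k (fun x => c * u x) :=
  mem_polySpace.1 ((polySpace n k).smul_mem c (mem_polySpace.2 hu))

theorem IsPoly.mul_const {u : Pt n → ℝ} (hu : IsPoly k u) (c : ℝ) :
    IsPoly k (fun x => u x * c) := by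
  simpa [mul_comm] using hu.const_mul c

theorem IsPoly.zero : IsPoly k (fun _ : Pt n => (0 : ℝ)) :=
  mem_polySpace.1 (polySpace n k).zero_mem

theorem IsPoly.sum {ι : Type*} (s : Finset ι) {u : ι → Pt n → ℝ}
    (hu : ∀ i ∈ s, IsPoly k (u i)) : IsPoly k (fun x => ∑ i ∈ s, u i x) := by
  have := (polySpace n k).sum_mem (t := s) (f := u) fun i hi => mem_polySpace.2 (hu i hi)
  convert mem_polySpace.1 this using 1
  ext x; simp

theorem IsPoly.inner_const {r : Pt n → Pt n} (hr : ∀ i, IsPoly k (fun x => r x i)) (a : Pt n) :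
    IsPoly k (fun x => ⟪r x, a⟫) := by
  have : (fun x => ⟪r x, a⟫) = fun x => ∑ i, r x i * a i := by
    ext x; simp [PiLp.inner_apply, mul_comm]
  rw [this]
  exact IsPoly.sum _ fun i _ => (hr i).mul_const _

/-- Identifying the analytic derivative with the formal one shows that differentiation does not
leave the polynomials of degree at most k. -/
theorem hasFDerivAt_evalFun (P : MvPolynomial (Fin n) ℝ) (x : Pt n) :
    HasFDerivAt (evalFun n P)
      (∑ i, (evalFun n (MvPolynomial.pderiv i P) x) •
        (EuclideanSpace.proj i : Pt n →L[ℝ] ℝ)) x := by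
  induction P using MvPolynomial.induction_on with
  | C a =>
    have : evalFun n (MvPolynomial.C a) = fun _ => a := by ext; simp [evalFun]
    rw [this]
    simpa [evalFun] using hasFDerivAt_const a x
  | add p q hp hq =>
    rw [map_add]
    exact (hp.add hq).congr_fderiv (by simp [add_smul, Finset.sum_add_distrib])
  | mul_X p i hp =>
    have h1 : evalFun n (p * MvPolynomial.X i) = fun y => evalFun n p y * y i := by
      ext; simp [evalFun]
    rw [h1]
    have h2 : HasFDerivAt (fun y : Pt n => y i) (EuclideanSpace.proj i : Pt n →L[ℝ] ℝ) x :=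
      (EuclideanSpace.proj i : Pt n →L[ℝ] ℝ).hasFDerivAt
    refine (hp.mul h2).congr_fderiv ?_
    have h3 : ∀ j, evalFun n (MvPolynomial.pderiv j (p * MvPolynomial.X i)) x
        = (if j = i then evalFun n p x else 0) + x i * evalFun n (MvPolynomial.pderiv j p) x := by
      intro j
      by_cases h : j = i
      · subst h; simp [evalFun]
      · simp [evalFun, h, Ne.symm h]
    simp_rw [h3, add_smul, Finset.sum_add_distrib, Finset.smul_sum, smul_smul]
    simp

theorem contDiff_evalFun (P : MvPolynomial (Fin n) ℝ) : ContDiff ℝ ∞ (evalFun n P) := by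
  induction P using MvPolynomial.induction_on with
  | C a =>
    have : evalFun n (MvPolynomial.C a) = fun _ => a := by ext; simp [evalFun]
    rw [this]; exact contDiff_const
  | add p q hp hq => rw [map_add]; exact hp.add hq
  | mul_X p i hp =>
    have h1 : evalFun n (p * MvPolynomial.X i)
        = fun y => evalFun n p y * (EuclideanSpace.proj i : Pt n →L[ℝ] ℝ) y := by
      ext; simp [evalFun]
    rw [h1]
    exact hp.mul (EuclideanSpace.proj i : Pt n →L[ℝ] ℝ).contDiff

theorem IsPoly.contDiff {u : Pt n → ℝ} (hu : IsPoly k u) : ContDiff ℝ ∞ u := by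
  obtain ⟨P, -, h⟩ := hu
  have : u = evalFun n P := funext h
  rw [this]; exact contDiff_evalFun P

theorem IsPoly.continuous {u : Pt n → ℝ} (hu : IsPoly k u) : Continuous u := hu.contDiff.continuous

theorem totalDegree_pderiv_le (P : MvPolynomial (Fin n) ℝ) (i : Fin n) :
    (MvPolynomial.pderiv i P).totalDegree ≤ P.totalDegree := by
  classical
  conv_lhs => rw [P.as_sum, map_sum]
  refine (MvPolynomial.totalDegree_finsetSum _ _).trans (Finset.sup_le fun m hm => ?_)
  rw [MvPolynomial.pderiv_monomial]
  refine (MvPolynomial.totalDegree_monomial_le _ _).trans ?_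
  refine le_trans ?_ (MvPolynomial.le_totalDegree hm)
  exact Finsupp.degree_mono (tsub_le_self)

theorem IsPoly.fderiv {u : Pt n → ℝ} (hu : IsPoly k u) (v : Pt n) :
    IsPoly k (fun x => fderiv ℝ u x v) := by
  obtain ⟨P, hP, h⟩ := hu
  have : u = evalFun n P := funext h
  subst this
  have h2 : (fun x => _root_.fderiv ℝ (evalFun n P) x v)
      = fun x => ∑ i, evalFun n (MvPolynomial.pderiv i P) x * v i := by
    ext x
    rw [(hasFDerivAt_evalFun P x).fderiv]
    simp
  rw [h2]
  exact IsPoly.sum _ fun i _ => IsPoly.mul_const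
    ⟨_, (totalDegree_pderiv_le P i).trans hP, fun x => rfl⟩ _

theorem IsPoly.const (c : ℝ) : IsPoly k (fun _ : Pt n => c) :=
  ⟨MvPolynomial.C c, by simp, fun x => by simp⟩

theorem IsPoly.mono {l : ℕ} (h : k ≤ l) {u : Pt n → ℝ} (hu : IsPoly k u) : IsPoly l u := by
  obtain ⟨P, hP, h'⟩ := hu
  exact ⟨P, hP.trans h, h'⟩

theorem IsPoly.coord (i : Fin n) : IsPoly 1 (fun x : Pt n => x i) :=
  ⟨MvPolynomial.X i, by simp, fun x => by simp⟩

theorem IsPoly.mul {l : ℕ} {u v : Pt n → ℝ} (hu : IsPoly k u) (hv : IsPoly l v) :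
    IsPoly (k + l) (fun x => u x * v x) := by
  obtain ⟨P, hP, h⟩ := hu
  obtain ⟨Q, hQ, h'⟩ := hv
  exact ⟨P * Q, (MvPolynomial.totalDegree_mul _ _).trans (add_le_add hP hQ),
    fun x => by simp [h, h']⟩

theorem IsPoly.prod {m : ℕ} {u : Fin m → Pt n → ℝ} (hu : ∀ i, IsPoly 1 (u i)) :
    IsPoly m (fun x => ∏ i, u i x) := by
  induction m with
  | zero => simpa using IsPoly.const 1
  | succ m ih =>
    simp_rw [Fin.prod_univ_succ]
    simpa [add_comm] using (hu 0).mul (ih fun i => hu i.succ)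

/-- Needed to transport polynomials from an element to the unit ball. In the expansion into
monomials every factor c i + h * x i has degree at most one. -/
theorem IsPoly.comp_affine {u : Pt n → ℝ} (hu : IsPoly k u) (c : Pt n) (h : ℝ) :
    IsPoly k (fun x => u (c + h • x)) := by
  obtain ⟨P, hP, hu⟩ := hu
  have key : ∀ m ∈ P.support, IsPoly k (fun x : Pt n =>
      MvPolynomial.coeff m P * ∏ i ∈ m.support, (c i + h * x i) ^ m i) := by
    intro m hm
    refine IsPoly.const_mul _ ?_
    have hd : ∑ i ∈ m.support, m i ≤ k := (MvPolynomial.le_totalDegree hm).trans hP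
    have pw : ∀ (i : Fin n) (j : ℕ), IsPoly j (fun x : Pt n => (c i + h * x i) ^ j) := by
      intro i j
      have := IsPoly.prod (m := j) (u := fun _ (x : Pt n) => c i + h * x i)
        fun _ => (IsPoly.const _).add ((IsPoly.coord i).const_mul h)
      simpa using this
    have : ∀ s : Finset (Fin n),
        IsPoly (∑ i ∈ s, m i) (fun x : Pt n => ∏ i ∈ s, (c i + h * x i) ^ m i) := by
      classical
      intro s
      induction s using Finset.induction_on with
      | empty => simpa using IsPoly.const 1
      | insert a s ha ih =>
        simp_rw [Finset.prod_insert ha, Finset.sum_insert ha]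
        exact (pw a (m a)).mul ih
    exact (this m.support).mono hd
  have : (fun x => u (c + h • x)) = fun x : Pt n => ∑ m ∈ P.support,
      MvPolynomial.coeff m P * ∏ i ∈ m.support, (c i + h * x i) ^ m i := by
    ext x
    rw [hu, MvPolynomial.eval_eq]
    simp
  rw [this]
  exact IsPoly.sum _ key

/-! ### The `L²` projection onto polynomials -/

/-- The polynomials have a finite-dimensional image in L²(μ), onto which the orthogonal projection
exists. On a face distinct polynomials of ℝⁿ may coincide, so P is determined only up to a μ-null
set. -/
theorem exists_l2_projection (μ : Measure (Pt n)) (hμ : ∀ Q, IsPoly k Q → MemLp Q 2 μ)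
    {u : Pt n → ℝ} (hu : MemLp u 2 μ) :
    ∃ P, IsPoly k P ∧ ∀ Q, IsPoly k Q → ∫ x, (u x - P x) * Q x ∂μ = 0 := by
  let f : polySpace n k →ₗ[ℝ] Lp ℝ 2 μ :=
    { toFun := fun P => (hμ P.1 (mem_polySpace.1 P.2)).toLp P.1
      map_add' := fun P Q => rfl
      map_smul' := fun c P => rfl }
  obtain ⟨P, hP⟩ : ∃ P, f P = (LinearMap.range f).starProjection (hu.toLp u) :=
    (LinearMap.range f).starProjection_apply_mem _
  refine ⟨P.1, mem_polySpace.1 P.2, fun Q hQ => ?_⟩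
  have h := Submodule.starProjection_inner_eq_zero (K := LinearMap.range f) (hu.toLp u)
    (f ⟨Q, mem_polySpace.2 hQ⟩) ⟨_, rfl⟩
  rw [← hP, L2.inner_def] at h
  rw [← h]
  apply integral_congr_ae
  have h1 := hu.coeFn_toLp
  have h2 : f P =ᵐ[μ] P.1 := (hμ P.1 (mem_polySpace.1 P.2)).coeFn_toLp
  have h3 : f ⟨Q, mem_polySpace.2 hQ⟩ =ᵐ[μ] Q := (hμ Q hQ).coeFn_toLp
  filter_upwards [h1, h2, h3, Lp.coeFn_sub (hu.toLp u) (f P)] with x a b c d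
  rw [d, c]
  simp [a, b, mul_comm]

/-- Pythagoras: the cross term vanishes by assumption. -/
theorem integral_sq_sub_le_of_orthogonal (μ : Measure (Pt n)) {u P Q : Pt n → ℝ}
    (hu : MemLp u 2 μ) (hP : MemLp P 2 μ) (hQ : MemLp Q 2 μ)
    (h : ∫ x, (u x - P x) * (P x - Q x) ∂μ = 0) :
    ∫ x, (u x - P x) ^ 2 ∂μ ≤ ∫ x, (u x - Q x) ^ 2 ∂μ := by
  have e : ∀ x, (u x - Q x) ^ 2
      = (u x - P x) ^ 2 + 2 * ((u x - P x) * (P x - Q x)) + (P x - Q x) ^ 2 := fun x => by ring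
  have h1 : MemLp (fun x => u x - P x) 2 μ := hu.sub hP
  have h2 : MemLp (fun x => P x - Q x) 2 μ := hP.sub hQ
  have i1 := h1.integrable_sq
  have i2 : Integrable (fun x => 2 * ((u x - P x) * (P x - Q x))) μ :=
    (h1.integrable_mul h2).const_mul 2
  have i12 : Integrable (fun x => (u x - P x) ^ 2 + 2 * ((u x - P x) * (P x - Q x))) μ :=
    i1.add i2
  simp_rw [e]
  rw [integral_add i12 h2.integrable_sq, integral_add i1 i2, integral_const_mul, h]
  have : 0 ≤ ∫ x, (P x - Q x) ^ 2 ∂μ := integral_nonneg fun x => sq_nonneg _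
  linarith

/-! ### The inverse inequality -/

/-- On the finite-dimensional range of f the map g ∘ f⁻¹ is automatically continuous. This is the
equivalence of norms by which L² norms over different balls are compared. -/
theorem exists_norm_le_of_injective {V E F : Type*} [AddCommGroup V] [Module ℝ V]
    [FiniteDimensional ℝ V] [NormedAddCommGroup E] [NormedSpace ℝ E] [NormedAddCommGroup F]
    [NormedSpace ℝ F] (f : V →ₗ[ℝ] E) (g : V →ₗ[ℝ] F) (hf : Function.Injective f) :
    ∃ C : ℝ, 0 < C ∧ ∀ v, ‖g v‖ ≤ C * ‖f v‖ := by
  let e := LinearEquiv.ofInjective f hf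
  let G : LinearMap.range f →ₗ[ℝ] F := g ∘ₗ e.symm.toLinearMap
  -- Adding 1 keeps the constant positive even if g vanishes.
  refine ⟨‖G.toContinuousLinearMap‖ + 1, by positivity, fun v => ?_⟩
  have h1 := G.toContinuousLinearMap.le_opNorm (e v)
  have h2 : G.toContinuousLinearMap (e v) = g v := by simp [G]
  rw [h2] at h1
  have h3 : ‖e v‖ = ‖f v‖ := rfl
  rw [h3] at h1
  nlinarith [norm_nonneg (f v)]

theorem L2_norm_sq_toLp {μ : Measure (Pt n)} {u : Pt n → ℝ} (hu : MemLp u 2 μ) :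
    ‖hu.toLp u‖ ^ 2 = ∫ x, u x ^ 2 ∂μ := by
  rw [← real_inner_self_eq_norm_sq, L2.inner_def]
  apply integral_congr_ae
  filter_upwards [hu.coeFn_toLp] with x hx
  rw [hx]; simp [sq]

theorem memLp_of_continuous {μ : Measure (Pt n)} [IsFiniteMeasureOnCompacts μ] {K : Set (Pt n)}
    (hK : IsCompact K) {u : Pt n → ℝ} (hu : ContinuousOn u K) : MemLp u 2 (μ.restrict K) := by
  obtain ⟨C, hC⟩ := hK.exists_bound_of_continuousOn hu
  haveI : IsFiniteMeasure (μ.restrict K) := ⟨by simpa using hK.measure_lt_top⟩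
  exact MemLp.of_bound (hu.aestronglyMeasurable hK.measurableSet) C
    ((ae_restrict_iff' hK.measurableSet).2 (Filter.Eventually.of_forall hC))

end Polynomials

end HDG

/-! ### Inverse inequality: norm equivalence on balls and scaling -/

namespace HDG

section Inverse

variable {n k : ℕ}

/-- By Cauchy–Schwarz, the operator norm is at most the Euclidean norm of the gradient. -/
theorem norm_fderiv_sq_le (u : Pt n → ℝ) (x : Pt n) :
    ‖fderiv ℝ u x‖ ^ 2 ≤ ∑ i, (fderiv ℝ u x (unitVec i)) ^ 2 := by
  have h : ‖fderiv ℝ u x‖ ≤ √(∑ i, (fderiv ℝ u x (unitVec i)) ^ 2) := by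
    refine ContinuousLinearMap.opNorm_le_bound _ (Real.sqrt_nonneg _) fun v => ?_
    have hv : v = ∑ i, v i • (unitVec i : Pt n) := by
      ext j; simp [unitVec, Finset.sum_apply, Pi.single_apply]
    have h1 : fderiv ℝ u x v = ∑ i, fderiv ℝ u x (unitVec i) * v i := by
      conv_lhs => rw [hv]
      simp [mul_comm]
    rw [h1, EuclideanSpace.norm_eq, Real.norm_eq_abs]
    refine Real.abs_le_sqrt ?_ |>.trans (le_of_eq ?_) (b := √((∑ i, (fderiv ℝ u x (unitVec i)) ^ 2) * ∑ i, (v i) ^ 2))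
    · exact Finset.sum_mul_sq_le_sq_mul_sq _ _ _
    · rw [Real.sqrt_mul (Finset.sum_nonneg fun _ _ => sq_nonneg _)]
      simp
  calc ‖fderiv ℝ u x‖ ^ 2 ≤ √(∑ i, (fderiv ℝ u x (unitVec i)) ^ 2) ^ 2 := by gcongr
    _ = _ := Real.sq_sqrt (Finset.sum_nonneg fun _ _ => sq_nonneg _)

/-- A polynomial that vanishes on a ball vanishes identically. -/
theorem IsPoly.eq_zero_of_ball {u : Pt n → ℝ} (hu : IsPoly k u) {c : Pt n} {r : ℝ} (hr : 0 < r)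
    (h : ∀ x ∈ Metric.ball c r, u x = 0) : ∀ x, u x = 0 := by
  obtain ⟨P, -, hP⟩ := hu
  have hP0 : P = 0 := by
    have hopen : IsOpen ((WithLp.toLp 2 : (Fin n → ℝ) → Pt n) ⁻¹' Metric.ball c r) :=
      Metric.isOpen_ball.preimage (PiLp.continuous_toLp 2 _)
    -- The ball contains a cube, a product of infinite sets, on which a nonzero polynomial cannot
    -- vanish.
    obtain ⟨δ, hδ, hb⟩ := Metric.isOpen_iff.1 hopen (WithLp.ofLp c) (by simpa using hr)
    refine MvPolynomial.funext_set (fun i => Metric.ball (c i) δ) (fun i => ?_) fun x hx => ?_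
    · rw [Real.ball_eq_Ioo]; exact Set.Ioo_infinite (by linarith)
    · have h1 : x ∈ Metric.ball (WithLp.ofLp c) δ := by
        rw [ball_pi _ hδ]; exact hx
      have h2 := h _ (hb h1)
      rw [hP] at h2
      simpa using h2
  intro x; rw [hP, hP0]; simp

/-- A linear map into square integrable functions as a linear map into `L²`. -/
noncomputable def toL2 {V : Type*} [AddCommGroup V] [Module ℝ V] {μ : Measure (Pt n)}
    (L : V →ₗ[ℝ] (Pt n → ℝ)) (hL : ∀ v, MemLp (L v) 2 μ) : V →ₗ[ℝ] Lp ℝ 2 μ where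
  toFun v := (hL v).toLp (L v)
  map_add' v w := by
    rw [← MemLp.toLp_add (hL v) (hL w)]
    exact MemLp.toLp_congr _ _ (by rw [map_add])
  map_smul' c v := by
    rw [RingHom.id_apply, ← MemLp.toLp_const_smul c (hL v)]
    exact MemLp.toLp_congr _ _ (by rw [map_smul])

/-- The directional derivative as a linear map on polynomial functions. -/
noncomputable def polyDeriv (n k : ℕ) (a : Pt n) : polySpace n k →ₗ[ℝ] (Pt n → ℝ) where
  toFun P x := fderiv ℝ P.1 x a
  map_add' P Q := by
    ext x
    have h := fderiv_add ((mem_polySpace.1 P.2).contDiff.differentiable (by simp) x)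
      ((mem_polySpace.1 Q.2).contDiff.differentiable (by simp) x)
    simp [h]
  map_smul' c P := by
    ext x
    have h := fderiv_const_smul ((mem_polySpace.1 P.2).contDiff.differentiable (by simp) x) c
    simp [h]

/-- Both sides come from linear maps of the finite-dimensional polynomial space into L², and the one
on the right is injective since a polynomial vanishing on a ball is zero. Derivatives are taken over
the unit ball and values over the small one, so that inscribed and circumscribed balls are all that
is needed after scaling. -/
theorem exists_deriv_le_unit (n k : ℕ) {σ : ℝ} (hσ : 0 < σ) (a : Pt n) : ∃ C : ℝ, 0 < C ∧
    ∀ u : Pt n → ℝ, IsPoly k u →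
      ∫ x in Metric.closedBall 0 1, (fderiv ℝ u x a) ^ 2
        ≤ C * ∫ x in Metric.closedBall 0 σ, u x ^ 2 := by
  have hm : ∀ (r : ℝ) (u : Pt n → ℝ), IsPoly k u →
      MemLp u 2 (volume.restrict (Metric.closedBall 0 r)) := fun r u hu =>
    memLp_of_continuous (isCompact_closedBall _ _) hu.continuous.continuousOn
  have m1 : ∀ P, MemLp ((polySpace n k).subtype P) 2 (volume.restrict (Metric.closedBall 0 σ)) :=
    fun P => hm σ P.1 (mem_polySpace.1 P.2)
  have m2 : ∀ P, MemLp (polyDeriv n k a P) 2 (volume.restrict (Metric.closedBall 0 1)) :=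
    fun P => hm 1 _ ((mem_polySpace.1 P.2).fderiv a)
  have hf : Function.Injective (toL2 _ m1) := by
    rw [injective_iff_map_eq_zero]
    intro P hP
    have hP' : P.1 =ᵐ[volume.restrict (Metric.closedBall (0 : Pt n) σ)] 0 :=
      (m1 P).coeFn_toLp.symm.trans ((Lp.eq_zero_iff_ae_eq_zero).1 hP)
    have h1 := Measure.eqOn_of_ae_eq (μ := volume) (s := Metric.ball (0 : Pt n) σ)
      (ae_restrict_of_ae_restrict_of_subset Metric.ball_subset_closedBall hP')
      (mem_polySpace.1 P.2).continuous.continuousOn (continuousOn_const) (by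
        rw [Metric.isOpen_ball.interior_eq]; exact subset_closure)
    exact Subtype.ext (funext ((mem_polySpace.1 P.2).eq_zero_of_ball hσ h1))
  obtain ⟨C, hC, hCf⟩ := exists_norm_le_of_injective _ (toL2 _ m2) hf
  refine ⟨C ^ 2, by positivity, fun u hu => ?_⟩
  have h2 := pow_le_pow_left₀ (norm_nonneg _) (hCf ⟨u, mem_polySpace.2 hu⟩) 2
  rw [mul_pow] at h2
  have e1 := L2_norm_sq_toLp (m1 ⟨u, mem_polySpace.2 hu⟩)
  have e2 := L2_norm_sq_toLp (m2 ⟨u, mem_polySpace.2 hu⟩)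
  calc _ = _ := e2.symm
    _ ≤ _ := h2
    _ = _ := by rw [← show _ = ∫ x in Metric.closedBall 0 σ, u x ^ 2 from e1]; rfl

theorem exists_inverse_unit (n k : ℕ) {σ : ℝ} (hσ : 0 < σ) : ∃ C : ℝ, 0 < C ∧
    ∀ u : Pt n → ℝ, IsPoly k u →
      ∫ x in Metric.closedBall 0 1, ‖fderiv ℝ u x‖ ^ 2
        ≤ C * ∫ x in Metric.closedBall 0 σ, u x ^ 2 := by
  choose C hC hCf using fun i => exists_deriv_le_unit n k hσ (unitVec i : Pt n)
  refine ⟨∑ i, C i + 1, by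
    have := Finset.sum_nonneg fun i (_ : i ∈ Finset.univ) => (hC i).le
    linarith, fun u hu => ?_⟩
  have hi : ∀ i, IntegrableOn (fun x => (fderiv ℝ u x (unitVec i)) ^ 2)
      (Metric.closedBall (0 : Pt n) 1) := fun i =>
    ((hu.fderiv (unitVec i)).continuous.pow 2).continuousOn.integrableOn_compact
      (isCompact_closedBall _ _)
  have h1 : ∫ x in Metric.closedBall 0 1, ‖fderiv ℝ u x‖ ^ 2
      ≤ ∑ i, ∫ x in Metric.closedBall 0 1, (fderiv ℝ u x (unitVec i)) ^ 2 := by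
    rw [← integral_finsetSum _ fun i _ => hi i]
    refine integral_mono ?_ (integrable_finsetSum _ fun i _ => hi i)
      fun x => norm_fderiv_sq_le u x
    exact (((hu.contDiff.continuous_fderiv (by simp)).norm.pow 2).continuousOn).integrableOn_compact
        (isCompact_closedBall _ _)
  refine h1.trans ?_
  rw [add_mul, Finset.sum_mul, one_mul]
  exact (Finset.sum_le_sum fun i _ => hCf i u hu).trans
    (le_add_of_nonneg_right (integral_nonneg fun x => sq_nonneg _))

theorem setIntegral_closedBall_scale (f : Pt n → ℝ) (c : Pt n) {h r : ℝ} (hh : 0 < h)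
    (hr : 0 ≤ r) :
    ∫ x in Metric.closedBall 0 r, f (c + h • x)
      = (h ^ n)⁻¹ * ∫ x in Metric.closedBall c (h * r), f x := by
  have h1 := Measure.setIntegral_comp_smul_of_pos (volume : Measure (Pt n)) (fun x => f (c + x))
    (Metric.closedBall 0 r) hh
  rw [h1]
  simp only [finrank_euclideanSpace, Fintype.card_fin, smul_eq_mul]
  congr 1
  rw [smul_closedBall _ _ hr, smul_zero, Real.norm_of_nonneg hh.le]
  have h2 := (measurePreserving_add_left (volume : Measure (Pt n)) c).setIntegral_preimage_emb
    (measurableEmbedding_addLeft c) f (Metric.closedBall c (h * r))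
  rw [← h2]
  congr 2
  ext x
  simp [dist_eq_norm]

/-- Rescale so that the ball of radius h becomes the unit ball. The set K enters only through the
two balls that enclose it, so no reference element is needed and the constant depends on n, k and σ
alone. -/
theorem exists_inverse_inequality (n k : ℕ) {σ : ℝ} (hσ : 0 < σ) : ∃ C : ℝ, 0 < C ∧
    ∀ (u : Pt n → ℝ), IsPoly k u → ∀ (K : Set (Pt n)) (c : Pt n) (h : ℝ), 0 < h →
      IsCompact K → Metric.closedBall c (σ * h) ⊆ K → K ⊆ Metric.closedBall c h →
      h ^ 2 * ∫ x in K, ‖fderiv ℝ u x‖ ^ 2 ≤ C * ∫ x in K, u x ^ 2 := by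
  obtain ⟨C, hC, H⟩ := exists_inverse_unit n k hσ
  refine ⟨C, hC, fun u hu K c h hh hK h1 h2 => ?_⟩
  have h3 := H _ (hu.comp_affine c h)
  have h4 : ∀ x, fderiv ℝ (fun x => u (c + h • x)) x = h • fderiv ℝ u (c + h • x) := by
    intro x
    have hd : HasFDerivAt u (fderiv ℝ u (c + h • x)) (c + h • x) :=
      (hu.contDiff.differentiable (by simp) _).hasFDerivAt
    have hi : HasFDerivAt (fun x : Pt n => c + h • x) (h • ContinuousLinearMap.id ℝ (Pt n)) x :=
      ((hasFDerivAt_id x).const_smul h).const_add c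
    refine (HasFDerivAt.fderiv (hd.comp x hi)).trans ?_
    ext; simp
  simp_rw [h4, norm_smul, mul_pow, Real.norm_eq_abs, sq_abs] at h3
  rw [integral_const_mul, setIntegral_closedBall_scale (fun x => ‖fderiv ℝ u x‖ ^ 2) c hh zero_le_one,
    setIntegral_closedBall_scale (fun x => u x ^ 2) c hh hσ.le] at h3
  have hp : 0 < (h ^ n)⁻¹ := by positivity
  have h5 : h ^ 2 * ∫ x in Metric.closedBall c (h * 1), ‖fderiv ℝ u x‖ ^ 2
      ≤ C * ∫ x in Metric.closedBall c (h * σ), u x ^ 2 := by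
    refine le_of_mul_le_mul_left ?_ hp
    linarith
  have c1 : Continuous fun x => ‖fderiv ℝ u x‖ ^ 2 :=
    (hu.contDiff.continuous_fderiv (by simp)).norm.pow 2
  have c2 : Continuous fun x => u x ^ 2 := hu.continuous.pow 2
  calc h ^ 2 * ∫ x in K, ‖fderiv ℝ u x‖ ^ 2
      ≤ h ^ 2 * ∫ x in Metric.closedBall c (h * 1), ‖fderiv ℝ u x‖ ^ 2 := by
        gcongr ?_ * ?_
        rw [mul_one]
        exact setIntegral_mono_set (c1.continuousOn.integrableOn_compact (isCompact_closedBall _ _))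
          (Filter.Eventually.of_forall fun x => sq_nonneg _) h2.eventuallyLE
    _ ≤ _ := h5
    _ ≤ _ := by
        gcongr ?_ * ?_
        rw [mul_comm h σ]
        exact setIntegral_mono_set (c2.continuousOn.integrableOn_compact hK)
          (Filter.Eventually.of_forall fun x => sq_nonneg _) h1.eventuallyLE

end Inverse

end HDG

/-! ### Integration over cones -/

namespace HDG

section Cone

open scoped Pointwise

variable {m : ℕ}

/-- Extend N to an orthonormal basis. The coordinates along N and along the other basis vectors
preserve volume, and J embeds ℝᵐ as the hyperplane orthogonal to N. -/
theorem exists_coords (N : Pt (m + 1)) (hN : ‖N‖ = 1) :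
    ∃ (J : Pt m →ₗᵢ[ℝ] Pt (m + 1)) (e : ℝ × Pt m ≃ᵐ Pt (m + 1)),
      (∀ ξ, ⟪N, J ξ⟫ = 0) ∧ (∀ x, ⟪N, x⟫ = 0 → ∃ ξ, J ξ = x) ∧ MeasurePreserving e ∧
      ∀ p, e p = p.1 • N + J p.2 := by
  obtain ⟨b, hb⟩ := Orthonormal.exists_orthonormalBasis_extension_of_card_eq (𝕜 := ℝ)
    (E := Pt (m + 1)) (ι := Fin (m + 1)) (by simp) (v := fun _ => N) (s := {0}) (by
      refine ⟨fun i => by simpa using hN, fun i j hij => ?_⟩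
      exact absurd (Subtype.ext (i.2.trans j.2.symm)) hij)
  have hb0 : b 0 = N := hb 0 rfl
  let J₀ : Pt m →ₗ[ℝ] Pt (m + 1) :=
    { toFun := fun ξ => WithLp.toLp 2 (Fin.cons 0 (WithLp.ofLp ξ))
      map_add' := fun x y => by
        ext i; refine Fin.cases ?_ (fun i => ?_) i <;> simp
      map_smul' := fun c x => by
        ext i; refine Fin.cases ?_ (fun i => ?_) i <;> simp }
  let J₁ : Pt m →ₗᵢ[ℝ] Pt (m + 1) :=
    ⟨J₀, fun ξ => by simp [J₀, EuclideanSpace.norm_eq, Fin.sum_univ_succ]⟩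
  let J : Pt m →ₗᵢ[ℝ] Pt (m + 1) := b.repr.symm.toLinearIsometry.comp J₁
  let e₁ : ℝ × Pt m ≃ᵐ ℝ × (Fin m → ℝ) :=
    MeasurableEquiv.prodCongr (MeasurableEquiv.refl ℝ) (MeasurableEquiv.toLp 2 (Fin m → ℝ)).symm
  let e₂ := (MeasurableEquiv.piFinSuccAbove (fun _ : Fin (m + 1) => ℝ) 0).symm
  let e₃ := MeasurableEquiv.toLp 2 (Fin (m + 1) → ℝ)
  let e₄ : Pt (m + 1) ≃ᵐ Pt (m + 1) := b.repr.symm.toHomeomorph.toMeasurableEquiv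
  let e := ((e₁.trans e₂).trans e₃).trans e₄
  have p1 : MeasurePreserving e₁ :=
    (MeasurePreserving.id volume).prod (PiLp.volume_preserving_ofLp (Fin m))
  have p2 : MeasurePreserving e₂ :=
    (volume_preserving_piFinSuccAbove (fun _ : Fin (m + 1) => ℝ) 0).symm _
  have p3 : MeasurePreserving e₃ := PiLp.volume_preserving_toLp (Fin (m + 1))
  have p4 : MeasurePreserving e₄ := b.repr.symm.measurePreserving
  have hN' : ∀ x, ⟪N, x⟫ = b.repr x 0 := fun x => by rw [← hb0, b.repr_apply_apply]
  have hJr : ∀ ξ, b.repr (J ξ) = WithLp.toLp 2 (Fin.cons 0 (WithLp.ofLp ξ)) := fun ξ => by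
    simp [J, J₁, J₀]
  refine ⟨J, e, fun ξ => ?_, fun x hx => ?_, p4.comp (p3.comp (p2.comp p1)), fun p => ?_⟩
  · rw [hN', hJr]; simp
  · refine ⟨WithLp.toLp 2 (fun i => b.repr x i.succ), b.repr.injective ?_⟩
    rw [hJr]
    ext i
    refine Fin.cases ?_ (fun i => ?_) i
    · simpa [← hN'] using hx.symm
    · simp
  · apply b.repr.injective
    have h1 : b.repr (e p) = WithLp.toLp 2 (Fin.cons p.1 (WithLp.ofLp p.2)) := by
      have : e p = b.repr.symm (WithLp.toLp 2 (e₂ (p.1, WithLp.ofLp p.2))) := rfl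
      rw [this, LinearIsometryEquiv.apply_symm_apply]
      congr 1
      ext i
      refine Fin.cases ?_ (fun i => ?_) i <;>
        simp [e₂, MeasurableEquiv.piFinSuccAbove, Fin.insertNthEquiv]
    rw [h1, map_add, map_smul, hJr, ← hb0, b.repr_self]
    ext i
    refine Fin.cases ?_ (fun i => ?_) i <;> simp

/-- The cone with apex `v` over `F`. -/
def coneSet (v : Pt (m + 1)) (F : Set (Pt (m + 1))) : Set (Pt (m + 1)) :=
  {x | ∃ s ∈ Set.Icc (0 : ℝ) 1, ∃ z ∈ F, x = v + s • (z - v)}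

theorem setIntegral_smul_set {f : Pt m → ℝ} (S : Set (Pt m)) {c : ℝ} (hc : 0 < c) :
    ∫ x in c • S, f x = c ^ m * ∫ x in S, f (c • x) := by
  rw [Measure.setIntegral_comp_smul_of_pos (volume : Measure (Pt m)) f S hc]
  simp only [finrank_euclideanSpace, Fintype.card_fin, smul_eq_mul]
  field_simp

/-- The slice of the cone at height s * h is s • S, so Fubini and scaling in dimension m produce the
weight s ^ m. -/
theorem integral_cone_coords (S : Set (Pt m)) (hS : IsCompact S) {h : ℝ} (hh : 0 < h)
    {g : ℝ × Pt m → ℝ} (hg : Continuous g) :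
    ∫ p in {p : ℝ × Pt m | ∃ s ∈ Set.Icc (0 : ℝ) 1, ∃ ξ ∈ S, p = (s * h, s • ξ)}, g p
      = h * ∫ s in (0 : ℝ)..1, s ^ m * ∫ ξ in S, g (s * h, s • ξ) := by
  set D := {p : ℝ × Pt m | ∃ s ∈ Set.Icc (0 : ℝ) 1, ∃ ξ ∈ S, p = (s * h, s • ξ)} with hD
  have hDc : IsCompact D := by
    have : D = (fun q : ℝ × Pt m => (q.1 * h, q.1 • q.2)) '' (Set.Icc (0 : ℝ) 1 ×ˢ S) := by
      ext p
      constructor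
      · rintro ⟨s, hs, ξ, hξ, rfl⟩; exact ⟨(s, ξ), ⟨hs, hξ⟩, rfl⟩
      · rintro ⟨⟨s, ξ⟩, ⟨hs, hξ⟩, rfl⟩; exact ⟨s, hs, ξ, hξ, rfl⟩
    rw [this]
    exact (isCompact_Icc.prod hS).image (by fun_prop)
  have hint : Integrable (D.indicator g) (volume.prod volume) := by
    rw [integrable_indicator_iff hDc.measurableSet]
    exact hg.continuousOn.integrableOn_compact hDc
  rw [← integral_indicator hDc.measurableSet, Measure.volume_eq_prod, integral_prod _ hint]
  -- The height t = 0 is left out, since scaling by t / h degenerates there; it is a null set of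
  -- heights.
  have key : ∀ t : ℝ, t ≠ 0 → ∫ ξ, D.indicator g (t, ξ)
      = (Set.Ioc (0 : ℝ) h).indicator
        (fun t => (t / h) ^ m * ∫ ξ in S, g (t / h * h, (t / h) • ξ)) t := by
    intro t ht
    by_cases ht' : t ∈ Set.Ioc 0 h
    · have hc : 0 < t / h := div_pos ht'.1 hh
      rw [Set.indicator_of_mem ht', ← setIntegral_smul_set (f := fun ξ => g (t / h * h, ξ)) S hc,
        ← integral_indicator (IsCompact.smul (t / h) hS).measurableSet]
      congr 1
      ext ξ
      have hth : t / h * h = t := by field_simp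
      by_cases hx : ξ ∈ (t / h) • S
      · rw [Set.indicator_of_mem hx, Set.indicator_of_mem, hth]
        obtain ⟨z, hz, rfl⟩ := hx
        exact ⟨t / h, ⟨hc.le, (div_le_one hh).2 ht'.2⟩, z, hz, by simp [hth]⟩
      · rw [Set.indicator_of_notMem hx, Set.indicator_of_notMem]
        rintro ⟨s, hs, z, hz, hp⟩
        simp only [Prod.mk.injEq] at hp
        have : t / h = s := by rw [hp.1]; field_simp
        exact hx ⟨z, hz, by simp [hp.2, this]⟩
    · rw [Set.indicator_of_notMem ht']
      have : ∀ ξ, D.indicator g (t, ξ) = 0 := by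
        intro ξ
        rw [Set.indicator_of_notMem]
        rintro ⟨s, hs, z, hz, hp⟩
        simp only [Prod.mk.injEq] at hp
        have h0 : 0 ≤ t := by rw [hp.1]; exact mul_nonneg hs.1 hh.le
        have h1 : t ≤ h := by rw [hp.1]; nlinarith [hs.2]
        exact ht' ⟨lt_of_le_of_ne h0 (Ne.symm ht), h1⟩
      simp [this]
  have hae : ∀ᵐ t : ℝ, ∫ ξ, D.indicator g (t, ξ)
      = (Set.Ioc (0 : ℝ) h).indicator
        (fun t => (t / h) ^ m * ∫ ξ in S, g (t / h * h, (t / h) • ξ)) t := by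
    filter_upwards [Measure.ae_ne volume (0 : ℝ)] with t ht using key t ht
  rw [integral_congr_ae hae, integral_indicator measurableSet_Ioc,
    ← intervalIntegral.integral_of_le hh.le]
  have := intervalIntegral.integral_comp_div (a := 0) (b := h)
    (fun s => s ^ m * ∫ ξ in S, g (s * h, s • ξ)) hh.ne'
  rw [this]
  simp [hh.ne']

/-- The integrand is the derivative of s ^ (m + 1) * φ (v + s • w), which vanishes at s = 0. -/
theorem radial_ftc {φ : Pt (m + 1) → ℝ} (hφ : ContDiff ℝ 1 φ) (v w : Pt (m + 1)) :
    ∫ s in (0 : ℝ)..1, s ^ m * ((m + 1) * φ (v + s • w) + fderiv ℝ φ (v + s • w) (s • w))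
      = φ (v + w) := by
  have hd : ∀ s : ℝ, HasDerivAt (fun s : ℝ => s ^ (m + 1) * φ (v + s • w))
      (s ^ m * ((m + 1) * φ (v + s • w) + fderiv ℝ φ (v + s • w) (s • w))) s := by
    intro s
    have h1 : HasDerivAt (fun s : ℝ => v + s • w) w s := by
      simpa using ((hasDerivAt_id s).smul_const w).const_add v
    have h2 := ((hφ.differentiable (by simp) (v + s • w)).hasFDerivAt).comp_hasDerivAt s h1
    have h3 := (hasDerivAt_pow (m + 1) s).mul h2
    refine h3.congr_deriv ?_
    simp
    ring
  rw [intervalIntegral.integral_eq_sub_of_hasDerivAt (fun s _ => hd s)]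
  · simp
  · apply Continuous.intervalIntegrable
    have c1 := hφ.continuous
    have c2 : Continuous fun s : ℝ => fderiv ℝ φ (v + s • w) (s • w) :=
      ((hφ.continuous_fderiv (by simp)).comp (by fun_prop)).clm_apply (by fun_prop)
    fun_prop

/-- F lies in a hyperplane normal to N at signed distance h from v, so ξ ↦ v + h N + J ξ
parametrises it isometrically. Isometries carry Lebesgue measure on ℝᵐ to the normalized Hausdorff
measure. -/
theorem exists_face_coords {v N : Pt (m + 1)} (hN : ‖N‖ = 1) {h : ℝ}
    {F : Set (Pt (m + 1))} (hF : IsCompact F) (hFN : ∀ z ∈ F, ⟪N, z - v⟫ = h) :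
    ∃ (J : Pt m →ₗᵢ[ℝ] Pt (m + 1)) (e : ℝ × Pt m ≃ᵐ Pt (m + 1)) (S : Set (Pt m)),
      MeasurePreserving e ∧ (∀ p, e p = p.1 • N + J p.2) ∧ IsCompact S ∧
      F = (fun ξ => v + e (h, ξ)) '' S ∧
      ∀ g : Pt (m + 1) → ℝ, ∫ x in F, g x ∂(μHE[m] : Measure (Pt (m + 1)))
        = ∫ ξ in S, g (v + e (h, ξ)) := by
  obtain ⟨J, e, hJ, hJs, he, hep⟩ := exists_coords N hN
  have hι : Isometry (fun ξ => v + e (h, ξ)) := by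
    intro x y
    simp only [hep, edist_add_left]
    exact J.isometry x y
  have hNN : ⟪N, N⟫ = (1 : ℝ) := by rw [real_inner_self_eq_norm_sq, hN]; norm_num
  have hFr : F ⊆ Set.range (fun ξ => v + e (h, ξ)) := by
    intro z hz
    obtain ⟨ξ, hξ⟩ := hJs (z - v - h • N) (by
      rw [inner_sub_right, hFN z hz, inner_smul_right, hNN]; simp)
    exact ⟨ξ, by simp [hep, hξ]⟩
  refine ⟨J, e, (fun ξ => v + e (h, ξ)) ⁻¹' F, he, hep,
    hι.isClosedEmbedding.isCompact_preimage hF, ?_, fun g => ?_⟩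
  · rw [Set.image_preimage_eq_of_subset hFr]
  · have hmp := hι.map_euclideanHausdorffMeasure (d := m)
    rw [EuclideanSpace.euclideanHausdorffMeasure_eq_volume] at hmp
    rw [← hι.isClosedEmbedding.measurableEmbedding.setIntegral_map g F, hmp,
      Measure.restrict_restrict hF.measurableSet, Set.inter_eq_left.2 hFr]

/-- The divergence theorem on a cone for vector fields in radial direction. -/
theorem integral_cone_radial {v N : Pt (m + 1)} (hN : ‖N‖ = 1) {h : ℝ} (hh : 0 < h)
    {F : Set (Pt (m + 1))} (hF : IsCompact F) (hFN : ∀ z ∈ F, ⟪N, z - v⟫ = h)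
    {φ : Pt (m + 1) → ℝ} (hφ : ContDiff ℝ 1 φ) :
    ∫ x in coneSet v F, ((m + 1) * φ x + fderiv ℝ φ x (x - v))
      = h * ∫ z in F, φ z ∂(μHE[m] : Measure (Pt (m + 1))) := by
  obtain ⟨J, e, S, he, hep, hS, hFS, hint⟩ := exists_face_coords hN hF hFN
  rw [hint]
  set G : Pt (m + 1) → ℝ := fun x => (m + 1) * φ x + fderiv ℝ φ x (x - v) with hG
  have hGc : Continuous G := by
    have c1 := hφ.continuous
    have c2 : Continuous fun x => fderiv ℝ φ x (x - v) :=
      (hφ.continuous_fderiv (by simp)).clm_apply (by fun_prop)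
    exact (continuous_const.mul c1).add c2
  have hec : Continuous e := by
    have : (e : ℝ × Pt m → Pt (m + 1)) = fun p => p.1 • N + J p.2 := funext hep
    rw [this]
    have := J.continuous
    fun_prop
  have h1 : ∫ x in coneSet v F, G x
      = ∫ p in {p : ℝ × Pt m | ∃ s ∈ Set.Icc (0 : ℝ) 1, ∃ ξ ∈ S, p = (s * h, s • ξ)},
        G (v + e p) := by
    have hmp : MeasurePreserving (fun p => v + e p) :=
      (measurePreserving_add_left (volume : Measure (Pt (m + 1))) v).comp he
    have hemb : MeasurableEmbedding (fun p => v + e p) :=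
      (measurableEmbedding_addLeft v).comp e.measurableEmbedding
    rw [← hmp.setIntegral_preimage_emb hemb G]
    congr 2
    ext p
    have hlin : ∀ (s : ℝ) ξ, s • e (h, ξ) = e (s * h, s • ξ) := by
      intro s ξ; simp [hep, smul_smul]
    constructor
    · rintro ⟨s, hs, z, hz, hp⟩
      rw [hFS] at hz
      obtain ⟨ξ, hξ, rfl⟩ := hz
      refine ⟨s, hs, ξ, hξ, e.injective ?_⟩
      simpa [hlin] using hp
    · rintro ⟨s, hs, ξ, hξ, rfl⟩
      exact ⟨s, hs, v + e (h, ξ), by rw [hFS]; exact ⟨ξ, hξ, rfl⟩, by simp [hlin]⟩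
  rw [h1, integral_cone_coords S hS hh (g := fun p => G (v + e p)) (by fun_prop)]
  congr 1
  have h2 : ∀ s : ℝ, s ^ m * ∫ ξ in S, G (v + e (s * h, s • ξ))
      = ∫ ξ in S, s ^ m * G (v + s • e (h, ξ)) := by
    intro s
    rw [← integral_const_mul]
    simp [hep, smul_smul]
  simp_rw [h2]
  -- After the exchange, the inner integral runs along the ray from the apex to a point of F, and
  -- `radial_ftc` evaluates it to the value of φ at that point.
  rw [intervalIntegral.integral_of_le zero_le_one, integral_integral_swap]
  · refine integral_congr_ae (Filter.Eventually.of_forall fun ξ => ?_)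
    dsimp only
    rw [← intervalIntegral.integral_of_le zero_le_one, ← radial_ftc hφ v (e (h, ξ))]
    simp [hG]
  · rw [Measure.prod_restrict]
    have hc : Continuous (Function.uncurry fun (x : ℝ) (y : Pt m) => x ^ m * G (v + x • e (h, y))) := by
      unfold Function.uncurry
      fun_prop
    exact (hc.continuousOn.integrableOn_compact (isCompact_Icc.prod hS)).mono_set
      (Set.prod_mono Set.Ioc_subset_Icc_self subset_rfl)

end Cone

end HDG

/-! ### Simplices: heights, normals and the divergence theorem -/

namespace HDG
namespace Triangulation

section Geometry

variable {m : ℕ} {Ω : Set (Pt (m + 1))} {T : Triangulation Ω}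

/-- The vertices of an element. -/
def Cell.verts (K : T.Cell) : Finset (Pt (m + 1)) := K.1

/-- The vertices of a face. -/
def Face.verts (e : T.Face) : Finset (Pt (m + 1)) := e.1

theorem Cell.verts_mem (K : T.Cell) : K.verts ∈ T.complex.faces := K.2.1

theorem Cell.verts_card (K : T.Cell) : K.verts.card = m + 2 := K.2.2

theorem Face.verts_mem (e : T.Face) : e.verts ∈ T.complex.faces := e.2.1

theorem Face.verts_card (e : T.Face) : e.verts.card = m + 1 := e.2.2

theorem HalfFace.verts_subset (F : T.HalfFace) : F.face.verts ⊆ F.cell.verts := F.2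

open Classical in
/-- The face of `K` opposite to its vertex `v`. -/
noncomputable def oppFace (K : T.Cell) (v : {v // v ∈ K.verts}) : T.HalfFace :=
  ⟨(K, ⟨K.verts.erase v.1, T.complex.down_closed K.verts_mem (Finset.erase_subset _ _)
    (Finset.card_pos.1 (by rw [Finset.card_erase_of_mem v.2, K.verts_card]; omega)), by
      rw [Finset.card_erase_of_mem v.2, K.verts_card]; omega⟩), Finset.erase_subset _ _⟩

@[simp] theorem oppFace_cell (K : T.Cell) (v : {v // v ∈ K.verts}) : (oppFace K v).cell = K := rfl

theorem mem_oppFace {K : T.Cell} {v : {v // v ∈ K.verts}} {w : Pt (m + 1)} :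
    w ∈ (oppFace K v).face.verts ↔ w ≠ v.1 ∧ w ∈ K.verts := by
  classical
  exact Finset.mem_erase

theorem insert_oppFace (K : T.Cell) (v : {v // v ∈ K.verts}) :
    (K.verts : Set (Pt (m + 1))) = insert v.1 ((oppFace K v).face.verts : Set (Pt (m + 1))) := by
  ext w
  simp only [Set.mem_insert_iff, Finset.mem_coe, mem_oppFace]
  by_cases h : w = v.1
  · simp [h, v.2]
  · simp [h]

/-- A face of an element omits exactly one of its m + 2 vertices. Sums over ∂𝒯_h are thereby sorted
by elements and vertices. -/
theorem oppFace_bijective : Function.Bijective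
    (fun q : (Σ K : T.Cell, {v // v ∈ K.verts}) => oppFace q.1 q.2) := by
  classical
  constructor
  · rintro ⟨K, v⟩ ⟨K', v'⟩ h
    have h1 : K = K' := congrArg HalfFace.cell h
    subst h1
    have h2 : K.verts.erase v.1 = K.verts.erase v'.1 := congrArg (fun F => (HalfFace.face F).verts) h
    congr 1
    by_contra hne
    have : v.1 ∈ K.verts.erase v'.1 := Finset.mem_erase.2 ⟨fun h => hne (Subtype.ext h), v.2⟩
    rw [← h2] at this
    exact (Finset.mem_erase.1 this).1 rfl
  · intro F
    have hcard : (F.cell.verts \ F.face.verts).card = 1 := by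
      rw [Finset.card_sdiff_of_subset F.verts_subset, F.cell.verts_card, F.face.verts_card]; omega
    obtain ⟨v, hv⟩ := Finset.card_eq_one.1 hcard
    have hv' : v ∈ F.cell.verts \ F.face.verts := by rw [hv]; simp
    rw [Finset.mem_sdiff] at hv'
    refine ⟨⟨F.cell, ⟨v, hv'.1⟩⟩, ?_⟩
    refine Subtype.ext (Prod.ext rfl (Subtype.ext ?_))
    change F.cell.verts.erase v = F.face.verts
    symm
    refine Finset.eq_of_subset_of_card_le ?_ ?_
    · intro w hw
      exact Finset.mem_erase.2 ⟨fun h => hv'.2 (h ▸ hw), F.verts_subset hw⟩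
    · rw [Finset.card_erase_of_mem hv'.1, F.cell.verts_card, F.face.verts_card]; omega

/-- A sum over all pairs of an element and one of its faces, sorted by elements. -/
theorem sum_halfFace {E : Type*} [AddCommMonoid E] (g : T.HalfFace → E) :
    ∑ F, g F = ∑ K : T.Cell, ∑ v : {v // v ∈ K.verts}, g (oppFace K v) := by
  rw [← Function.Bijective.sum_comp oppFace_bijective g]
  exact Fintype.sum_sigma' (fun (K : T.Cell) (v : {v // v ∈ K.verts}) => g (oppFace K v))

theorem centroid_eq {s : Finset (Pt (m + 1))} (hs : s.Nonempty) :
    s.centroid ℝ id = (s.card : ℝ)⁻¹ • ∑ w ∈ s, w := by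
  rw [Finset.centroid_def, Finset.affineCombination_eq_linear_combination _ _ _
    (Finset.sum_centroidWeights_eq_one_of_nonempty ℝ s hs)]
  simp [Finset.centroidWeights, Finset.smul_sum]

theorem affineIndependent_cell (K : T.Cell) :
    AffineIndependent ℝ ((↑) : {v // v ∈ K.verts} → Pt (m + 1)) := T.complex.indep K.verts_mem

theorem inner_outwardVec (F : T.HalfFace) {u : Pt (m + 1)}
    (hu : u ∈ vectorSpan ℝ (F.face.verts : Set (Pt (m + 1)))) : ⟪F.outwardVec, u⟫ = 0 :=
  Submodule.inner_left_of_mem_orthogonal hu (Submodule.starProjection_apply_mem _ _)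

theorem oppFace_nonempty (K : T.Cell) (v : {v // v ∈ K.verts}) : (oppFace K v).face.verts.Nonempty :=
  T.complex.nonempty_of_mem_faces (oppFace K v).face.verts_mem

/-- The vector from v to the barycentre of the opposite face is m + 2 times the one from the
barycentre of K, and w differs from the barycentre of the face by a vector in the direction of the
face. The outward vector is nonzero, since otherwise v would lie in the affine span of the other
vertices. -/
theorem outwardVec_oppFace (K : T.Cell) (v : {v // v ∈ K.verts}) {w : Pt (m + 1)}
    (hw : w ∈ (oppFace K v).face.verts) :
    ⟪(oppFace K v).outwardVec, w - v.1⟫ = (m + 2) * ‖(oppFace K v).outwardVec‖ ^ 2 ∧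
      (oppFace K v).outwardVec ≠ 0 := by
  classical
  set F := oppFace K v with hF
  set U := vectorSpan ℝ (F.face.verts : Set (Pt (m + 1))) with hU
  set ce := F.face.verts.centroid ℝ id with hce
  have hne : F.face.verts.Nonempty := ⟨w, hw⟩
  have hces : ce ∈ affineSpan ℝ (F.face.verts : Set (Pt (m + 1))) := by
    have := centroid_mem_affineSpan_of_nonempty ℝ
      (fun i : {i // i ∈ F.face.verts} => (i : Pt (m + 1))) (s := Finset.univ)
      (by simpa using hne)
    rw [Subtype.range_coe_subtype, Finset.setOfPred_mem] at this
    convert this using 1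
    rw [hce, Finset.centroid_univ]
  have hwce : w - ce ∈ U := by
    have := AffineSubspace.vsub_mem_direction (mem_affineSpan ℝ (s := (F.face.verts : Set (Pt (m + 1)))) hw) hces
    rwa [direction_affineSpan] at this
  have hcard : F.face.verts.card = m + 1 := F.face.verts_card
  have hK : K.verts.centroid ℝ id = ((m : ℝ) + 2)⁻¹ • (v.1 + ∑ w ∈ F.face.verts, w) := by
    rw [centroid_eq ⟨v.1, v.2⟩, K.verts_card]
    have : ∑ w ∈ F.face.verts, w = ∑ w ∈ K.verts.erase v.1, w := rfl
    rw [this, Finset.add_sum_erase K.verts (fun w => w) v.2]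
    push_cast
    ring_nf
  have hsum : ∑ w ∈ F.face.verts, w = ((m : ℝ) + 1) • ce := by
    rw [hce, centroid_eq hne, hcard, smul_smul]
    push_cast
    rw [mul_inv_cancel₀ (by positivity), one_smul]
  have hdiff : ce - v.1 = ((m : ℝ) + 2) • (ce - K.verts.centroid ℝ id) := by
    rw [hK, hsum, smul_sub, smul_smul, mul_inv_cancel₀ (by positivity), one_smul]
    module
  have hself : ⟪F.outwardVec, ce - K.verts.centroid ℝ id⟫ = ‖F.outwardVec‖ ^ 2 := by
    have h1 : F.outwardVec = Uᗮ.starProjection (ce - K.verts.centroid ℝ id) := rfl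
    have h2 := Submodule.inner_starProjection_left_eq_right Uᗮ F.outwardVec (ce - K.verts.centroid ℝ id)
    rw [← h1, real_inner_self_eq_norm_sq, Submodule.starProjection_eq_self_iff.2] at h2
    · exact h2
    · rw [h1]; exact Submodule.starProjection_apply_mem _ _
  constructor
  · have : w - v.1 = (w - ce) + (ce - v.1) := by abel
    rw [this, inner_add_right, inner_outwardVec F hwce, zero_add, hdiff, inner_smul_right, hself]
  · intro h0
    have h1 : Uᗮ.starProjection (ce - K.verts.centroid ℝ id) = 0 := h0
    rw [Submodule.starProjection_apply_eq_zero_iff, Submodule.orthogonal_orthogonal] at h1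
    have h2 : ce - v.1 ∈ U := by rw [hdiff]; exact U.smul_mem _ h1
    have h3 : v.1 ∈ affineSpan ℝ (F.face.verts : Set (Pt (m + 1))) := by
      have h4 : v.1 = -(ce - v.1) +ᵥ ce := by simp
      rw [h4]
      refine AffineSubspace.vadd_mem_of_mem_direction ?_ hces
      rw [direction_affineSpan]
      exact U.neg_mem h2
    have h5 := (affineIndependent_cell K).notMem_affineSpan_sdiff v Set.univ
    apply h5
    convert h3 using 2
    ext x
    simp only [Set.mem_image, Set.mem_sdiff, Set.mem_univ, true_and, Set.mem_singleton_iff,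
      Finset.mem_coe, hF, mem_oppFace]
    constructor
    · rintro ⟨y, hy, rfl⟩
      exact ⟨fun h => hy (Subtype.ext h), y.2⟩
    · rintro ⟨h, h'⟩
      exact ⟨⟨x, h'⟩, fun h'' => h (congrArg Subtype.val h''), rfl⟩

/-- The distance of the vertex `v` of `K` from the opposite face. -/
noncomputable def height (K : T.Cell) (v : {v // v ∈ K.verts}) : ℝ :=
  (m + 2) * ‖(oppFace K v).outwardVec‖

theorem height_pos (K : T.Cell) (v : {v // v ∈ K.verts}) : 0 < height K v := by
  obtain ⟨w, hw⟩ := oppFace_nonempty K v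
  have := norm_pos_iff.2 (outwardVec_oppFace K v hw).2
  unfold height; positivity

theorem norm_normal_oppFace (K : T.Cell) (v : {v // v ∈ K.verts}) : ‖(oppFace K v).normal‖ = 1 := by
  obtain ⟨w, hw⟩ := oppFace_nonempty K v
  have := norm_pos_iff.2 (outwardVec_oppFace K v hw).2
  rw [HalfFace.normal, norm_smul, norm_inv, norm_norm, inv_mul_cancel₀ this.ne']

theorem norm_normal (F : T.HalfFace) : ‖F.normal‖ = 1 := by
  obtain ⟨q, rfl⟩ := oppFace_bijective.2 F
  exact norm_normal_oppFace _ _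

theorem inner_normal_vertex (K : T.Cell) (v : {v // v ∈ K.verts}) {w : Pt (m + 1)}
    (hw : w ∈ K.verts) (hwv : w ≠ v.1) : ⟪(oppFace K v).normal, w - v.1⟫ = height K v := by
  obtain ⟨h1, h2⟩ := outwardVec_oppFace K v (mem_oppFace.2 ⟨hwv, hw⟩)
  have := norm_pos_iff.2 h2
  rw [HalfFace.normal, real_inner_smul_left, h1, height]
  field_simp

theorem inner_normal_face (K : T.Cell) (v : {v // v ∈ K.verts}) {z : Pt (m + 1)}
    (hz : z ∈ (oppFace K v).face.carrier) : ⟪(oppFace K v).normal, z - v.1⟫ = height K v := by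
  have hc : Convex ℝ {z : Pt (m + 1) | ⟪(oppFace K v).normal, z - v.1⟫ = height K v} := by
    have : {z : Pt (m + 1) | ⟪(oppFace K v).normal, z - v.1⟫ = height K v}
        = {z | innerSL ℝ (oppFace K v).normal z
          = height K v + ⟪(oppFace K v).normal, v.1⟫} := by
      ext z; simp [inner_sub_right, sub_eq_iff_eq_add]
    rw [this]
    exact convex_hyperplane (innerSL ℝ (oppFace K v).normal).isLinear _
  refine convexHull_min (fun w hw => ?_) hc hz
  have := mem_oppFace.1 hw
  exact inner_normal_vertex K v this.2 this.1

theorem isCompact_cell (K : T.Cell) : IsCompact K.carrier :=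
  K.verts.finite_toSet.isCompact_convexHull (𝕜 := ℝ)

theorem isCompact_face (e : T.Face) : IsCompact e.carrier :=
  e.verts.finite_toSet.isCompact_convexHull (𝕜 := ℝ)

theorem face_subset_cell (F : T.HalfFace) : F.face.carrier ⊆ F.cell.carrier :=
  convexHull_mono (by exact_mod_cast F.verts_subset)

theorem carrier_eq_coneSet (K : T.Cell) (v : {v // v ∈ K.verts}) :
    K.carrier = coneSet v.1 (oppFace K v).face.carrier := by
  rw [show K.carrier = convexHull ℝ (K.verts : Set (Pt (m + 1))) from rfl, insert_oppFace K v, convexHull_insert (oppFace_nonempty K v)]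
  ext x
  simp only [mem_convexJoin, Set.mem_singleton_iff, exists_eq_left, coneSet, Set.mem_ofPred_eq,
    segment_eq_image']
  constructor
  · rintro ⟨z, hz, s, hs, rfl⟩
    exact ⟨s, hs, z, hz, rfl⟩
  · rintro ⟨s, hs, z, hz, rfl⟩
    exact ⟨z, hz, s, hs, rfl⟩

/-- The radial field φ(x) (x - v) is tangential to all faces through v, and its normal component on
the opposite face is φ times the constant height; hence a single face integral survives. -/
theorem integral_cell_radial (K : T.Cell) (v : {v // v ∈ K.verts}) {φ : Pt (m + 1) → ℝ}
    (hφ : ContDiff ℝ 1 φ) :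
    ∫ x in K.carrier, ((m + 1) * φ x + fderiv ℝ φ x (x - v.1))
      = height K v * ∫ z in (oppFace K v).face.carrier, φ z ∂(μHE[m] : Measure (Pt (m + 1))) := by
  rw [carrier_eq_coneSet K v]
  exact integral_cone_radial (norm_normal_oppFace K v) (height_pos K v) (isCompact_face _)
    (fun z hz => inner_normal_face K v hz) hφ

theorem vectorSpan_cell (K : T.Cell) : vectorSpan ℝ (K.verts : Set (Pt (m + 1))) = ⊤ := by
  have := (affineIndependent_cell K).vectorSpan_eq_top_of_card_eq_finrank_add_one (by
    simp [K.verts_card])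
  simpa using this

theorem integrableOn_cell (K : T.Cell) {f : Pt (m + 1) → ℝ} (hf : ContinuousOn f K.carrier) :
    IntegrableOn f K.carrier := hf.integrableOn_compact (isCompact_cell K)

/-- The divergence theorem on an element. -/
theorem integral_cell_fderiv (K : T.Cell) {φ : Pt (m + 1) → ℝ} (hφ : ContDiff ℝ 1 φ)
    (a : Pt (m + 1)) :
    ∫ x in K.carrier, fderiv ℝ φ x a = ∑ v : {v // v ∈ K.verts}, ⟪a, (oppFace K v).normal⟫ *
      ∫ z in (oppFace K v).face.carrier, φ z ∂(μHE[m] : Measure (Pt (m + 1))) := by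
  have hcont : ∀ a, Continuous fun x => fderiv ℝ φ x a := fun a =>
    (hφ.continuous_fderiv (by simp)).clm_apply continuous_const
  have hint : ∀ a, IntegrableOn (fun x => fderiv ℝ φ x a) K.carrier := fun a =>
    integrableOn_cell K (hcont a).continuousOn
  set I : {v // v ∈ K.verts} → ℝ := fun v =>
    ∫ z in (oppFace K v).face.carrier, φ z ∂(μHE[m] : Measure (Pt (m + 1))) with hI
  have ha : a ∈ vectorSpan ℝ (K.verts : Set (Pt (m + 1))) := by rw [vectorSpan_cell]; trivial
  rw [vectorSpan_def] at ha
  -- Both sides are linear in a, and the differences of vertices span the space.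
  induction ha using Submodule.span_induction with
  | zero => simp
  | add a b _ _ iha ihb =>
    simp only [map_add, inner_add_left, add_mul, Finset.sum_add_distrib]
    rw [integral_add (hint a) (hint b), iha, ihb]
  | smul c a _ iha =>
    simp only [map_smul, smul_eq_mul, real_inner_smul_left, mul_assoc]
    rw [integral_const_mul, iha, Finset.mul_sum]
  | mem a ha =>
    obtain ⟨i, hi, j, hj, rfl⟩ := ha
    have hr : ∀ v : {v // v ∈ K.verts},
        IntegrableOn (fun x => (m + 1) * φ x + fderiv ℝ φ x (x - v.1)) K.carrier := fun v => by
      refine integrableOn_cell K (Continuous.continuousOn ?_)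
      exact (continuous_const.mul hφ.continuous).add
        ((hφ.continuous_fderiv (by simp)).clm_apply (by fun_prop))
    -- The constant field i - j is the difference of the radial fields x - j and x - i.
    have h1 : ∫ x in K.carrier, fderiv ℝ φ x (i -ᵥ j)
        = height K ⟨j, hj⟩ * I ⟨j, hj⟩ - height K ⟨i, hi⟩ * I ⟨i, hi⟩ := by
      rw [hI, ← integral_cell_radial K ⟨j, hj⟩ hφ, ← integral_cell_radial K ⟨i, hi⟩ hφ,
        ← integral_sub (hr _) (hr _)]
      congr 1
      ext x
      simp only [vsub_eq_sub, map_sub]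
      ring
    rw [h1]
    -- The normal opposite v has the product `height K v` with w - v for every vertex w other than
    -- v, and zero for w = v.
    have h2 : ∀ v : {v // v ∈ K.verts}, ⟪i -ᵥ j, (oppFace K v).normal⟫
        = (if v = ⟨j, hj⟩ then height K ⟨j, hj⟩ else 0)
          - (if v = ⟨i, hi⟩ then height K ⟨i, hi⟩ else 0) := by
      intro v
      have e : ∀ w (hw : w ∈ K.verts), ⟪(oppFace K v).normal, w - v.1⟫
          = height K v - if v = ⟨w, hw⟩ then height K ⟨w, hw⟩ else 0 := by
        intro w hw
        by_cases h : v = ⟨w, hw⟩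
        · subst h; simp
        · rw [if_neg h, sub_zero]
          exact inner_normal_vertex K v hw fun h' => h (Subtype.ext h'.symm)
      have : i -ᵥ j = (i - v.1) - (j - v.1) := by simp
      rw [this, real_inner_comm, inner_sub_right, e i hi, e j hj]
      ring
    simp_rw [h2, sub_mul, Finset.sum_sub_distrib, ite_mul, zero_mul]
    simp [hI]

end Geometry

end Triangulation
end HDG

/-! ### Meshes: trace inequalities, covering of the domain, cancellation of normals -/

namespace HDG
namespace Triangulation

section Mesh

variable {m : ℕ} {Ω : Set (Pt (m + 1))} {T : Triangulation Ω}

/-! ### Measures of faces and trace inequalities -/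

/-- A face is the isometric image of a compact subset of ℝᵐ. -/
theorem face_measure_ne_top (F : T.HalfFace) :
    (μHE[m] : Measure (Pt (m + 1))) F.face.carrier ≠ ⊤ := by
  obtain ⟨⟨K, v⟩, rfl⟩ := oppFace_bijective.2 F
  obtain ⟨J, e, S, he, hep, hS, hF, -⟩ := exists_face_coords (norm_normal_oppFace K v)
    (isCompact_face (oppFace K v).face) (fun z hz => inner_normal_face K v hz)
  have hι : Isometry (fun ξ => v.1 + e (height K v, ξ)) := by
    intro x y
    simp only [hep, edist_add_left]
    exact J.isometry x y
  change (μHE[m] : Measure (Pt (m + 1))) (oppFace K v).face.carrier ≠ ⊤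
  rw [hF, hι.euclideanHausdorffMeasure_image, EuclideanSpace.euclideanHausdorffMeasure_eq_volume]
  exact hS.measure_lt_top.ne

/-- The surface measure on the face of a pair. -/
noncomputable abbrev faceMeasure (F : T.HalfFace) : Measure (Pt (m + 1)) :=
  (μHE[m] : Measure (Pt (m + 1))).restrict F.face.carrier

instance (F : T.HalfFace) : IsFiniteMeasure (faceMeasure F) :=
  ⟨by simpa using (face_measure_ne_top F).lt_top⟩

theorem memLp_face (F : T.HalfFace) {u : Pt (m + 1) → ℝ} (hu : ContinuousOn u F.face.carrier)
    (p : ℝ≥0∞) : MemLp u p (faceMeasure F) := by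
  obtain ⟨C, hC⟩ := (isCompact_face F.face).exists_bound_of_continuousOn hu
  exact MemLp.of_bound (hu.aestronglyMeasurable (isCompact_face F.face).measurableSet) C
    ((ae_restrict_iff' (isCompact_face F.face).measurableSet).2 (Filter.Eventually.of_forall hC))

theorem integrable_face (F : T.HalfFace) {u : Pt (m + 1) → ℝ}
    (hu : ContinuousOn u F.face.carrier) : Integrable u (faceMeasure F) :=
  memLp_one_iff_integrable.1 (memLp_face F hu 1)

theorem memLp_cell (K : T.Cell) {u : Pt (m + 1) → ℝ} (hu : ContinuousOn u K.carrier) :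
    MemLp u 2 (volume.restrict K.carrier) := memLp_of_continuous (isCompact_cell K) hu

theorem exists_two_vertices (K : T.Cell) : ∃ v ∈ K.verts, ∃ w ∈ K.verts, v ≠ w :=
  Finset.one_lt_card.1 (by rw [K.verts_card]; omega)

theorem diam_pos (K : T.Cell) : 0 < Metric.diam K.carrier := by
  obtain ⟨v, hv, w, hw, h⟩ := exists_two_vertices K
  have h1 : dist v w ≤ Metric.diam K.carrier :=
    Metric.dist_le_diam_of_mem (isCompact_cell K).isBounded (subset_convexHull ℝ _ hv)
      (subset_convexHull ℝ _ hw)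
  exact (dist_pos.2 h).trans_le h1

theorem vertex_mem (K : T.Cell) (v : {v // v ∈ K.verts}) : v.1 ∈ K.carrier :=
  subset_convexHull ℝ _ v.2

theorem inner_normal_cell (K : T.Cell) (v : {v // v ∈ K.verts}) {x : Pt (m + 1)}
    (hx : x ∈ K.carrier) : 0 ≤ ⟪(oppFace K v).normal, x - v.1⟫ ∧
      ⟪(oppFace K v).normal, x - v.1⟫ ≤ height K v := by
  rw [carrier_eq_coneSet K v] at hx
  obtain ⟨s, hs, z, hz, rfl⟩ := hx
  rw [add_sub_cancel_left, inner_smul_right, inner_normal_face K v hz]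
  have := height_pos K v
  exact ⟨mul_nonneg hs.1 this.le, mul_le_of_le_one_left this.le hs.2⟩

/-- The coordinate normal to the face ranges over the interval from 0 to the height on K, and the
inscribed ball occupies an interval of twice its radius. -/
theorem two_mul_le_height {σ : ℝ} (hσ : 0 < σ) (K : T.Cell) (v : {v // v ∈ K.verts})
    {c : Pt (m + 1)} (hc : Metric.closedBall c (σ * Metric.diam K.carrier) ⊆ K.carrier) :
    2 * σ * Metric.diam K.carrier ≤ height K v := by
  set N := (oppFace K v).normal
  set r := σ * Metric.diam K.carrier with hr
  have hr0 : 0 < r := mul_pos hσ (diam_pos K)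
  have hN : ‖N‖ = 1 := norm_normal_oppFace K v
  have h1 := (inner_normal_cell K v (x := c + r • N) (hc (by
    simp [norm_smul, hN, abs_of_pos hr0]))).2
  have h2 := (inner_normal_cell K v (x := c - r • N) (hc (by
    simp [dist_eq_norm, norm_smul, hN, abs_of_pos hr0]))).1
  have hNN : ⟪N, N⟫ = (1 : ℝ) := by rw [real_inner_self_eq_norm_sq, hN]; norm_num
  have e1 : c + r • N - v.1 = (c - v.1) + r • N := by abel
  have e2 : c - r • N - v.1 = (c - v.1) - r • N := by abel
  rw [e1, inner_add_right, inner_smul_right] at h1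
  rw [e2, inner_sub_right, inner_smul_right] at h2
  change _ + r * ⟪N, N⟫ ≤ _ at h1
  change 0 ≤ _ - r * ⟪N, N⟫ at h2
  rw [hNN] at h1 h2
  linarith

/-- The radial identity for φ² equates the height times the face integral with the integral of (m +
1) φ² + 2 φ Dφ(x - v). Young's inequality and |x - v| ≤ h_K bound the latter; shape regularity
bounds the height from below. -/
theorem trace_inequality {σ : ℝ} (hσ : 0 < σ) (hT : T.ShapeRegular σ) (F : T.HalfFace)
    {φ : Pt (m + 1) → ℝ} (hφ : ContDiff ℝ 1 φ) :
    2 * σ * Metric.diam F.cell.carrier * ∫ x, φ x ^ 2 ∂(faceMeasure F)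
      ≤ (m + 2) * (∫ x in F.cell.carrier, φ x ^ 2)
        + Metric.diam F.cell.carrier ^ 2 * ∫ x in F.cell.carrier, ‖fderiv ℝ φ x‖ ^ 2 := by
  obtain ⟨⟨K, v⟩, rfl⟩ := oppFace_bijective.2 F
  change 2 * σ * Metric.diam K.carrier * ∫ x, φ x ^ 2 ∂(faceMeasure (oppFace K v))
      ≤ (m + 2) * (∫ x in K.carrier, φ x ^ 2)
        + Metric.diam K.carrier ^ 2 * ∫ x in K.carrier, ‖fderiv ℝ φ x‖ ^ 2
  obtain ⟨c, hc⟩ := hT K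
  have h1 := integral_cell_radial K v (hφ.pow 2)
  have h2 := two_mul_le_height hσ K v hc
  have h3 : 0 ≤ ∫ x, φ x ^ 2 ∂(faceMeasure (oppFace K v)) := integral_nonneg fun x => sq_nonneg _
  refine (mul_le_mul_of_nonneg_right h2 h3).trans ?_
  rw [← h1]
  have c1 := hφ.continuous
  have c2 := hφ.continuous_fderiv (by simp)
  have i1 : IntegrableOn (fun x => φ x ^ 2) K.carrier := integrableOn_cell K (by fun_prop)
  have i2 : IntegrableOn (fun x => ‖fderiv ℝ φ x‖ ^ 2) K.carrier :=
    integrableOn_cell K (by fun_prop)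
  rw [← integral_const_mul, ← integral_const_mul, ← integral_add (i1.const_mul _) (i2.const_mul _)]
  refine setIntegral_mono_on ?_ ((i1.const_mul _).add (i2.const_mul _))
    (isCompact_cell K).measurableSet fun x hx => ?_
  · refine integrableOn_cell K (Continuous.continuousOn ?_)
    have := (hφ.pow 2).continuous_fderiv (by simp)
    exact (continuous_const.mul (c1.pow 2)).add (this.clm_apply (by fun_prop))
  · have hd : fderiv ℝ (fun x => φ x ^ 2) x (x - v.1) = 2 * φ x * fderiv ℝ φ x (x - v.1) := by
      have h6 := ((hφ.differentiable (by simp) x).hasFDerivAt).pow 2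
      refine (congrArg (fun L : Pt (m + 1) →L[ℝ] ℝ => L (x - v.1)) h6.fderiv).trans ?_
      simp
    rw [hd]
    have hx' : ‖x - v.1‖ ≤ Metric.diam K.carrier := by
      rw [← dist_eq_norm]
      exact Metric.dist_le_diam_of_mem (isCompact_cell K).isBounded hx (vertex_mem K v)
    have h4 : |fderiv ℝ φ x (x - v.1)| ≤ ‖fderiv ℝ φ x‖ * Metric.diam K.carrier :=
      ((fderiv ℝ φ x).le_opNorm _).trans (by gcongr)
    have h5 := pow_le_pow_left₀ (abs_nonneg _) h4 2
    rw [sq_abs] at h5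
    nlinarith [sq_nonneg (φ x - fderiv ℝ φ x (x - v.1))]

theorem cell_subset_closedBall {σ : ℝ} (hσ : 0 < σ) {K : T.Cell} {c : Pt (m + 1)}
    (hc : Metric.closedBall c (σ * Metric.diam K.carrier) ⊆ K.carrier) :
    K.carrier ⊆ Metric.closedBall c (Metric.diam K.carrier) := fun x hx => by
  have hcK : c ∈ K.carrier := hc (by simpa using (mul_pos hσ (diam_pos K)).le)
  exact Metric.dist_le_diam_of_mem (isCompact_cell K).isBounded hx hcK

/-- The inverse inequality on the elements of a shape regular mesh. -/
theorem exists_inverse (m k : ℕ) {σ : ℝ} (hσ : 0 < σ) : ∃ C : ℝ, 0 < C ∧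
    ∀ {Ω : Set (Pt (m + 1))} (T : Triangulation Ω), T.ShapeRegular σ → ∀ (K : T.Cell)
      (u : Pt (m + 1) → ℝ), IsPoly k u →
      Metric.diam K.carrier ^ 2 * ∫ x in K.carrier, ‖fderiv ℝ u x‖ ^ 2
        ≤ C * ∫ x in K.carrier, u x ^ 2 := by
  obtain ⟨C, hC, H⟩ := exists_inverse_inequality (m + 1) k hσ
  refine ⟨C, hC, fun T hT K u hu => ?_⟩
  obtain ⟨c, hc⟩ := hT K
  exact H u hu _ c _ (diam_pos K) (isCompact_cell K) hc (cell_subset_closedBall hσ hc)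

/-- The discrete trace inequality on the elements of a shape regular mesh. -/
theorem exists_discrete_trace (m k : ℕ) {σ : ℝ} (hσ : 0 < σ) : ∃ C : ℝ, 0 < C ∧
    ∀ {Ω : Set (Pt (m + 1))} (T : Triangulation Ω), T.ShapeRegular σ → ∀ (F : T.HalfFace)
      (u : Pt (m + 1) → ℝ), IsPoly k u →
      Metric.diam F.cell.carrier * ∫ x, u x ^ 2 ∂(faceMeasure F)
        ≤ C * ∫ x in F.cell.carrier, u x ^ 2 := by
  obtain ⟨C, hC, H⟩ := exists_inverse m k hσ
  refine ⟨(2 * σ)⁻¹ * (m + 2 + C), by positivity, fun T hT F u hu => ?_⟩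
  have h1 := trace_inequality hσ hT F (hu.contDiff.of_le (by simp))
  have h2 := H T hT F.cell u hu
  rw [mul_assoc, ← div_eq_inv_mul, le_div_iff₀ (by positivity)]
  linarith

/-! ### The elements cover the domain -/

theorem volume_convexHull_eq_zero {s : Finset (Pt (m + 1))} (hs : s.card ≤ m + 1) :
    volume (convexHull ℝ (s : Set (Pt (m + 1)))) = 0 := by
  classical
  rcases s.eq_empty_or_nonempty with rfl | hne
  · simp
  refine measure_mono_null (convexHull_subset_affineSpan _) ?_
  refine Measure.addHaar_affineSubspace _ _ fun htop => ?_
  have h1 := AffineSubspace.vectorSpan_eq_top_of_affineSpan_eq_top ℝ _ _ htop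
  have h2 := finrank_vectorSpan_image_finset_le ℝ (id : Pt (m + 1) → Pt (m + 1)) s
    (n := s.card - 1) (by have := hne.card_pos; omega)
  rw [Finset.image_id, h1, finrank_top] at h2
  simp at h2
  have := hne.card_pos
  omega

theorem cell_subset_closure (K : T.Cell) : K.carrier ⊆ closure Ω := by
  rw [← T.space_eq]
  exact T.complex.convexHull_subset_space K.verts_mem

theorem face_subset_closure (F : T.HalfFace) : F.face.carrier ⊆ closure Ω :=
  (face_subset_cell F).trans (cell_subset_closure _)

/-- By conformity the intersection lies in the hull of the common vertices, of which there are at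
most m + 1. -/
theorem volume_inter_cell {K K' : T.Cell} (h : K ≠ K') : volume (K.carrier ∩ K'.carrier) = 0 := by
  classical
  have h1 := T.complex.inter_subset_convexHull K.verts_mem K'.verts_mem
  refine measure_mono_null h1 ?_
  rw [← Finset.coe_inter]
  refine volume_convexHull_eq_zero ?_
  have h2 : (K.verts ∩ K'.verts).card < K.verts.card := by
    refine Finset.card_lt_card ⟨Finset.inter_subset_left, fun hsub => h ?_⟩
    have h3 : K.verts ⊆ K'.verts := fun x hx => (Finset.mem_inter.1 (hsub hx)).2
    exact Subtype.ext (Finset.eq_of_subset_of_card_le h3 (K'.verts_card.trans K.verts_card.symm).le)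
  rw [K.verts_card] at h2
  omega

/-- A point that belongs to no element lies in a simplex of the complex with at most m + 1 vertices,
and these are finitely many null sets. -/
theorem volume_closure_sdiff_cells : volume (closure Ω \ ⋃ K : T.Cell, K.carrier) = 0 := by
  have h1 : closure Ω \ ⋃ K : T.Cell, K.carrier
      ⊆ ⋃ s ∈ {s ∈ T.complex.faces | s.card ≤ m + 1}, convexHull ℝ (s : Set (Pt (m + 1))) := by
    rintro x ⟨hx, hx'⟩
    rw [← T.space_eq] at hx
    obtain ⟨s, hs, hxs⟩ := T.complex.mem_space_iff.1 hx
    refine Set.mem_biUnion (x := s) ⟨hs, ?_⟩ hxs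
    by_contra hcard
    have h2 : s.card ≤ m + 2 := by
      have := (T.complex.indep hs).card_le_finrank_succ
      have h3 := Submodule.finrank_le (vectorSpan ℝ (Set.range ((↑) : s → Pt (m + 1))))
      simp at this h3
      omega
    exact hx' (Set.mem_iUnion.2 ⟨⟨s, hs, by omega⟩, hxs⟩)
  refine measure_mono_null h1 ?_
  rw [measure_biUnion_null_iff (T.finite_faces.subset fun s hs => hs.1).countable]
  exact fun s hs => volume_convexHull_eq_zero hs.2

/-- The boundary of a convex set is a null set. -/
theorem restrict_closure (hΩ : IsConvexPolytopeDomain Ω) :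
    volume.restrict (closure Ω) = volume.restrict Ω := by
  refine Measure.restrict_congr_set ?_
  refine (Filter.EventuallyLE.antisymm ?_ subset_closure.eventuallyLE)
  rw [ae_le_set]
  refine measure_mono_null ?_ (hΩ.convex.addHaar_frontier volume)
  rw [frontier, hΩ.isOpen.interior_eq]

theorem restrict_cell_le (hΩ : IsConvexPolytopeDomain Ω) (K : T.Cell) :
    volume.restrict K.carrier ≤ volume.restrict Ω := by
  rw [← restrict_closure hΩ]
  exact Measure.restrict_mono (cell_subset_closure K) le_rfl

theorem restrict_iUnion_cell (hΩ : IsConvexPolytopeDomain Ω) :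
    volume.restrict (⋃ K : T.Cell, K.carrier) = volume.restrict Ω := by
  rw [← restrict_closure hΩ]
  refine Measure.restrict_congr_set ?_
  refine Filter.EventuallyLE.antisymm
    (Set.iUnion_subset fun K => cell_subset_closure K).eventuallyLE ?_
  rw [ae_le_set]
  exact volume_closure_sdiff_cells

theorem sum_integral_cell (hΩ : IsConvexPolytopeDomain Ω) {f : Pt (m + 1) → ℝ}
    (hf : IntegrableOn f Ω) : ∑ K : T.Cell, ∫ x in K.carrier, f x = ∫ x in Ω, f x := by
  rw [← restrict_iUnion_cell (T := T) hΩ, integral_iUnion_ae, tsum_fintype]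
  · exact fun K => (isCompact_cell K).measurableSet.nullMeasurableSet
  · exact fun K K' h => volume_inter_cell h
  · rwa [IntegrableOn, restrict_iUnion_cell hΩ]

/-! ### The normals of the two sides of an interior face -/

/-- The radial identity with φ = 1 reads (m + 1) |K| = height * |e|, and K has interior points. -/
theorem measure_face_pos (K : T.Cell) (v : {v // v ∈ K.verts}) :
    0 < (μHE[m] : Measure (Pt (m + 1))) (oppFace K v).face.carrier := by
  rw [pos_iff_ne_zero]
  intro h0
  have h1 := integral_cell_radial K v (φ := fun _ => 1) contDiff_const
  rw [Measure.restrict_eq_zero.2 h0] at h1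
  simp only [fderiv_fun_const, Pi.zero_apply, zero_apply, add_zero,
    integral_zero_measure, mul_zero, mul_one, setIntegral_const, smul_eq_mul] at h1
  have h2 : (interior K.carrier).Nonempty := by
    refine interior_convexHull_nonempty_iff_affineSpan_eq_top.2 ?_
    rw [AffineSubspace.affineSpan_eq_top_iff_vectorSpan_eq_top_of_nonempty]
    · exact vectorSpan_cell K
    · exact ⟨v.1, v.2⟩
  have h3 : 0 < volume K.carrier :=
    (isOpen_interior.measure_pos volume h2).trans_le (measure_mono interior_subset)
  have h4 : 0 < volume.real K.carrier :=
    ENNReal.toReal_pos h3.ne' (isCompact_cell K).measure_lt_top.ne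
  have h5 : (0 : ℝ) < m + 1 := by positivity
  exact (mul_pos h4 h5).ne' h1

/-- Move a point of the face that lies in Ω slightly towards the barycentre b of the face. If
another face contained the new point, conformity would place it in the hull of the common vertices,
which misses a vertex w. The coordinate normal to the face of K opposite w is maximal on that hull,
but strictly smaller at b and hence at the new point. -/
theorem exists_relint_point (hΩ : IsOpen Ω) (K : T.Cell) (v : {v // v ∈ K.verts})
    (hf : ¬ (oppFace K v).face.carrier ⊆ frontier Ω) :
    ∃ z ∈ (oppFace K v).face.carrier, z ∈ Ω ∧
      ∀ e : T.Face, e ≠ (oppFace K v).face → z ∉ e.carrier := by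
  classical
  obtain ⟨z₀, hz₀, hz₀'⟩ := Set.not_subset.1 hf
  have hz₀Ω : z₀ ∈ Ω := by
    by_contra h
    exact hz₀' ⟨face_subset_closure _ hz₀, by rwa [hΩ.interior_eq]⟩
  set e₀ := (oppFace K v).face with he₀
  set b := e₀.verts.centroid ℝ id with hb
  have hbe : b ∈ e₀.carrier := by
    have := Finset.centroid_mem_convexHull (R := ℝ) e₀.verts (oppFace_nonempty K v)
    exact this
  have hcont : Filter.Tendsto (fun t : ℝ => z₀ + t • (b - z₀)) (nhdsWithin 0 (Set.Ioi 0))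
      (nhds z₀) := by
    have : Continuous fun t : ℝ => z₀ + t • (b - z₀) := by fun_prop
    have h := this.tendsto 0
    simp only [zero_smul, add_zero] at h
    exact h.mono_left nhdsWithin_le_nhds
  have hev := (hcont.eventually (hΩ.mem_nhds hz₀Ω)).and
    ((Ioo_mem_nhdsGT (zero_lt_one (α := ℝ))))
  obtain ⟨t, htΩ, ht⟩ := hev.exists
  refine ⟨z₀ + t • (b - z₀), (convex_convexHull ℝ _).add_smul_sub_mem hz₀ hbe ⟨ht.1.le, ht.2.le⟩,
    htΩ, fun e hne hze => ?_⟩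
  have hsub : (e₀.verts ∩ e.verts) ⊂ e₀.verts := by
    refine ⟨Finset.inter_subset_left, fun hsub => hne ?_⟩
    have h3 : e₀.verts ⊆ e.verts := fun x hx => (Finset.mem_inter.1 (hsub hx)).2
    exact (Subtype.ext (Finset.eq_of_subset_of_card_le h3
      (e.verts_card.trans e₀.verts_card.symm).le)).symm
  obtain ⟨w, hw, hw'⟩ := Finset.exists_of_ssubset hsub
  have hwK : w ∈ K.verts := (mem_oppFace.1 hw).2
  let w' : {v // v ∈ K.verts} := ⟨w, hwK⟩
  have hzi := T.complex.inter_subset_convexHull e₀.verts_mem e.verts_mem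
    ⟨(convex_convexHull ℝ _).add_smul_sub_mem hz₀ hbe ⟨ht.1.le, ht.2.le⟩, hze⟩
  rw [← Finset.coe_inter] at hzi
  have h1 : z₀ + t • (b - z₀) ∈ (oppFace K w').face.carrier := by
    refine convexHull_mono (fun x hx => ?_) hzi
    have hx' := Finset.mem_inter.1 hx
    refine mem_oppFace.2 ⟨fun h => hw' ?_, (mem_oppFace.1 hx'.1).2⟩
    have h' : x = w := h
    rw [← h']; exact hx
  have h2 := inner_normal_face K w' h1
  set N := (oppFace K w').normal
  have h3 : ⟪N, z₀ - w⟫ ≤ height K w' :=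
    (inner_normal_cell K w' (face_subset_cell (oppFace K v) hz₀)).2
  -- Strict, because w itself is among the averaged vertices and has coordinate zero.
  have h4 : ⟪N, b - w⟫ < height K w' := by
    have hbs : b - w = ((m : ℝ) + 1)⁻¹ • ∑ x ∈ e₀.verts, (x - w) := by
      rw [hb, centroid_eq (oppFace_nonempty K v), e₀.verts_card, Finset.sum_sub_distrib,
        Finset.sum_const, e₀.verts_card, smul_sub, ← Nat.cast_smul_eq_nsmul ℝ, smul_smul]
      push_cast
      rw [inv_mul_cancel₀ (by positivity), one_smul]
    rw [hbs, inner_smul_right, inner_sum, inv_mul_lt_iff₀ (by positivity)]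
    have hpos := height_pos K w'
    have : ∑ x ∈ e₀.verts, ⟪N, x - w⟫ < ∑ x ∈ e₀.verts, height K w' := by
      refine Finset.sum_lt_sum (fun x hx => ?_) ⟨w, hw, ?_⟩
      · exact (inner_normal_cell K w' (vertex_mem K ⟨x, (mem_oppFace.1 hx).2⟩)).2
      · simpa using hpos
    rw [Finset.sum_const, e₀.verts_card, nsmul_eq_mul] at this
    push_cast at this
    exact this
  have h5 : z₀ + t • (b - z₀) - w = (1 - t) • (z₀ - w) + t • (b - w) := by module
  change ⟪N, z₀ + t • (b - z₀) - w⟫ = _ at h2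
  rw [h5, inner_add_right, inner_smul_right, inner_smul_right] at h2
  nlinarith [ht.1, ht.2]

/-- A copy of the face shrunk towards z lies in the face and in the ball where the bump equals 1,
and a homothety multiplies the measure by a positive factor. -/
theorem integral_bump_face_pos (K : T.Cell) (v : {v // v ∈ K.verts}) {z : Pt (m + 1)}
    (hz : z ∈ (oppFace K v).face.carrier) (φ : ContDiffBump z) :
    0 < ∫ x, φ x ∂(faceMeasure (oppFace K v)) := by
  set E := (oppFace K v).face.carrier with hE
  have hd : 0 < Metric.diam K.carrier := diam_pos K
  set t : ℝ := min 1 (φ.rIn / Metric.diam K.carrier) with ht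
  have ht0 : 0 < t := lt_min one_pos (div_pos φ.rIn_pos hd)
  set S := AffineMap.homothety z t '' E with hS
  have hSE : S ⊆ E := by
    rintro _ ⟨x, hx, rfl⟩
    rw [AffineMap.homothety_apply, vsub_eq_sub, vadd_eq_add, add_comm (t • (x - z)) z]
    exact (convex_convexHull ℝ _).add_smul_sub_mem hz hx ⟨ht0.le, min_le_left _ _⟩
  have hSb : S ⊆ Metric.closedBall z φ.rIn := by
    rintro _ ⟨x, hx, rfl⟩
    rw [AffineMap.homothety_apply, vsub_eq_sub, vadd_eq_add, mem_closedBall_iff_norm,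
      add_sub_cancel_right, norm_smul, Real.norm_of_nonneg ht0.le, ← dist_eq_norm]
    have h1 : dist x z ≤ Metric.diam K.carrier :=
      Metric.dist_le_diam_of_mem (isCompact_cell K).isBounded
        (face_subset_cell (oppFace K v) hx) (face_subset_cell (oppFace K v) hz)
    calc t * dist x z ≤ (φ.rIn / Metric.diam K.carrier) * Metric.diam K.carrier := by
          exact mul_le_mul (min_le_right _ _) h1 dist_nonneg (div_pos φ.rIn_pos hd).le
      _ = φ.rIn := by field_simp
  have hSm : MeasurableSet S := by
    have hc : Continuous (AffineMap.homothety z t : Pt (m + 1) →ᵃ[ℝ] Pt (m + 1)) := by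
      rw [show (AffineMap.homothety z t : Pt (m + 1) → Pt (m + 1)) = fun x => t • (x - z) + z from
        funext fun x => by simp [AffineMap.homothety_apply]]
      fun_prop
    exact ((isCompact_face _).image hc).measurableSet
  have hSpos : 0 < (μHE[m] : Measure (Pt (m + 1))) S := by
    rw [hS, euclideanHausdorffMeasure_homothety_image m z ht0.ne']
    have := measure_face_pos K v
    have h2 : 0 < ‖t‖₊ ^ m := pow_pos (by simpa using ht0.ne') _
    rw [ENNReal.smul_def, smul_eq_mul]
    exact ENNReal.mul_pos (by exact_mod_cast h2.ne') this.ne'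
  have hfin := face_measure_ne_top (oppFace K v)
  have h3 : ∫ x in S, φ x ∂(μHE[m] : Measure (Pt (m + 1))) = (μHE[m] : Measure _).real S := by
    rw [setIntegral_congr_fun hSm (g := fun _ => (1 : ℝ))
      fun x hx => φ.one_of_mem_closedBall (hSb hx)]
    simp
  have h4 : 0 < (μHE[m] : Measure (Pt (m + 1))).real S :=
    ENNReal.toReal_pos hSpos.ne' ((measure_mono hSE).trans_lt hfin.lt_top).ne
  refine (h4.trans_eq h3.symm).trans_le ?_
  refine setIntegral_mono_set (integrable_face _ φ.continuous.continuousOn)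
    (Filter.Eventually.of_forall fun x => φ.nonneg) hSE.eventuallyLE

theorem integral_fderiv_eq_zero {φ : Pt (m + 1) → ℝ} (hφ : ContDiff ℝ 1 φ)
    (hc : HasCompactSupport φ) (a : Pt (m + 1)) : ∫ x, fderiv ℝ φ x a = 0 := by
  have h := integral_mul_fderiv_eq_neg_fderiv_mul_of_integrable (μ := volume) (f := φ)
    (g := fun _ => (1 : ℝ)) (v := a) (𝕜 := ℝ) ?_ ?_ ?_ ?_ ?_
  · simpa using h.symm
  · simp only [mul_one]
    exact ((hφ.continuous_fderiv (by simp)).clm_apply continuous_const).integrable_of_hasCompactSupport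
      (hc.fderiv_apply ℝ a)
  · simp
  · simpa using hφ.continuous.integrable_of_hasCompactSupport hc
  · exact fun x _ => hφ.differentiable (by simp) x
  · exact fun x _ => differentiableAt_const _

-- Apply the divergence theorem on all elements to a bump function supported in Ω near a point of
-- this face that lies on no other face. The volume integrals add up to the integral of a derivative
-- of a compactly supported function, which is zero; the face integrals add up to the sum of the
-- normals, in direction a, times a positive number. The elements sharing the face need not be
-- counted.
open Classical in
theorem sum_normal_eq_zero (hΩ : IsConvexPolytopeDomain Ω) (e : T.Face)
    (he : ¬ e.carrier ⊆ frontier Ω) :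
    ∑ F : T.HalfFace with F.face = e, F.normal = 0 := by
  by_cases hex : ∃ F : T.HalfFace, F.face = e
  swap
  · refine Finset.sum_eq_zero fun F hF => absurd ⟨F, (Finset.mem_filter.1 hF).2⟩ hex
  obtain ⟨F₀, rfl⟩ := hex
  obtain ⟨⟨K, v⟩, rfl⟩ := oppFace_bijective.2 F₀
  obtain ⟨z, hz, hzΩ, hze⟩ := exists_relint_point hΩ.isOpen K v he
  haveI := T.finite_face
  have hcl : IsClosed (⋃ e : {e : T.Face // e ≠ (oppFace K v).face}, e.1.carrier) :=
    isClosed_iUnion_of_finite fun e => (isCompact_face e.1).isClosed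
  have hopen : IsOpen (Ω ∩ (⋃ e : {e : T.Face // e ≠ (oppFace K v).face}, e.1.carrier)ᶜ) :=
    hΩ.isOpen.inter hcl.isOpen_compl
  obtain ⟨r, hr, hball⟩ := Metric.isOpen_iff.1 hopen z ⟨hzΩ, by
    simp only [Set.mem_compl_iff, Set.mem_iUnion, not_exists]
    exact fun e => hze e.1 e.2⟩
  let φ : ContDiffBump z := ⟨r / 4, r / 2, by linarith, by linarith⟩
  have hsupp : Function.support φ ⊆ Metric.ball z r := by
    rw [φ.support_eq]; exact Metric.ball_subset_ball (by change r / 2 ≤ r; linarith)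
  have htsupp : tsupport φ ⊆ Metric.ball z r := by
    rw [φ.tsupport_eq]; exact Metric.closedBall_subset_ball (by change r / 2 < r; linarith)
  have hφ : ContDiff ℝ 1 φ := φ.contDiff
  refine ext_inner_left ℝ fun a => ?_
  rw [inner_zero_right]
  have h1 : ∫ x in Ω, fderiv ℝ φ x a = 0 := by
    rw [← integral_fderiv_eq_zero hφ φ.hasCompactSupport a]
    refine setIntegral_eq_integral_of_forall_compl_eq_zero fun x hx => ?_
    have : x ∉ tsupport φ := fun h => hx (hball (htsupp h)).1
    rw [fderiv_of_notMem_tsupport ℝ this]; simp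
  have hint : IntegrableOn (fun x => fderiv ℝ φ x a) Ω :=
    (((hφ.continuous_fderiv (by simp)).clm_apply continuous_const).integrable_of_hasCompactSupport
      (φ.hasCompactSupport.fderiv_apply ℝ a)).integrableOn
  rw [← sum_integral_cell (T := T) hΩ hint] at h1
  simp_rw [fun K => integral_cell_fderiv K hφ a] at h1
  have h2 := sum_halfFace (T := T) fun F => ⟪a, F.normal⟫ * ∫ x, φ x ∂(faceMeasure F)
  rw [← show _ = ∑ K : T.Cell, _ from h2] at h1
  rw [← Finset.sum_filter_add_sum_filter_not _ (fun F : T.HalfFace => F.face = (oppFace K v).face)]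
    at h1
  have h3 : ∑ F : T.HalfFace with ¬ F.face = (oppFace K v).face,
      ⟪a, F.normal⟫ * ∫ x, φ x ∂(faceMeasure F) = 0 := by
    refine Finset.sum_eq_zero fun F hF => ?_
    have hF' := (Finset.mem_filter.1 hF).2
    have : ∫ x, φ x ∂(faceMeasure F) = 0 := by
      refine setIntegral_eq_zero_of_forall_eq_zero fun x hx => ?_
      by_contra h0
      exact (hball (hsupp h0)).2 (Set.mem_iUnion.2 ⟨⟨F.face, hF'⟩, hx⟩)
    rw [this, mul_zero]
  rw [h3, add_zero] at h1
  have h4 : ∀ F ∈ ({F : T.HalfFace | F.face = (oppFace K v).face} : Finset _),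
      ⟪a, F.normal⟫ * ∫ x, φ x ∂(faceMeasure F)
        = ⟪a, F.normal⟫ * ∫ x, φ x ∂(faceMeasure (oppFace K v)) := by
    intro F hF
    rw [faceMeasure, faceMeasure, (Finset.mem_filter.1 hF).2]
  rw [Finset.sum_congr rfl h4, ← Finset.sum_mul, ← inner_sum] at h1
  exact (mul_eq_zero.1 h1).resolve_right (integral_bump_face_pos K v hz φ).ne'

end Mesh

end Triangulation
end HDG

/-! ### Mollification combined with a contraction of the domain -/

namespace HDG

section Smoothing

open Filter Topology

variable {n : ℕ}

/-- The convolution of `f` with the kernel `ψ`. -/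
noncomputable def mollify (ψ f : Pt n → ℝ) (X : Pt n) : ℝ := ∫ z, f z * ψ (X - z)

theorem mollify_eq_convolution (ψ f : Pt n → ℝ) :
    mollify ψ f = convolution f ψ (ContinuousLinearMap.mul ℝ ℝ) volume := rfl

theorem mollify_eq_normed (φ : ContDiffBump (0 : Pt n)) (f : Pt n → ℝ) (X : Pt n) :
    mollify (φ.normed volume) f X
      = convolution (φ.normed volume) f (ContinuousLinearMap.lsmul ℝ ℝ) volume X := by
  rw [mollify, convolution_def, ← integral_sub_left_eq_self _ volume X]
  refine integral_congr_ae (Eventually.of_forall fun z => ?_)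
  simp [mul_comm]

theorem iteratedFDeriv_succ_apply {g : Pt n → ℝ} (hg : ContDiff ℝ ∞ g) (m : ℕ) (x : Pt n)
    (w : Fin (m + 1) → Pt n) :
    iteratedFDeriv ℝ (m + 1) g x w
      = fderiv ℝ (fun y => iteratedFDeriv ℝ m g y (Fin.tail w)) x (w 0) := by
  rw [iteratedFDeriv_succ_apply_left]
  have hd : DifferentiableAt ℝ (iteratedFDeriv ℝ m g) x :=
    (hg.differentiable_iteratedFDeriv (m := m) (by exact_mod_cast ENat.natCast_lt_top m)) x
  rw [fderiv_continuousMultilinear_apply_const_apply hd]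

theorem contDiff_iteratedFDeriv_apply {g : Pt n → ℝ} (hg : ContDiff ℝ ∞ g) (m : ℕ)
    (w : Fin m → Pt n) : ContDiff ℝ ∞ (fun y => iteratedFDeriv ℝ m g y w) := by
  have h1 : ContDiff ℝ ∞ (iteratedFDeriv ℝ m g) := by
    refine hg.iteratedFDeriv_right (by exact_mod_cast le_top)
  exact (ContinuousMultilinearMap.apply ℝ (fun _ : Fin m => Pt n) ℝ w).contDiff.comp h1

theorem hasCompactSupport_iteratedFDeriv_apply {g : Pt n → ℝ} (hg : HasCompactSupport g) (m : ℕ)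
    (w : Fin m → Pt n) : HasCompactSupport (fun y => iteratedFDeriv ℝ m g y w) :=
  (hg.iteratedFDeriv (𝕜 := ℝ) m).comp_left
    (g := fun L : Pt n [×m]→L[ℝ] ℝ => L w) rfl

theorem fderiv_mollify {ψ f : Pt n → ℝ} (hψ : ContDiff ℝ ∞ ψ) (hc : HasCompactSupport ψ)
    (hf : LocallyIntegrable f) (X a : Pt n) :
    fderiv ℝ (mollify ψ f) X a = mollify (fun y => fderiv ℝ ψ y a) f X := by
  rw [mollify_eq_convolution, mollify_eq_convolution,
    (hc.hasFDerivAt_convolution_right (ContinuousLinearMap.mul ℝ ℝ) hf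
      (hψ.of_le (by simp)) X).fderiv]
  exact convolution_precompR_apply (ContinuousLinearMap.mul ℝ ℝ) hf (hc.fderiv ℝ)
    (hψ.continuous_fderiv (by simp)) X a

theorem contDiff_mollify {ψ f : Pt n → ℝ} (hψ : ContDiff ℝ ∞ ψ) (hc : HasCompactSupport ψ)
    (hf : LocallyIntegrable f) : ContDiff ℝ ∞ (mollify ψ f) := by
  rw [mollify_eq_convolution]
  exact hc.contDiff_convolution_right (n := ⊤) (ContinuousLinearMap.mul ℝ ℝ) hf hψ

theorem iteratedFDeriv_mollify {ψ f : Pt n → ℝ} (hψ : ContDiff ℝ ∞ ψ) (hc : HasCompactSupport ψ)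
    (hf : LocallyIntegrable f) (m : ℕ) (w : Fin m → Pt n) (X : Pt n) :
    iteratedFDeriv ℝ m (mollify ψ f) X w = mollify (fun y => iteratedFDeriv ℝ m ψ y w) f X := by
  induction m generalizing X with
  | zero => simp
  | succ m ih =>
    rw [iteratedFDeriv_succ_apply (contDiff_mollify hψ hc hf)]
    have : (fun y => iteratedFDeriv ℝ m (mollify ψ f) y (Fin.tail w))
        = mollify (fun y => iteratedFDeriv ℝ m ψ y (Fin.tail w)) f := funext fun y => ih _ y
    rw [this, fderiv_mollify (contDiff_iteratedFDeriv_apply hψ m _)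
      (hasCompactSupport_iteratedFDeriv_apply hc m _) hf]
    simp_rw [iteratedFDeriv_succ_apply hψ]

/-- Used with t the contraction factor, and with t = -1 for the reflected kernel. -/
theorem iteratedFDeriv_comp_affine {g : Pt n → ℝ} (hg : ContDiff ℝ ∞ g) (b : Pt n) (t : ℝ) (m : ℕ)
    (w : Fin m → Pt n) (z : Pt n) :
    iteratedFDeriv ℝ m (fun z => g (b + t • z)) z w
      = t ^ m * iteratedFDeriv ℝ m g (b + t • z) w := by
  have h1 : ContDiff ℝ ∞ (fun z => g (b + z)) := hg.comp (contDiff_const.add contDiff_id)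
  have h2 := (t • ContinuousLinearMap.id ℝ (Pt n)).iteratedFDeriv_comp_right h1 z
    (i := m) (by exact_mod_cast le_top)
  have h3 : (fun z => g (b + t • z))
      = (fun z => g (b + z)) ∘ (t • ContinuousLinearMap.id ℝ (Pt n)) := by ext; simp
  rw [h3, h2, iteratedFDeriv_comp_add_left]
  simp [ContinuousMultilinearMap.map_smul_univ]

/-- The map `x ↦ c + t (x - c)`. -/
noncomputable def shrink (c : Pt n) (t : ℝ) (x : Pt n) : Pt n := (c - t • c) + t • x

/-- With w the deviation of y from the contracted point, y = t x + (1 - t) (c + w / (1 - t)), and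
the second point lies in the ball about c. The contraction thus leaves the room (1 - t) r around its
image, even for x on the boundary. -/
theorem shrink_add_mem {Ω : Set (Pt n)} (ho : IsOpen Ω) (hconv : Convex ℝ Ω) {c : Pt n} {r t : ℝ}
    (hc : Metric.ball c r ⊆ Ω) (ht0 : 0 ≤ t) (ht1 : t < 1) {x : Pt n} (hx : x ∈ closure Ω)
    {y : Pt n} (hy : dist y (shrink c t x) < (1 - t) * r) : y ∈ Ω := by
  have h1t : 0 < 1 - t := by linarith
  set w := y - shrink c t x with hw
  have h1 : c + (1 - t)⁻¹ • w ∈ interior Ω := by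
    rw [ho.interior_eq]
    refine hc ?_
    rw [mem_ball_iff_norm, add_sub_cancel_left, norm_smul, norm_inv, Real.norm_of_nonneg h1t.le,
      inv_mul_lt_iff₀ h1t, hw, ← dist_eq_norm]
    exact hy
  have h2 := hconv.combo_closure_interior_mem_interior hx h1 ht0 h1t (by ring)
  rw [ho.interior_eq] at h2
  convert h2 using 1
  rw [smul_add, smul_smul, mul_inv_cancel₀ h1t.ne', one_smul, hw, shrink]
  module

/-! ### The smoothing operators -/

/-- The bump function used in the smoothing operators. -/
noncomputable def smoothingBump (r : ℝ) (hr : 0 < r) (N : ℕ) : ContDiffBump (0 : Pt n) where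
  rIn := r / (4 * (N + 2))
  rOut := r / (2 * (N + 2))
  rIn_pos := by positivity
  rIn_lt_rOut := by
    apply div_lt_div_of_pos_left hr (by positivity)
    nlinarith [(Nat.cast_nonneg N : (0 : ℝ) ≤ N)]

/-- The contraction factor of the smoothing operators. -/
noncomputable def factor (N : ℕ) : ℝ := 1 - 1 / (N + 2)

theorem factor_pos (N : ℕ) : 0 < factor N := by
  have : (0 : ℝ) < N + 2 := by positivity
  rw [factor, sub_pos, div_lt_one this]; linarith [(Nat.cast_nonneg N : (0 : ℝ) ≤ N)]

theorem half_le_factor (N : ℕ) : 1 / 2 ≤ factor N := by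
  have : (1 : ℝ) / (N + 2) ≤ 1 / 2 := by
    apply one_div_le_one_div_of_le (by norm_num); linarith [(Nat.cast_nonneg N : (0 : ℝ) ≤ N)]
  rw [factor]; linarith

theorem factor_lt_one (N : ℕ) : factor N < 1 := by
  have : (0 : ℝ) < 1 / (N + 2) := by positivity
  rw [factor]; linarith

theorem tendsto_factor : Tendsto factor atTop (𝓝 1) := by
  have h1 : Tendsto (fun N : ℕ => (1 : ℝ) / ((N : ℝ) + 2)) atTop (𝓝 0) := by
    refine Tendsto.div_atTop tendsto_const_nhds ?_
    exact tendsto_atTop_add_const_right _ _ tendsto_natCast_atTop_atTop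
  have h2 := (tendsto_const_nhds (x := (1 : ℝ))).sub h1
  rw [sub_zero] at h2
  exact h2

/-- The mollification radius is half of the room (1 - factor N) * r left by the contraction. -/
theorem rOut_lt {r : ℝ} (hr : 0 < r) (N : ℕ) :
    (smoothingBump (n := n) r hr N).rOut < (1 - factor N) * r := by
  change r / (2 * (N + 2)) < _
  rw [factor, sub_sub_cancel, div_mul_eq_mul_div, one_mul]
  apply div_lt_div_of_pos_left hr (by positivity)
  nlinarith [(Nat.cast_nonneg N : (0 : ℝ) ≤ N)]

/-- The smoothing of functions on `ℝⁿ`: a contraction towards `c` after a convolution. -/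
noncomputable def smoothFull (c : Pt n) (r : ℝ) (hr : 0 < r) (N : ℕ) (f : Pt n → ℝ) (x : Pt n) : ℝ :=
  mollify ((smoothingBump r hr N).normed volume) f (shrink c (factor N) x)

/-- The smoothing of functions on `Ω`. -/
noncomputable def smoothing (Ω : Set (Pt n)) (c : Pt n) (r : ℝ) (hr : 0 < r) (N : ℕ)
    (f : Pt n → ℝ) : Pt n → ℝ := smoothFull c r hr N (Ω.indicator f)

theorem contDiff_smoothFull (c : Pt n) {r : ℝ} (hr : 0 < r) (N : ℕ) {f : Pt n → ℝ}
    (hf : LocallyIntegrable f) : ContDiff ℝ ∞ (smoothFull c r hr N f) := by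
  have h := contDiff_mollify (smoothingBump r hr N).contDiff_normed
    ((smoothingBump r hr N).hasCompactSupport_normed (μ := volume)) hf
  have h2 : ContDiff ℝ ∞ (shrink c (factor N)) := by
    unfold shrink; fun_prop
  exact h.comp h2

/-- Jensen's inequality for a probability density, obtained from Cauchy–Schwarz by splitting the
density into two square roots. -/
theorem enorm_mollify_sq_le (φ : ContDiffBump (0 : Pt n)) {f : Pt n → ℝ}
    (hf : AEStronglyMeasurable f volume) (X : Pt n) :
    ‖mollify (φ.normed volume) f X‖ₑ ^ 2
      ≤ ∫⁻ z, ‖φ.normed volume z‖ₑ * ‖f (X - z)‖ₑ ^ 2 := by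
  set a : Pt n → ℝ≥0∞ := fun z => ‖φ.normed volume z‖ₑ with ha
  have hψc : Continuous (φ.normed volume) := φ.continuous_normed
  have ham : Measurable a := hψc.enorm.measurable
  have hfm : AEMeasurable (fun z => ‖f (X - z)‖ₑ) volume :=
    (hf.comp_quasiMeasurePreserving
      (Measure.measurePreserving_sub_left volume X).quasiMeasurePreserving).enorm
  have h1 : ∫⁻ z, a z = 1 := by
    have := ofReal_integral_norm_eq_lintegral_enorm (φ.integrable_normed (μ := volume))
    rw [ha, ← this]
    simp_rw [Real.norm_of_nonneg (φ.nonneg_normed _)]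
    rw [φ.integral_normed]; simp
  have h2 : ‖mollify (φ.normed volume) f X‖ₑ ≤ ∫⁻ z, a z * ‖f (X - z)‖ₑ := by
    rw [mollify_eq_normed, convolution_def]
    refine (enorm_integral_le_lintegral_enorm _).trans (le_of_eq ?_)
    simp [ha, enorm_mul]
  have h3 : ∫⁻ z, a z * ‖f (X - z)‖ₑ
      ≤ (∫⁻ z, a z) ^ (1 / 2 : ℝ) * (∫⁻ z, a z * ‖f (X - z)‖ₑ ^ 2) ^ (1 / 2 : ℝ) := by
    have := ENNReal.lintegral_mul_le_Lp_mul_Lq volume Real.HolderConjugate.two_two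
      (f := fun z => a z ^ (1 / 2 : ℝ)) (g := fun z => a z ^ (1 / 2 : ℝ) * ‖f (X - z)‖ₑ)
      (ham.pow_const _).aemeasurable ((ham.pow_const _).aemeasurable.mul hfm)
    have e1 : ∀ z, (a z ^ (1 / 2 : ℝ)) ^ (2 : ℝ) = a z := fun z => by
      rw [← ENNReal.rpow_mul]; norm_num
    have e2 : ∀ z, a z ^ (1 / 2 : ℝ) * (a z ^ (1 / 2 : ℝ) * ‖f (X - z)‖ₑ) = a z * ‖f (X - z)‖ₑ := by
      intro z
      rw [← mul_assoc, ← ENNReal.rpow_add_of_nonneg _ _ (by norm_num) (by norm_num)]; norm_num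
    have e3 : ∀ z, (a z ^ (1 / 2 : ℝ) * ‖f (X - z)‖ₑ) ^ (2 : ℝ) = a z * ‖f (X - z)‖ₑ ^ 2 := by
      intro z
      rw [ENNReal.mul_rpow_of_nonneg _ _ (by norm_num), e1]; norm_num
    simp only [Pi.mul_apply, e1, e2, e3] at this
    exact this
  rw [h1, ENNReal.one_rpow, one_mul] at h3
  calc _ ≤ ((∫⁻ z, a z * ‖f (X - z)‖ₑ ^ 2) ^ (1 / 2 : ℝ)) ^ 2 := by
        gcongr; exact h2.trans h3
    _ = _ := by
        rw [← ENNReal.rpow_natCast, ← ENNReal.rpow_mul]; norm_num [ha]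

theorem lintegral_comp_shrink {F : Pt n → ℝ≥0∞} (c : Pt n) {t : ℝ} (ht : 0 < t) :
    ∫⁻ x, F (shrink c t x) = ENNReal.ofReal ((t ^ n)⁻¹) * ∫⁻ x, F x := by
  let e : Pt n ≃ᵐ Pt n := (Homeomorph.smul (Units.mk0 t ht.ne')).toMeasurableEquiv
  have h1 : ∫⁻ x, F (shrink c t x) = ∫⁻ x, F ((c - t • c) + e x) := rfl
  rw [h1, ← lintegral_map_equiv (fun y => F ((c - t • c) + y)) e]
  have h2 : Measure.map e (volume : Measure (Pt n)) = ENNReal.ofReal |(t ^ n)⁻¹| • volume := by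
    have := Measure.map_addHaar_smul (volume : Measure (Pt n)) ht.ne'
    rw [finrank_euclideanSpace, Fintype.card_fin] at this
    exact this
  rw [h2, lintegral_smul_measure, lintegral_add_left_eq_self F, abs_of_pos (by positivity)]
  rfl

/-- Jensen's inequality for the mollification and a change of variables for the contraction. Since
the factor is at least 1/2, the bound does not depend on N, as the density argument requires. -/
theorem lintegral_smoothFull_sq_le (c : Pt n) {r : ℝ} (hr : 0 < r) (N : ℕ) {f : Pt n → ℝ}
    (hf : AEStronglyMeasurable f volume) :
    ∫⁻ x, ‖smoothFull c r hr N f x‖ₑ ^ 2 ≤ ENNReal.ofReal (2 ^ n) * ∫⁻ x, ‖f x‖ₑ ^ 2 := by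
  set φ := smoothingBump (n := n) r hr N
  have ht := factor_pos N
  have h1 : ∫⁻ z, ‖φ.normed volume z‖ₑ = 1 := by
    rw [← ofReal_integral_norm_eq_lintegral_enorm (φ.integrable_normed (μ := volume))]
    simp_rw [Real.norm_of_nonneg (φ.nonneg_normed _)]
    rw [φ.integral_normed]; simp
  have hψm : Measurable fun z => ‖φ.normed volume z‖ₑ :=
    (φ.continuous_normed (μ := volume)).enorm.measurable
  have hm : AEMeasurable (Function.uncurry fun (X z : Pt n) =>
      ‖φ.normed volume z‖ₑ * ‖f (X - z)‖ₑ ^ 2) (volume.prod volume) := by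
    refine (hψm.comp measurable_snd).aemeasurable.mul (AEMeasurable.pow_const ?_ 2)
    exact (hf.comp_quasiMeasurePreserving (quasiMeasurePreserving_sub volume volume)).enorm
  calc ∫⁻ x, ‖smoothFull c r hr N f x‖ₑ ^ 2
      = ENNReal.ofReal (((factor N) ^ n)⁻¹) * ∫⁻ X, ‖mollify (φ.normed volume) f X‖ₑ ^ 2 :=
        lintegral_comp_shrink (F := fun X => ‖mollify (φ.normed volume) f X‖ₑ ^ 2) c ht
    _ ≤ ENNReal.ofReal (2 ^ n) * ∫⁻ X, ∫⁻ z, ‖φ.normed volume z‖ₑ * ‖f (X - z)‖ₑ ^ 2 := by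
        gcongr with X
        · rw [inv_le_comm₀ (by positivity) (by positivity), ← inv_pow]
          have := half_le_factor N
          gcongr
          linarith
        · exact enorm_mollify_sq_le φ hf X
    _ = ENNReal.ofReal (2 ^ n) * ∫⁻ x, ‖f x‖ₑ ^ 2 := by
        congr 1
        rw [lintegral_lintegral_swap hm]
        have : ∀ z, ∫⁻ X, ‖φ.normed volume z‖ₑ * ‖f (X - z)‖ₑ ^ 2
            = ‖φ.normed volume z‖ₑ * ∫⁻ x, ‖f x‖ₑ ^ 2 := by
          intro z
          rw [lintegral_const_mul' _ _ enorm_ne_top,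
            lintegral_sub_right_eq_self (fun X => ‖f X‖ₑ ^ 2) z]
        simp_rw [this]
        rw [lintegral_mul_const _ hψm, h1, one_mul]

end Smoothing

end HDG

/-! ### The smoothing operators: weak derivatives and convergence -/

namespace HDG

section SmoothingProperties

open Filter Topology

variable {n : ℕ} {Ω : Set (Pt n)} {c : Pt n} {r : ℝ}

theorem mollify_sub {ψ f g : Pt n → ℝ} (hψ : Continuous ψ) (hc : HasCompactSupport ψ)
    (hf : LocallyIntegrable f) (hg : LocallyIntegrable g) (X : Pt n) :
    mollify ψ (f - g) X = mollify ψ f X - mollify ψ g X := by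
  have h1 : Integrable (fun z => f z * ψ (X - z)) :=
    hc.convolutionExists_right (ContinuousLinearMap.mul ℝ ℝ) hf hψ X
  have h2 : Integrable (fun z => g z * ψ (X - z)) :=
    hc.convolutionExists_right (ContinuousLinearMap.mul ℝ ℝ) hg hψ X
  unfold mollify
  rw [← integral_sub h1 h2]
  simp [sub_mul]

theorem eLpNorm_two_sq (f : Pt n → ℝ) (μ : Measure (Pt n)) :
    eLpNorm f 2 μ ^ 2 = ∫⁻ x, ‖f x‖ₑ ^ 2 ∂μ := by
  have := eLpNorm_nnreal_pow_eq_lintegral (f := f) (μ := μ) (p := 2) (by norm_num)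
  simpa using this

theorem eLpNorm_smoothFull_le (c : Pt n) {r : ℝ} (hr : 0 < r) (N : ℕ) {f : Pt n → ℝ}
    (hf : AEStronglyMeasurable f volume) :
    eLpNorm (smoothFull c r hr N f) 2 volume ≤ ENNReal.ofReal (2 ^ n) * eLpNorm f 2 volume := by
  rw [← ENNReal.pow_le_pow_left_iff (two_ne_zero), mul_pow, eLpNorm_two_sq, eLpNorm_two_sq]
  refine (lintegral_smoothFull_sq_le c hr N hf).trans ?_
  gcongr
  have h1 : (1 : ℝ≥0∞) ≤ ENNReal.ofReal (2 ^ n) := by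
    rw [← ENNReal.ofReal_one]
    exact ENNReal.ofReal_le_ofReal (one_le_pow₀ (by norm_num))
  calc _ = ENNReal.ofReal (2 ^ n) * 1 := (mul_one _).symm
    _ ≤ _ := by rw [sq]; gcongr

theorem mem_of_dist_shrink (ho : IsOpen Ω) (hconv : Convex ℝ Ω) (hr : 0 < r)
    (hc : Metric.ball c r ⊆ Ω) (N : ℕ) {x : Pt n} (hx : x ∈ closure Ω) {y : Pt n}
    (hy : dist y (shrink c (factor N) x) ≤ (smoothingBump (n := n) r hr N).rOut) : y ∈ Ω :=
  shrink_add_mem ho hconv hc (factor_pos N).le (factor_lt_one N) hx (hy.trans_lt (rOut_lt hr N))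

/-- As a function of the integration variable the kernel is supported in Ω even when x lies on the
boundary, so weak derivatives may be tested with it. The reflection is written with (-1 : ℝ) • z to
fit the affine chain rule. -/
theorem isTestFunction_kernel (ho : IsOpen Ω) (hconv : Convex ℝ Ω) (hr : 0 < r)
    (hc : Metric.ball c r ⊆ Ω) (N : ℕ) {x : Pt n} (hx : x ∈ closure Ω) :
    IsTestFunction Ω (fun z => (smoothingBump r hr N).normed volume
      (shrink c (factor N) x + (-1 : ℝ) • z)) := by
  set φ := smoothingBump (n := n) r hr N
  set X := shrink c (factor N) x
  have hsub : Function.support (fun z => φ.normed volume (X + (-1 : ℝ) • z))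
      ⊆ Metric.closedBall X φ.rOut := by
    intro z hz
    have h1 : X + (-1 : ℝ) • z ∈ Function.support (φ.normed volume) := hz
    rw [φ.support_normed_eq, mem_ball_zero_iff] at h1
    rw [mem_closedBall_iff_norm', show X - z = X + (-1 : ℝ) • z by module]
    exact h1.le
  have hts : tsupport (fun z => φ.normed volume (X + (-1 : ℝ) • z))
      ⊆ Metric.closedBall X φ.rOut := closure_minimal hsub Metric.isClosed_closedBall
  refine ⟨φ.contDiff_normed.comp (by fun_prop), ?_, fun z hz =>
    mem_of_dist_shrink ho hconv hr hc N hx (hts hz)⟩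
  exact HasCompactSupport.of_support_subset_isCompact (isCompact_closedBall _ _) hsub

theorem integrable_of_memLp_two [IsFiniteMeasure (volume.restrict Ω)] {f : Pt n → ℝ}
    (hf : MemLp f 2 (volume.restrict Ω)) : IntegrableOn f Ω :=
  hf.integrable (by norm_num)

theorem locallyIntegrable_indicator (ho : IsOpen Ω) {f : Pt n → ℝ}
    (hf : IntegrableOn f Ω) : LocallyIntegrable (Ω.indicator f) volume :=
  ((integrable_indicator_iff ho.measurableSet).2 hf).locallyIntegrable

theorem mollify_indicator (ho : IsOpen Ω) (ψ f : Pt n → ℝ) (X : Pt n) :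
    mollify ψ (Ω.indicator f) X = ∫ z in Ω, f z * ψ (X - z) := by
  rw [mollify, ← integral_indicator ho.measurableSet]
  congr 1
  ext z
  by_cases hz : z ∈ Ω <;> simp [hz]

/-- Derivatives fall on the kernel, which is a test function. The sign from its reflection cancels
the sign in the definition of the weak derivative, and the contraction contributes `factor N ^ m`.
-/
theorem iteratedFDeriv_smoothing (ho : IsOpen Ω) (hconv : Convex ℝ Ω) (hr : 0 < r)
    (hc : Metric.ball c r ⊆ Ω) {m : ℕ} {α : Fin m → Fin n} {u v : Pt n → ℝ}
    (hu : IntegrableOn u Ω) (huv : HasWeakDeriv Ω α u v) (N : ℕ) {x : Pt n}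
    (hx : x ∈ closure Ω) :
    iteratedFDeriv ℝ m (smoothing Ω c r hr N u) x (fun j => unitVec (α j))
      = factor N ^ m * smoothing Ω c r hr N v x := by
  set φ := smoothingBump (n := n) r hr N
  have hψ : ContDiff ℝ ∞ (φ.normed volume) := φ.contDiff_normed
  have hψc : HasCompactSupport (φ.normed volume) := φ.hasCompactSupport_normed
  have hui := locallyIntegrable_indicator ho hu
  have h1 := iteratedFDeriv_comp_affine (contDiff_mollify hψ hψc hui)
    (c - factor N • c) (factor N) m (fun j => unitVec (α j)) x
  refine h1.trans ?_
  congr 1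
  change iteratedFDeriv ℝ m _ (shrink c (factor N) x) _ = _
  set X := shrink c (factor N) x with hX
  rw [iteratedFDeriv_mollify hψ hψc hui, mollify_indicator ho]
  have h2 := huv.integral_eq _ (isTestFunction_kernel ho hconv hr hc N hx)
  change ∫ z in Ω, u z * iteratedFDeriv ℝ m (fun z => φ.normed volume (X + (-1 : ℝ) • z)) z
    (fun j => unitVec (α j)) = (-1) ^ m * ∫ z in Ω, v z * φ.normed volume (X + (-1 : ℝ) • z) at h2
  simp only [fun z => iteratedFDeriv_comp_affine hψ X (-1) m (fun j => unitVec (α j)) z] at h2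
  have h3 : ∀ z, X + (-1 : ℝ) • z = X - z := fun z => by module
  simp only [h3] at h2
  change _ = mollify (φ.normed volume) (Ω.indicator v) X
  rw [mollify_indicator ho]
  have h4 : ∫ z in Ω, u z * ((-1) ^ m * iteratedFDeriv ℝ m (φ.normed volume) (X - z)
      (fun j => unitVec (α j)))
      = (-1) ^ m * ∫ z in Ω, u z * iteratedFDeriv ℝ m (φ.normed volume) (X - z)
      (fun j => unitVec (α j)) := by
    rw [← integral_const_mul]
    congr 1; ext z; ring
  have h5 := h4.symm.trans h2
  have h6 : ((-1 : ℝ) ^ m) ≠ 0 := pow_ne_zero _ (by norm_num)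
  exact mul_left_cancel₀ h6 h5

/-- The divergence is transferred to the kernel as a whole, so the components of V need not have
weak derivatives. -/
theorem div_smoothing (ho : IsOpen Ω) (hconv : Convex ℝ Ω) (hr : 0 < r)
    (hc : Metric.ball c r ⊆ Ω) {V : Pt n → Pt n} {d : Pt n → ℝ}
    (hV : ∀ i, IntegrableOn (fun x => V x i) Ω) (hVd : HasWeakDiv Ω V d) (N : ℕ) {x : Pt n}
    (hx : x ∈ closure Ω) :
    ∑ i, fderiv ℝ (smoothing Ω c r hr N (fun x => V x i)) x (unitVec i)
      = factor N * smoothing Ω c r hr N d x := by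
  set φ := smoothingBump (n := n) r hr N
  have hψ : ContDiff ℝ ∞ (φ.normed volume) := φ.contDiff_normed
  have hψc : HasCompactSupport (φ.normed volume) := φ.hasCompactSupport_normed
  have hVi := fun i => locallyIntegrable_indicator ho (hV i)
  set X := shrink c (factor N) x with hX
  have h1 : ∀ i, fderiv ℝ (smoothing Ω c r hr N (fun x => V x i)) x (unitVec i)
      = factor N * ∫ z in Ω, V z i * fderiv ℝ (φ.normed volume) (X - z) (unitVec i) := by
    intro i
    have hd : HasFDerivAt (mollify (φ.normed volume) (Ω.indicator fun x => V x i))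
        (fderiv ℝ (mollify (φ.normed volume) (Ω.indicator fun x => V x i)) X) X :=
      ((contDiff_mollify hψ hψc (hVi i)).differentiable (by simp) X).hasFDerivAt
    have hs : HasFDerivAt (shrink c (factor N)) (factor N • ContinuousLinearMap.id ℝ (Pt n)) x :=
      ((hasFDerivAt_id x).const_smul (factor N)).const_add _
    have h := (hd.comp x hs).fderiv
    have h' : fderiv ℝ (smoothing Ω c r hr N (fun x => V x i)) x = _ := h
    rw [h']
    simp only [ContinuousLinearMap.comp_smul, ContinuousLinearMap.comp_id, smul_apply, smul_eq_mul]
    rw [fderiv_mollify hψ hψc (hVi i), mollify_indicator ho]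
  simp_rw [h1]
  rw [← Finset.mul_sum]
  congr 1
  have hint : ∀ i, Integrable (fun z => V z i * fderiv ℝ (φ.normed volume) (X - z) (unitVec i))
      (volume.restrict Ω) := by
    intro i
    have := (hψc.fderiv_apply ℝ (unitVec i)).convolutionExists_right
      (ContinuousLinearMap.mul ℝ ℝ) (hVi i)
      ((hψ.continuous_fderiv (by simp)).clm_apply continuous_const) X
    have h2 := (integrable_indicator_iff ho.measurableSet (μ := volume)
      (f := fun z => V z i * fderiv ℝ (φ.normed volume) (X - z) (unitVec i))).1 (by
        refine this.congr (Eventually.of_forall fun z => ?_)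
        by_cases hz : z ∈ Ω <;> simp [hz])
    exact h2
  rw [← integral_finsetSum _ fun i _ => hint i]
  have h2 := hVd.integral_eq _ (isTestFunction_kernel ho hconv hr hc N hx)
  have h3 : ∀ z, X + (-1 : ℝ) • z = X - z := fun z => by module
  have h4 : ∀ z, fderiv ℝ (fun z => φ.normed volume (X + (-1 : ℝ) • z)) z (V z)
      = - ∑ i, V z i * fderiv ℝ (φ.normed volume) (X - z) (unitVec i) := by
    intro z
    have hd : HasFDerivAt (φ.normed volume) (fderiv ℝ (φ.normed volume) (X + (-1 : ℝ) • z))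
        (X + (-1 : ℝ) • z) := (hψ.differentiable (by simp) _).hasFDerivAt
    have hs : HasFDerivAt (fun z : Pt n => X + (-1 : ℝ) • z)
        ((-1 : ℝ) • ContinuousLinearMap.id ℝ (Pt n)) z :=
      ((hasFDerivAt_id z).const_smul (-1 : ℝ)).const_add _
    have h := (hd.comp z hs).fderiv
    have h' : fderiv ℝ (fun z => φ.normed volume (X + (-1 : ℝ) • z)) z = _ := h
    rw [h', h3]
    have hv : V z = ∑ i, V z i • (unitVec i : Pt n) := by
      ext j; simp [unitVec, Finset.sum_apply, Pi.single_apply]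
    conv_lhs => rw [hv]
    simp
  change ∫ z in Ω, fderiv ℝ (fun z => φ.normed volume (X + (-1 : ℝ) • z)) z (V z)
    = -∫ z in Ω, d z * φ.normed volume (X + (-1 : ℝ) • z) at h2
  simp only [h4] at h2
  simp only [h3] at h2
  rw [integral_neg, neg_inj] at h2
  rw [h2]
  exact (mollify_indicator ho _ _ _).symm

/-- The kernel is a probability density. -/
theorem abs_smoothing_le (hr : 0 < r) (ho : IsOpen Ω) {f : Pt n → ℝ} {L : ℝ} (hL : 0 ≤ L)
    (hf : ∀ᵐ x ∂volume.restrict Ω, |f x| ≤ L) (N : ℕ) (x : Pt n) :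
    |smoothing Ω c r hr N f x| ≤ L := by
  set φ := smoothingBump (n := n) r hr N
  set X := shrink c (factor N) x
  change |mollify (φ.normed volume) (Ω.indicator f) X| ≤ L
  have hae : ∀ᵐ z, ‖Ω.indicator f z‖ ≤ L := by
    rw [ae_restrict_iff' ho.measurableSet] at hf
    filter_upwards [hf] with z hz
    by_cases h : z ∈ Ω
    · simpa [h] using hz h
    · simpa [h] using hL
  have hi : Integrable (fun z => L * φ.normed volume (X - z)) :=
    (φ.integrable_normed.comp_sub_left X).const_mul L
  have h1 := norm_integral_le_of_norm_le (f := fun z => Ω.indicator f z * φ.normed volume (X - z))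
    hi (by
      filter_upwards [hae] with z hz
      rw [norm_mul, Real.norm_of_nonneg (φ.nonneg_normed _)]
      exact mul_le_mul_of_nonneg_right hz (φ.nonneg_normed _))
  rw [integral_const_mul, integral_sub_left_eq_self (fun z => φ.normed volume z),
    φ.integral_normed, mul_one] at h1
  exact h1

/-- The smoothed value at x averages f over points of Ω close to x, also for x on the boundary, so
the extension by zero is never seen. Uniform continuity on the compact closure concludes. -/
theorem tendstoUniformlyOn_smoothing (ho : IsOpen Ω) (hconv : Convex ℝ Ω)
    (hb : Bornology.IsBounded Ω) (hr : 0 < r) (hc : Metric.ball c r ⊆ Ω) {f : Pt n → ℝ}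
    (hf : ContinuousOn f (closure Ω)) :
    TendstoUniformlyOn (fun N => smoothing Ω c r hr N f) f atTop (closure Ω) := by
  have hcomp : IsCompact (closure Ω) := hb.isCompact_closure
  have hunif := hcomp.uniformContinuousOn_of_continuous hf
  rw [Metric.tendstoUniformlyOn_iff]
  intro ε hε
  obtain ⟨δ, hδ, H⟩ := Metric.uniformContinuousOn_iff.1 hunif (ε / 3) (by linarith)
  set R := Metric.diam (closure Ω) with hR
  have hcΩ : c ∈ closure Ω := subset_closure (hc (Metric.mem_ball_self hr))
  -- The contraction moves x by at most (1 - factor N) * R, and the mollification adds less than (1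
  -- - factor N) * r.
  have hlim : Tendsto (fun N => (1 - factor N) * (R + r)) atTop (𝓝 0) := by
    have := ((tendsto_const_nhds (x := (1 : ℝ))).sub tendsto_factor).mul_const (R + r)
    simpa using this
  filter_upwards [hlim.eventually (gt_mem_nhds hδ)] with N hN x hx
  have h1t : 0 < 1 - factor N := by linarith [factor_lt_one N]
  set φ := smoothingBump (n := n) r hr N
  set X := shrink c (factor N) x
  have hXΩ : X ∈ Ω := mem_of_dist_shrink ho hconv hr hc N hx 
    (show dist X X ≤ _ by rw [dist_self]; exact φ.rOut_pos.le)
  have hXx : dist X x ≤ (1 - factor N) * R := by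
    have : X - x = (1 - factor N) • (c - x) := by simp only [X, shrink]; module
    rw [dist_eq_norm, this, norm_smul, Real.norm_of_nonneg h1t.le, ← dist_eq_norm]
    exact mul_le_mul_of_nonneg_left (Metric.dist_le_diam_of_mem hcomp.isBounded hcΩ hx) h1t.le
  have hfX : dist (f X) (f x) < ε / 3 := by
    refine H X (subset_closure hXΩ) x hx ?_
    nlinarith
  have hmeas : AEStronglyMeasurable (Ω.indicator f) volume :=
    (aestronglyMeasurable_indicator_iff ho.measurableSet).2
      ((hf.mono subset_closure).aestronglyMeasurable ho.measurableSet)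
  have h2 := φ.dist_normed_convolution_le (μ := volume) (g := Ω.indicator f) (x₀ := X)
    (ε := ε / 3 + ε / 3) hmeas (by
      intro y hy
      have hyΩ : y ∈ Ω := mem_of_dist_shrink ho hconv hr hc N hx (Metric.mem_ball.1 hy).le
      rw [Set.indicator_of_mem hyΩ, Set.indicator_of_mem hXΩ]
      have h3 : dist (f y) (f x) < ε / 3 := by
        refine H y (subset_closure hyΩ) x hx ?_
        have h4 := (Metric.mem_ball.1 hy).trans (rOut_lt hr N)
        have := dist_triangle y X x
        nlinarith
      have h5 := dist_triangle_right (f y) (f X) (f x)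
      linarith)
  rw [← mollify_eq_normed, Set.indicator_of_mem hXΩ] at h2
  have h6 : dist (f x) (mollify (φ.normed volume) (Ω.indicator f) X)
      ≤ dist (f X) (f x) + dist (mollify (φ.normed volume) (Ω.indicator f) X) (f X) := by
    rw [dist_comm (f X) (f x), dist_comm (mollify _ _ _) (f X)]
    exact dist_triangle (f x) (f X) _
  refine lt_of_le_of_lt (b := dist (f X) (f x) + (ε / 3 + ε / 3)) (h6.trans (by linarith)) (by linarith)

/-- Approximate f in L² by a continuous function g of compact support. For g the convergence is
uniform, and f - g is controlled by the operator bound that is independent of N. -/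
theorem tendsto_eLpNorm_smoothing (ho : IsOpen Ω) (hconv : Convex ℝ Ω)
    (hb : Bornology.IsBounded Ω) (hr : 0 < r) (hc : Metric.ball c r ⊆ Ω) {f : Pt n → ℝ}
    (hf : MemLp f 2 (volume.restrict Ω)) :
    Tendsto (fun N => eLpNorm (fun x => smoothing Ω c r hr N f x - f x) 2 (volume.restrict Ω))
      atTop (𝓝 0) := by
  haveI : IsFiniteMeasure (volume.restrict Ω) := ⟨by simpa using hb.measure_lt_top⟩
  have hF : MemLp (Ω.indicator f) 2 volume := (memLp_indicator_iff_restrict ho.measurableSet).2 hf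
  rw [ENNReal.tendsto_nhds_zero]
  intro ε hε
  by_cases hεt : ε = ⊤
  · simp [hεt]
  set A : ℝ≥0∞ := ENNReal.ofReal (2 ^ n) with hA
  have hA0 : A ≠ 0 := by rw [hA]; positivity
  have hAt : A ≠ ⊤ := ENNReal.ofReal_ne_top
  -- Chosen so that (A + 1) * η = ε / 3: the smoothing of f - g costs A * η, and f - g itself costs
  -- η.
  set η : ℝ≥0∞ := ε / 3 / (A + 1) with hη
  have hη0 : η ≠ 0 := by
    rw [hη]
    refine (ENNReal.div_pos (ENNReal.div_pos hε.ne' (by norm_num)).ne' ?_).ne'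
    simp [hAt]
  obtain ⟨g, hgc, hfg, hgcont, hgL⟩ := hF.exists_hasCompactSupport_eLpNorm_sub_le
    (by norm_num) hη0
  have hunif := tendstoUniformlyOn_smoothing ho hconv hb hr hc hgcont.continuousOn
  have hη1 : (A + 1) * η = ε / 3 := by
    rw [hη]; exact ENNReal.mul_div_cancel (by simp) (by simp [hAt])
  set M : ℝ := (volume Ω).toReal with hM
  -- the smooth part converges uniformly
  obtain ⟨κ, hκ, hκε⟩ : ∃ κ : ℝ, 0 < κ ∧
      (volume Ω) ^ (1 / 2 : ℝ) * ENNReal.ofReal κ ≤ ε / 3 := by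
    have h3 : ε / 3 ≠ 0 := (ENNReal.div_pos hε.ne' (by norm_num)).ne'
    have hfin : (volume Ω) ^ (1 / 2 : ℝ) ≠ ⊤ :=
      ENNReal.rpow_ne_top_of_nonneg (by norm_num) hb.measure_lt_top.ne
    set B := (volume Ω) ^ (1 / 2 : ℝ)
    have h4 : ε / 3 / (B + 1) ≠ ⊤ := by
      refine ENNReal.div_ne_top (ENNReal.div_ne_top hεt (by norm_num)) (by simp)
    have h5 : ε / 3 / (B + 1) ≠ 0 := (ENNReal.div_pos h3 (by simp [hfin])).ne'
    refine ⟨(ε / 3 / (B + 1)).toReal, ENNReal.toReal_pos h5 h4, ?_⟩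
    rw [ENNReal.ofReal_toReal h4]
    calc B * (ε / 3 / (B + 1)) ≤ (B + 1) * (ε / 3 / (B + 1)) := by gcongr; exact le_self_add
      _ = ε / 3 := ENNReal.mul_div_cancel (by simp) (by simp [hfin])
  filter_upwards [Metric.tendstoUniformlyOn_iff.1 hunif κ hκ] with N hN
  set S := smoothFull c r hr N with hS
  have hψc : HasCompactSupport ((smoothingBump (n := n) r hr N).normed volume) :=
    (smoothingBump r hr N).hasCompactSupport_normed
  have hψ : Continuous ((smoothingBump (n := n) r hr N).normed volume) :=
    (smoothingBump r hr N).continuous_normed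
  have hFl : LocallyIntegrable (Ω.indicator f) volume :=
    locallyIntegrable_indicator ho (integrable_of_memLp_two hf)
  have hGL : MemLp (Ω.indicator g) 2 volume :=
    hgL.indicator ho.measurableSet
  have hGl : LocallyIntegrable (Ω.indicator g) volume := hGL.locallyIntegrable (by norm_num)
  have hlin : ∀ x, smoothing Ω c r hr N f x - smoothing Ω c r hr N g x
      = S (Ω.indicator f - Ω.indicator g) x := fun x =>
    (mollify_sub hψ hψc hFl hGl _).symm
  have hfgi : eLpNorm (Ω.indicator f - Ω.indicator g) 2 volume ≤ η := by
    refine le_trans ?_ hfg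
    have : Ω.indicator f - Ω.indicator g = Ω.indicator (Ω.indicator f - g) := by
      ext x; by_cases hx : x ∈ Ω <;> simp [hx]
    rw [this]
    exact eLpNorm_indicator_le _
  have hsm : ∀ {h : Pt n → ℝ}, LocallyIntegrable h → AEStronglyMeasurable (S h) volume :=
    fun hh => (contDiff_smoothFull c hr N hh).continuous.aestronglyMeasurable
  have e1 : (fun x => smoothing Ω c r hr N f x - f x)
      = (S (Ω.indicator f - Ω.indicator g) + fun x => smoothing Ω c r hr N g x - g x)
        + (fun x => g x - f x) := by
    ext x
    simp only [Pi.add_apply, ← hlin]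
    ring
  have m1 : AEStronglyMeasurable (S (Ω.indicator f - Ω.indicator g)) (volume.restrict Ω) :=
    (hsm (hFl.sub hGl)).restrict
  have m2 : AEStronglyMeasurable (fun x => smoothing Ω c r hr N g x - g x) (volume.restrict Ω) :=
    ((hsm hGl).sub hgcont.aestronglyMeasurable).restrict
  have m3 : AEStronglyMeasurable (fun x => g x - f x) (volume.restrict Ω) :=
    hgcont.aestronglyMeasurable.restrict.sub hf.aestronglyMeasurable
  have b1 : eLpNorm (S (Ω.indicator f - Ω.indicator g)) 2 (volume.restrict Ω) ≤ A * η := by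
    refine (eLpNorm_mono_measure _ Measure.restrict_le_self).trans ?_
    refine (eLpNorm_smoothFull_le c hr N
      (hF.aestronglyMeasurable.sub hGL.aestronglyMeasurable)).trans ?_
    gcongr
  have b2 : eLpNorm (fun x => smoothing Ω c r hr N g x - g x) 2 (volume.restrict Ω) ≤ ε / 3 := by
    refine le_trans ?_ hκε
    have := eLpNorm_le_of_ae_bound (p := 2) (μ := volume.restrict Ω) (C := κ)
      (f := fun x => smoothing Ω c r hr N g x - g x) (by
        rw [ae_restrict_iff' ho.measurableSet]
        refine Eventually.of_forall fun x hx => ?_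
        have := hN x (subset_closure hx)
        rw [dist_comm, dist_eq_norm] at this
        exact this.le)
    simpa using this
  have b3 : eLpNorm (fun x => g x - f x) 2 (volume.restrict Ω) ≤ η := by
    refine le_trans (le_of_eq ?_) ((eLpNorm_mono_measure _
      (Measure.restrict_le_self (s := Ω))).trans hfg)
    rw [eLpNorm_sub_comm (Ω.indicator f) g]
    refine eLpNorm_congr_ae ?_
    filter_upwards [ae_restrict_mem ho.measurableSet] with x hx
    simp [hx]
  rw [e1]
  calc _ ≤ (eLpNorm (S (Ω.indicator f - Ω.indicator g)) 2 (volume.restrict Ω)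
        + eLpNorm (fun x => smoothing Ω c r hr N g x - g x) 2 (volume.restrict Ω))
        + eLpNorm (fun x => g x - f x) 2 (volume.restrict Ω) :=
        (eLpNorm_add_le (m1.add m2) m3 (by norm_num)).trans
          (by gcongr; exact eLpNorm_add_le m1 m2 (by norm_num))
    _ ≤ (A * η + ε / 3) + η := by gcongr
    _ = (A + 1) * η + ε / 3 := by ring
    _ = ε / 3 + ε / 3 := by rw [hη1]
    _ ≤ ε := by
      rw [← two_mul, ← mul_div_assoc]
      refine ENNReal.div_le_of_le_mul ?_
      rw [mul_comm]; gcongr; norm_num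

end SmoothingProperties

end HDG

/-! ### Taylor polynomials and the Bramble–Hilbert lemma -/

namespace HDG

section Taylor

open Filter Topology

variable {n : ℕ}

/-- The sum of the squares of all partial derivatives of order `m`. -/
noncomputable def derivSq (m : ℕ) (u : Pt n → ℝ) (x : Pt n) : ℝ :=
  ∑ α : Fin m → Fin n, (iteratedFDeriv ℝ m u x (fun j => unitVec (α j))) ^ 2

theorem derivSq_nonneg (m : ℕ) (u : Pt n → ℝ) (x : Pt n) : 0 ≤ derivSq m u x :=
  Finset.sum_nonneg fun _ _ => sq_nonneg _

theorem continuous_derivSq {u : Pt n → ℝ} (hu : ContDiff ℝ ∞ u) (m : ℕ) :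
    Continuous (derivSq m u) :=
  continuous_finsetSum _ fun _ _ => (contDiff_iteratedFDeriv_apply hu m _).continuous.pow 2

/-- The Taylor polynomial of degree less than `k` of `u` at `y`. -/
noncomputable def taylorPoly (k : ℕ) (u : Pt n → ℝ) (y x : Pt n) : ℝ :=
  ∑ j ∈ Finset.range k, ((j.factorial : ℝ)⁻¹) * iteratedFDeriv ℝ j u y (fun _ => x - y)

theorem multilinear_const_eq_sum {m : ℕ} (L : Pt n [×m]→L[ℝ] ℝ) (h : Pt n) :
    L (fun _ => h) = ∑ α : Fin m → Fin n, (∏ j, h (α j)) * L (fun j => unitVec (α j)) := by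
  have hv : h = ∑ i, h i • (unitVec i : Pt n) := by
    ext j; simp [unitVec, Finset.sum_apply, Pi.single_apply]
  conv_lhs => rw [hv]
  rw [L.map_sum]
  refine Finset.sum_congr rfl fun α _ => ?_
  rw [L.map_smul_univ, smul_eq_mul]

/-- Cauchy–Schwarz over the multi-indices; the squared products of coordinates sum to ‖h‖ ^ (2 * m).
-/
theorem multilinear_const_sq_le {m : ℕ} (L : Pt n [×m]→L[ℝ] ℝ) (h : Pt n) :
    L (fun _ => h) ^ 2 ≤ ‖h‖ ^ (2 * m) * ∑ α : Fin m → Fin n, L (fun j => unitVec (α j)) ^ 2 := by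
  rw [multilinear_const_eq_sum]
  refine (Finset.sum_mul_sq_le_sq_mul_sq _ _ _).trans (le_of_eq ?_)
  congr 1
  rw [pow_mul, EuclideanSpace.norm_sq_eq, Fintype.sum_pow]
  refine Finset.sum_congr rfl fun α _ => ?_
  rw [← Finset.prod_pow]
  simp

theorem isPoly_taylorPoly (k : ℕ) (u : Pt n → ℝ) (y : Pt n) : IsPoly k (taylorPoly (k + 1) u y) := by
  refine IsPoly.sum _ fun j hj => IsPoly.const_mul _ ?_
  simp_rw [multilinear_const_eq_sum]
  refine IsPoly.mono (Nat.lt_succ_iff.1 (Finset.mem_range.1 hj)) ?_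
  refine IsPoly.sum _ fun α _ => IsPoly.mul_const (IsPoly.prod fun i => ?_) _
  exact (IsPoly.coord (α i)).sub (IsPoly.const (y (α i)))

theorem continuous_taylorPoly {u : Pt n → ℝ} (hu : ContDiff ℝ ∞ u) (k : ℕ) :
    Continuous (fun q : Pt n × Pt n => taylorPoly k u q.1 q.2) := by
  unfold taylorPoly
  refine continuous_finsetSum _ fun j _ => continuous_const.mul ?_
  simp_rw [multilinear_const_eq_sum]
  refine continuous_finsetSum _ fun α _ => Continuous.mul ?_ ?_
  · refine continuous_finsetProd _ fun i _ => ?_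
    have : Continuous fun q : Pt n × Pt n => q.2 - q.1 := by fun_prop
    exact (EuclideanSpace.proj (α i) : Pt n →L[ℝ] ℝ).continuous.comp this
  · exact (contDiff_iteratedFDeriv_apply hu j _).continuous.comp continuous_fst

theorem hasDerivAt_iteratedFDeriv_line {u : Pt n → ℝ} (hu : ContDiff ℝ ∞ u) (j : ℕ) (y h : Pt n)
    (t : ℝ) : HasDerivAt (fun t : ℝ => iteratedFDeriv ℝ j u (y + t • h) (fun _ => h))
      (iteratedFDeriv ℝ (j + 1) u (y + t • h) (fun _ => h)) t := by
  rw [iteratedFDeriv_succ_apply hu]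
  have h1 := ((contDiff_iteratedFDeriv_apply hu j (fun _ => h)).differentiable (by simp)
    (y + t • h)).hasFDerivAt
  have h2 : HasDerivAt (fun t : ℝ => y + t • h) h t := by
    simpa using ((hasDerivAt_id t).smul_const h).const_add y
  exact h1.comp_hasDerivAt t h2

/-- Induction on k: the derivative of the remainder is the remainder of the derivative, one order
lower, and the mean value inequality integrates it. The factorial of the classical remainder is not
needed. -/
theorem abs_sub_taylor_le (k : ℕ) (f : ℕ → ℝ → ℝ) (hf : ∀ j t, HasDerivAt (f j) (f (j + 1) t) t)
    {s : ℝ} (hs : s ∈ Set.Icc (0 : ℝ) 1) :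
    |f 0 s - ∑ j ∈ Finset.range (k + 1), ((j.factorial : ℝ)⁻¹) * (s ^ j * f j 0)|
      ≤ ∫ t in (0 : ℝ)..1, |f (k + 1) t| := by
  have hc : ∀ j, Continuous (f j) := fun j =>
    continuous_iff_continuousAt.2 fun t => (hf j t).continuousAt
  induction k generalizing f s with
  | zero =>
    have h1 : ∫ t in (0 : ℝ)..s, f 1 t = f 0 s - f 0 0 :=
      intervalIntegral.integral_eq_sub_of_hasDerivAt (fun t _ => hf 0 t)
        ((hc 1).intervalIntegrable _ _)
    simp only [zero_add, Finset.range_one, Finset.sum_singleton, Nat.factorial_zero, Nat.cast_one,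
      inv_one, pow_zero, one_mul]
    rw [← h1]
    refine (intervalIntegral.abs_integral_le_integral_abs hs.1).trans ?_
    exact intervalIntegral.integral_mono_interval le_rfl hs.1 hs.2
      (Eventually.of_forall fun t => abs_nonneg _) ((hc 1).abs.intervalIntegrable _ _)
  | succ k ih =>
    set M := ∫ t in (0 : ℝ)..1, |f (k + 1 + 1) t| with hM
    set F : ℝ → ℝ := fun s => f 0 s
      - ∑ j ∈ Finset.range (k + 2), ((j.factorial : ℝ)⁻¹) * (s ^ j * f j 0) with hF
    have hd : ∀ r, HasDerivAt F (f 1 r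
        - ∑ j ∈ Finset.range (k + 1), ((j.factorial : ℝ)⁻¹) * (r ^ j * f (j + 1) 0)) r := by
      intro r
      refine (hf 0 r).sub ?_
      have h1 : ∀ j ∈ Finset.range (k + 2), HasDerivAt
          (fun s => ((j.factorial : ℝ)⁻¹) * (s ^ j * f j 0))
          (((j.factorial : ℝ)⁻¹) * (j * r ^ (j - 1) * f j 0)) r := fun j _ =>
        ((hasDerivAt_pow j r).mul_const _).const_mul _
      have h2 := HasDerivAt.fun_sum h1
      convert h2 using 1
      rw [Finset.sum_range_succ' _ (k + 1)]
      simp only [Nat.cast_zero, zero_mul, mul_zero, add_zero, Nat.add_sub_cancel]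
      refine Finset.sum_congr rfl fun j _ => ?_
      rw [Nat.factorial_succ]
      push_cast
      field_simp
    -- The segment from 0 to s is rescaled to [0, 1]; the resulting factor s ≤ 1 is discarded.
    have h3 := norm_image_sub_le_of_norm_deriv_le_segment_01' (f := fun t => F (t * s))
      (f' := fun t => (f 1 (t * s)
        - ∑ j ∈ Finset.range (k + 1), ((j.factorial : ℝ)⁻¹) * ((t * s) ^ j * f (j + 1) 0)) * s)
      (C := M) (fun t _ => by
        have := (hd (t * s)).comp t ((hasDerivAt_id t).mul_const s)
        rw [one_mul] at this
        exact this.hasDerivWithinAt) (fun t ht => by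
        have hts : t * s ∈ Set.Icc (0 : ℝ) 1 :=
          ⟨mul_nonneg ht.1 hs.1, mul_le_one₀ ht.2.le hs.1 hs.2⟩
        have := ih (fun j => f (j + 1)) (fun j => hf (j + 1)) hts (fun j => hc (j + 1))
        rw [norm_mul, Real.norm_eq_abs, Real.norm_of_nonneg hs.1]
        exact (mul_le_of_le_one_right (abs_nonneg _) hs.2).trans this)
    have h0 : F 0 = 0 := by
      simp only [hF]
      rw [Finset.sum_range_succ']
      simp
    simpa [h0] using h3

/-- The variance of |f| on [0, 1] is nonnegative. -/
theorem sq_integral_abs_le {f : ℝ → ℝ} (hf : Continuous f) :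
    (∫ t in (0 : ℝ)..1, |f t|) ^ 2 ≤ ∫ t in (0 : ℝ)..1, f t ^ 2 := by
  set c := ∫ t in (0 : ℝ)..1, |f t| with hc
  have h1 : 0 ≤ ∫ t in (0 : ℝ)..1, (|f t| - c) ^ 2 :=
    intervalIntegral.integral_nonneg (by norm_num) fun t _ => sq_nonneg _
  have h2 : ∀ t, (|f t| - c) ^ 2 = f t ^ 2 - 2 * c * |f t| + c ^ 2 := fun t => by
    rw [sub_sq, sq_abs]; ring
  simp_rw [h2] at h1
  rw [intervalIntegral.integral_add, intervalIntegral.integral_sub,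
    intervalIntegral.integral_const_mul, intervalIntegral.integral_const, ← hc] at h1
  · simp only [sub_zero, one_smul] at h1
    nlinarith
  · exact (hf.pow 2).intervalIntegrable _ _
  · exact (continuous_const.mul hf.abs).intervalIntegrable _ _
  · exact ((hf.pow 2).sub (continuous_const.mul hf.abs)).intervalIntegrable _ _
  · exact continuous_const.intervalIntegrable _ _

/-- Taylor's formula on the segment from y to x, with Cauchy–Schwarz once in the segment parameter
and once in the multi-indices. -/
theorem sq_sub_taylorPoly_le {u : Pt n → ℝ} (hu : ContDiff ℝ ∞ u) (k : ℕ) (y x : Pt n) :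
    (u x - taylorPoly (k + 1) u y x) ^ 2
      ≤ ‖x - y‖ ^ (2 * (k + 1)) * ∫ t in (0 : ℝ)..1, derivSq (k + 1) u (y + t • (x - y)) := by
  set h := x - y with hh
  have h1 := abs_sub_taylor_le k
    (fun j t => iteratedFDeriv ℝ j u (y + t • h) (fun _ => h))
    (fun j t => hasDerivAt_iteratedFDeriv_line hu j y h t) (s := 1) (by simp)
  have hcont : Continuous fun t : ℝ => iteratedFDeriv ℝ (k + 1) u (y + t • h) (fun _ => h) :=
    continuous_iff_continuousAt.2 fun t => (hasDerivAt_iteratedFDeriv_line hu (k + 1) y h t).continuousAt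
  simp only [one_pow, one_mul, one_smul, zero_smul, add_zero, iteratedFDeriv_zero_apply] at h1
  rw [show y + h = x by rw [hh]; abel] at h1
  calc (u x - taylorPoly (k + 1) u y x) ^ 2 = |u x - taylorPoly (k + 1) u y x| ^ 2 :=
        (sq_abs _).symm
    _ ≤ (∫ t in (0 : ℝ)..1, |iteratedFDeriv ℝ (k + 1) u (y + t • h) (fun _ => h)|) ^ 2 :=
        pow_le_pow_left₀ (abs_nonneg _) h1 2
    _ ≤ ∫ t in (0 : ℝ)..1, (iteratedFDeriv ℝ (k + 1) u (y + t • h) (fun _ => h)) ^ 2 :=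
        sq_integral_abs_le hcont
    _ ≤ ∫ t in (0 : ℝ)..1, ‖h‖ ^ (2 * (k + 1)) * derivSq (k + 1) u (y + t • h) := by
        have hG : Continuous fun t : ℝ => derivSq (k + 1) u (y + t • h) :=
          (continuous_derivSq hu _).comp (by fun_prop)
        refine intervalIntegral.integral_mono_on (by norm_num)
          ((hcont.pow 2).intervalIntegrable _ _)
          ((continuous_const.mul hG).intervalIntegrable _ _) fun t _ => ?_
        exact multilinear_const_sq_le _ _
    _ = _ := intervalIntegral.integral_const_mul _ _

/-! ### Averages over segments -/

theorem setLIntegral_comp_add_smul_le {G : Pt n → ℝ≥0∞} (hG : Measurable G) {K : Set (Pt n)}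
    (hK : MeasurableSet K) (b : Pt n) {t : ℝ} (ht : 1 / 2 ≤ t) (hmap : ∀ x ∈ K, b + t • x ∈ K) :
    ∫⁻ x in K, G (b + t • x) ≤ 2 ^ n * ∫⁻ x in K, G x := by
  have ht0 : 0 < t := by linarith
  calc ∫⁻ x in K, G (b + t • x) ≤ ∫⁻ x, K.indicator G (b + t • x) := by
        rw [← lintegral_indicator hK]
        refine lintegral_mono fun x => ?_
        by_cases hx : x ∈ K
        · simp [hx, hmap x hx]
        · simp [hx]
    _ = ENNReal.ofReal ((t ^ n)⁻¹) * ∫⁻ x, K.indicator G x := by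
        have h1 := lintegral_comp_shrink (F := fun x => K.indicator G (b + x)) 0 ht0
        simp only [shrink, smul_zero, sub_zero, zero_add] at h1
        rw [h1, lintegral_add_left_eq_self (K.indicator G)]
    _ ≤ 2 ^ n * ∫⁻ x in K, G x := by
        rw [lintegral_indicator hK]
        gcongr
        have : (2 : ℝ≥0∞) ^ n = ENNReal.ofReal (2 ^ n) := by
          rw [ENNReal.ofReal_pow (by norm_num)]; simp
        rw [this]
        refine ENNReal.ofReal_le_ofReal ?_
        rw [inv_le_comm₀ (by positivity) (by positivity), ← inv_pow]
        gcongr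
        linarith

/-- For t ≥ 1/2 the point y + t (x - y) is an affine function of x with Jacobian at least 2⁻ⁿ, for t
< 1/2 the same holds as a function of y, and convexity keeps the point in K. Using x alone would
produce a factor t⁻ⁿ near t = 0. -/
theorem lintegral_segments_le {G : Pt n → ℝ≥0∞} (hG : Measurable G) {K : Set (Pt n)}
    (hK : MeasurableSet K) (hconv : Convex ℝ K) :
    ∫⁻ y in K, ∫⁻ x in K, ∫⁻ t in Set.Icc (0 : ℝ) 1, G (y + t • (x - y))
      ≤ volume K * (2 ^ n * ∫⁻ x in K, G x) := by
  have hm3 : Measurable fun q : (Pt n × Pt n) × ℝ => G (q.1.1 + q.2 • (q.1.2 - q.1.1)) :=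
    hG.comp (by fun_prop)
  have key : ∀ t ∈ Set.Icc (0 : ℝ) 1, ∫⁻ y in K, ∫⁻ x in K, G (y + t • (x - y))
      ≤ volume K * (2 ^ n * ∫⁻ x in K, G x) := by
    intro t ht
    by_cases h : 1 / 2 ≤ t
    · calc _ ≤ ∫⁻ _ in K, (2 ^ n * ∫⁻ x in K, G x) := by
            refine setLIntegral_mono' hK fun y hy => ?_
            have := setLIntegral_comp_add_smul_le hG hK (y - t • y) h fun x hx => by
              have := hconv hy hx (show 0 ≤ 1 - t by linarith [ht.2]) ht.1 (by ring)
              convert this using 1; module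
            convert this using 4; module
        _ = _ := by rw [setLIntegral_const, mul_comm]
    · push Not at h
      rw [lintegral_lintegral_swap]
      · calc _ ≤ ∫⁻ _ in K, (2 ^ n * ∫⁻ x in K, G x) := by
              refine setLIntegral_mono' hK fun x hx => ?_
              have := setLIntegral_comp_add_smul_le hG hK (t • x) (t := 1 - t) (by linarith)
                fun y hy => by
                have := hconv hy hx (show 0 ≤ 1 - t by linarith [ht.2]) ht.1 (by ring)
                convert this using 1; module
              convert this using 4; module
          _ = _ := by rw [setLIntegral_const, mul_comm]
      · exact (hG.comp (by fun_prop : Measurable fun q : Pt n × Pt n =>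
          q.1 + t • (q.2 - q.1))).aemeasurable
  calc ∫⁻ y in K, ∫⁻ x in K, ∫⁻ t in Set.Icc (0 : ℝ) 1, G (y + t • (x - y))
      = ∫⁻ y in K, ∫⁻ t in Set.Icc (0 : ℝ) 1, ∫⁻ x in K, G (y + t • (x - y)) := by
        refine lintegral_congr fun y => lintegral_lintegral_swap ?_
        exact (hG.comp (by fun_prop : Measurable fun q : Pt n × ℝ =>
          y + q.2 • (q.1 - y))).aemeasurable
    _ = ∫⁻ t in Set.Icc (0 : ℝ) 1, ∫⁻ y in K, ∫⁻ x in K, G (y + t • (x - y)) := by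
        refine lintegral_lintegral_swap ?_
        refine Measurable.aemeasurable ?_
        refine Measurable.lintegral_prod_right' (f := fun q : (Pt n × ℝ) × Pt n =>
          G (q.1.1 + q.1.2 • (q.2 - q.1.1))) ?_
        exact hG.comp (by fun_prop)
    _ ≤ ∫⁻ _ in Set.Icc (0 : ℝ) 1, (volume K * (2 ^ n * ∫⁻ x in K, G x)) :=
        setLIntegral_mono' measurableSet_Icc key
    _ = _ := by rw [setLIntegral_const]; simp

/-- The pointwise remainder estimate is integrated over base point and evaluation point;
`lintegral_segments_le` then removes the segments. -/
theorem lintegral_taylor_le {u : Pt n → ℝ} (hu : ContDiff ℝ ∞ u) (k : ℕ) {K : Set (Pt n)}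
    (hK : MeasurableSet K) (hconv : Convex ℝ K) {d : ℝ} (hd : ∀ x ∈ K, ∀ y ∈ K, ‖x - y‖ ≤ d) :
    ∫⁻ y in K, ∫⁻ x in K, ENNReal.ofReal ((u x - taylorPoly k u y x) ^ 2)
      ≤ volume K * (ENNReal.ofReal (d ^ (2 * k)) * (2 ^ n *
        ∫⁻ x in K, ENNReal.ofReal (derivSq k u x))) := by
  have hGm : Measurable fun x => ENNReal.ofReal (derivSq k u x) :=
    (continuous_derivSq hu k).measurable.ennreal_ofReal
  cases k with
  -- Here the Taylor polynomial is empty. The case is needed for the first derivatives when the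
  -- approximating polynomials are constants.
  | zero =>
    have h1 : ∀ x, derivSq 0 u x = u x ^ 2 := fun x => by simp [derivSq]
    simp only [taylorPoly, Finset.range_zero, Finset.sum_empty, sub_zero, h1, mul_zero, pow_zero,
      ENNReal.ofReal_one, one_mul]
    rw [setLIntegral_const, mul_comm]
    gcongr
    exact le_mul_of_one_le_left' (one_le_pow₀ (by norm_num))
  | succ k =>
    calc _ ≤ ∫⁻ y in K, ∫⁻ x in K, ENNReal.ofReal (d ^ (2 * (k + 1))) *
          ∫⁻ t in Set.Icc (0 : ℝ) 1, ENNReal.ofReal (derivSq (k + 1) u (y + t • (x - y))) := by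
          refine setLIntegral_mono' hK fun y hy => setLIntegral_mono' hK fun x hx => ?_
          have hG : Continuous fun t : ℝ => derivSq (k + 1) u (y + t • (x - y)) :=
            (continuous_derivSq hu _).comp (by fun_prop)
          rw [← ofReal_integral_eq_lintegral_ofReal (hG.integrableOn_Icc)
            (Eventually.of_forall fun t => derivSq_nonneg _ _ _),
            ← ENNReal.ofReal_mul (by rw [pow_mul]; exact pow_nonneg (sq_nonneg _) _),
            integral_Icc_eq_integral_Ioc, ← intervalIntegral.integral_of_le (by norm_num)]
          refine ENNReal.ofReal_le_ofReal ((sq_sub_taylorPoly_le hu k y x).trans ?_)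
          refine mul_le_mul_of_nonneg_right (pow_le_pow_left₀ (norm_nonneg _) (hd x hx y hy) _) ?_
          exact intervalIntegral.integral_nonneg (by norm_num) fun t _ => derivSq_nonneg _ _ _
      _ = ENNReal.ofReal (d ^ (2 * (k + 1))) * ∫⁻ y in K, ∫⁻ x in K,
          ∫⁻ t in Set.Icc (0 : ℝ) 1, ENNReal.ofReal (derivSq (k + 1) u (y + t • (x - y))) := by
          rw [← lintegral_const_mul' _ _ ENNReal.ofReal_ne_top]
          refine lintegral_congr fun y => ?_
          rw [lintegral_const_mul' _ _ ENNReal.ofReal_ne_top]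
      _ ≤ ENNReal.ofReal (d ^ (2 * (k + 1))) * (volume K * (2 ^ n *
          ∫⁻ x in K, ENNReal.ofReal (derivSq (k + 1) u x))) := by
          gcongr
          exact lintegral_segments_le hGm hK hconv
      _ = _ := by ring

/-! ### The derivative of the Taylor polynomial -/

/-- Derivatives are symmetric, so the exceptional direction a may be differentiated first, wherever
it stands. Induction peels off the outermost slot; the symmetry of second derivatives is used when a
occupies that slot. -/
theorem iteratedFDeriv_update_const {u : Pt n → ℝ} (hu : ContDiff ℝ ∞ u) (j : ℕ) (i : Fin (j + 1))
    (y h a : Pt n) :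
    iteratedFDeriv ℝ (j + 1) u y (Function.update (fun _ => h) i a)
      = iteratedFDeriv ℝ j (fun z => fderiv ℝ u z a) y (fun _ => h) := by
  induction j generalizing y with
  | zero =>
    rw [iteratedFDeriv_succ_apply hu]
    obtain rfl : i = 0 := by omega
    simp
  | succ j ih =>
    have ha : ContDiff ℝ ∞ (fun z => fderiv ℝ u z a) :=
      (hu.fderiv_right (m := ∞) (by simp)).clm_apply contDiff_const
    rw [iteratedFDeriv_succ_apply hu, iteratedFDeriv_succ_apply ha]
    refine Fin.cases ?_ (fun i => ?_) i
    · have h1 : Fin.tail (Function.update (fun _ : Fin (j + 2) => h) 0 a) = fun _ => h := by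
        ext l; simp [Fin.tail]
      have h2 : Fin.tail (fun _ : Fin (j + 1) => h) = fun _ => h := rfl
      rw [h1, h2, Function.update_self]
      have h3 : (fun z => iteratedFDeriv ℝ j (fun z => fderiv ℝ u z a) z fun _ => h)
          = fun z => fderiv ℝ (fun z => iteratedFDeriv ℝ j u z (fun _ => h)) z a := by
        ext z
        rw [← ih 0 z, iteratedFDeriv_succ_apply hu]
        have h4 : Fin.tail (Function.update (fun _ : Fin (j + 1) => h) 0 a) = fun _ => h := by
          ext l; simp [Fin.tail]
        rw [h4, Function.update_self]
      rw [h3]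
      set v : Pt n → ℝ := fun z => iteratedFDeriv ℝ j u z (fun _ => h) with hv
      have hvs : ContDiff ℝ ∞ v := contDiff_iteratedFDeriv_apply hu j _
      have h5 : (fun z => iteratedFDeriv ℝ (j + 1) u z fun _ => h)
          = fun z => fderiv ℝ v z h := by
        ext z; rw [iteratedFDeriv_succ_apply hu]; rfl
      rw [h5]
      have hd : DifferentiableAt ℝ (fderiv ℝ v) y :=
        (hvs.fderiv_right (m := ∞) (by simp)).differentiable (by simp) y
      have h6 : ∀ b : Pt n, fderiv ℝ (fun z => fderiv ℝ v z b) y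
          = (fderiv ℝ (fderiv ℝ v) y).flip b := by
        intro b
        rw [fderiv_clm_apply hd (differentiableAt_const b), fderiv_fun_const]
        ext w
        simp
      rw [h6, h6]
      have h7 := second_derivative_symmetric (f := v) (f' := fderiv ℝ v)
        (f'' := fderiv ℝ (fderiv ℝ v) y) (x := y)
        (fun z => (hvs.differentiable (by simp) z).hasFDerivAt) hd.hasFDerivAt a h
      exact h7
    · have h1 : Fin.tail (Function.update (fun _ : Fin (j + 2) => h) i.succ a)
          = Function.update (fun _ : Fin (j + 1) => h) i a := by
        ext l
        simp only [Fin.tail]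
        by_cases hl : l = i
        · subst hl; simp
        · simp [Function.update_of_ne hl, Function.update_of_ne (Fin.succ_injective _ |>.ne hl)]
      rw [h1]
      simp_rw [ih i]
      rw [Function.update_of_ne (Fin.succ_ne_zero i).symm]
      rfl

theorem hasFDerivAt_multilinear_const {m : ℕ} (L : Pt n [×m]→L[ℝ] ℝ) (y x a : Pt n) :
    fderiv ℝ (fun x => L (fun _ => x - y)) x a
      = ∑ i, L (Function.update (fun _ => x - y) i a) := by
  have h1 : HasFDerivAt (fun x : Pt n => (fun _ : Fin m => x - y))
      (ContinuousLinearMap.pi fun _ => ContinuousLinearMap.id ℝ (Pt n)) x := by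
    rw [hasFDerivAt_pi]
    exact fun i => (hasFDerivAt_id x).sub_const y
  have h2 := (L.hasFDerivAt (fun _ : Fin m => x - y)).comp x h1
  have h3 : fderiv ℝ (fun x => L (fun _ => x - y)) x = _ := h2.fderiv
  rw [h3]
  simp [ContinuousMultilinearMap.linearDeriv_apply]

/-- The j + 1 slots contribute equal terms, which cancel one factor of the factorial. Gradient
errors of Taylor polynomials thereby become Taylor errors of the derivatives. -/
theorem fderiv_taylorPoly {u : Pt n → ℝ} (hu : ContDiff ℝ ∞ u) (k : ℕ) (y x a : Pt n) :
    fderiv ℝ (taylorPoly (k + 1) u y) x a = taylorPoly k (fun z => fderiv ℝ u z a) y x := by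
  have hd : ∀ j, DifferentiableAt ℝ (fun x => iteratedFDeriv ℝ j u y (fun _ => x - y)) x := by
    intro j
    simp_rw [multilinear_const_eq_sum]
    have h1 : IsPoly j (fun x => ∑ α : Fin j → Fin n, (∏ l, (x - y : Pt n) (α l)) *
        iteratedFDeriv ℝ j u y (fun l => unitVec (α l))) :=
      IsPoly.sum _ fun α _ => IsPoly.mul_const (IsPoly.prod fun i =>
        (IsPoly.coord (α i)).sub (IsPoly.const (y (α i)))) _
    exact h1.contDiff.differentiable (by simp) x
  have h1 : fderiv ℝ (taylorPoly (k + 1) u y) x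
      = ∑ j ∈ Finset.range (k + 1), ((j.factorial : ℝ)⁻¹) •
        fderiv ℝ (fun x => iteratedFDeriv ℝ j u y (fun _ => x - y)) x := by
    refine (HasFDerivAt.fun_sum fun j _ => ?_).fderiv
    exact (hd j).hasFDerivAt.const_smul ((j.factorial : ℝ)⁻¹)
  rw [h1, Finset.sum_range_succ']
  simp only [add_apply, _root_.sum_apply, smul_apply, smul_eq_mul,
    hasFDerivAt_multilinear_const, Finset.univ_eq_empty, Finset.sum_empty, mul_zero, add_zero,
    iteratedFDeriv_update_const hu, Finset.sum_const, Finset.card_univ, Fintype.card_fin]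
  refine Finset.sum_congr rfl fun j _ => ?_
  rw [Nat.factorial_succ, nsmul_eq_mul]
  push_cast
  field_simp

/-- Appending the index i to a multi-index is injective, so the sum on the left is part of the one
on the right. -/
theorem sum_derivSq_fderiv {u : Pt n → ℝ} (hu : ContDiff ℝ ∞ u) (k : ℕ) (x : Pt n) (i : Fin n) :
    derivSq k (fun z => fderiv ℝ u z (unitVec i)) x ≤ derivSq (k + 1) u x := by
  have h1 : ∀ α : Fin k → Fin n,
      iteratedFDeriv ℝ k (fun z => fderiv ℝ u z (unitVec i)) x (fun j => unitVec (α j))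
        = iteratedFDeriv ℝ (k + 1) u x
          (fun j => unitVec ((Fin.snoc α i : Fin (k + 1) → Fin n) j)) := by
    intro α
    rw [iteratedFDeriv_succ_apply_right]
    have hf : ContDiff ℝ ∞ (fderiv ℝ u) := hu.fderiv_right (m := ∞) (by simp)
    have h2 := ((ContinuousLinearMap.apply ℝ ℝ (unitVec i : Pt n))).iteratedFDeriv_comp_left
      (f := fderiv ℝ u) (x := x) (i := k) hf.contDiffAt (by exact_mod_cast le_top)
    have h3 : (fun z => fderiv ℝ u z (unitVec i))
      = (ContinuousLinearMap.apply ℝ ℝ (unitVec i : Pt n)) ∘ (fderiv ℝ u) := rfl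
    rw [h3, h2]
    have h4 : Fin.init (fun j => (unitVec ((Fin.snoc α i : Fin (k + 1) → Fin n) j) : Pt n))
        = fun j => unitVec (α j) := by
      ext j; simp [Fin.init]
    rw [h4]
    simp
  unfold derivSq
  simp_rw [h1]
  rw [← Finset.sum_image (s := Finset.univ) (g := fun α : Fin k → Fin n =>
    (Fin.snoc α i : Fin (k + 1) → Fin n)) (f := fun β => iteratedFDeriv ℝ (k + 1) u x
      (fun j => unitVec (β j)) ^ 2) fun α _ α' _ h => (Fin.snoc_injective2 h).1]
  exact Finset.sum_le_univ_sum_of_nonneg fun _ => sq_nonneg _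

/-- The Bramble-Hilbert lemma for smooth functions on a convex compact set. -/
theorem exists_isPoly_approx {u : Pt n → ℝ} (hu : ContDiff ℝ ∞ u) (k : ℕ) {K : Set (Pt n)}
    (hK : IsCompact K) (hconv : Convex ℝ K) (hvol : volume K ≠ 0) {d : ℝ} (hd0 : 0 ≤ d)
    (hd : ∀ x ∈ K, ∀ y ∈ K, ‖x - y‖ ≤ d) :
    ∃ P, IsPoly k P ∧
      ∫ x in K, (u x - P x) ^ 2 ≤ (n + 1) * 2 ^ n * d ^ (2 * (k + 1)) * ∫ x in K, derivSq (k + 1) u x ∧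
      d ^ 2 * ∫ x in K, ‖fderiv ℝ (fun x => u x - P x) x‖ ^ 2
        ≤ (n + 1) * 2 ^ n * d ^ (2 * (k + 1)) * ∫ x in K, derivSq (k + 1) u x := by
  have hKm := hK.measurableSet
  have hKt : volume K ≠ ⊤ := hK.measure_lt_top.ne
  have hDi : ∀ i : Fin n, ContDiff ℝ ∞ (fun z => fderiv ℝ u z (unitVec i)) := fun i =>
    (hu.fderiv_right (m := ∞) (by simp)).clm_apply contDiff_const
  set I : ℝ≥0∞ := ∫⁻ x in K, ENNReal.ofReal (derivSq (k + 1) u x) with hI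
  have hmeas : ∀ (l : ℕ) {v : Pt n → ℝ}, ContDiff ℝ ∞ v → Measurable fun y =>
      ∫⁻ x in K, ENNReal.ofReal ((v x - taylorPoly l v y x) ^ 2) := by
    intro l v hv
    refine Measurable.lintegral_prod_right'
      (f := fun q : Pt n × Pt n => ENNReal.ofReal ((v q.2 - taylorPoly l v q.1 q.2) ^ 2)) ?_
    exact (((hv.continuous.comp continuous_snd).sub
      (continuous_taylorPoly hv l)).pow 2).measurable.ennreal_ofReal
  -- The error of u and the scaled errors of its n partial derivatives are added before averaging
  -- over the base point, so that a single y serves both estimates. This is the origin of the factor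
  -- n + 1.
  set S : Pt n → ℝ≥0∞ := fun y =>
    (∫⁻ x in K, ENNReal.ofReal ((u x - taylorPoly (k + 1) u y x) ^ 2))
      + ∑ i : Fin n, ENNReal.ofReal (d ^ 2) * ∫⁻ x in K, ENNReal.ofReal
        ((fderiv ℝ u x (unitVec i) - taylorPoly k (fun z => fderiv ℝ u z (unitVec i)) y x) ^ 2)
    with hS
  have hSm : Measurable S :=
    (hmeas (k + 1) hu).add (Finset.measurable_fun_sum _ fun i _ => (hmeas k (hDi i)).const_mul _)
  have hSint : ∫⁻ y in K, S y ≤ volume K * (ENNReal.ofReal ((n + 1) * 2 ^ n * d ^ (2 * (k + 1))) * I) := by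
    rw [hS, lintegral_add_left (hmeas (k + 1) hu),
      lintegral_finsetSum _ fun i _ => (hmeas k (hDi i)).const_mul _]
    have h1 := lintegral_taylor_le hu (k + 1) hKm hconv hd
    have h2 : ∀ i : Fin n, ∫⁻ y in K, ENNReal.ofReal (d ^ 2) * ∫⁻ x in K, ENNReal.ofReal
        ((fderiv ℝ u x (unitVec i) - taylorPoly k (fun z => fderiv ℝ u z (unitVec i)) y x) ^ 2)
        ≤ volume K * (ENNReal.ofReal (d ^ (2 * (k + 1))) * (2 ^ n * I)) := by
      intro i
      rw [lintegral_const_mul' _ _ ENNReal.ofReal_ne_top]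
      have h3 := lintegral_taylor_le (hDi i) k hKm hconv hd
      calc _ ≤ ENNReal.ofReal (d ^ 2) * (volume K * (ENNReal.ofReal (d ^ (2 * k)) * (2 ^ n * I))) := by
            gcongr
            refine h3.trans ?_
            gcongr
            exact lintegral_mono fun x => ENNReal.ofReal_le_ofReal (sum_derivSq_fderiv hu k x i)
        _ = _ := by
            rw [show d ^ (2 * (k + 1)) = d ^ 2 * d ^ (2 * k) by ring,
              ENNReal.ofReal_mul (by positivity)]
            ring
    calc _ ≤ volume K * (ENNReal.ofReal (d ^ (2 * (k + 1))) * (2 ^ n * I))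
          + ∑ i : Fin n, volume K * (ENNReal.ofReal (d ^ (2 * (k + 1))) * (2 ^ n * I)) :=
          add_le_add h1 (Finset.sum_le_sum fun i _ => h2 i)
      _ = _ := by
          rw [Finset.sum_const, Finset.card_univ, Fintype.card_fin, nsmul_eq_mul,
            ENNReal.ofReal_mul (by positivity), ENNReal.ofReal_mul (by positivity),
            ENNReal.ofReal_pow (by norm_num : (0 : ℝ) ≤ 2), ENNReal.ofReal_add (by positivity) (by norm_num)]
          simp
          ring
  obtain ⟨y, hy, hSy⟩ := exists_le_setLAverage hvol hKt hSm.aemeasurable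
  have hSy2 : S y ≤ ENNReal.ofReal ((n + 1) * 2 ^ n * d ^ (2 * (k + 1))) * I := by
    refine hSy.trans ?_
    rw [setLAverage_eq]
    refine ENNReal.div_le_of_le_mul ?_
    rw [mul_comm]
    exact hSint
  set P := taylorPoly (k + 1) u y with hP
  have hPp : IsPoly k P := isPoly_taylorPoly k u y
  have hIr : I = ENNReal.ofReal (∫ x in K, derivSq (k + 1) u x) := by
    rw [ofReal_integral_eq_lintegral_ofReal
      ((continuous_derivSq hu _).continuousOn.integrableOn_compact hK)
      (Eventually.of_forall fun x => derivSq_nonneg _ _ _)]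
  have hI0 : 0 ≤ ∫ x in K, derivSq (k + 1) u x :=
    integral_nonneg fun x => derivSq_nonneg _ _ _
  rw [hIr, ← ENNReal.ofReal_mul (by positivity)] at hSy2
  refine ⟨P, hPp, ?_, ?_⟩
  · have h1 : ∫⁻ x in K, ENNReal.ofReal ((u x - P x) ^ 2) ≤ S y := le_self_add
    rw [← ofReal_integral_eq_lintegral_ofReal (f := fun x => (u x - P x) ^ 2)
      (((hu.continuous.sub hPp.continuous).pow 2).continuousOn.integrableOn_compact hK)
      (Eventually.of_forall fun x => sq_nonneg _)] at h1
    exact (ENNReal.ofReal_le_ofReal_iff (by positivity)).1 (h1.trans hSy2)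
  · have hf : ∀ x i, fderiv ℝ (fun x => u x - P x) x (unitVec i)
        = fderiv ℝ u x (unitVec i) - taylorPoly k (fun z => fderiv ℝ u z (unitVec i)) y x := by
      intro x i
      rw [fderiv_fun_sub (hu.differentiable (by simp) x) (hPp.contDiff.differentiable (by simp) x),
        sub_apply, hP, fderiv_taylorPoly hu]
    have hc : ∀ i : Fin n, Continuous fun x =>
        (fderiv ℝ u x (unitVec i) - taylorPoly k (fun z => fderiv ℝ u z (unitVec i)) y x) ^ 2 := by
      intro i
      exact ((hDi i).continuous.sub ((continuous_taylorPoly (hDi i) k).comp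
        (continuous_const.prodMk continuous_id))).pow 2
    have hup : ContDiff ℝ ∞ (fun x => u x - P x) := hu.sub hPp.contDiff
    have h1 : d ^ 2 * ∫ x in K, ‖fderiv ℝ (fun x => u x - P x) x‖ ^ 2
        ≤ ∑ i : Fin n, d ^ 2 * ∫ x in K,
          (fderiv ℝ u x (unitVec i) - taylorPoly k (fun z => fderiv ℝ u z (unitVec i)) y x) ^ 2 := by
      rw [← Finset.mul_sum, ← integral_finsetSum _ fun i _ =>
        (hc i).continuousOn.integrableOn_compact hK]
      refine mul_le_mul_of_nonneg_left ?_ (sq_nonneg d)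
      refine setIntegral_mono_on ?_ ?_ hKm fun x _ => ?_
      · exact ((hup.continuous_fderiv (by simp)).norm.pow 2).continuousOn.integrableOn_compact hK
      · exact (continuous_finsetSum _ fun i _ => hc i).continuousOn.integrableOn_compact hK
      · refine (norm_fderiv_sq_le _ _).trans (le_of_eq ?_)
        exact Finset.sum_congr rfl fun i _ => by rw [hf]
    have h2 : ENNReal.ofReal (∑ i : Fin n, d ^ 2 * ∫ x in K,
          (fderiv ℝ u x (unitVec i) - taylorPoly k (fun z => fderiv ℝ u z (unitVec i)) y x) ^ 2)
        ≤ S y := by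
      rw [ENNReal.ofReal_sum_of_nonneg fun i _ =>
        mul_nonneg (sq_nonneg d) (integral_nonneg fun x => sq_nonneg _)]
      refine le_trans (le_of_eq ?_) le_add_self
      refine Finset.sum_congr rfl fun i _ => ?_
      rw [ENNReal.ofReal_mul (sq_nonneg d), ofReal_integral_eq_lintegral_ofReal
        ((hc i).continuousOn.integrableOn_compact hK) (Eventually.of_forall fun x => sq_nonneg _)]
    exact h1.trans ((ENNReal.ofReal_le_ofReal_iff (by positivity)).1 (h2.trans hSy2))

end Taylor

end HDG

/-! ### Convergence in L² and uniform convergence -/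

namespace HDG

section L2

open Filter Topology

variable {n : ℕ} {μ ν : Measure (Pt n)} {f g : Pt n → ℝ}

theorem integral_mul_sq_le (hf : MemLp f 2 μ) (hg : MemLp g 2 μ) :
    (∫ x, f x * g x ∂μ) ^ 2 ≤ (∫ x, f x ^ 2 ∂μ) * ∫ x, g x ^ 2 ∂μ := by
  have h1 := abs_real_inner_le_norm (hf.toLp f) (hg.toLp g)
  have h2 : ⟪hf.toLp f, hg.toLp g⟫ = ∫ x, f x * g x ∂μ := by
    rw [L2.inner_def]
    refine integral_congr_ae ?_
    filter_upwards [hf.coeFn_toLp, hg.coeFn_toLp] with x hx hx'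
    rw [hx, hx']; simp [mul_comm]
  rw [h2] at h1
  rw [← L2_norm_sq_toLp hf, ← L2_norm_sq_toLp hg, ← mul_pow, ← sq_abs]
  exact pow_le_pow_left₀ (abs_nonneg _) h1 2

theorem abs_integral_mul_le (hf : MemLp f 2 μ) (hg : MemLp g 2 μ) :
    |∫ x, f x * g x ∂μ| ≤ Real.sqrt (∫ x, f x ^ 2 ∂μ) * Real.sqrt (∫ x, g x ^ 2 ∂μ) := by
  rw [← Real.sqrt_mul (integral_nonneg fun x => sq_nonneg _), ← Real.sqrt_sq_eq_abs]
  exact Real.sqrt_le_sqrt (integral_mul_sq_le hf hg)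

theorem integral_add_sq_le (hf : MemLp f 2 μ) (hg : MemLp g 2 μ) :
    ∫ x, (f x + g x) ^ 2 ∂μ ≤ 2 * (∫ x, f x ^ 2 ∂μ) + 2 * ∫ x, g x ^ 2 ∂μ := by
  rw [← integral_const_mul, ← integral_const_mul,
    ← integral_add (hf.integrable_sq.const_mul 2) (hg.integrable_sq.const_mul 2)]
  refine integral_mono (hf.add hg).integrable_sq
    ((hf.integrable_sq.const_mul 2).add (hg.integrable_sq.const_mul 2)) fun x => ?_
  simp only [Pi.add_apply]
  nlinarith [sq_nonneg (f x - g x)]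

theorem integral_sq_eq_eLpNorm (hf : MemLp f 2 μ) :
    ∫ x, f x ^ 2 ∂μ = (eLpNorm f 2 μ).toReal ^ 2 := by
  rw [← L2_norm_sq_toLp hf, Lp.norm_toLp]

theorem integral_sq_mono (h : ν ≤ μ) (hf : MemLp f 2 μ) :
    ∫ x, f x ^ 2 ∂ν ≤ ∫ x, f x ^ 2 ∂μ :=
  integral_mono_measure h (Eventually.of_forall fun x => sq_nonneg _) hf.integrable_sq

theorem MemLp.mul_bdd {f g : Pt n → ℝ} (hf : MemLp f 2 μ) (hg : AEStronglyMeasurable g μ) {M : ℝ}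
    (hM : ∀ᵐ x ∂μ, |g x| ≤ M) : MemLp (fun x => f x * g x) 2 μ := by
  refine (hf.const_mul M).mono (hf.aestronglyMeasurable.mul hg) ?_
  filter_upwards [hM] with x hx
  rw [norm_mul, norm_mul, mul_comm]
  exact mul_le_mul_of_nonneg_right (hx.trans (le_abs_self M)) (norm_nonneg _)

/-- Convergence in `L²`. -/
structure TendstoL2 (μ : Measure (Pt n)) (f : ℕ → Pt n → ℝ) (g : Pt n → ℝ) : Prop where
  mem : ∀ N, MemLp (f N) 2 μ
  mem_lim : MemLp g 2 μ
  tendsto : Tendsto (fun N => ∫ x, (f N x - g x) ^ 2 ∂μ) atTop (𝓝 0)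

/-- Uniform convergence up to null sets to a bounded function. -/
structure TendstoUnif (μ : Measure (Pt n)) (f : ℕ → Pt n → ℝ) (g : Pt n → ℝ) : Prop where
  meas : ∀ N, AEStronglyMeasurable (f N) μ
  meas_lim : AEStronglyMeasurable g μ
  bdd : ∃ M, ∀ᵐ x ∂μ, |g x| ≤ M
  tendsto : ∀ ε > 0, ∀ᶠ N in atTop, ∀ᵐ x ∂μ, |f N x - g x| ≤ ε

theorem TendstoL2.mono {f : ℕ → Pt n → ℝ} (h : ν ≤ μ) (hf : TendstoL2 μ f g) : TendstoL2 ν f g :=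
  ⟨fun N => (hf.mem N).mono_measure h, hf.mem_lim.mono_measure h,
    squeeze_zero (fun N => integral_nonneg fun x => sq_nonneg _)
      (fun N => integral_sq_mono h ((hf.mem N).sub hf.mem_lim)) hf.tendsto⟩

theorem TendstoL2.add {f f' : ℕ → Pt n → ℝ} {g' : Pt n → ℝ} (hf : TendstoL2 μ f g)
    (hf' : TendstoL2 μ f' g') :
    TendstoL2 μ (fun N x => f N x + f' N x) (fun x => g x + g' x) := by
  refine ⟨fun N => (hf.mem N).add (hf'.mem N), hf.mem_lim.add hf'.mem_lim, ?_⟩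
  refine squeeze_zero (fun N => integral_nonneg fun x => sq_nonneg _) (fun N => ?_)
    (by simpa using (hf.tendsto.const_mul 2).add (hf'.tendsto.const_mul 2))
  have := integral_add_sq_le ((hf.mem N).sub hf.mem_lim) ((hf'.mem N).sub hf'.mem_lim)
  simp only [Pi.sub_apply] at this
  simpa only [add_sub_add_comm] using this

theorem TendstoL2.zero : TendstoL2 μ (fun _ _ => 0) (fun _ => 0) :=
  ⟨fun _ => MemLp.zero', MemLp.zero', by simp⟩

theorem TendstoL2.sum {ι : Type*} (s : Finset ι) {f : ι → ℕ → Pt n → ℝ} {g : ι → Pt n → ℝ}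
    (hf : ∀ i ∈ s, TendstoL2 μ (f i) (g i)) :
    TendstoL2 μ (fun N x => ∑ i ∈ s, f i N x) (fun x => ∑ i ∈ s, g i x) := by
  classical
  induction s using Finset.induction_on with
  | empty => simpa using TendstoL2.zero
  | insert a s ha ih =>
    simp_rw [Finset.sum_insert ha]
    exact (hf a (Finset.mem_insert_self _ _)).add
      (ih fun i hi => hf i (Finset.mem_insert_of_mem hi))

/-- Split the difference of the products into (f_N - g) u_N + g (u_N - v). -/
theorem TendstoL2.mul_unif {f u : ℕ → Pt n → ℝ} {v : Pt n → ℝ} (hf : TendstoL2 μ f g)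
    (hu : TendstoUnif μ u v) (hub : ∀ N, ∃ M, ∀ᵐ x ∂μ, |u N x| ≤ M) :
    TendstoL2 μ (fun N x => f N x * u N x) (fun x => g x * v x) := by
  obtain ⟨M, hM⟩ := hu.bdd
  have hM' : ∀ᵐ x ∂μ, |v x| ≤ |M| := hM.mono fun x hx => hx.trans (le_abs_self M)
  refine ⟨fun N => ?_, MemLp.mul_bdd hf.mem_lim hu.meas_lim hM, ?_⟩
  · obtain ⟨M', hM'⟩ := hub N
    exact MemLp.mul_bdd (hf.mem N) (hu.meas N) hM'
  set A := |M| + 1 with hA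
  set J := ∫ x, g x ^ 2 ∂μ with hJ
  have hJ0 : 0 ≤ J := integral_nonneg fun x => sq_nonneg _
  rw [Metric.tendsto_atTop']
  intro ε hε
  -- The bound 1 keeps |u N x| below |M| + 1, and the square root makes 2 * δ ^ 2 * J smaller than
  -- ε.
  set δ : ℝ := min 1 (Real.sqrt (ε / (4 * (J + 1)))) with hδ
  have hδ0 : 0 < δ := lt_min one_pos (Real.sqrt_pos.2 (by positivity))
  have hδ2 : 2 * δ ^ 2 * J < ε := by
    have h1 : δ ^ 2 ≤ ε / (4 * (J + 1)) := by
      calc δ ^ 2 ≤ Real.sqrt (ε / (4 * (J + 1))) ^ 2 := pow_le_pow_left₀ hδ0.le (min_le_right _ _) 2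
        _ = _ := Real.sq_sqrt (by positivity)
    calc 2 * δ ^ 2 * J ≤ 2 * (ε / (4 * (J + 1))) * (J + 1) := by gcongr; linarith
      _ = ε / 2 := by field_simp; norm_num
      _ < ε := by linarith
  have hlim : Tendsto (fun N => 2 * A ^ 2 * (∫ x, (f N x - g x) ^ 2 ∂μ) + 2 * δ ^ 2 * J) atTop
      (𝓝 (2 * δ ^ 2 * J)) := by
    simpa using (hf.tendsto.const_mul (2 * A ^ 2)).add_const (2 * δ ^ 2 * J)
  obtain ⟨N₀, hN₀⟩ := eventually_atTop.1 ((hlim.eventually (gt_mem_nhds hδ2)).and (hu.tendsto δ hδ0))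
  refine ⟨N₀, fun N hN => ?_⟩
  obtain ⟨h1, h2⟩ := hN₀ N hN.le
  rw [Real.dist_0_eq_abs, abs_of_nonneg (integral_nonneg fun x => sq_nonneg _)]
  refine lt_of_le_of_lt ?_ h1
  have hi1 := (((hf.mem N).sub hf.mem_lim).integrable_sq).const_mul (2 * A ^ 2)
  have hi2 := hf.mem_lim.integrable_sq.const_mul (2 * δ ^ 2)
  rw [hJ, ← integral_const_mul, ← integral_const_mul]
  have hsum := integral_add hi1 hi2
  simp only [Pi.sub_apply] at hsum
  rw [← hsum]
  refine integral_mono_of_nonneg (Eventually.of_forall fun x => sq_nonneg _) (hi1.add hi2) ?_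
  filter_upwards [h2, hM'] with x hx hMx
  have h3 : |u N x| ≤ A := by
    have := abs_sub_abs_le_abs_sub (u N x) (v x)
    have hδ1 : δ ≤ 1 := min_le_left _ _
    linarith
  have h4 : u N x ^ 2 ≤ A ^ 2 := sq_le_sq.2 (h3.trans (le_abs_self _))
  have h5 : (u N x - v x) ^ 2 ≤ δ ^ 2 := sq_le_sq.2 (hx.trans (le_abs_self _))
  have h6 : f N x * u N x - g x * v x = (f N x - g x) * u N x + g x * (u N x - v x) := by ring
  rw [h6]
  have h7 := mul_le_mul_of_nonneg_left h4 (sq_nonneg (f N x - g x))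
  have h8 := mul_le_mul_of_nonneg_left h5 (sq_nonneg (g x))
  nlinarith [sq_nonneg ((f N x - g x) * u N x - g x * (u N x - v x))]

theorem TendstoUnif.const_seq {a : ℕ → ℝ} {b : ℝ} (h : Tendsto a atTop (𝓝 b)) :
    TendstoUnif μ (fun N _ => a N) (fun _ => b) := by
  refine ⟨fun N => aestronglyMeasurable_const, aestronglyMeasurable_const,
    ⟨|b|, Eventually.of_forall fun _ => le_rfl⟩, fun ε hε => ?_⟩
  filter_upwards [Metric.tendsto_nhds.1 h ε hε] with N hN
  exact Eventually.of_forall fun _ => hN.le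

theorem TendstoUnif.const (hg : AEStronglyMeasurable g μ) {M : ℝ} (hM : ∀ᵐ x ∂μ, |g x| ≤ M) :
    TendstoUnif μ (fun _ => g) g :=
  ⟨fun _ => hg, hg, ⟨M, hM⟩, fun ε hε => Eventually.of_forall fun _ =>
    Eventually.of_forall fun _ => by simpa using hε.le⟩

theorem TendstoL2.const (hg : MemLp g 2 μ) : TendstoL2 μ (fun _ => g) g :=
  ⟨fun _ => hg, hg, by simp⟩

theorem TendstoL2.integral_mul {f : ℕ → Pt n → ℝ} {h : Pt n → ℝ} (hf : TendstoL2 μ f g)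
    (hh : MemLp h 2 μ) :
    Tendsto (fun N => ∫ x, f N x * h x ∂μ) atTop (𝓝 (∫ x, g x * h x ∂μ)) := by
  rw [tendsto_iff_dist_tendsto_zero]
  have h0 : Tendsto (fun N => Real.sqrt (∫ x, (f N x - g x) ^ 2 ∂μ) * Real.sqrt (∫ x, h x ^ 2 ∂μ))
      atTop (𝓝 0) := by
    have := (Real.continuous_sqrt.tendsto 0).comp hf.tendsto
    simpa using this.mul_const (Real.sqrt (∫ x, h x ^ 2 ∂μ))
  refine squeeze_zero (fun _ => dist_nonneg) (fun N => ?_) h0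
  have i1 : Integrable (fun x => f N x * h x) μ := (hf.mem N).integrable_mul hh
  have i2 : Integrable (fun x => g x * h x) μ := hf.mem_lim.integrable_mul hh
  rw [Real.dist_eq, ← integral_sub i1 i2]
  have := abs_integral_mul_le ((hf.mem N).sub hf.mem_lim) hh
  simp only [Pi.sub_apply, sub_mul] at this
  exact this

theorem TendstoUnif.of_tendstoUniformlyOn {K : Set (Pt n)} (hK : IsCompact K)
    {f : ℕ → Pt n → ℝ} (hf : ∀ N, ContinuousOn (f N) K) (hg : ContinuousOn g K)
    (h : TendstoUniformlyOn f g atTop K) : TendstoUnif (μ.restrict K) f g := by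
  obtain ⟨M, hM⟩ := hK.exists_bound_of_continuousOn hg
  refine ⟨fun N => (hf N).aestronglyMeasurable hK.measurableSet,
    hg.aestronglyMeasurable hK.measurableSet,
    ⟨M, (ae_restrict_iff' hK.measurableSet).2 (Eventually.of_forall hM)⟩, fun ε hε => ?_⟩
  filter_upwards [Metric.tendstoUniformlyOn_iff.1 h ε hε] with N hN
  refine (ae_restrict_iff' hK.measurableSet).2 (Eventually.of_forall fun x hx => ?_)
  rw [← Real.dist_eq, dist_comm]
  exact (hN x hx).le

theorem ae_bdd_of_continuousOn {K : Set (Pt n)} (hK : IsCompact K) (hg : ContinuousOn g K) :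
    ∃ M, ∀ᵐ x ∂μ.restrict K, |g x| ≤ M := by
  obtain ⟨M, hM⟩ := hK.exists_bound_of_continuousOn hg
  exact ⟨M, (ae_restrict_iff' hK.measurableSet).2 (Eventually.of_forall hM)⟩

theorem TendstoUnif.toL2 [IsFiniteMeasure μ] {f : ℕ → Pt n → ℝ}
    (hf : TendstoUnif μ f g) (hub : ∀ N, ∃ M, ∀ᵐ x ∂μ, |f N x| ≤ M) : TendstoL2 μ f g := by
  have h1 := (TendstoL2.const (μ := μ) (memLp_const (1 : ℝ))).mul_unif hf hub
  simpa using h1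

end L2

/-! ### Weak derivatives: uniqueness and integrability -/

section Weak

open Filter Topology

variable {n : ℕ} {Ω : Set (Pt n)}

theorem integrable_mul_of_compactSupport {u φ : Pt n → ℝ} (hu : LocallyIntegrableOn u Ω)
    (hφ : Continuous φ) (hc : HasCompactSupport φ) (hs : tsupport φ ⊆ Ω) :
    Integrable (fun x => u x * φ x) (volume.restrict Ω) := by
  have h3 : IntegrableOn u (tsupport φ) := hu.integrableOn_compact_subset hs hc
  have h4 : IntegrableOn (fun x => u x * φ x) (tsupport φ) :=
    h3.mul_continuousOn hφ.continuousOn hc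
  refine (IntegrableOn.integrable_of_forall_notMem_eq_zero h4 fun x hx => ?_).integrableOn
  rw [image_eq_zero_of_notMem_tsupport hx, mul_zero]

/-- The fundamental lemma of the calculus of variations, applied to v - w. -/
theorem ae_eq_of_integral_test_eq (ho : IsOpen Ω) {v w : Pt n → ℝ}
    (hv : LocallyIntegrableOn v Ω) (hw : LocallyIntegrableOn w Ω)
    (h : ∀ φ : Pt n → ℝ, IsTestFunction Ω φ → ∫ x in Ω, v x * φ x = ∫ x in Ω, w x * φ x) :
    v =ᵐ[volume.restrict Ω] w := by
  have h1 := ho.ae_eq_zero_of_integral_contDiff_smul_eq_zero (μ := volume) (f := fun x => v x - w x)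
    (hv.sub hw) (fun φ hφ hc hs => by
      have hi : ∀ {u : Pt n → ℝ}, LocallyIntegrableOn u Ω → Integrable (fun x => u x * φ x)
          (volume.restrict Ω) := fun hu =>
        integrable_mul_of_compactSupport hu hφ.continuous hc hs
      have h2 := h φ ⟨hφ, hc, hs⟩
      have h5 : ∫ x in Ω, φ x • (v x - w x) = 0 := by
        simp_rw [smul_eq_mul, mul_comm (φ _), sub_mul]
        rw [integral_sub (hi hv) (hi hw), h2, sub_self]
      rw [← h5]
      refine (setIntegral_eq_integral_of_forall_compl_eq_zero fun x hx => ?_).symm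
      rw [image_eq_zero_of_notMem_tsupport fun h => hx (hs h), zero_smul])
  rw [EventuallyEq, ae_restrict_iff' ho.measurableSet]
  filter_upwards [h1] with x hx hxΩ
  exact sub_eq_zero.1 (hx hxΩ)

theorem HasWeakDeriv.ae_eq (ho : IsOpen Ω) {m : ℕ} {α : Fin m → Fin n} {u v w : Pt n → ℝ}
    (hv : HasWeakDeriv Ω α u v) (hw : HasWeakDeriv Ω α u w) : v =ᵐ[volume.restrict Ω] w := by
  refine ae_eq_of_integral_test_eq ho hv.locInt_deriv hw.locInt_deriv fun φ hφ => ?_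
  have h := (hv.integral_eq φ hφ).symm.trans (hw.integral_eq φ hφ)
  exact mul_left_cancel₀ (pow_ne_zero _ (by norm_num)) h

theorem MemH.weakDeriv (ho : IsOpen Ω) {m : ℕ} {u : Pt n → ℝ} (hu : MemH Ω m u) {j : ℕ}
    (hj : j ≤ m) (α : Fin j → Fin n) :
    HasWeakDeriv Ω α u (weakDeriv Ω α u) ∧ MemLp (weakDeriv Ω α u) 2 (volume.restrict Ω) := by
  obtain ⟨v, hv, hd⟩ := hu.2 j hj α
  have hex : ∃ v : Pt n → ℝ, HasWeakDeriv Ω α u v := ⟨v, hd⟩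
  have h1 : HasWeakDeriv Ω α u (HDG.weakDeriv Ω α u) := by
    rw [HDG.weakDeriv, dif_pos hex]; exact hex.choose_spec
  exact ⟨h1, hv.ae_eq (hd.ae_eq ho h1)⟩

theorem HasWeakGradient.memLp (ho : IsOpen Ω) {u : Pt n → ℝ} {G : Pt n → Pt n} {m : ℕ}
    (hu : MemH Ω (m + 1) u) (hG : HasWeakGradient Ω u G) (i : Fin n) :
    MemLp (fun x => G x i) 2 (volume.restrict Ω) := by
  obtain ⟨v, hv, hd⟩ := hu.2 1 (by omega) ![i]
  exact hv.ae_eq (hd.ae_eq ho (hG i))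

theorem iteratedFDeriv_one_unitVec (φ : Pt n → ℝ) (x : Pt n) (i : Fin n) :
    iteratedFDeriv ℝ 1 φ x (fun j => unitVec (![i] j)) = fderiv ℝ φ x (unitVec i) := by
  rw [iteratedFDeriv_one_apply]; simp

theorem fderiv_eq_sum (L : Pt n →L[ℝ] ℝ) (v : Pt n) : L v = ∑ i, v i * L (unitVec i) := by
  have hv : v = ∑ i, v i • (unitVec i : Pt n) := by
    ext j; simp [unitVec, Finset.sum_apply, Pi.single_apply]
  conv_lhs => rw [hv]
  simp

/-- Both functions have the same integrals against test functions. This transfers integrability from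
the weak partial derivatives to the given d, which by definition is only locally integrable. -/
theorem HasWeakDiv.ae_eq_sum (ho : IsOpen Ω) {V : Pt n → Pt n} {d : Pt n → ℝ}
    (hd : HasWeakDiv Ω V d) {v : Fin n → Pt n → ℝ}
    (hv : ∀ i, HasWeakDeriv Ω ![i] (fun x => V x i) (v i)) :
    d =ᵐ[volume.restrict Ω] fun x => ∑ i, v i x := by
  have hvi : ∀ i, LocallyIntegrableOn (v i) Ω := fun i => (hv i).locInt_deriv
  have hsum : LocallyIntegrableOn (fun x => ∑ i, v i x) Ω := by
    intro x hx
    have h1 := fun i => hvi i x hx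
    choose s hs hi using h1
    refine ⟨⋂ i, s i, (Filter.iInter_mem).2 hs, ?_⟩
    exact integrable_finsetSum _ fun i _ => (hi i).mono_set (Set.iInter_subset _ i)
  refine ae_eq_of_integral_test_eq ho hd.locInt_div hsum fun φ hφ => ?_
  have h1 := hd.integral_eq φ hφ
  have hφc : ∀ i : Fin n, Continuous fun x => fderiv ℝ φ x (unitVec i) := fun i =>
    (hφ.smooth.continuous_fderiv (by simp)).clm_apply continuous_const
  have h2 : ∫ x in Ω, fderiv ℝ φ x (V x) = ∑ i, ∫ x in Ω, V x i * fderiv ℝ φ x (unitVec i) := by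
    simp_rw [fun x => fderiv_eq_sum (fderiv ℝ φ x) (V x)]
    refine integral_finsetSum _ fun i _ => ?_
    exact integrable_mul_of_compactSupport (hv i).locInt (hφc i)
      (hφ.compactSupport.fderiv_apply ℝ _)
      ((tsupport_fderiv_apply_subset ℝ (unitVec i)).trans hφ.support_subset)
  have h3 : ∀ i, ∫ x in Ω, V x i * fderiv ℝ φ x (unitVec i) = - ∫ x in Ω, v i x * φ x := by
    intro i
    have := (hv i).integral_eq φ hφ
    simp_rw [iteratedFDeriv_one_unitVec] at this
    simpa using this
  simp_rw [h2, h3] at h1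
  rw [Finset.sum_neg_distrib, neg_inj] at h1
  rw [← h1]
  simp_rw [Finset.sum_mul]
  rw [integral_finsetSum]
  exact fun i _ => integrable_mul_of_compactSupport (hvi i) hφ.smooth.continuous
    hφ.compactSupport hφ.support_subset

theorem HasWeakDiv.memLp (ho : IsOpen Ω) {V : Pt n → Pt n} {d : Pt n → ℝ} {m : ℕ}
    (hV : MemHVec Ω (m + 1) V) (hd : HasWeakDiv Ω V d) : MemLp d 2 (volume.restrict Ω) := by
  have h := fun i => (hV i).2 1 (by omega) ![i]
  choose v hv hvd using h
  exact (memLp_finsetSum Finset.univ fun i _ => hv i).ae_eq (hd.ae_eq_sum ho hvd).symm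

theorem HasWeakDiv.memLp_top (ho : IsOpen Ω) {V : Pt n → Pt n} {d : Pt n → ℝ}
    (hV : ∀ i, MemW1inf Ω (fun x => V x i)) (hd : HasWeakDiv Ω V d) :
    MemLp d ⊤ (volume.restrict Ω) := by
  have h := fun i => (hV i).2
  choose v hv hvd using h
  exact (memLp_finsetSum Finset.univ fun i _ => hv i i).ae_eq
    (hd.ae_eq_sum ho fun i => hvd i i).symm

end Weak

end HDG

/-! ### Smooth approximation of Sobolev functions -/

namespace HDG

section Approx

open Filter Topology

variable {n : ℕ} {Ω : Set (Pt n)}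

theorem TendstoL2.congr {μ : Measure (Pt n)} {f f' : ℕ → Pt n → ℝ} {g : Pt n → ℝ}
    (hf : TendstoL2 μ f g) (h : ∀ N, f N =ᵐ[μ] f' N) : TendstoL2 μ f' g := by
  refine ⟨fun N => (hf.mem N).ae_eq (h N), hf.mem_lim, hf.tendsto.congr fun N => ?_⟩
  refine integral_congr_ae ?_
  filter_upwards [h N] with x hx
  rw [hx]

theorem TendstoL2.integral_sq {μ : Measure (Pt n)} {f : ℕ → Pt n → ℝ} {g : Pt n → ℝ}
    (hf : TendstoL2 μ f g) :
    Tendsto (fun N => ∫ x, f N x ^ 2 ∂μ) atTop (𝓝 (∫ x, g x ^ 2 ∂μ)) := by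
  have h1 : ∀ N, ∫ x, f N x ^ 2 ∂μ
      = (∫ x, (f N x - g x) ^ 2 ∂μ) + 2 * (∫ x, f N x * g x ∂μ) - ∫ x, g x ^ 2 ∂μ := by
    intro N
    have i1 : Integrable (fun x => (f N x - g x) ^ 2) μ := ((hf.mem N).sub hf.mem_lim).integrable_sq
    have i2 : Integrable (fun x => f N x * g x) μ := (hf.mem N).integrable_mul hf.mem_lim
    have i3 : Integrable (fun x => (f N x - g x) ^ 2 + 2 * (f N x * g x)) μ :=
      i1.add (i2.const_mul 2)
    rw [← integral_const_mul, ← integral_add i1 (i2.const_mul 2),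
      ← integral_sub i3 hf.mem_lim.integrable_sq]
    refine integral_congr_ae (Eventually.of_forall fun x => ?_)
    simp only
    ring
  simp_rw [h1]
  have h2 := (hf.tendsto.add ((hf.integral_mul hf.mem_lim).const_mul 2)).sub_const
    (∫ x, g x ^ 2 ∂μ)
  have h3 : ∫ x, g x * g x ∂μ = ∫ x, g x ^ 2 ∂μ := by simp_rw [sq]
  rw [h3] at h2
  convert h2 using 2
  ring

theorem MemLp.ae_bdd {μ : Measure (Pt n)} {f : Pt n → ℝ} (hf : MemLp f ⊤ μ) :
    ∃ M, 0 ≤ M ∧ ∀ᵐ x ∂μ, |f x| ≤ M := by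
  refine ⟨(eLpNorm f ⊤ μ).toReal, ENNReal.toReal_nonneg, ?_⟩
  filter_upwards [ae_le_eLpNormEssSup (f := f) (μ := μ)] with x hx
  have h := ENNReal.toReal_mono hf.2.ne (hx.trans_eq eLpNorm_exponent_top.symm)
  simpa using h

theorem IsConvexPolytopeDomain.isCompact_closure (hΩ : IsConvexPolytopeDomain Ω) : IsCompact (closure Ω) := by
  obtain ⟨V, hV⟩ := hΩ.polytope
  rw [hV]
  exact V.finite_toSet.isCompact_convexHull (𝕜 := ℝ)

theorem IsConvexPolytopeDomain.isBounded (hΩ : IsConvexPolytopeDomain Ω) : Bornology.IsBounded Ω :=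
  hΩ.isCompact_closure.isBounded.subset subset_closure

theorem IsConvexPolytopeDomain.isFiniteMeasure (hΩ : IsConvexPolytopeDomain Ω) : IsFiniteMeasure (volume.restrict Ω) :=
  ⟨by simpa using hΩ.isBounded.measure_lt_top⟩

theorem IsConvexPolytopeDomain.exists_ball (hΩ : IsConvexPolytopeDomain Ω) : ∃ q : Pt n × ℝ, 0 < q.2 ∧ Metric.ball q.1 q.2 ⊆ Ω := by
  obtain ⟨c, hc⟩ := hΩ.nonempty
  obtain ⟨r, hr, h⟩ := Metric.isOpen_iff.1 hΩ.isOpen c hc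
  exact ⟨(c, r), hr, h⟩

/-- Smooth approximations of functions on a convex domain. -/
noncomputable def approx (hΩ : IsConvexPolytopeDomain Ω) (N : ℕ) (f : Pt n → ℝ) : Pt n → ℝ :=
  smoothing Ω hΩ.exists_ball.choose.1 hΩ.exists_ball.choose.2 hΩ.exists_ball.choose_spec.1 N f

theorem contDiff_approx (hΩ : IsConvexPolytopeDomain Ω) {f : Pt n → ℝ} (hf : IntegrableOn f Ω) (N : ℕ) :
    ContDiff ℝ ∞ (approx hΩ N f) :=
  contDiff_smoothFull _ _ _ (locallyIntegrable_indicator hΩ.isOpen hf)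

theorem memLp_of_continuousOn_closure (hΩ : IsConvexPolytopeDomain Ω) {f : Pt n → ℝ} (hf : ContinuousOn f (closure Ω)) :
    MemLp f 2 (volume.restrict Ω) :=
  (memLp_of_continuous hΩ.isCompact_closure hf).mono_measure
    (Measure.restrict_mono subset_closure le_rfl)

theorem integrableOn_of_memLp (hΩ : IsConvexPolytopeDomain Ω) {f : Pt n → ℝ} (hf : MemLp f 2 (volume.restrict Ω)) :
    IntegrableOn f Ω :=
  haveI := hΩ.isFiniteMeasure
  integrable_of_memLp_two hf

theorem tendstoL2_approx (hΩ : IsConvexPolytopeDomain Ω) {f : Pt n → ℝ} (hf : MemLp f 2 (volume.restrict Ω)) :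
    TendstoL2 (volume.restrict Ω) (fun N => approx hΩ N f) f := by
  have h1 := tendsto_eLpNorm_smoothing hΩ.isOpen hΩ.convex hΩ.isBounded
    hΩ.exists_ball.choose_spec.1 hΩ.exists_ball.choose_spec.2 hf
  have hm : ∀ N, MemLp (approx hΩ N f) 2 (volume.restrict Ω) := fun N =>
    memLp_of_continuousOn_closure hΩ
      (contDiff_approx hΩ (integrableOn_of_memLp hΩ hf) N).continuous.continuousOn
  refine ⟨hm, hf, ?_⟩
  have h2 := (ENNReal.tendsto_toReal ENNReal.zero_ne_top).comp h1
  have h3 := h2.pow 2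
  simp only [ENNReal.toReal_zero, ne_eq, OfNat.ofNat_ne_zero, not_false_eq_true, zero_pow] at h3
  refine h3.congr fun N => ?_
  exact (integral_sq_eq_eLpNorm ((hm N).sub hf)).symm

theorem tendstoUniformlyOn_approx (hΩ : IsConvexPolytopeDomain Ω) {f : Pt n → ℝ} (hf : ContinuousOn f (closure Ω)) :
    TendstoUniformlyOn (fun N => approx hΩ N f) f atTop (closure Ω) :=
  tendstoUniformlyOn_smoothing hΩ.isOpen hΩ.convex hΩ.isBounded
    hΩ.exists_ball.choose_spec.1 hΩ.exists_ball.choose_spec.2 hf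

theorem tendstoL2_iteratedFDeriv_approx (hΩ : IsConvexPolytopeDomain Ω) {m : ℕ} {α : Fin m → Fin n} {u v : Pt n → ℝ}
    (hu : IntegrableOn u Ω) (huv : HasWeakDeriv Ω α u v) (hv : MemLp v 2 (volume.restrict Ω)) :
    TendstoL2 (volume.restrict Ω)
      (fun N x => iteratedFDeriv ℝ m (approx hΩ N u) x (fun j => unitVec (α j))) v := by
  have h1 := (tendstoL2_approx hΩ hv).mul_unif
    (TendstoUnif.const_seq (a := fun N => factor N ^ m) (b := 1)
      (by simpa using tendsto_factor.pow m))
    (fun N => ⟨|factor N ^ m|, Eventually.of_forall fun _ => le_rfl⟩)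
  simp only [mul_one] at h1
  refine h1.congr fun N => ?_
  rw [EventuallyEq, ae_restrict_iff' hΩ.isOpen.measurableSet]
  refine Eventually.of_forall fun x hx => ?_
  rw [mul_comm]
  exact (iteratedFDeriv_smoothing hΩ.isOpen hΩ.convex hΩ.exists_ball.choose_spec.1
    hΩ.exists_ball.choose_spec.2 hu huv N (subset_closure hx)).symm

theorem tendstoL2_fderiv_approx (hΩ : IsConvexPolytopeDomain Ω) {i : Fin n} {u v : Pt n → ℝ}
    (hu : IntegrableOn u Ω) (huv : HasWeakDeriv Ω ![i] u v) (hv : MemLp v 2 (volume.restrict Ω)) :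
    TendstoL2 (volume.restrict Ω) (fun N x => fderiv ℝ (approx hΩ N u) x (unitVec i)) v := by
  have h1 := tendstoL2_iteratedFDeriv_approx hΩ hu huv hv
  simp_rw [iteratedFDeriv_one_unitVec] at h1
  exact h1

theorem tendstoL2_div_approx (hΩ : IsConvexPolytopeDomain Ω) {V : Pt n → Pt n} {d : Pt n → ℝ}
    (hV : ∀ i, IntegrableOn (fun x => V x i) Ω) (hd : HasWeakDiv Ω V d)
    (hdL : MemLp d 2 (volume.restrict Ω)) :
    TendstoL2 (volume.restrict Ω)
      (fun N x => ∑ i, fderiv ℝ (approx hΩ N (fun x => V x i)) x (unitVec i)) d := by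
  have h1 := (tendstoL2_approx hΩ hdL).mul_unif
    (TendstoUnif.const_seq (a := fun N => factor N) (b := 1) tendsto_factor)
    (fun N => ⟨|factor N|, Eventually.of_forall fun _ => le_rfl⟩)
  simp only [mul_one] at h1
  refine h1.congr fun N => ?_
  rw [EventuallyEq, ae_restrict_iff' hΩ.isOpen.measurableSet]
  refine Eventually.of_forall fun x hx => ?_
  rw [mul_comm]
  exact (div_smoothing hΩ.isOpen hΩ.convex hΩ.exists_ball.choose_spec.1
    hΩ.exists_ball.choose_spec.2 hV hd N (subset_closure hx)).symm

/-- Estimates are proved for smooth functions in terms of `derivSq` and pass to the Sobolev seminorm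
through this limit. -/
theorem tendsto_derivSq_approx (hΩ : IsConvexPolytopeDomain Ω) {m : ℕ} {u : Pt n → ℝ} (hu : MemH Ω m u) :
    Tendsto (fun N => ∫ x in Ω, derivSq m (approx hΩ N u) x) atTop (𝓝 (seminormSq Ω m u)) := by
  have hui := integrableOn_of_memLp hΩ hu.1
  have h1 : ∀ N, ∫ x in Ω, derivSq m (approx hΩ N u) x = ∑ α : Fin m → Fin n,
      ∫ x in Ω, iteratedFDeriv ℝ m (approx hΩ N u) x (fun j => unitVec (α j)) ^ 2 := fun N =>
    integral_finsetSum _ fun α _ => (memLp_of_continuousOn_closure hΩ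
      (contDiff_iteratedFDeriv_apply (contDiff_approx hΩ hui N) m _).continuous.continuousOn).integrable_sq
  simp_rw [h1]
  refine tendsto_finsetSum _ fun α _ => ?_
  obtain ⟨h2, h3⟩ := hu.weakDeriv hΩ.isOpen le_rfl α
  exact (tendstoL2_iteratedFDeriv_approx hΩ hui h2 h3).integral_sq

/-- The gradients of the smoothings are bounded by the essential bounds of the weak derivatives,
uniformly in N. On the convex closure the smoothings thus have a common Lipschitz constant, which
the pointwise limit inherits. -/
theorem exists_lipschitz (hΩ : IsConvexPolytopeDomain Ω) {u : Pt n → ℝ} (hu : MemW1inf Ω u) (hc : ContinuousOn u (closure Ω)) :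
    ∃ L, 0 ≤ L ∧ ∀ x ∈ closure Ω, ∀ y ∈ closure Ω, |u x - u y| ≤ L * ‖x - y‖ := by
  have hui : IntegrableOn u Ω := integrableOn_of_memLp hΩ (memLp_of_continuousOn_closure hΩ hc)
  choose v hv hd using hu.2
  choose M hM0 hM using fun i => MemLp.ae_bdd (hv i)
  have hd1 : ∀ N i, ∀ x ∈ closure Ω, |fderiv ℝ (approx hΩ N u) x (unitVec i)| ≤ M i := by
    intro N i x hx
    have h1 := iteratedFDeriv_smoothing hΩ.isOpen hΩ.convex hΩ.exists_ball.choose_spec.1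
      hΩ.exists_ball.choose_spec.2 hui (hd i) N hx
    rw [iteratedFDeriv_one_unitVec] at h1
    change fderiv ℝ (approx hΩ N u) x (unitVec i) = _ at h1
    rw [h1, abs_mul, pow_one, abs_of_pos (factor_pos N)]
    calc _ ≤ 1 * M i := mul_le_mul (factor_lt_one N).le
          (abs_smoothing_le _ hΩ.isOpen (hM0 i) (hM i) N x) (abs_nonneg _) (by norm_num)
      _ = M i := one_mul _
  set L := Real.sqrt (∑ i, M i ^ 2) with hL
  refine ⟨L, Real.sqrt_nonneg _, fun x hx y hy => ?_⟩
  have h2 : ∀ N, |approx hΩ N u x - approx hΩ N u y| ≤ L * ‖x - y‖ := by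
    intro N
    refine hΩ.convex.closure.norm_image_sub_le_of_norm_fderiv_le (𝕜 := ℝ)
      (fun z _ => (contDiff_approx hΩ hui N).differentiable (by simp) z) (fun z hz => ?_) hy hx
    refine Real.le_sqrt_of_sq_le ((norm_fderiv_sq_le _ _).trans ?_)
    exact Finset.sum_le_sum fun i _ => sq_le_sq.2 ((hd1 N i z hz).trans (le_abs_self _))
  have h3 := tendstoUniformlyOn_approx hΩ hc
  exact le_of_tendsto ((((h3.tendsto_at hx).sub (h3.tendsto_at hy))).abs)
    (Eventually.of_forall h2)

end Approx

end HDG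

/-! ### L² projections and their errors on elements and faces -/

namespace HDG

section Projection

variable {n k : ℕ} {μ : Measure (Pt n)} {u v : Pt n → ℝ}

open Classical in
/-- The `L²(μ)`-projection onto the polynomials of degree at most `k`. -/
noncomputable def l2Proj (k : ℕ) (μ : Measure (Pt n)) (u : Pt n → ℝ) : Pt n → ℝ :=
  if h : (∀ Q, IsPoly k Q → MemLp Q 2 μ) ∧ MemLp u 2 μ then
    (exists_l2_projection μ h.1 h.2).choose else fun _ => 0

theorem isPoly_l2Proj (k : ℕ) (μ : Measure (Pt n)) (u : Pt n → ℝ) : IsPoly k (l2Proj k μ u) := by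
  unfold l2Proj
  split_ifs with h
  · exact (exists_l2_projection μ h.1 h.2).choose_spec.1
  · exact IsPoly.zero

theorem l2Proj_orthogonal (hμ : ∀ Q, IsPoly k Q → MemLp Q 2 μ) (hu : MemLp u 2 μ)
    {Q : Pt n → ℝ} (hQ : IsPoly k Q) : ∫ x, (u x - l2Proj k μ u x) * Q x ∂μ = 0 := by
  have h : l2Proj k μ u = (exists_l2_projection μ hμ hu).choose := by
    unfold l2Proj; rw [dif_pos ⟨hμ, hu⟩]
  rw [h]
  exact (exists_l2_projection μ hμ hu).choose_spec.2 Q hQ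

theorem l2Proj_inner (hμ : ∀ Q, IsPoly k Q → MemLp Q 2 μ) (hu : MemLp u 2 μ)
    {Q : Pt n → ℝ} (hQ : IsPoly k Q) : ∫ x, l2Proj k μ u x * Q x ∂μ = ∫ x, u x * Q x ∂μ := by
  have h := l2Proj_orthogonal hμ hu hQ
  simp_rw [sub_mul] at h
  have i1 : Integrable (fun x => u x * Q x) μ := hu.integrable_mul (hμ Q hQ)
  have i2 : Integrable (fun x => l2Proj k μ u x * Q x) μ :=
    (hμ _ (isPoly_l2Proj k μ u)).integrable_mul (hμ Q hQ)
  rw [integral_sub i1 i2] at h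
  linarith

theorem l2Proj_best (hμ : ∀ Q, IsPoly k Q → MemLp Q 2 μ) (hu : MemLp u 2 μ)
    {Q : Pt n → ℝ} (hQ : IsPoly k Q) :
    ∫ x, (u x - l2Proj k μ u x) ^ 2 ∂μ ≤ ∫ x, (u x - Q x) ^ 2 ∂μ :=
  integral_sq_sub_le_of_orthogonal μ hu (hμ _ (isPoly_l2Proj k μ u)) (hμ Q hQ)
    (l2Proj_orthogonal hμ hu ((isPoly_l2Proj k μ u).sub hQ))

/-- Test the difference e of the projections with itself: ‖e‖² = (u - v, e) ≤ ‖u - v‖ ‖e‖. -/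
theorem l2Proj_stable (hμ : ∀ Q, IsPoly k Q → MemLp Q 2 μ) (hu : MemLp u 2 μ) (hv : MemLp v 2 μ) :
    ∫ x, (l2Proj k μ u x - l2Proj k μ v x) ^ 2 ∂μ ≤ ∫ x, (u x - v x) ^ 2 ∂μ := by
  set e : Pt n → ℝ := fun x => l2Proj k μ u x - l2Proj k μ v x with he
  have hep : IsPoly k e := (isPoly_l2Proj k μ u).sub (isPoly_l2Proj k μ v)
  have heL := hμ e hep
  have hi : ∀ {f : Pt n → ℝ}, MemLp f 2 μ → Integrable (fun x => f x * e x) μ :=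
    fun hf => hf.integrable_mul heL
  have h1 : ∫ x, e x ^ 2 ∂μ = ∫ x, (u x - v x) * e x ∂μ := by
    calc ∫ x, e x ^ 2 ∂μ = ∫ x, (l2Proj k μ u x * e x - l2Proj k μ v x * e x) ∂μ := by
          refine integral_congr_ae (Filter.Eventually.of_forall fun x => ?_)
          simp only [he]; ring
      _ = ∫ x, (u x * e x - v x * e x) ∂μ := by
          rw [integral_sub (hi (hμ _ (isPoly_l2Proj k μ u))) (hi (hμ _ (isPoly_l2Proj k μ v))),
            integral_sub (hi hu) (hi hv), l2Proj_inner hμ hu hep, l2Proj_inner hμ hv hep]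
      _ = _ := by simp_rw [sub_mul]
  have h2 := integral_mul_sq_le (hu.sub hv) heL
  simp only [Pi.sub_apply] at h2
  rw [← h1] at h2
  have h3 : 0 ≤ ∫ x, e x ^ 2 ∂μ := integral_nonneg fun x => sq_nonneg _
  have h4 : 0 ≤ ∫ x, (u x - v x) ^ 2 ∂μ := integral_nonneg fun x => sq_nonneg _
  change ∫ x, e x ^ 2 ∂μ ≤ _
  by_contra hlt
  push Not at hlt
  nlinarith

theorem sum_integral_mul_sq_le {ι : Type*} [Fintype ι] (ν : ι → Measure (Pt n))
    {f g : ι → Pt n → ℝ} (hf : ∀ i, MemLp (f i) 2 (ν i)) (hg : ∀ i, MemLp (g i) 2 (ν i)) :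
    (∑ i, ∫ x, f i x * g i x ∂ν i) ^ 2
      ≤ (∑ i, ∫ x, f i x ^ 2 ∂ν i) * ∑ i, ∫ x, g i x ^ 2 ∂ν i := by
  have h1 : |∑ i, ∫ x, f i x * g i x ∂ν i|
      ≤ ∑ i, Real.sqrt (∫ x, f i x ^ 2 ∂ν i) * Real.sqrt (∫ x, g i x ^ 2 ∂ν i) :=
    (Finset.abs_sum_le_sum_abs _ _).trans
      (Finset.sum_le_sum fun i _ => abs_integral_mul_le (hf i) (hg i))
  rw [← sq_abs]
  refine (pow_le_pow_left₀ (abs_nonneg _) h1 2).trans ?_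
  refine (Finset.sum_mul_sq_le_sq_mul_sq _ _ _).trans (le_of_eq ?_)
  congr 1 <;>
  exact Finset.sum_congr rfl fun i _ => Real.sq_sqrt (integral_nonneg fun x => sq_nonneg _)

end Projection

namespace Triangulation

open Filter Topology

variable {m k : ℕ} {Ω : Set (Pt (m + 1))} {T : Triangulation Ω}

/-- The `L²`-projection onto `W_h`. -/
noncomputable def cellProj (T : Triangulation Ω) (k : ℕ) (u : Pt (m + 1) → ℝ) :
    T.Cell → Pt (m + 1) → ℝ := fun K => l2Proj k (volume.restrict K.carrier) u

/-- The `L²`-projection onto `V_h`. -/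
noncomputable def cellProjVec (T : Triangulation Ω) (k : ℕ) (V : Pt (m + 1) → Pt (m + 1)) :
    T.Cell → Pt (m + 1) → Pt (m + 1) :=
  fun K x => WithLp.toLp 2 fun i => T.cellProj k (fun z => V z i) K x

theorem isPoly_cellProj (u : Pt (m + 1) → ℝ) : T.MemW k (T.cellProj k u) :=
  fun _ => isPoly_l2Proj _ _ _

theorem memV_cellProjVec (V : Pt (m + 1) → Pt (m + 1)) : T.MemV k (T.cellProjVec k V) :=
  fun _ _ => isPoly_l2Proj _ _ _

theorem memLp_isPoly_cell (K : T.Cell) (Q : Pt (m + 1) → ℝ) (hQ : IsPoly k Q) :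
    MemLp Q 2 (volume.restrict K.carrier) := memLp_cell K hQ.continuous.continuousOn

theorem diam_le_meshSize (K : T.Cell) : Metric.diam K.carrier ≤ T.meshSize :=
  le_ciSup (f := fun K : T.Cell => Metric.diam K.carrier) (Set.finite_range _).bddAbove K

theorem meshSize_nonneg (T : Triangulation Ω) : 0 ≤ T.meshSize :=
  Real.iSup_nonneg fun _ => Metric.diam_nonneg

theorem volume_cell_ne_zero {σ : ℝ} (hσ : 0 < σ) (hT : T.ShapeRegular σ) (K : T.Cell) :
    volume K.carrier ≠ 0 := by
  obtain ⟨c, hc⟩ := hT K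
  have h := Metric.measure_ball_pos volume c (mul_pos hσ (diam_pos K))
  exact (h.trans_le (measure_mono (Metric.ball_subset_closedBall.trans hc))).ne'

theorem exists_approx_cell {σ : ℝ} (hσ : 0 < σ) (hT : T.ShapeRegular σ) (K : T.Cell)
    {u : Pt (m + 1) → ℝ} (hu : ContDiff ℝ ∞ u) (k : ℕ) :
    ∃ P, IsPoly k P ∧
      ∫ x in K.carrier, (u x - P x) ^ 2 ≤ (m + 2) * 2 ^ (m + 1) *
        Metric.diam K.carrier ^ (2 * (k + 1)) * ∫ x in K.carrier, derivSq (k + 1) u x ∧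
      Metric.diam K.carrier ^ 2 * ∫ x in K.carrier, ‖fderiv ℝ (fun x => u x - P x) x‖ ^ 2
        ≤ (m + 2) * 2 ^ (m + 1) * Metric.diam K.carrier ^ (2 * (k + 1)) *
          ∫ x in K.carrier, derivSq (k + 1) u x := by
  have h := exists_isPoly_approx hu k (isCompact_cell K) (convex_convexHull ℝ _)
    (volume_cell_ne_zero hσ hT K) Metric.diam_nonneg fun x hx y hy => by
      rw [← dist_eq_norm]
      exact Metric.dist_le_diam_of_mem (isCompact_cell K).isBounded hx hy
  push_cast at h
  norm_num [add_assoc] at h ⊢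
  exact h

theorem integral_sub_cellProj_le {σ : ℝ} (hσ : 0 < σ) (hT : T.ShapeRegular σ) (K : T.Cell)
    {u : Pt (m + 1) → ℝ} (hu : ContDiff ℝ ∞ u) (k : ℕ) :
    ∫ x in K.carrier, (u x - T.cellProj k u K x) ^ 2 ≤ (m + 2) * 2 ^ (m + 1) *
        Metric.diam K.carrier ^ (2 * (k + 1)) * ∫ x in K.carrier, derivSq (k + 1) u x := by
  obtain ⟨P, hP, h, -⟩ := exists_approx_cell hσ hT K hu k
  exact (l2Proj_best (memLp_isPoly_cell K) (memLp_cell K hu.continuous.continuousOn) hP).trans h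

/-- The trace inequality requires the gradient of u - Q, where Q is the projection. A Taylor
approximation P mediates: the gradient of u - P is controlled by Bramble–Hilbert, that of the
polynomial P - Q by the inverse inequality. The factor h_K on the left of the trace inequality costs
one power in the squared error. -/
theorem exists_trace_sub_cellProj_le (m k : ℕ) {σ : ℝ} (hσ : 0 < σ) : ∃ C : ℝ, 0 < C ∧
    ∀ {Ω : Set (Pt (m + 1))} (T : Triangulation Ω), T.ShapeRegular σ → ∀ (F : T.HalfFace)
      (u : Pt (m + 1) → ℝ), ContDiff ℝ ∞ u →
      ∫ x, (u x - T.cellProj k u F.cell x) ^ 2 ∂(faceMeasure F)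
        ≤ C * T.meshSize ^ (2 * k + 1) * ∫ x in F.cell.carrier, derivSq (k + 1) u x := by
  obtain ⟨C, hC, H⟩ := exists_inverse m k hσ
  set A : ℝ := (m + 2) * 2 ^ (m + 1) with hA
  have hA0 : 0 < A := by positivity
  -- The summand m + 2 comes from the values in the trace inequality, 2 from the gradient of u - P,
  -- and 8 * C from the gradient of P - Q, whose squared norm is at most four times the
  -- Bramble–Hilbert bound.
  refine ⟨(2 * σ)⁻¹ * ((m + 2) + 2 + 8 * C) * A, by positivity, fun T hT F u hu => ?_⟩
  set K := F.cell with hK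
  set d := Metric.diam K.carrier with hd
  have hd0 : 0 < d := diam_pos K
  set I := ∫ x in K.carrier, derivSq (k + 1) u x with hI
  have hI0 : 0 ≤ I := integral_nonneg fun x => derivSq_nonneg _ _ _
  obtain ⟨P, hP, h1, h2⟩ := exists_approx_cell hσ hT K hu k
  rw [← hA, ← hd, ← hI] at h1 h2
  set Q := T.cellProj k u K with hQ
  have hQp : IsPoly k Q := isPoly_cellProj u K
  have h3 : ∫ x in K.carrier, (u x - Q x) ^ 2 ≤ A * d ^ (2 * (k + 1)) * I :=
    integral_sub_cellProj_le hσ hT K hu k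
  have huP : ContDiff ℝ ∞ (fun x => u x - P x) := hu.sub hP.contDiff
  have huQ : ContDiff ℝ ∞ (fun x => u x - Q x) := hu.sub hQp.contDiff
  have hPQ : IsPoly k (fun x => P x - Q x) := hP.sub hQp
  have h4 : ∫ x in K.carrier, (P x - Q x) ^ 2 ≤ 4 * (A * d ^ (2 * (k + 1)) * I) := by
    have h5 := integral_add_sq_le (μ := volume.restrict K.carrier) (f := fun x => u x - Q x)
      (g := fun x => -(u x - P x))
      (memLp_cell K huQ.continuous.continuousOn) (memLp_cell K huP.continuous.neg.continuousOn)
    simp only [even_two, Even.neg_pow] at h5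
    have h6 : ∀ x, u x - Q x + -(u x - P x) = P x - Q x := fun x => by ring
    simp only [h6] at h5
    linarith
  have h5 := H T hT K _ hPQ
  have hg : ∀ {f : Pt (m + 1) → ℝ}, ContDiff ℝ ∞ f → IntegrableOn (fun x => ‖fderiv ℝ f x‖ ^ 2)
      K.carrier := fun hf =>
    integrableOn_cell K ((hf.continuous_fderiv (by simp)).norm.pow 2).continuousOn
  have h6 : ∫ x in K.carrier, ‖fderiv ℝ (fun x => u x - Q x) x‖ ^ 2
      ≤ 2 * (∫ x in K.carrier, ‖fderiv ℝ (fun x => u x - P x) x‖ ^ 2)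
        + 2 * ∫ x in K.carrier, ‖fderiv ℝ (fun x => P x - Q x) x‖ ^ 2 := by
    rw [← integral_const_mul, ← integral_const_mul, ← integral_add ((hg huP).const_mul 2)
      ((hg hPQ.contDiff).const_mul 2)]
    refine integral_mono (hg huQ) (((hg huP).const_mul 2).add ((hg hPQ.contDiff).const_mul 2))
      fun x => ?_
    have h7 : fderiv ℝ (fun x => u x - Q x) x
        = fderiv ℝ (fun x => u x - P x) x + fderiv ℝ (fun x => P x - Q x) x := by
      rw [← fderiv_fun_add (huP.differentiable (by simp) x)
        (hPQ.contDiff.differentiable (by simp) x)]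
      congr 1
      ext z; ring
    rw [h7]
    have h8 := norm_add_le (fderiv ℝ (fun x => u x - P x) x) (fderiv ℝ (fun x => P x - Q x) x)
    have h9 := pow_le_pow_left₀ (norm_nonneg _) h8 2
    simp only
    nlinarith [sq_nonneg (‖fderiv ℝ (fun x => u x - P x) x‖ - ‖fderiv ℝ (fun x => P x - Q x) x‖)]
  have h7 := trace_inequality hσ hT F (φ := fun x => u x - Q x) (huQ.of_le (by simp))
  rw [← hK, ← hd] at h7
  have h8 : d ^ 2 * ∫ x in K.carrier, ‖fderiv ℝ (fun x => u x - Q x) x‖ ^ 2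
      ≤ (2 + 8 * C) * (A * d ^ (2 * (k + 1)) * I) := by
    have := mul_le_mul_of_nonneg_left h6 (sq_nonneg d)
    have h9 := mul_le_mul_of_nonneg_left h4 hC.le
    nlinarith
  have h9 : 2 * σ * d * ∫ x, (u x - Q x) ^ 2 ∂(faceMeasure F)
      ≤ ((m + 2) + 2 + 8 * C) * (A * d ^ (2 * (k + 1)) * I) := by
    have := mul_le_mul_of_nonneg_left h3 (show (0 : ℝ) ≤ m + 2 by positivity)
    nlinarith
  have h10 : ∫ x, (u x - Q x) ^ 2 ∂(faceMeasure F)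
      ≤ (2 * σ)⁻¹ * ((m + 2) + 2 + 8 * C) * A * d ^ (2 * k + 1) * I := by
    have h11 : (2 * σ * d) * ((2 * σ)⁻¹ * ((m + 2) + 2 + 8 * C) * A * d ^ (2 * k + 1) * I)
        = ((m + 2) + 2 + 8 * C) * (A * d ^ (2 * (k + 1)) * I) := by
      field_simp
      ring
    rw [← h11] at h9
    exact le_of_mul_le_mul_left h9 (by positivity)
  refine h10.trans ?_
  have h12 : d ^ (2 * k + 1) ≤ T.meshSize ^ (2 * k + 1) :=
    pow_le_pow_left₀ hd0.le (diam_le_meshSize K) _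
  gcongr

theorem sum_halfFace_cell (g : T.Cell → ℝ) : ∑ F : T.HalfFace, g F.cell = (m + 2) * ∑ K, g K := by
  rw [sum_halfFace, Finset.mul_sum]
  refine Finset.sum_congr rfl fun K _ => ?_
  simp only [oppFace_cell, Finset.sum_const, Finset.card_univ, Fintype.card_coe, nsmul_eq_mul]
  rw [K.verts_card]
  push_cast; ring

theorem sum_integral_derivSq (hΩ : IsConvexPolytopeDomain Ω) {u : Pt (m + 1) → ℝ}
    (hu : ContDiff ℝ ∞ u) (j : ℕ) :
    ∑ K : T.Cell, ∫ x in K.carrier, derivSq j u x = ∫ x in Ω, derivSq j u x := by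
  refine sum_integral_cell hΩ ?_
  exact ((continuous_derivSq hu j).continuousOn.integrableOn_compact hΩ.isCompact_closure).mono_set
    subset_closure

/-- The approximation property of the projection onto `W_h`. -/
theorem sum_integral_sub_cellProj_le (hΩ : IsConvexPolytopeDomain Ω) {σ : ℝ} (hσ : 0 < σ)
    (hT : T.ShapeRegular σ) {u : Pt (m + 1) → ℝ} (hu : MemH Ω (k + 1) u) :
    ∑ K : T.Cell, ∫ x in K.carrier, (u x - T.cellProj k u K x) ^ 2
      ≤ 2 * ((m + 2) * 2 ^ (m + 1)) * T.meshSize ^ (2 * (k + 1)) * seminormSq Ω (k + 1) u := by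
  set A : ℝ := (m + 2) * 2 ^ (m + 1) with hA
  have hui := integrableOn_of_memLp hΩ hu.1
  have happ := tendstoL2_approx hΩ hu.1
  have huK : ∀ K : T.Cell, MemLp u 2 (volume.restrict K.carrier) := fun K =>
    hu.1.mono_measure (restrict_cell_le hΩ K)
  have hlim : Tendsto (fun N => 2 * (∑ K : T.Cell, ∫ x in K.carrier, (approx hΩ N u x - u x) ^ 2)
      + 2 * (A * T.meshSize ^ (2 * (k + 1)) * ∫ x in Ω, derivSq (k + 1) (approx hΩ N u) x)) atTop
      (𝓝 (2 * (∑ K : T.Cell, 0)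
        + 2 * (A * T.meshSize ^ (2 * (k + 1)) * seminormSq Ω (k + 1) u))) := by
    refine Tendsto.add (Tendsto.const_mul 2 (tendsto_finsetSum _ fun K _ => ?_))
      (((tendsto_derivSq_approx hΩ hu).const_mul _).const_mul 2)
    exact (happ.mono (restrict_cell_le hΩ K)).tendsto
  rw [Finset.sum_const_zero, mul_zero, zero_add] at hlim
  refine (ge_of_tendsto hlim (Eventually.of_forall fun N => ?_)).trans (le_of_eq (by ring))
  have hN := contDiff_approx hΩ hui N
  rw [← sum_integral_derivSq (T := T) hΩ hN (k + 1), Finset.mul_sum, Finset.mul_sum, Finset.mul_sum,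
    ← Finset.sum_add_distrib]
  refine Finset.sum_le_sum fun K _ => ?_
  have hNK : MemLp (approx hΩ N u) 2 (volume.restrict K.carrier) :=
    memLp_cell K hN.continuous.continuousOn
  -- The projection of the smooth approximation is a competitor in the best approximation of u
  -- itself.
  have h1 := l2Proj_best (memLp_isPoly_cell K) (huK K) (isPoly_cellProj (T := T) (k := k) (approx hΩ N u) K)
  refine h1.trans ?_
  have h2 := integral_add_sq_le ((huK K).sub hNK) (hNK.sub
    (memLp_isPoly_cell K _ (isPoly_cellProj (T := T) (k := k) (approx hΩ N u) K)))
  simp only [Pi.sub_apply, sub_add_sub_cancel] at h2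
  refine h2.trans (add_le_add (le_of_eq ?_) ?_)
  · congr 2; ext x; ring
  · refine mul_le_mul_of_nonneg_left ((integral_sub_cellProj_le hσ hT K hN k).trans ?_) (by norm_num)
    refine mul_le_mul_of_nonneg_right ?_ (integral_nonneg fun x => derivSq_nonneg _ _ _)
    gcongr
    exact diam_le_meshSize K

theorem sum_trace_sub_cellProj_smooth_le (hΩ : IsConvexPolytopeDomain Ω) {C : ℝ}
    (H : ∀ (F : T.HalfFace) (u : Pt (m + 1) → ℝ), ContDiff ℝ ∞ u →
      ∫ x, (u x - T.cellProj k u F.cell x) ^ 2 ∂(faceMeasure F)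
        ≤ C * T.meshSize ^ (2 * k + 1) * ∫ x in F.cell.carrier, derivSq (k + 1) u x)
    {u : Pt (m + 1) → ℝ} (hu : ContDiff ℝ ∞ u) :
    ∑ F : T.HalfFace, ∫ x, (u x - T.cellProj k u F.cell x) ^ 2 ∂(faceMeasure F)
      ≤ (m + 2) * C * T.meshSize ^ (2 * k + 1) * ∫ x in Ω, derivSq (k + 1) u x := by
  refine (Finset.sum_le_sum fun F _ => H F u hu).trans (le_of_eq ?_)
  rw [sum_halfFace_cell fun K => C * T.meshSize ^ (2 * k + 1) *
    ∫ x in K.carrier, derivSq (k + 1) u x, ← Finset.mul_sum,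
    sum_integral_derivSq hΩ hu]
  ring

/-- On a fixed mesh the discrete trace inequality turns the L² stability of the projection into
convergence of traces, so u itself needs no trace. -/
theorem tendsto_trace_cellProj (hΩ : IsConvexPolytopeDomain Ω) {C : ℝ}
    (H : ∀ (F : T.HalfFace) (u : Pt (m + 1) → ℝ), IsPoly k u →
      Metric.diam F.cell.carrier * ∫ x, u x ^ 2 ∂(faceMeasure F)
        ≤ C * ∫ x in F.cell.carrier, u x ^ 2)
    {u : Pt (m + 1) → ℝ} (hu : MemLp u 2 (volume.restrict Ω)) (F : T.HalfFace) :
    Tendsto (fun N => ∫ x, (T.cellProj k (approx hΩ N u) F.cell x - T.cellProj k u F.cell x) ^ 2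
      ∂(faceMeasure F)) atTop (𝓝 0) := by
  have hd := diam_pos F.cell
  have happ := (tendstoL2_approx hΩ hu).mono (restrict_cell_le hΩ F.cell)
  have h0 := happ.tendsto.const_mul ((Metric.diam F.cell.carrier)⁻¹ * |C|)
  rw [mul_zero] at h0
  refine squeeze_zero (fun N => integral_nonneg fun x => sq_nonneg _) (fun N => ?_) h0
  have h1 := H F _ ((isPoly_cellProj (T := T) (k := k) (approx hΩ N u) F.cell).sub
    (isPoly_cellProj (T := T) (k := k) u F.cell))
  have h2 := l2Proj_stable (k := k) (memLp_isPoly_cell F.cell) (happ.mem N) happ.mem_lim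
  rw [mul_assoc, ← inv_mul_le_iff₀ (by positivity), inv_inv]
  refine h1.trans ((mul_le_mul_of_nonneg_right (le_abs_self C)
    (integral_nonneg fun x => sq_nonneg _)).trans ?_)
  exact mul_le_mul_of_nonneg_left h2 (abs_nonneg C)

theorem tendstoL2_trace (hΩ : IsConvexPolytopeDomain Ω) {u : Pt (m + 1) → ℝ}
    (hu : ContinuousOn u (closure Ω)) (F : T.HalfFace) :
    TendstoL2 (faceMeasure F) (fun N => approx hΩ N u) u := by
  have hui := integrableOn_of_memLp hΩ (memLp_of_continuousOn_closure hΩ hu)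
  have hc := fun N => (contDiff_approx hΩ hui N).continuous.continuousOn (s := F.face.carrier)
  refine TendstoUnif.toL2 ?_ fun N => ae_bdd_of_continuousOn (isCompact_face F.face) (hc N)
  exact TendstoUnif.of_tendstoUniformlyOn (isCompact_face F.face) hc
    (hu.mono (face_subset_closure F)) ((tendstoUniformlyOn_approx hΩ hu).mono (face_subset_closure F))

/-- The approximation property of the traces of the projection onto `W_h`. -/
theorem exists_sum_trace_sub_cellProj_le (m k : ℕ) {σ : ℝ} (hσ : 0 < σ) : ∃ C : ℝ, 0 < C ∧
    ∀ {Ω : Set (Pt (m + 1))} (_ : IsConvexPolytopeDomain Ω) (T : Triangulation Ω),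
      T.ShapeRegular σ → ∀ u : Pt (m + 1) → ℝ, MemH Ω (k + 1) u → ContinuousOn u (closure Ω) →
      ∑ F : T.HalfFace, ∫ x, (u x - T.cellProj k u F.cell x) ^ 2 ∂(faceMeasure F)
        ≤ C * T.meshSize ^ (2 * k + 1) * seminormSq Ω (k + 1) u := by
  obtain ⟨C, hC, H⟩ := exists_trace_sub_cellProj_le m k hσ
  obtain ⟨C', hC', H'⟩ := exists_discrete_trace m k hσ
  refine ⟨4 * ((m + 2) * C), by positivity, fun {Ω} hΩ T hT u hu huc => ?_⟩
  have hui := integrableOn_of_memLp hΩ hu.1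
  have hlim : Tendsto (fun N =>
      2 * (∑ F : T.HalfFace, ∫ x, (approx hΩ N u x - u x) ^ 2 ∂(faceMeasure F))
      + 2 * (2 * ((m + 2) * C * T.meshSize ^ (2 * k + 1) *
        ∫ x in Ω, derivSq (k + 1) (approx hΩ N u) x)
      + 2 * ∑ F : T.HalfFace, ∫ x, (T.cellProj k (approx hΩ N u) F.cell x
        - T.cellProj k u F.cell x) ^ 2 ∂(faceMeasure F))) atTop
      (𝓝 (2 * (∑ F : T.HalfFace, 0) + 2 * (2 * ((m + 2) * C * T.meshSize ^ (2 * k + 1) *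
        seminormSq Ω (k + 1) u) + 2 * ∑ F : T.HalfFace, 0))) := by
    refine Tendsto.add (Tendsto.const_mul 2 (tendsto_finsetSum _ fun F _ =>
      (tendstoL2_trace hΩ huc F).tendsto)) (Tendsto.const_mul 2 (Tendsto.add
      (((tendsto_derivSq_approx hΩ hu).const_mul _).const_mul 2)
      (Tendsto.const_mul 2 (tendsto_finsetSum _ fun F _ =>
        tendsto_trace_cellProj hΩ (H' T hT) hu.1 F))))
  simp only [Finset.sum_const_zero, mul_zero, zero_add, add_zero] at hlim
  refine (ge_of_tendsto hlim (Eventually.of_forall fun N => ?_)).trans (le_of_eq (by ring))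
  have hN := contDiff_approx hΩ hui N
  have h0 := sum_trace_sub_cellProj_smooth_le hΩ (fun F u hu => H T hT F u hu) hN
  -- Split u - Πu into u - u_N, u_N - Πu_N and Πu_N - Πu. The outer two vanish in the limit, the
  -- first one because u is continuous up to the boundary.
  have h1 : ∀ F : T.HalfFace, ∫ x, (u x - T.cellProj k u F.cell x) ^ 2 ∂(faceMeasure F)
      ≤ 2 * (∫ x, (approx hΩ N u x - u x) ^ 2 ∂(faceMeasure F))
        + 2 * (2 * (∫ x, (approx hΩ N u x - T.cellProj k (approx hΩ N u) F.cell x) ^ 2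
            ∂(faceMeasure F))
          + 2 * ∫ x, (T.cellProj k (approx hΩ N u) F.cell x - T.cellProj k u F.cell x) ^ 2
            ∂(faceMeasure F)) := by
    intro F
    have m1 : MemLp u 2 (faceMeasure F) := (tendstoL2_trace hΩ huc F).mem_lim
    have m2 : MemLp (approx hΩ N u) 2 (faceMeasure F) := (tendstoL2_trace hΩ huc F).mem N
    have m3 : MemLp (T.cellProj k (approx hΩ N u) F.cell) 2 (faceMeasure F) :=
      memLp_face F (isPoly_cellProj _ F.cell).continuous.continuousOn 2
    have m4 : MemLp (T.cellProj k u F.cell) 2 (faceMeasure F) :=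
      memLp_face F (isPoly_cellProj _ F.cell).continuous.continuousOn 2
    have h2 := integral_add_sq_le (m1.sub m2) (m2.sub m4)
    have h3 := integral_add_sq_le (m2.sub m3) (m3.sub m4)
    simp only [Pi.sub_apply, sub_add_sub_cancel] at h2 h3
    have h4 : ∫ x, (u x - approx hΩ N u x) ^ 2 ∂(faceMeasure F)
        = ∫ x, (approx hΩ N u x - u x) ^ 2 ∂(faceMeasure F) := by
      congr 1; ext x; ring
    rw [h4] at h2
    linarith
  refine (Finset.sum_le_sum fun F _ => h1 F).trans ?_
  simp only [Finset.sum_add_distrib, ← Finset.mul_sum]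
  linarith

end Triangulation

end HDG

/-! ### Integration by parts on elements and consistency of the normal flux -/

namespace HDG

namespace Triangulation

open Filter Topology

variable {m k : ℕ} {Ω : Set (Pt (m + 1))} {T : Triangulation Ω}

/-- The normal fluxes of a continuous vector field from the two sides of a face cancel. -/
theorem sum_integral_normal_mul_eq_zero (hΩ : IsConvexPolytopeDomain Ω)
    {ψ : Pt (m + 1) → Pt (m + 1)} (hψ : ContinuousOn ψ (closure Ω))
    {μ : T.Face → Pt (m + 1) → ℝ} (hμ : T.MemLambda0 k μ) :
    ∑ F : T.HalfFace, ∫ x, ⟪ψ x, F.normal⟫ * μ F.face x ∂(faceMeasure F) = 0 := by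
  classical
  haveI := T.finite_face
  letI : Fintype T.Face := Fintype.ofFinite _
  rw [← Finset.sum_fiberwise Finset.univ (fun F : T.HalfFace => F.face)]
  refine Finset.sum_eq_zero fun e _ => ?_
  -- On boundary faces μ vanishes; on the other faces the normals of the adjacent elements add up to
  -- zero.
  by_cases he : e.carrier ⊆ frontier Ω
  · refine Finset.sum_eq_zero fun F hF => ?_
    have hFe : F.face = e := (Finset.mem_filter.1 hF).2
    refine integral_eq_zero_of_ae ?_
    rw [EventuallyEq, ae_restrict_iff' (isCompact_face F.face).measurableSet]
    refine Eventually.of_forall fun x hx => ?_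
    rw [hFe] at hx ⊢
    simp [hμ.2 e he x hx]
  · have h1 : ∀ F ∈ (Finset.univ : Finset T.HalfFace).filter (fun F => F.face = e),
        ∫ x, ⟪ψ x, F.normal⟫ * μ F.face x ∂(faceMeasure F)
          = ∫ x in e.carrier, ⟪ψ x, F.normal⟫ * μ e x ∂(μHE[m] : Measure (Pt (m + 1))) := by
      intro F hF
      have hFe : F.face = e := (Finset.mem_filter.1 hF).2
      rw [faceMeasure, hFe]
    rw [Finset.sum_congr rfl h1, ← integral_finsetSum]
    · have h2 : ∀ x, ∑ F : T.HalfFace with F.face = e, ⟪ψ x, F.normal⟫ * μ e x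
          = ⟪ψ x, ∑ F : T.HalfFace with F.face = e, F.normal⟫ * μ e x := fun x => by
        rw [inner_sum, Finset.sum_mul]
      simp_rw [h2, sum_normal_eq_zero hΩ e he]
      simp
    · intro F hF
      have hFe : F.face = e := (Finset.mem_filter.1 hF).2
      have h3 := integrable_face F (u := fun x => ⟪ψ x, F.normal⟫ * μ F.face x)
        (((hψ.mono (face_subset_closure F)).inner continuousOn_const).mul
          (hμ.1 F.face).continuous.continuousOn)
      rwa [faceMeasure, hFe] at h3

theorem inner_eq_sum (a b : Pt (m + 1)) : ⟪a, b⟫ = ∑ i, a i * b i := by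
  simp [PiLp.inner_apply, mul_comm]

theorem integral_cell_div (K : T.Cell) {V : Fin (m + 1) → Pt (m + 1) → ℝ}
    (hV : ∀ i, ContDiff ℝ ∞ (V i)) :
    ∫ x in K.carrier, ∑ i, fderiv ℝ (V i) x (unitVec i)
      = ∑ v : {v // v ∈ K.verts}, ∫ x, (∑ i, V i x * (oppFace K v).normal i)
        ∂(faceMeasure (oppFace K v)) := by
  have hc : ∀ i, Continuous fun x => fderiv ℝ (V i) x (unitVec i) := fun i =>
    ((hV i).continuous_fderiv (by simp)).clm_apply continuous_const
  rw [integral_finsetSum _ fun i _ => integrableOn_cell K (hc i).continuousOn]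
  have h1 : ∀ i, ∫ x in K.carrier, fderiv ℝ (V i) x (unitVec i)
      = ∑ v : {v // v ∈ K.verts}, ∫ x, V i x * (oppFace K v).normal i
        ∂(faceMeasure (oppFace K v)) := by
    intro i
    rw [integral_cell_fderiv K ((hV i).of_le (by simp))]
    refine Finset.sum_congr rfl fun v _ => ?_
    rw [integral_mul_const, mul_comm]
    congr 1
    simp [unitVec, EuclideanSpace.inner_single_left]
  simp_rw [h1]
  rw [Finset.sum_comm]
  refine Finset.sum_congr rfl fun v _ => ?_
  rw [integral_finsetSum]
  exact fun i _ => integrable_face _ ((hV i).continuous.mul continuous_const).continuousOn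

theorem integral_cell_div_mul (K : T.Cell) {V : Fin (m + 1) → Pt (m + 1) → ℝ}
    (hV : ∀ i, ContDiff ℝ ∞ (V i)) {w : Pt (m + 1) → ℝ} (hw : ContDiff ℝ ∞ w) :
    (∫ x in K.carrier, (∑ i, fderiv ℝ (V i) x (unitVec i)) * w x)
      + ∑ i, ∫ x in K.carrier, V i x * fderiv ℝ w x (unitVec i)
      = ∑ v : {v // v ∈ K.verts}, ∑ i, ∫ x, V i x * ((oppFace K v).normal i * w x)
        ∂(faceMeasure (oppFace K v)) := by
  have hc : ∀ i, Continuous fun x => fderiv ℝ (V i) x (unitVec i) := fun i =>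
    ((hV i).continuous_fderiv (by simp)).clm_apply continuous_const
  have hwc : ∀ i, Continuous fun x => fderiv ℝ w x (unitVec i) := fun i =>
    (hw.continuous_fderiv (by simp)).clm_apply continuous_const
  have h1 := integral_cell_div K (V := fun i x => V i x * w x) fun i => (hV i).mul hw
  have h2 : ∀ x, ∑ i, fderiv ℝ (fun x => V i x * w x) x (unitVec i)
      = (∑ i, fderiv ℝ (V i) x (unitVec i)) * w x + ∑ i, V i x * fderiv ℝ w x (unitVec i) := by
    intro x
    rw [Finset.sum_mul, ← Finset.sum_add_distrib]
    refine Finset.sum_congr rfl fun i _ => ?_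
    rw [fderiv_fun_mul ((hV i).differentiable (by simp) x) (hw.differentiable (by simp) x)]
    simp only [add_apply, smul_apply, smul_eq_mul]
    ring
  simp_rw [h2] at h1
  rw [integral_add, integral_finsetSum] at h1
  · rw [h1]
    refine Finset.sum_congr rfl fun v _ => ?_
    rw [integral_finsetSum]
    · refine Finset.sum_congr rfl fun i _ => ?_
      congr 1; ext x; ring
    · exact fun i _ => integrable_face _
        (((hV i).continuous.mul hw.continuous).mul continuous_const).continuousOn
  · exact fun i _ => integrableOn_cell K ((hV i).continuous.mul (hwc i)).continuousOn
  · exact integrableOn_cell K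
      ((continuous_finsetSum _ fun i _ => hc i).mul hw.continuous).continuousOn
  · exact integrableOn_cell K
      (continuous_finsetSum _ fun i _ => (hV i).continuous.mul (hwc i)).continuousOn

/-- Every term pairs an L²-convergent sequence with a fixed function, so the identity for smooth
fields survives the limit. -/
theorem integral_cell_div_mul_of_tendsto (K : T.Cell) {V : ℕ → Fin (m + 1) → Pt (m + 1) → ℝ}
    (hV : ∀ N i, ContDiff ℝ ∞ (V N i)) {W : Fin (m + 1) → Pt (m + 1) → ℝ} {d : Pt (m + 1) → ℝ}
    (hd : TendstoL2 (volume.restrict K.carrier)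
      (fun N x => ∑ i, fderiv ℝ (V N i) x (unitVec i)) d)
    (hK : ∀ i, TendstoL2 (volume.restrict K.carrier) (fun N => V N i) (W i))
    (hF : ∀ v i, TendstoL2 (faceMeasure (oppFace K v)) (fun N => V N i) (W i))
    {w : Pt (m + 1) → ℝ} (hw : ContDiff ℝ ∞ w) :
    (∫ x in K.carrier, d x * w x) + ∑ i, ∫ x in K.carrier, W i x * fderiv ℝ w x (unitVec i)
      = ∑ v : {v // v ∈ K.verts}, ∑ i, ∫ x, W i x * ((oppFace K v).normal i * w x)
        ∂(faceMeasure (oppFace K v)) := by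
  have hwc : ∀ i, Continuous fun x => fderiv ℝ w x (unitVec i) := fun i =>
    (hw.continuous_fderiv (by simp)).clm_apply continuous_const
  have h1 := (hd.integral_mul (memLp_cell K hw.continuous.continuousOn)).add
    (tendsto_finsetSum Finset.univ fun i _ =>
      (hK i).integral_mul (memLp_cell K (hwc i).continuousOn))
  have h2 := tendsto_finsetSum (Finset.univ : Finset {v // v ∈ K.verts}) fun v _ =>
    tendsto_finsetSum Finset.univ fun i _ => (hF v i).integral_mul
      (h := fun x => (oppFace K v).normal i * w x)
      (memLp_face (oppFace K v) (continuous_const.mul hw.continuous).continuousOn 2)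
  refine tendsto_nhds_unique h1 (h2.congr fun N => ?_)
  exact (integral_cell_div_mul K (hV N) hw).symm

theorem tendstoUnif_approx (hΩ : IsConvexPolytopeDomain Ω) {u : Pt (m + 1) → ℝ}
    (hu : ContinuousOn u (closure Ω)) (ν : Measure (Pt (m + 1))) {S : Set (Pt (m + 1))}
    (hS : IsCompact S) (hSΩ : S ⊆ closure Ω) :
    TendstoUnif (ν.restrict S) (fun N => approx hΩ N u) u ∧
      ∀ N, ∃ M, ∀ᵐ x ∂ν.restrict S, |approx hΩ N u x| ≤ M := by
  have hui := integrableOn_of_memLp hΩ (memLp_of_continuousOn_closure hΩ hu)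
  have hc := fun N => (contDiff_approx hΩ hui N).continuous.continuousOn (s := S)
  exact ⟨TendstoUnif.of_tendstoUniformlyOn hS hc (hu.mono hSΩ)
    ((tendstoUniformlyOn_approx hΩ hu).mono hSΩ), fun N => ae_bdd_of_continuousOn hS (hc N)⟩

theorem tendstoL2_approx_cell (hΩ : IsConvexPolytopeDomain Ω) {u : Pt (m + 1) → ℝ}
    (hu : MemLp u 2 (volume.restrict Ω)) (K : T.Cell) :
    TendstoL2 (volume.restrict K.carrier) (fun N => approx hΩ N u) u :=
  (tendstoL2_approx hΩ hu).mono (restrict_cell_le hΩ K)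

/-- Integration by parts on an element for a field with a weak divergence. -/
theorem integral_cell_weakDiv (hΩ : IsConvexPolytopeDomain Ω) (K : T.Cell)
    {V : Pt (m + 1) → Pt (m + 1)} (hV : ContinuousOn V (closure Ω)) {d : Pt (m + 1) → ℝ}
    (hd : HasWeakDiv Ω V d) (hdL : MemLp d 2 (volume.restrict Ω))
    {w : Pt (m + 1) → ℝ} (hw : ContDiff ℝ ∞ w) :
    (∫ x in K.carrier, d x * w x) + ∑ i, ∫ x in K.carrier, V x i * fderiv ℝ w x (unitVec i)
      = ∑ v : {v // v ∈ K.verts}, ∑ i, ∫ x, V x i * ((oppFace K v).normal i * w x)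
        ∂(faceMeasure (oppFace K v)) := by
  have hVi : ∀ i, ContinuousOn (fun x => V x i) (closure Ω) := fun i =>
    (EuclideanSpace.proj i : Pt (m + 1) →L[ℝ] ℝ).continuous.comp_continuousOn hV
  have hVI := fun i => integrableOn_of_memLp hΩ (memLp_of_continuousOn_closure hΩ (hVi i))
  exact integral_cell_div_mul_of_tendsto K (V := fun N i => approx hΩ N (fun x => V x i))
    (fun N i => contDiff_approx hΩ (hVI i) N)
    ((tendstoL2_div_approx hΩ hVI hd hdL).mono (restrict_cell_le hΩ K))
    (fun i => tendstoL2_approx_cell hΩ (memLp_of_continuousOn_closure hΩ (hVi i)) K)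
    (fun v i => tendstoL2_trace hΩ (hVi i) (oppFace K v)) hw

theorem bdd_isPoly (ν : Measure (Pt (m + 1))) {S : Set (Pt (m + 1))} (hS : IsCompact S)
    {r : Pt (m + 1) → ℝ} (hr : Continuous r) :
    TendstoUnif (ν.restrict S) (fun _ => r) r ∧ ∀ _N : ℕ, ∃ M, ∀ᵐ x ∂ν.restrict S, |r x| ≤ M := by
  obtain ⟨M, hM⟩ := ae_bdd_of_continuousOn (μ := ν) hS hr.continuousOn
  exact ⟨TendstoUnif.const hr.aestronglyMeasurable hM, fun _ => ⟨M, hM⟩⟩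

/-- Integration by parts on an element for a function with a weak gradient. -/
theorem integral_cell_weakGradient (hΩ : IsConvexPolytopeDomain Ω) (K : T.Cell)
    {y : Pt (m + 1) → ℝ} (hy : ContinuousOn y (closure Ω)) {G : Pt (m + 1) → Pt (m + 1)}
    (hG : HasWeakGradient Ω y G) (hGL : ∀ i, MemLp (fun x => G x i) 2 (volume.restrict Ω))
    {r : Fin (m + 1) → Pt (m + 1) → ℝ} (hr : ∀ i, ContDiff ℝ ∞ (r i)) :
    ∫ x in K.carrier, ((∑ i, fderiv ℝ (r i) x (unitVec i)) * y x + ∑ i, G x i * r i x)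
      = ∑ v : {v // v ∈ K.verts}, ∑ i, ∫ x, (y x * r i x) * (oppFace K v).normal i
        ∂(faceMeasure (oppFace K v)) := by
  have hyL := memLp_of_continuousOn_closure hΩ hy
  have hyi := integrableOn_of_memLp hΩ hyL
  have hyN := fun N => contDiff_approx hΩ hyi N
  have hrc : ∀ i, Continuous fun x => fderiv ℝ (r i) x (unitVec i) := fun i =>
    ((hr i).continuous_fderiv (by simp)).clm_apply continuous_const
  have hK := fun {r : Pt (m + 1) → ℝ} (hr : Continuous r) =>
    bdd_isPoly volume (isCompact_cell K) hr
  have hyK := tendstoL2_approx_cell (T := T) hΩ hyL K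
  have hd : TendstoL2 (volume.restrict K.carrier)
      (fun N x => ∑ i, fderiv ℝ (fun x => approx hΩ N y x * r i x) x (unitVec i))
      (fun x => (∑ i, y x * fderiv ℝ (r i) x (unitVec i)) + ∑ i, G x i * r i x) := by
    have h1 := (TendstoL2.sum Finset.univ fun i _ =>
      hyK.mul_unif (hK (hrc i)).1 (hK (hrc i)).2).add (TendstoL2.sum Finset.univ fun i _ =>
      ((tendstoL2_fderiv_approx hΩ hyi (hG i) (hGL i)).mono (restrict_cell_le hΩ K)).mul_unif
        (hK (hr i).continuous).1 (hK (hr i).continuous).2)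
    refine h1.congr fun N => Eventually.of_forall fun x => ?_
    simp only
    rw [← Finset.sum_add_distrib]
    refine Finset.sum_congr rfl fun i _ => ?_
    rw [fderiv_fun_mul ((hyN N).differentiable (by simp) x) ((hr i).differentiable (by simp) x)]
    simp only [add_apply, smul_apply, smul_eq_mul]
    ring
  -- The polynomial field is absorbed into the vector field y r, which leaves the constant 1 as test
  -- function.
  have h := integral_cell_div_mul_of_tendsto K (V := fun N i x => approx hΩ N y x * r i x)
    (W := fun i x => y x * r i x) (fun N i => (hyN N).mul (hr i)) hd
    (fun i => hyK.mul_unif (hK (hr i).continuous).1 (hK (hr i).continuous).2)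
    (fun v i => (tendstoL2_trace hΩ hy (oppFace K v)).mul_unif
      (bdd_isPoly _ (isCompact_face _) (hr i).continuous).1
      (bdd_isPoly _ (isCompact_face _) (hr i).continuous).2)
    (w := fun _ => 1) contDiff_const
  simp only [mul_one, fderiv_fun_const, Pi.zero_apply, zero_apply, mul_zero, integral_zero,
    Finset.sum_const_zero, add_zero] at h
  rw [← h]
  congr 1
  ext x
  rw [Finset.sum_mul]
  congr 1
  exact Finset.sum_congr rfl fun i _ => mul_comm _ _

/-- Integration by parts on an element for a convective term. -/
theorem integral_cell_convection (hΩ : IsConvexPolytopeDomain Ω) (K : T.Cell)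
    {ζ : Pt (m + 1) → Pt (m + 1)} (hζ : ContinuousOn ζ (closure Ω)) {dζ : Pt (m + 1) → ℝ}
    (hdζ : HasWeakDiv Ω ζ dζ) (hdζL : MemLp dζ 2 (volume.restrict Ω))
    {y : Pt (m + 1) → ℝ} (hy : ContinuousOn y (closure Ω)) {G : Pt (m + 1) → Pt (m + 1)}
    (hG : HasWeakGradient Ω y G) (hGL : ∀ i, MemLp (fun x => G x i) 2 (volume.restrict Ω))
    {w : Pt (m + 1) → ℝ} (hw : ContDiff ℝ ∞ w) :
    (∫ x in K.carrier, (dζ x * y x + ∑ i, G x i * ζ x i) * w x)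
      + ∑ i, ∫ x in K.carrier, (y x * ζ x i) * fderiv ℝ w x (unitVec i)
      = ∑ v : {v // v ∈ K.verts}, ∑ i, ∫ x, (y x * ζ x i) * ((oppFace K v).normal i * w x)
        ∂(faceMeasure (oppFace K v)) := by
  have hyL := memLp_of_continuousOn_closure hΩ hy
  have hyi := integrableOn_of_memLp hΩ hyL
  have hyN := fun N => contDiff_approx hΩ hyi N
  have hζi : ∀ i, ContinuousOn (fun x => ζ x i) (closure Ω) := fun i =>
    (EuclideanSpace.proj i : Pt (m + 1) →L[ℝ] ℝ).continuous.comp_continuousOn hζ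
  have hζI := fun i => integrableOn_of_memLp hΩ (memLp_of_continuousOn_closure hΩ (hζi i))
  have hζN := fun N i => contDiff_approx hΩ (hζI i) N
  have hyU := tendstoUnif_approx hΩ hy volume (isCompact_cell K) (cell_subset_closure K)
  have hζU := fun i => tendstoUnif_approx hΩ (hζi i) volume (isCompact_cell K)
    (cell_subset_closure K)
  -- In div (y_N ζ_N) = y_N div ζ_N + ∇y_N · ζ_N the undifferentiated factors converge uniformly and
  -- the differentiated ones in L².
  have hd : TendstoL2 (volume.restrict K.carrier)
      (fun N x => ∑ i, fderiv ℝ (fun x => approx hΩ N y x * approx hΩ N (fun x => ζ x i) x) x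
        (unitVec i)) (fun x => dζ x * y x + ∑ i, G x i * ζ x i) := by
    have h1 := (((tendstoL2_div_approx hΩ hζI hdζ hdζL).mono
      (restrict_cell_le hΩ K)).mul_unif hyU.1 hyU.2).add (TendstoL2.sum Finset.univ fun i _ =>
      ((tendstoL2_fderiv_approx hΩ hyi (hG i) (hGL i)).mono (restrict_cell_le hΩ K)).mul_unif
        (hζU i).1 (hζU i).2)
    refine h1.congr fun N => Eventually.of_forall fun x => ?_
    simp only
    rw [Finset.sum_mul, ← Finset.sum_add_distrib]
    refine Finset.sum_congr rfl fun i _ => ?_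
    rw [fderiv_fun_mul ((hyN N).differentiable (by simp) x) ((hζN N i).differentiable (by simp) x)]
    simp only [add_apply, smul_apply, smul_eq_mul]
    ring
  refine integral_cell_div_mul_of_tendsto K
    (V := fun N i x => approx hΩ N y x * approx hΩ N (fun x => ζ x i) x)
    (W := fun i x => y x * ζ x i) (fun N i => (hyN N).mul (hζN N i)) hd
    (fun i => (tendstoL2_approx_cell (T := T) hΩ hyL K).mul_unif (hζU i).1 (hζU i).2)
    (fun v i => ?_) hw
  have hζF := tendstoUnif_approx hΩ (hζi i) (μHE[m]) (isCompact_face (oppFace K v).face)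
    (face_subset_closure (oppFace K v))
  exact (tendstoL2_trace hΩ hy (oppFace K v)).mul_unif hζF.1 hζF.2

/-- The consistency error of the normal flux of the projection. -/
theorem exists_flux_consistency (m k : ℕ) {σ : ℝ} (hσ : 0 < σ) : ∃ C : ℝ, 0 < C ∧
    ∀ {Ω : Set (Pt (m + 1))} (_ : IsConvexPolytopeDomain Ω) (T : Triangulation Ω),
      T.ShapeRegular σ → ∀ (V : Pt (m + 1) → Pt (m + 1)) (d : Pt (m + 1) → ℝ),
      MemHVec Ω (k + 1) V → HasWeakDiv Ω V d →
      ∀ (w : T.Cell → Pt (m + 1) → ℝ) (μ : T.Face → Pt (m + 1) → ℝ), T.MemW k w →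
      T.MemLambda0 k μ →
      ((∑ K : T.Cell, ((∫ x in K.carrier, d x * w K x)
          + ∑ i, ∫ x in K.carrier, V x i * fderiv ℝ (w K) x (unitVec i)))
        - ∑ F : T.HalfFace, ∫ x, ⟪T.cellProjVec k V F.cell x, F.normal⟫ *
          (w F.cell x - μ F.face x) ∂(faceMeasure F)) ^ 2
        ≤ C * T.meshSize ^ (2 * k + 1) * (∑ i, seminormSq Ω (k + 1) (fun x => V x i)) *
          ∑ F : T.HalfFace, ∫ x, (w F.cell x - μ F.face x) ^ 2 ∂(faceMeasure F) := by
  obtain ⟨C, hC, H⟩ := exists_trace_sub_cellProj_le m k hσ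
  obtain ⟨C', hC', H'⟩ := exists_discrete_trace m k hσ
  refine ⟨2 * ((m + 2) * C), by positivity, fun {Ω} hΩ T hT V d hV hd w μ hw hμ => ?_⟩
  have hVL : ∀ i, MemLp (fun x => V x i) 2 (volume.restrict Ω) := fun i => (hV i).1
  have hVI := fun i => integrableOn_of_memLp hΩ (hVL i)
  have hVN := fun N i => contDiff_approx hΩ (hVI i) N
  have hdL := hd.memLp hΩ.isOpen hV
  set VN : ℕ → Pt (m + 1) → Pt (m + 1) := fun N x =>
    WithLp.toLp 2 fun i => approx hΩ N (fun x => V x i) x with hVNdef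
  have hVNc : ∀ N, Continuous (VN N) := fun N =>
    (PiLp.continuous_toLp 2 _).comp (continuous_pi fun i => (hVN N i).continuous)
  have hwc : ∀ K i, Continuous fun x => fderiv ℝ (w K) x (unitVec i) := fun K i =>
    ((hw K).contDiff.continuous_fderiv (by simp)).clm_apply continuous_const
  set J := ∑ F : T.HalfFace, ∫ x, (w F.cell x - μ F.face x) ^ 2 ∂(faceMeasure F) with hJ
  set Pn : T.HalfFace → Pt (m + 1) → ℝ := fun F x => ⟪T.cellProjVec k V F.cell x, F.normal⟫ with hPn
  have hPc : ∀ F, Continuous (Pn F) := fun F =>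
    (IsPoly.inner_const (memV_cellProjVec V F.cell) F.normal).continuous
  have hwμ : ∀ F : T.HalfFace, Continuous fun x => w F.cell x - μ F.face x := fun F =>
    (hw F.cell).continuous.sub (hμ.1 F.face).continuous
  -- For the smooth field V_N the volume terms become V_N · n tested with w. Subtracting V_N · n
  -- tested with μ, which sums to zero, leaves V_N - ΠV against w - μ. The projection is that of V,
  -- and V itself is never evaluated on faces.
  have hX : ∀ N, (∑ K : T.Cell, ((∫ x in K.carrier,
        (∑ i, fderiv ℝ (approx hΩ N (fun x => V x i)) x (unitVec i)) * w K x)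
          + ∑ i, ∫ x in K.carrier, approx hΩ N (fun x => V x i) x * fderiv ℝ (w K) x (unitVec i)))
        - ∑ F : T.HalfFace, ∫ x, Pn F x * (w F.cell x - μ F.face x) ∂(faceMeasure F)
      = ∑ F : T.HalfFace, ∫ x, (⟪VN N x, F.normal⟫ - Pn F x) * (w F.cell x - μ F.face x)
          ∂(faceMeasure F) := by
    intro N
    have h1 : ∑ K : T.Cell, ((∫ x in K.carrier,
        (∑ i, fderiv ℝ (approx hΩ N (fun x => V x i)) x (unitVec i)) * w K x)
          + ∑ i, ∫ x in K.carrier, approx hΩ N (fun x => V x i) x * fderiv ℝ (w K) x (unitVec i))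
        = ∑ F : T.HalfFace, ∫ x, ⟪VN N x, F.normal⟫ * w F.cell x ∂(faceMeasure F) := by
      rw [sum_halfFace]
      refine Finset.sum_congr rfl fun K _ => ?_
      rw [integral_cell_div_mul K (hVN N) (hw K).contDiff]
      refine Finset.sum_congr rfl fun v _ => ?_
      rw [← integral_finsetSum]
      · congr 1; ext x
        rw [inner_eq_sum, Finset.sum_mul]
        exact Finset.sum_congr rfl fun i _ => by simp only [hVNdef, oppFace_cell]; ring
      · exact fun i _ => integrable_face _ ((hVN N i).continuous.mul
          (continuous_const.mul (hw K).continuous)).continuousOn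
    have h2 := sum_integral_normal_mul_eq_zero (T := T) hΩ (hVNc N).continuousOn hμ
    have h3 : ∀ F : T.HalfFace, ∫ x, (⟪VN N x, F.normal⟫ - Pn F x) * (w F.cell x - μ F.face x)
          ∂(faceMeasure F)
        = (∫ x, ⟪VN N x, F.normal⟫ * w F.cell x ∂(faceMeasure F))
          - (∫ x, ⟪VN N x, F.normal⟫ * μ F.face x ∂(faceMeasure F))
          - ∫ x, Pn F x * (w F.cell x - μ F.face x) ∂(faceMeasure F) := by
      intro F
      have c1 : Continuous fun x => ⟪VN N x, F.normal⟫ := (hVNc N).inner continuous_const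
      have i1 := integrable_face F (u := fun x => ⟪VN N x, F.normal⟫ * w F.cell x)
        (c1.mul (hw F.cell).continuous).continuousOn
      have i2 := integrable_face F (u := fun x => ⟪VN N x, F.normal⟫ * μ F.face x)
        (c1.mul (hμ.1 F.face).continuous).continuousOn
      have i3 := integrable_face F (u := fun x => Pn F x * (w F.cell x - μ F.face x))
        ((hPc F).mul (hwμ F)).continuousOn
      have i4 : Integrable (fun x => ⟪VN N x, F.normal⟫ * w F.cell x
        - ⟪VN N x, F.normal⟫ * μ F.face x) (faceMeasure F) := i1.sub i2
      rw [← integral_sub i1 i2, ← integral_sub i4 i3]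
      congr 1; ext x; ring
    simp_rw [h3]
    rw [Finset.sum_sub_distrib, Finset.sum_sub_distrib, h1, h2, sub_zero]
  -- Cauchy–Schwarz and V_N - ΠV = (V_N - ΠV_N) + (ΠV_N - ΠV): the first part obeys the trace
  -- estimate for smooth functions, the second tends to zero on the fixed mesh.
  have hbound : ∀ N, (∑ F : T.HalfFace, ∫ x, (⟪VN N x, F.normal⟫ - Pn F x) *
      (w F.cell x - μ F.face x) ∂(faceMeasure F)) ^ 2
      ≤ (2 * ((m + 2) * C * T.meshSize ^ (2 * k + 1) *
          ∑ i, ∫ x in Ω, derivSq (k + 1) (approx hΩ N (fun x => V x i)) x)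
        + 2 * ∑ i, ∑ F : T.HalfFace, ∫ x, (T.cellProj k (approx hΩ N (fun x => V x i)) F.cell x
          - T.cellProj k (fun x => V x i) F.cell x) ^ 2 ∂(faceMeasure F)) * J := by
    intro N
    have hpc : ∀ (u : Pt (m + 1) → ℝ) (F : T.HalfFace), Continuous (T.cellProj k u F.cell) :=
      fun u F => (isPoly_cellProj u F.cell).continuous
    have c1 : ∀ F : T.HalfFace, Continuous fun x => ⟪VN N x, F.normal⟫ - Pn F x := fun F =>
      ((hVNc N).inner continuous_const).sub (hPc F)
    refine (sum_integral_mul_sq_le (fun F : T.HalfFace => faceMeasure F)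
      (fun F => memLp_face F (c1 F).continuousOn 2)
      (fun F => memLp_face F (hwμ F).continuousOn 2)).trans ?_
    refine mul_le_mul_of_nonneg_right ?_ (Finset.sum_nonneg fun F _ =>
      integral_nonneg fun x => sq_nonneg _)
    have h1 : ∀ F : T.HalfFace, ∫ x, (⟪VN N x, F.normal⟫ - Pn F x) ^ 2 ∂(faceMeasure F)
        ≤ ∑ i, (2 * (∫ x, (approx hΩ N (fun x => V x i) x
            - T.cellProj k (approx hΩ N (fun x => V x i)) F.cell x) ^ 2 ∂(faceMeasure F))
          + 2 * ∫ x, (T.cellProj k (approx hΩ N (fun x => V x i)) F.cell x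
            - T.cellProj k (fun x => V x i) F.cell x) ^ 2 ∂(faceMeasure F)) := by
      intro F
      have c2 : ∀ i, Continuous fun x => approx hΩ N (fun x => V x i) x
          - T.cellProj k (fun x => V x i) F.cell x := fun i => (hVN N i).continuous.sub (hpc _ F)
      calc _ ≤ ∫ x, ∑ i, (approx hΩ N (fun x => V x i) x
            - T.cellProj k (fun x => V x i) F.cell x) ^ 2 ∂(faceMeasure F) := by
            refine integral_mono (integrable_face F ((c1 F).pow 2).continuousOn)
              (integrable_face F (continuous_finsetSum _ fun i _ =>
                (c2 i).pow 2).continuousOn) fun x => ?_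
            have h2 : ⟪VN N x, F.normal⟫ - Pn F x
                = ⟪VN N x - T.cellProjVec k V F.cell x, F.normal⟫ := by
              rw [inner_sub_left]
            have h3 := abs_real_inner_le_norm (VN N x - T.cellProjVec k V F.cell x) F.normal
            rw [norm_normal, mul_one] at h3
            simp only
            rw [h2, ← sq_abs]
            refine (pow_le_pow_left₀ (abs_nonneg _) h3 2).trans (le_of_eq ?_)
            rw [EuclideanSpace.norm_sq_eq]
            refine Finset.sum_congr rfl fun i _ => ?_
            rw [Real.norm_eq_abs, sq_abs]
            rfl
        _ = ∑ i, ∫ x, (approx hΩ N (fun x => V x i) x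
            - T.cellProj k (fun x => V x i) F.cell x) ^ 2 ∂(faceMeasure F) :=
            integral_finsetSum _ fun i _ => integrable_face F ((c2 i).pow 2).continuousOn
        _ ≤ _ := by
            refine Finset.sum_le_sum fun i _ => ?_
            have h4 := integral_add_sq_le (μ := faceMeasure F)
              (f := fun x => approx hΩ N (fun x => V x i) x
                - T.cellProj k (approx hΩ N (fun x => V x i)) F.cell x)
              (g := fun x => T.cellProj k (approx hΩ N (fun x => V x i)) F.cell x
                - T.cellProj k (fun x => V x i) F.cell x)
              (memLp_face F ((hVN N i).continuous.sub (hpc _ F)).continuousOn 2)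
              (memLp_face F ((hpc _ F).sub (hpc _ F)).continuousOn 2)
            simpa only [sub_add_sub_cancel] using h4
    refine (Finset.sum_le_sum fun F _ => h1 F).trans ?_
    rw [Finset.sum_comm]
    simp only [Finset.sum_add_distrib, ← Finset.mul_sum]
    have h5 : ∑ i, ∑ F : T.HalfFace, ∫ x, (approx hΩ N (fun x => V x i) x
            - T.cellProj k (approx hΩ N (fun x => V x i)) F.cell x) ^ 2 ∂(faceMeasure F)
        ≤ (m + 2) * C * T.meshSize ^ (2 * k + 1) *
          ∑ i, ∫ x in Ω, derivSq (k + 1) (approx hΩ N (fun x => V x i)) x := by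
      rw [Finset.mul_sum]
      exact Finset.sum_le_sum fun i _ =>
        sum_trace_sub_cellProj_smooth_le hΩ (fun F u hu => H T hT F u hu) (hVN N i)
    linarith
  have hlimL : Tendsto (fun N => ((∑ K : T.Cell, ((∫ x in K.carrier,
        (∑ i, fderiv ℝ (approx hΩ N (fun x => V x i)) x (unitVec i)) * w K x)
          + ∑ i, ∫ x in K.carrier, approx hΩ N (fun x => V x i) x * fderiv ℝ (w K) x (unitVec i)))
        - ∑ F : T.HalfFace, ∫ x, Pn F x * (w F.cell x - μ F.face x) ∂(faceMeasure F)) ^ 2) atTop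
      (𝓝 (((∑ K : T.Cell, ((∫ x in K.carrier, d x * w K x)
          + ∑ i, ∫ x in K.carrier, V x i * fderiv ℝ (w K) x (unitVec i)))
        - ∑ F : T.HalfFace, ∫ x, Pn F x * (w F.cell x - μ F.face x) ∂(faceMeasure F)) ^ 2)) := by
    refine ((tendsto_finsetSum _ fun K _ => Tendsto.add ?_
      (tendsto_finsetSum _ fun i _ => ?_)).sub_const _).pow 2
    · exact ((tendstoL2_div_approx hΩ hVI hd hdL).mono (restrict_cell_le hΩ K)).integral_mul
        (memLp_isPoly_cell K _ (hw K))
    · exact (tendstoL2_approx_cell hΩ (hVL i) K).integral_mul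
        (memLp_cell K (hwc K i).continuousOn)
  have hlimR : Tendsto (fun N => (2 * ((m + 2) * C * T.meshSize ^ (2 * k + 1) *
          ∑ i, ∫ x in Ω, derivSq (k + 1) (approx hΩ N (fun x => V x i)) x)
        + 2 * ∑ i, ∑ F : T.HalfFace, ∫ x, (T.cellProj k (approx hΩ N (fun x => V x i)) F.cell x
          - T.cellProj k (fun x => V x i) F.cell x) ^ 2 ∂(faceMeasure F)) * J) atTop
      (𝓝 ((2 * ((m + 2) * C * T.meshSize ^ (2 * k + 1) *
          ∑ i, seminormSq Ω (k + 1) (fun x => V x i))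
        + 2 * ∑ i : Fin (m + 1), ∑ F : T.HalfFace, 0) * J)) := by
    refine ((Tendsto.const_mul 2 (Tendsto.const_mul _ (tendsto_finsetSum _ fun i _ =>
      tendsto_derivSq_approx hΩ (hV i)))).add (Tendsto.const_mul 2
      (tendsto_finsetSum _ fun i _ => tendsto_finsetSum _ fun F _ => ?_))).mul_const J
    exact tendsto_trace_cellProj hΩ (H' T hT) (hVL i) F
  simp only [Finset.sum_const_zero, mul_zero, add_zero] at hlimR
  refine (le_of_tendsto_of_tendsto' hlimL hlimR fun N => ?_).trans (le_of_eq (by ring))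
  rw [hX N]
  exact hbound N

end Triangulation

end HDG

/-! ### Calculus of sums over the mesh, bilinear forms and energy identities -/

namespace HDG

namespace Triangulation

variable {m k : ℕ} {Ω : Set (Pt (m + 1))} {T : Triangulation Ω}

/-! ### Sums of integrals over elements and over their boundaries -/

/-- The sum of the integrals over the elements. -/
noncomputable def cellInt (T : Triangulation Ω) (φ : T.Cell → Pt (m + 1) → ℝ) : ℝ :=
  ∑ K : T.Cell, ∫ x in K.carrier, φ K x

/-- The sum of the integrals over the boundaries of the elements. -/
noncomputable def bdryInt (T : Triangulation Ω) (η : T.HalfFace → Pt (m + 1) → ℝ) : ℝ :=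
  ∑ F : T.HalfFace, ∫ x, η F x ∂(faceMeasure F)

/-- Integrability on every element. -/
def CellIntegrable (φ : T.Cell → Pt (m + 1) → ℝ) : Prop :=
  ∀ K : T.Cell, IntegrableOn (φ K) K.carrier

/-- Continuity on every face of every element. -/
def FaceCont (η : T.HalfFace → Pt (m + 1) → ℝ) : Prop :=
  ∀ F : T.HalfFace, ContinuousOn (η F) F.face.carrier

theorem innerCell_eq (η ξ : T.Cell → Pt (m + 1) → ℝ) :
    T.innerCell η ξ = T.cellInt fun K x => η K x * ξ K x := rfl

theorem innerCellVec_eq (η ξ : T.Cell → Pt (m + 1) → Pt (m + 1)) :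
    T.innerCellVec η ξ = T.cellInt fun K x => ⟪η K x, ξ K x⟫ := rfl

theorem innerBdry_eq (η ξ : T.HalfFace → Pt (m + 1) → ℝ) :
    T.innerBdry η ξ = T.bdryInt fun F x => η F x * ξ F x := rfl

theorem cellInt_congr {φ ψ : T.Cell → Pt (m + 1) → ℝ} (h : ∀ K, ∀ x ∈ K.carrier, φ K x = ψ K x) :
    T.cellInt φ = T.cellInt ψ :=
  Finset.sum_congr rfl fun K _ => setIntegral_congr_fun (isCompact_cell K).measurableSet (h K)

theorem bdryInt_congr {φ ψ : T.HalfFace → Pt (m + 1) → ℝ}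
    (h : ∀ F, ∀ x ∈ F.face.carrier, φ F x = ψ F x) : T.bdryInt φ = T.bdryInt ψ :=
  Finset.sum_congr rfl fun F _ => setIntegral_congr_fun (isCompact_face F.face).measurableSet (h F)

theorem cellInt_congr_ae (hΩ : IsConvexPolytopeDomain Ω) {f g : Pt (m + 1) → ℝ}
    (h : f =ᵐ[volume.restrict Ω] g) (w : T.Cell → Pt (m + 1) → ℝ) :
    T.cellInt (fun K x => f x * w K x) = T.cellInt fun K x => g x * w K x := by
  refine Finset.sum_congr rfl fun K _ => integral_congr_ae ?_
  filter_upwards [(ae_mono (restrict_cell_le hΩ K)) h] with x hx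
  rw [hx]

theorem cellInt_add {φ ψ : T.Cell → Pt (m + 1) → ℝ} (hφ : CellIntegrable φ)
    (hψ : CellIntegrable ψ) :
    T.cellInt (fun K x => φ K x + ψ K x) = T.cellInt φ + T.cellInt ψ := by
  rw [cellInt, cellInt, cellInt, ← Finset.sum_add_distrib]
  exact Finset.sum_congr rfl fun K _ => integral_add (hφ K) (hψ K)

theorem cellInt_const_mul (c : ℝ) (φ : T.Cell → Pt (m + 1) → ℝ) :
    T.cellInt (fun K x => c * φ K x) = c * T.cellInt φ := by
  rw [cellInt, cellInt, Finset.mul_sum]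
  exact Finset.sum_congr rfl fun K _ => integral_const_mul c _

theorem bdryInt_add {φ ψ : T.HalfFace → Pt (m + 1) → ℝ} (hφ : FaceCont φ) (hψ : FaceCont ψ) :
    T.bdryInt (fun F x => φ F x + ψ F x) = T.bdryInt φ + T.bdryInt ψ := by
  rw [bdryInt, bdryInt, bdryInt, ← Finset.sum_add_distrib]
  exact Finset.sum_congr rfl fun F _ =>
    integral_add (integrable_face F (hφ F)) (integrable_face F (hψ F))

theorem bdryInt_const_mul (c : ℝ) (φ : T.HalfFace → Pt (m + 1) → ℝ) :
    T.bdryInt (fun F x => c * φ F x) = c * T.bdryInt φ := by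
  rw [bdryInt, bdryInt, Finset.mul_sum]
  exact Finset.sum_congr rfl fun F _ => integral_const_mul c _

theorem CellIntegrable.add {φ ψ : T.Cell → Pt (m + 1) → ℝ} (hφ : CellIntegrable φ)
    (hψ : CellIntegrable ψ) : CellIntegrable fun K x => φ K x + ψ K x :=
  fun K => Integrable.add (hφ K) (hψ K)

theorem CellIntegrable.const_mul {φ : T.Cell → Pt (m + 1) → ℝ} (hφ : CellIntegrable φ) (c : ℝ) :
    CellIntegrable fun K x => c * φ K x :=
  fun K => Integrable.const_mul (hφ K) c

theorem CellIntegrable.sub {φ ψ : T.Cell → Pt (m + 1) → ℝ} (hφ : CellIntegrable φ)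
    (hψ : CellIntegrable ψ) : CellIntegrable fun K x => φ K x - ψ K x :=
  fun K => Integrable.sub (hφ K) (hψ K)

theorem FaceCont.add {φ ψ : T.HalfFace → Pt (m + 1) → ℝ} (hφ : FaceCont φ) (hψ : FaceCont ψ) :
    FaceCont fun F x => φ F x + ψ F x := fun F => (hφ F).add (hψ F)

theorem FaceCont.sub {φ ψ : T.HalfFace → Pt (m + 1) → ℝ} (hφ : FaceCont φ) (hψ : FaceCont ψ) :
    FaceCont fun F x => φ F x - ψ F x := fun F => (hφ F).sub (hψ F)

theorem FaceCont.mul {φ ψ : T.HalfFace → Pt (m + 1) → ℝ} (hφ : FaceCont φ) (hψ : FaceCont ψ) :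
    FaceCont fun F x => φ F x * ψ F x := fun F => (hφ F).mul (hψ F)

theorem FaceCont.const_mul {φ : T.HalfFace → Pt (m + 1) → ℝ} (hφ : FaceCont φ) (c : ℝ) :
    FaceCont fun F x => c * φ F x := fun F => continuousOn_const.mul (hφ F)

/-- A linear combination of sums of integrals over the elements. -/
theorem cellInt_comb {φ φ₁ φ₂ φ₃ φ₄ φ₅ φ₆ : T.Cell → Pt (m + 1) → ℝ}
    (h₁ : CellIntegrable φ₁) (h₂ : CellIntegrable φ₂) (h₃ : CellIntegrable φ₃)
    (h₄ : CellIntegrable φ₄) (h₅ : CellIntegrable φ₅) (h₆ : CellIntegrable φ₆)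
    (c₁ c₂ c₃ c₄ c₅ c₆ : ℝ)
    (h : ∀ K, ∀ x ∈ K.carrier, φ K x = c₁ * φ₁ K x + c₂ * φ₂ K x + c₃ * φ₃ K x + c₄ * φ₄ K x
      + c₅ * φ₅ K x + c₆ * φ₆ K x) :
    T.cellInt φ = c₁ * T.cellInt φ₁ + c₂ * T.cellInt φ₂ + c₃ * T.cellInt φ₃ + c₄ * T.cellInt φ₄
      + c₅ * T.cellInt φ₅ + c₆ * T.cellInt φ₆ := by
  have i₁ := h₁.const_mul c₁
  have i₂ := i₁.add (h₂.const_mul c₂)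
  have i₃ := i₂.add (h₃.const_mul c₃)
  have i₄ := i₃.add (h₄.const_mul c₄)
  have i₅ := i₄.add (h₅.const_mul c₅)
  rw [cellInt_congr h, cellInt_add i₅ (h₆.const_mul c₆), cellInt_add i₄ (h₅.const_mul c₅),
    cellInt_add i₃ (h₄.const_mul c₄), cellInt_add i₂ (h₃.const_mul c₃),
    cellInt_add i₁ (h₂.const_mul c₂)]
  simp only [cellInt_const_mul]

/-- A linear combination of sums of integrals over the boundaries of the elements. -/
theorem bdryInt_comb {φ φ₁ φ₂ φ₃ φ₄ φ₅ φ₆ φ₇ : T.HalfFace → Pt (m + 1) → ℝ}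
    (h₁ : FaceCont φ₁) (h₂ : FaceCont φ₂) (h₃ : FaceCont φ₃)
    (h₄ : FaceCont φ₄) (h₅ : FaceCont φ₅) (h₆ : FaceCont φ₆) (h₇ : FaceCont φ₇)
    (c₁ c₂ c₃ c₄ c₅ c₆ c₇ : ℝ)
    (h : ∀ F, ∀ x ∈ F.face.carrier, φ F x = c₁ * φ₁ F x + c₂ * φ₂ F x + c₃ * φ₃ F x
      + c₄ * φ₄ F x + c₅ * φ₅ F x + c₆ * φ₆ F x + c₇ * φ₇ F x) :
    T.bdryInt φ = c₁ * T.bdryInt φ₁ + c₂ * T.bdryInt φ₂ + c₃ * T.bdryInt φ₃ + c₄ * T.bdryInt φ₄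
      + c₅ * T.bdryInt φ₅ + c₆ * T.bdryInt φ₆ + c₇ * T.bdryInt φ₇ := by
  have i₁ := h₁.const_mul c₁
  have i₂ := i₁.add (h₂.const_mul c₂)
  have i₃ := i₂.add (h₃.const_mul c₃)
  have i₄ := i₃.add (h₄.const_mul c₄)
  have i₅ := i₄.add (h₅.const_mul c₅)
  have i₆ := i₅.add (h₆.const_mul c₆)
  rw [bdryInt_congr h, bdryInt_add i₆ (h₇.const_mul c₇), bdryInt_add i₅ (h₆.const_mul c₆),
    bdryInt_add i₄ (h₅.const_mul c₅),
    bdryInt_add i₃ (h₄.const_mul c₄), bdryInt_add i₂ (h₃.const_mul c₃),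
    bdryInt_add i₁ (h₂.const_mul c₂)]
  simp only [bdryInt_const_mul]

theorem CellIntegrable.zero : CellIntegrable fun (_ : T.Cell) _ => (0 : ℝ) := fun _ =>
  integrableOn_zero

theorem FaceCont.zero : FaceCont fun (_ : T.HalfFace) _ => (0 : ℝ) := fun _ => continuousOn_const

theorem CellIntegrable.of_continuousOn {φ : T.Cell → Pt (m + 1) → ℝ}
    (h : ∀ K, ContinuousOn (φ K) K.carrier) : CellIntegrable φ := fun K => integrableOn_cell K (h K)

theorem CellIntegrable.memLp_mul (hΩ : IsConvexPolytopeDomain Ω) {g : Pt (m + 1) → ℝ}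
    (hg : MemLp g 2 (volume.restrict Ω)) {φ : T.Cell → Pt (m + 1) → ℝ}
    (h : ∀ K, ContinuousOn (φ K) K.carrier) : CellIntegrable fun K x => g x * φ K x := fun K =>
  (hg.mono_measure (restrict_cell_le hΩ K)).integrable_mul (memLp_cell K (h K))

/-! ### Continuity of discrete functions -/

theorem MemV.continuous {r : T.Cell → Pt (m + 1) → Pt (m + 1)} (hr : T.MemV k r) (K : T.Cell) :
    Continuous (r K) := by
  have h : r K = fun x => WithLp.toLp 2 fun i => r K x i := rfl
  rw [h]
  exact (PiLp.continuous_toLp 2 _).comp (continuous_pi fun i => (hr K i).continuous)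

theorem MemV.contDiff {r : T.Cell → Pt (m + 1) → Pt (m + 1)} (hr : T.MemV k r) (K : T.Cell) :
    ContDiff ℝ ∞ (r K) := contDiff_euclidean.2 fun i => (hr K i).contDiff

theorem divCell_eq {r : T.Cell → Pt (m + 1) → Pt (m + 1)} (hr : T.MemV k r) (K : T.Cell)
    (x : Pt (m + 1)) :
    divCell r K x = ∑ i, fderiv ℝ (fun x => r K x i) x (unitVec i) := by
  refine Finset.sum_congr rfl fun i _ => ?_
  have h1 := ((hr.contDiff K).differentiable (by simp) x).hasFDerivAt
  have h2 := (EuclideanSpace.proj i : Pt (m + 1) →L[ℝ] ℝ).hasFDerivAt.comp x h1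
  have h3 : fderiv ℝ (fun x => r K x i) x = _ := h2.fderiv
  rw [h3]; rfl

theorem memW_divCell {r : T.Cell → Pt (m + 1) → Pt (m + 1)} (hr : T.MemV k r) :
    T.MemW k (divCell r) := by
  intro K
  have h : divCell r K = fun x => ∑ i, fderiv ℝ (fun x => r K x i) x (unitVec i) :=
    funext fun x => divCell_eq hr K x
  rw [h]
  exact IsPoly.sum _ fun i _ => (hr K i).fderiv _

theorem continuousOn_fderiv_apply {w : T.Cell → Pt (m + 1) → ℝ} (hw : T.MemW k w) (K : T.Cell)
    {V : Pt (m + 1) → Pt (m + 1)} {S : Set (Pt (m + 1))} (hV : ContinuousOn V S) :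
    ContinuousOn (fun x => fderiv ℝ (w K) x (V x)) S :=
  (((hw K).contDiff.continuous_fderiv (by simp)).continuousOn).clm_apply hV

theorem continuousOn_cell {V : Type*} [TopologicalSpace V] {u : Pt (m + 1) → V}
    (hu : ContinuousOn u (closure Ω)) (K : T.Cell) : ContinuousOn u K.carrier :=
  hu.mono (cell_subset_closure K)

theorem faceCont_cellTrace {w : T.Cell → Pt (m + 1) → ℝ} (hw : T.MemW k w) :
    FaceCont fun F => w F.cell := fun F => (hw F.cell).continuous.continuousOn

theorem faceCont_faceTrace {μ : T.Face → Pt (m + 1) → ℝ} (hμ : T.MemLambda0 k μ) :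
    FaceCont fun F : T.HalfFace => μ F.face := fun F => (hμ.1 F.face).continuous.continuousOn

theorem faceCont_normalTrace {r : T.Cell → Pt (m + 1) → Pt (m + 1)} (hr : T.MemV k r) :
    FaceCont fun F x => ⟪r F.cell x, F.normal⟫ := fun F =>
  ((hr.continuous F.cell).inner continuous_const).continuousOn

theorem faceCont_inner_normal {V : Pt (m + 1) → Pt (m + 1)} (hV : ContinuousOn V (closure Ω)) :
    FaceCont fun (F : T.HalfFace) x => ⟪V x, F.normal⟫ := fun F =>
  (hV.mono (face_subset_closure F)).inner continuousOn_const

theorem faceCont_of_closure {u : Pt (m + 1) → ℝ} (hu : ContinuousOn u (closure Ω)) :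
    FaceCont fun (_ : T.HalfFace) => u := fun F => hu.mono (face_subset_closure F)

theorem faceCont_const (τ : T.HalfFace → ℝ) : FaceCont fun F (_ : Pt (m + 1)) => τ F := fun _ =>
  continuousOn_const

/-! ### Integration by parts for discrete functions -/

theorem cellInt_div_mul {r : T.Cell → Pt (m + 1) → Pt (m + 1)} (hr : T.MemV k r)
    {w : T.Cell → Pt (m + 1) → ℝ} (hw : T.MemW k w) :
    T.cellInt (fun K x => divCell r K x * w K x + fderiv ℝ (w K) x (r K x))
      = T.bdryInt fun F x => ⟪r F.cell x, F.normal⟫ * w F.cell x := by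
  rw [cellInt, bdryInt, sum_halfFace]
  refine Finset.sum_congr rfl fun K _ => ?_
  have h := integral_cell_div_mul K (V := fun i x => r K x i) (fun i => (hr K i).contDiff)
    (hw K).contDiff
  have hc : ∀ i, Continuous fun x => fderiv ℝ (w K) x (unitVec i) := fun i =>
    ((hw K).contDiff.continuous_fderiv (by simp)).clm_apply continuous_const
  have e1 : ∀ x, divCell r K x * w K x + fderiv ℝ (w K) x (r K x)
      = (∑ i, fderiv ℝ (fun x => r K x i) x (unitVec i)) * w K x
        + ∑ i, r K x i * fderiv ℝ (w K) x (unitVec i) := fun x => by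
    rw [divCell_eq hr, fderiv_eq_sum (fderiv ℝ (w K) x) (r K x)]
  simp_rw [e1]
  rw [integral_add, integral_finsetSum, h]
  · refine Finset.sum_congr rfl fun v _ => ?_
    rw [← integral_finsetSum]
    · congr 1; ext x
      rw [inner_eq_sum, Finset.sum_mul]
      exact Finset.sum_congr rfl fun i _ => by rw [oppFace_cell]; ring
    · exact fun i _ => integrable_face _ ((hr K i).continuous.mul
        (continuous_const.mul (hw K).continuous)).continuousOn
  · exact fun i _ => integrableOn_cell K ((hr K i).continuous.mul (hc i)).continuousOn
  · refine integrableOn_cell K (Continuous.continuousOn ?_)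
    refine Continuous.mul (continuous_finsetSum _ fun i _ => ?_) (hw K).continuous
    exact ((hr K i).fderiv (unitVec i)).continuous
  · exact integrableOn_cell K
      (continuous_finsetSum _ fun i _ => (hr K i).continuous.mul (hc i)).continuousOn

theorem cellInt_weakDiv (hΩ : IsConvexPolytopeDomain Ω)
    {V : Pt (m + 1) → Pt (m + 1)} (hV : ContinuousOn V (closure Ω)) {d : Pt (m + 1) → ℝ}
    (hd : HasWeakDiv Ω V d) (hdL : MemLp d 2 (volume.restrict Ω))
    {w : T.Cell → Pt (m + 1) → ℝ} (hw : T.MemW k w) :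
    T.cellInt (fun K x => d x * w K x + fderiv ℝ (w K) x (V x))
      = T.bdryInt fun F x => ⟪V x, F.normal⟫ * w F.cell x := by
  have hVi : ∀ i, ContinuousOn (fun x => V x i) (closure Ω) := fun i =>
    (EuclideanSpace.proj i : Pt (m + 1) →L[ℝ] ℝ).continuous.comp_continuousOn hV
  rw [cellInt, bdryInt, sum_halfFace]
  refine Finset.sum_congr rfl fun K _ => ?_
  have hc : ∀ i, Continuous fun x => fderiv ℝ (w K) x (unitVec i) := fun i =>
    ((hw K).contDiff.continuous_fderiv (by simp)).clm_apply continuous_const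
  have h := integral_cell_weakDiv hΩ K hV hd hdL (hw K).contDiff
  simp_rw [fun x => fderiv_eq_sum (fderiv ℝ (w K) x) (V x)]
  have i1 : ∀ i, IntegrableOn (fun x => V x i * fderiv ℝ (w K) x (unitVec i)) K.carrier := fun i =>
    integrableOn_cell K ((continuousOn_cell (hVi i) K).mul (hc i).continuousOn)
  rw [integral_add, integral_finsetSum _ fun i _ => i1 i, h]
  · refine Finset.sum_congr rfl fun v _ => ?_
    rw [← integral_finsetSum]
    · congr 1; ext x
      rw [inner_eq_sum, Finset.sum_mul]
      exact Finset.sum_congr rfl fun i _ => by rw [oppFace_cell]; ring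
    · exact fun i _ => integrable_face _ (((hVi i).mono (face_subset_closure _)).mul
        (continuous_const.mul (hw K).continuous).continuousOn)
  · exact (hdL.mono_measure (restrict_cell_le hΩ K)).integrable_mul
      (memLp_cell K (hw K).continuous.continuousOn)
  · exact integrable_finsetSum _ fun i _ => i1 i

/-- Integration by parts for a convective term with two discrete functions. -/
theorem cellInt_convection (hΩ : IsConvexPolytopeDomain Ω)
    {ζ : Pt (m + 1) → Pt (m + 1)} (hζ : ContinuousOn ζ (closure Ω)) {dζ : Pt (m + 1) → ℝ}
    (hdζ : HasWeakDiv Ω ζ dζ) (hdζL : MemLp dζ 2 (volume.restrict Ω))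
    {w w' : T.Cell → Pt (m + 1) → ℝ} (hw : T.MemW k w) (hw' : T.MemW k w') :
    T.cellInt (fun K x => dζ x * (w K x * w' K x)
      + (w' K x * fderiv ℝ (w K) x (ζ x) + w K x * fderiv ℝ (w' K) x (ζ x)))
      = T.bdryInt fun F x => ⟪ζ x, F.normal⟫ * (w F.cell x * w' F.cell x) := by
  have h := cellInt_weakDiv (T := T) (k := k + k) hΩ hζ hdζ hdζL
    (w := fun K x => w K x * w' K x) fun K => (hw K).mul (hw' K)
  rw [← h]
  refine cellInt_congr fun K x _ => ?_
  rw [fderiv_fun_mul ((hw K).contDiff.differentiable (by simp) x)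
    ((hw' K).contDiff.differentiable (by simp) x)]
  simp only [add_apply, smul_apply, smul_eq_mul]
  ring

/-- Products of functions in Λ_h^0 are still single-valued on faces and vanish on the boundary, only
with degree 2k. -/
theorem bdryInt_normal_mul_mul (hΩ : IsConvexPolytopeDomain Ω)
    {ζ : Pt (m + 1) → Pt (m + 1)} (hζ : ContinuousOn ζ (closure Ω))
    {μ μ' : T.Face → Pt (m + 1) → ℝ} (hμ : T.MemLambda0 k μ) (hμ' : T.MemLambda0 k μ') :
    T.bdryInt (fun F x => ⟪ζ x, F.normal⟫ * (μ F.face x * μ' F.face x)) = 0 :=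
  sum_integral_normal_mul_eq_zero (k := k + k) hΩ hζ (μ := fun e x => μ e x * μ' e x)
    ⟨fun e => (hμ.1 e).mul (hμ'.1 e), fun e he x hx => by
      show μ e x * μ' e x = 0
      rw [hμ.2 e he x hx, zero_mul]⟩

/-! ### The bilinear forms of the method -/

/-- The form of the state equation, tested with `(w, μ)`. -/
noncomputable def stateForm (T : Triangulation Ω) (ζ : Pt (m + 1) → Pt (m + 1))
    (dζ γ : Pt (m + 1) → ℝ) (τ : T.HalfFace → ℝ) (q : T.Cell → Pt (m + 1) → Pt (m + 1))
    (y : T.Cell → Pt (m + 1) → ℝ) (yhat : T.Face → Pt (m + 1) → ℝ)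
    (w : T.Cell → Pt (m + 1) → ℝ) (μ : T.Face → Pt (m + 1) → ℝ) : ℝ :=
  T.cellInt (fun K x => (γ x - dζ x) * (y K x * w K x)
      - (fderiv ℝ (w K) x (q K x) + y K x * fderiv ℝ (w K) x (ζ x)))
    + T.bdryInt fun F x => (⟪q F.cell x, F.normal⟫ + τ F * y F.cell x
      + (⟪ζ x, F.normal⟫ - τ F) * yhat F.face x) * (w F.cell x - μ F.face x)

/-- The form of the adjoint equation, tested with `(w, μ)`. -/
noncomputable def adjointForm (T : Triangulation Ω) (ζ : Pt (m + 1) → Pt (m + 1))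
    (γ : Pt (m + 1) → ℝ) (τ : T.HalfFace → ℝ) (q : T.Cell → Pt (m + 1) → Pt (m + 1))
    (y : T.Cell → Pt (m + 1) → ℝ) (yhat : T.Face → Pt (m + 1) → ℝ)
    (w : T.Cell → Pt (m + 1) → ℝ) (μ : T.Face → Pt (m + 1) → ℝ) : ℝ :=
  T.cellInt (fun K x => γ x * (y K x * w K x)
      - (fderiv ℝ (w K) x (q K x) - y K x * fderiv ℝ (w K) x (ζ x)))
    + T.bdryInt fun F x => (⟪q F.cell x, F.normal⟫ + (τ F - ⟪ζ x, F.normal⟫) * y F.cell x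
      - τ F * yhat F.face x) * (w F.cell x - μ F.face x)

/-- The discrete relation between a flux and a scalar unknown. -/
def FluxRelation (T : Triangulation Ω) (k : ℕ) (q : T.Cell → Pt (m + 1) → Pt (m + 1))
    (y : T.Cell → Pt (m + 1) → ℝ) (yhat : T.Face → Pt (m + 1) → ℝ) : Prop :=
  ∀ r, T.MemV k r → T.cellInt (fun K x => ⟪q K x, r K x⟫ - y K x * divCell r K x)
    + T.bdryInt (fun F x => yhat F.face x * ⟪r F.cell x, F.normal⟫) = 0

section Energy

variable {ζ : Pt (m + 1) → Pt (m + 1)} {dζ γ : Pt (m + 1) → ℝ} {τ : T.HalfFace → ℝ}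
  {q p : T.Cell → Pt (m + 1) → Pt (m + 1)} {y s : T.Cell → Pt (m + 1) → ℝ}
  {yhat shat : T.Face → Pt (m + 1) → ℝ}

theorem cellIntegrable_flux (hq : T.MemV k q) (hp : T.MemV k p) (hy : T.MemW k y) :
    CellIntegrable fun K x => ⟪q K x, p K x⟫ - y K x * divCell p K x :=
  CellIntegrable.of_continuousOn fun K => (((hq.continuous K).inner (hp.continuous K)).sub
    ((hy K).continuous.mul (memW_divCell hp K).continuous)).continuousOn

theorem cellIntegrable_div_mul (hp : T.MemV k p) (hy : T.MemW k y) :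
    CellIntegrable fun K x => divCell p K x * y K x + fderiv ℝ (y K) x (p K x) :=
  CellIntegrable.of_continuousOn fun K =>
    ((memW_divCell hp K).continuous.mul (hy K).continuous).continuousOn.add
      (continuousOn_fderiv_apply hy K (hp.continuous K).continuousOn)

theorem cellIntegrable_convection (hΩ : IsConvexPolytopeDomain Ω) (hζ : ContinuousOn ζ (closure Ω))
    (hdζ : MemLp dζ 2 (volume.restrict Ω)) (hy : T.MemW k y) (hs : T.MemW k s) :
    CellIntegrable fun K x => dζ x * (y K x * s K x)
      + (s K x * fderiv ℝ (y K) x (ζ x) + y K x * fderiv ℝ (s K) x (ζ x)) :=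
  (CellIntegrable.memLp_mul hΩ hdζ fun K =>
    ((hy K).continuous.mul (hs K).continuous).continuousOn).add
    (CellIntegrable.of_continuousOn fun K =>
      ((hs K).continuous.continuousOn.mul (continuousOn_fderiv_apply hy K (continuousOn_cell hζ K))).add
      ((hy K).continuous.continuousOn.mul (continuousOn_fderiv_apply hs K (continuousOn_cell hζ K))))

theorem cellIntegrable_state (hΩ : IsConvexPolytopeDomain Ω) (hζ : ContinuousOn ζ (closure Ω))
    (hdζ : MemLp dζ 2 (volume.restrict Ω)) (hγ : MemLp γ 2 (volume.restrict Ω))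
    (hq : T.MemV k q) (hy : T.MemW k y) (hs : T.MemW k s) :
    CellIntegrable fun K x => (γ x - dζ x) * (y K x * s K x)
      - (fderiv ℝ (s K) x (q K x) + y K x * fderiv ℝ (s K) x (ζ x)) :=
  (CellIntegrable.memLp_mul hΩ (hγ.sub hdζ) fun K =>
    ((hy K).continuous.mul (hs K).continuous).continuousOn).sub
    (CellIntegrable.of_continuousOn fun K =>
      (continuousOn_fderiv_apply hs K (hq.continuous K).continuousOn).add
      ((hy K).continuous.continuousOn.mul (continuousOn_fderiv_apply hs K (continuousOn_cell hζ K))))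

theorem cellIntegrable_adjoint (hΩ : IsConvexPolytopeDomain Ω) (hζ : ContinuousOn ζ (closure Ω))
    (hγ : MemLp γ 2 (volume.restrict Ω))
    (hq : T.MemV k q) (hy : T.MemW k y) (hs : T.MemW k s) :
    CellIntegrable fun K x => γ x * (y K x * s K x)
      - (fderiv ℝ (s K) x (q K x) - y K x * fderiv ℝ (s K) x (ζ x)) :=
  (CellIntegrable.memLp_mul hΩ hγ fun K =>
    ((hy K).continuous.mul (hs K).continuous).continuousOn).sub
    (CellIntegrable.of_continuousOn fun K =>
      (continuousOn_fderiv_apply hs K (hq.continuous K).continuousOn).sub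
      ((hy K).continuous.continuousOn.mul (continuousOn_fderiv_apply hs K (continuousOn_cell hζ K))))

theorem cellIntegrable_energy (hΩ : IsConvexPolytopeDomain Ω)
    (hdζ : MemLp dζ 2 (volume.restrict Ω)) (hγ : MemLp γ 2 (volume.restrict Ω))
    (hq : T.MemV k q) (hy : T.MemW k y) :
    CellIntegrable fun K x => ⟪q K x, q K x⟫ + (γ x - 1 / 2 * dζ x) * (y K x * y K x) :=
  (CellIntegrable.of_continuousOn fun K =>
      ((hq.continuous K).inner (hq.continuous K)).continuousOn).add
    (CellIntegrable.memLp_mul hΩ (hγ.sub (hdζ.const_mul (1 / 2))) fun K =>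
    ((hy K).continuous.mul (hy K).continuous).continuousOn)

theorem faceCont_state (hζ : ContinuousOn ζ (closure Ω)) (hq : T.MemV k q) (hy : T.MemW k y)
    (hyhat : T.MemLambda0 k yhat) (hs : T.MemW k s) (hshat : T.MemLambda0 k shat) :
    FaceCont fun F x => (⟪q F.cell x, F.normal⟫ + τ F * y F.cell x
      + (⟪ζ x, F.normal⟫ - τ F) * yhat F.face x) * (s F.cell x - shat F.face x) :=
  (((faceCont_normalTrace hq).add ((faceCont_const τ).mul (faceCont_cellTrace hy))).add
    (((faceCont_inner_normal hζ).sub (faceCont_const τ)).mul (faceCont_faceTrace hyhat))).mul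
    ((faceCont_cellTrace hs).sub (faceCont_faceTrace hshat))

theorem faceCont_energy (hζ : ContinuousOn ζ (closure Ω)) (hy : T.MemW k y)
    (hyhat : T.MemLambda0 k yhat) :
    FaceCont fun F x => (τ F - 1 / 2 * ⟪ζ x, F.normal⟫) *
      ((y F.cell x - yhat F.face x) * (y F.cell x - yhat F.face x)) :=
  ((faceCont_const τ).sub ((faceCont_inner_normal hζ).const_mul (1 / 2))).mul
    (((faceCont_cellTrace hy).sub (faceCont_faceTrace hyhat)).mul
      ((faceCont_cellTrace hy).sub (faceCont_faceTrace hyhat)))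

/-- The energy identity of the state form. -/
theorem stateForm_self (hΩ : IsConvexPolytopeDomain Ω) (hζ : ContinuousOn ζ (closure Ω))
    (hdiv : HasWeakDiv Ω ζ dζ) (hdζ : MemLp dζ 2 (volume.restrict Ω))
    (hγ : MemLp γ 2 (volume.restrict Ω)) (hq : T.MemV k q) (hy : T.MemW k y)
    (hyhat : T.MemLambda0 k yhat) (hflux : T.FluxRelation k q y yhat) :
    T.stateForm ζ dζ γ τ q y yhat y yhat
      = T.cellInt (fun K x => ⟪q K x, q K x⟫ + (γ x - 1 / 2 * dζ x) * (y K x * y K x))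
        + T.bdryInt fun F x => (τ F - 1 / 2 * ⟪ζ x, F.normal⟫) *
          ((y F.cell x - yhat F.face x) * (y F.cell x - yhat F.face x)) := by
  -- Four identities are combined: the flux relation tested with q, integration by parts of div q
  -- against y, half of the divergence theorem for ζ y², and the vanishing of ζ · n against yhat².
  -- The numerical coefficients below are those that turn the form into the energy.
  have h1 := hflux q hq
  have h2 := cellInt_div_mul hq hy
  have h3 := cellInt_convection hΩ hζ hdiv hdζ hy hy
  have h4 := bdryInt_normal_mul_mul hΩ hζ hyhat hyhat
  have c := cellInt_comb (T := T) (φ := fun K x => (γ x - dζ x) * (y K x * y K x)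
      - (fderiv ℝ (y K) x (q K x) + y K x * fderiv ℝ (y K) x (ζ x)))
    (cellIntegrable_energy hΩ hdζ hγ hq hy) (cellIntegrable_flux hq hq hy)
    (cellIntegrable_div_mul hq hy) (cellIntegrable_convection hΩ hζ hdζ hy hy)
    CellIntegrable.zero CellIntegrable.zero 1 (-1) (-1) (-1 / 2) 0 0 (fun K x _ => by ring)
  have nc := faceCont_inner_normal (T := T) hζ
  have b := bdryInt_comb (T := T) (φ := fun F x => (⟪q F.cell x, F.normal⟫ + τ F * y F.cell x
      + (⟪ζ x, F.normal⟫ - τ F) * yhat F.face x) * (y F.cell x - yhat F.face x))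
    (faceCont_energy (τ := τ) hζ hy hyhat)
    ((faceCont_faceTrace hyhat).mul (faceCont_normalTrace hq))
    ((faceCont_normalTrace hq).mul (faceCont_cellTrace hy))
    (nc.mul ((faceCont_cellTrace hy).mul (faceCont_cellTrace hy)))
    (nc.mul ((faceCont_faceTrace hyhat).mul (faceCont_faceTrace hyhat)))
    FaceCont.zero FaceCont.zero 1 (-1) 1 (1 / 2) (-1 / 2) 0 0 (fun F x _ => by ring)
  rw [stateForm, c, b]
  linarith

/-- The energy identity of the adjoint form. -/
theorem adjointForm_self (hΩ : IsConvexPolytopeDomain Ω) (hζ : ContinuousOn ζ (closure Ω))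
    (hdiv : HasWeakDiv Ω ζ dζ) (hdζ : MemLp dζ 2 (volume.restrict Ω))
    (hγ : MemLp γ 2 (volume.restrict Ω)) (hq : T.MemV k q) (hy : T.MemW k y)
    (hyhat : T.MemLambda0 k yhat) (hflux : T.FluxRelation k q y yhat) :
    T.adjointForm ζ γ τ q y yhat y yhat
      = T.cellInt (fun K x => ⟪q K x, q K x⟫ + (γ x - 1 / 2 * dζ x) * (y K x * y K x))
        + T.bdryInt fun F x => (τ F - 1 / 2 * ⟪ζ x, F.normal⟫) *
          ((y F.cell x - yhat F.face x) * (y F.cell x - yhat F.face x)) := by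
  have h1 := hflux q hq
  have h2 := cellInt_div_mul hq hy
  -- The convective identity enters with the opposite sign to that in the state form, so that again
  -- γ - 1/2 * dζ remains.
  have h3 := cellInt_convection hΩ hζ hdiv hdζ hy hy
  have h4 := bdryInt_normal_mul_mul hΩ hζ hyhat hyhat
  have c := cellInt_comb (T := T) (φ := fun K x => γ x * (y K x * y K x)
      - (fderiv ℝ (y K) x (q K x) - y K x * fderiv ℝ (y K) x (ζ x)))
    (cellIntegrable_energy hΩ hdζ hγ hq hy) (cellIntegrable_flux hq hq hy)
    (cellIntegrable_div_mul hq hy) (cellIntegrable_convection hΩ hζ hdζ hy hy)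
    CellIntegrable.zero CellIntegrable.zero 1 (-1) (-1) (1 / 2) 0 0 (fun K x _ => by ring)
  have nc := faceCont_inner_normal (T := T) hζ
  have b := bdryInt_comb (T := T) (φ := fun F x => (⟪q F.cell x, F.normal⟫
      + (τ F - ⟪ζ x, F.normal⟫) * y F.cell x - τ F * yhat F.face x) *
      (y F.cell x - yhat F.face x))
    (faceCont_energy (τ := τ) hζ hy hyhat)
    ((faceCont_faceTrace hyhat).mul (faceCont_normalTrace hq))
    ((faceCont_normalTrace hq).mul (faceCont_cellTrace hy))
    (nc.mul ((faceCont_cellTrace hy).mul (faceCont_cellTrace hy)))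
    (nc.mul ((faceCont_faceTrace hyhat).mul (faceCont_faceTrace hyhat)))
    FaceCont.zero FaceCont.zero 1 (-1) 1 (-1 / 2) (1 / 2) 0 0 (fun F x _ => by ring)
  rw [adjointForm, c, b]
  linarith

/-- The forms of the state and the adjoint equation are adjoint to each other. -/
theorem adjointForm_eq_stateForm (hΩ : IsConvexPolytopeDomain Ω) (hζ : ContinuousOn ζ (closure Ω))
    (hdiv : HasWeakDiv Ω ζ dζ) (hdζ : MemLp dζ 2 (volume.restrict Ω))
    (hγ : MemLp γ 2 (volume.restrict Ω)) (hq : T.MemV k q) (hy : T.MemW k y)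
    (hyhat : T.MemLambda0 k yhat) (hflux : T.FluxRelation k q y yhat)
    (hp : T.MemV k p) (hs : T.MemW k s) (hshat : T.MemLambda0 k shat)
    (hflux' : T.FluxRelation k p s shat) :
    T.adjointForm ζ γ τ p s shat y yhat = T.stateForm ζ dζ γ τ q y yhat s shat := by
  -- Each flux relation is tested with the flux of the other pair; the products of the two fluxes
  -- then cancel by symmetry.
  have h1 := hflux p hp
  have h1' := hflux' q hq
  have h2 := cellInt_div_mul hp hy
  have h2' := cellInt_div_mul hq hs
  have h3 := cellInt_convection hΩ hζ hdiv hdζ hy hs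
  have h4 := bdryInt_normal_mul_mul hΩ hζ hyhat hshat
  have c := cellInt_comb (T := T) (φ := fun K x => γ x * (s K x * y K x)
      - (fderiv ℝ (y K) x (p K x) - s K x * fderiv ℝ (y K) x (ζ x)))
    (cellIntegrable_state hΩ hζ hdζ hγ hq hy hs) (cellIntegrable_flux hq hp hy)
    (cellIntegrable_flux hp hq hs) (cellIntegrable_div_mul hp hy) (cellIntegrable_div_mul hq hs)
    (cellIntegrable_convection hΩ hζ hdζ hy hs)
    1 (-1) 1 (-1) 1 1 (fun K x _ => by rw [real_inner_comm (q K x) (p K x)]; ring)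
  have nc := faceCont_inner_normal (T := T) hζ
  have b := bdryInt_comb (T := T) (φ := fun F x => (⟪p F.cell x, F.normal⟫
      + (τ F - ⟪ζ x, F.normal⟫) * s F.cell x - τ F * shat F.face x) *
      (y F.cell x - yhat F.face x))
    (faceCont_state (τ := τ) hζ hq hy hyhat hs hshat)
    ((faceCont_faceTrace hyhat).mul (faceCont_normalTrace hp))
    ((faceCont_faceTrace hshat).mul (faceCont_normalTrace hq))
    ((faceCont_normalTrace hp).mul (faceCont_cellTrace hy))
    ((faceCont_normalTrace hq).mul (faceCont_cellTrace hs))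
    (nc.mul ((faceCont_cellTrace hy).mul (faceCont_cellTrace hs)))
    (nc.mul ((faceCont_faceTrace hyhat).mul (faceCont_faceTrace hshat)))
    1 (-1) 1 1 (-1) (-1) 1 (fun F x _ => by ring)
  rw [adjointForm, stateForm, c, b]
  linarith

end Energy

end Triangulation

end HDG

/-! ### Face projections and exact flux relations -/

namespace HDG

namespace Triangulation

variable {m k : ℕ} {Ω : Set (Pt (m + 1))} {T : Triangulation Ω}

/-! ### Projections -/

open Classical in
/-- The `L²`-projection onto `Λ_h^0`. -/
noncomputable def faceProj (T : Triangulation Ω) (k : ℕ) (u : Pt (m + 1) → ℝ) :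
    T.Face → Pt (m + 1) → ℝ := fun e =>
  if e.carrier ⊆ frontier Ω then fun _ => 0
  else l2Proj k ((μHE[m] : Measure (Pt (m + 1))).restrict e.carrier) u

theorem memLambda0_faceProj (u : Pt (m + 1) → ℝ) : T.MemLambda0 k (T.faceProj k u) := by
  refine ⟨fun e => ?_, fun e he x _ => ?_⟩
  · unfold faceProj
    split_ifs
    · exact IsPoly.zero
    · exact isPoly_l2Proj _ _ _
  · rw [faceProj, if_pos he]

theorem memLp_isPoly_face (F : T.HalfFace) (Q : Pt (m + 1) → ℝ) (hQ : IsPoly k Q) :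
    MemLp Q 2 (faceMeasure F) := memLp_face F hQ.continuous.continuousOn 2

section FaceProj

variable {u : Pt (m + 1) → ℝ}

theorem ae_faceMeasure (F : T.HalfFace) : ∀ᵐ x ∂(faceMeasure F), x ∈ F.face.carrier :=
  ae_restrict_mem (isCompact_face F.face).measurableSet

theorem ae_eq_zero_of_face_subset (h0 : ∀ x ∈ frontier Ω, u x = 0) (F : T.HalfFace)
    (h : F.face.carrier ⊆ frontier Ω) :
    ∀ᵐ x ∂(faceMeasure F), u x = 0 := by
  filter_upwards [ae_faceMeasure F] with x hx
  exact h0 x (h hx)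

/-- On boundary faces the projection is zero by definition, which is consistent because u vanishes
there. -/
theorem integral_faceProj_mul (hu : ContinuousOn u (closure Ω)) (h0 : ∀ x ∈ frontier Ω, u x = 0)
    (F : T.HalfFace) {Q : Pt (m + 1) → ℝ} (hQ : IsPoly k Q) :
    ∫ x, T.faceProj k u F.face x * Q x ∂(faceMeasure F) = ∫ x, u x * Q x ∂(faceMeasure F) := by
  by_cases h : F.face.carrier ⊆ frontier Ω
  · refine integral_congr_ae ?_
    filter_upwards [ae_eq_zero_of_face_subset h0 F h] with x hx
    rw [faceProj, if_pos h, hx]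
  · rw [faceProj, if_neg h]
    exact l2Proj_inner (memLp_isPoly_face F) (memLp_face F (hu.mono (face_subset_closure F)) 2) hQ

/-- The face projection is a best approximation, so its error is bounded by that of the element
projection from either side. -/
theorem integral_sub_faceProj_le (hu : ContinuousOn u (closure Ω))
    (h0 : ∀ x ∈ frontier Ω, u x = 0) (F : T.HalfFace) {Q : Pt (m + 1) → ℝ} (hQ : IsPoly k Q) :
    ∫ x, (u x - T.faceProj k u F.face x) ^ 2 ∂(faceMeasure F)
      ≤ ∫ x, (u x - Q x) ^ 2 ∂(faceMeasure F) := by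
  by_cases h : F.face.carrier ⊆ frontier Ω
  · refine le_of_eq_of_le ?_ (integral_nonneg fun x => sq_nonneg (u x - Q x))
    refine integral_eq_zero_of_ae ?_
    filter_upwards [ae_eq_zero_of_face_subset h0 F h] with x hx
    rw [faceProj, if_pos h, hx]; simp
  · rw [faceProj, if_neg h]
    exact l2Proj_best (memLp_isPoly_face F) (memLp_face F (hu.mono (face_subset_closure F)) 2) hQ

theorem bdryInt_faceProj_mul (hu : ContinuousOn u (closure Ω)) (h0 : ∀ x ∈ frontier Ω, u x = 0)
    {η : T.HalfFace → Pt (m + 1) → ℝ} (hη : ∀ F, IsPoly k (η F)) :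
    T.bdryInt (fun F x => T.faceProj k u F.face x * η F x) = T.bdryInt fun F x => u x * η F x :=
  Finset.sum_congr rfl fun F _ => integral_faceProj_mul hu h0 F (hη F)

end FaceProj

theorem MemLp.cell (hΩ : IsConvexPolytopeDomain Ω) {u : Pt (m + 1) → ℝ}
    (hu : MemLp u 2 (volume.restrict Ω)) (K : T.Cell) : MemLp u 2 (volume.restrict K.carrier) :=
  hu.mono_measure (restrict_cell_le hΩ K)

theorem cellInt_cellProj_mul (hΩ : IsConvexPolytopeDomain Ω) {u : Pt (m + 1) → ℝ}
    (hu : MemLp u 2 (volume.restrict Ω)) {w : T.Cell → Pt (m + 1) → ℝ} (hw : T.MemW k w) :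
    T.cellInt (fun K x => T.cellProj k u K x * w K x) = T.cellInt fun K x => u x * w K x :=
  Finset.sum_congr rfl fun K _ => l2Proj_inner (memLp_isPoly_cell K) (MemLp.cell hΩ hu K) (hw K)

theorem cellInt_inner_cellProjVec (hΩ : IsConvexPolytopeDomain Ω) {V : Pt (m + 1) → Pt (m + 1)}
    (hV : ∀ i, MemLp (fun x => V x i) 2 (volume.restrict Ω))
    {r : T.Cell → Pt (m + 1) → Pt (m + 1)} (hr : T.MemV k r) :
    T.cellInt (fun K x => ⟪T.cellProjVec k V K x, r K x⟫)
      = T.cellInt fun K x => ⟪V x, r K x⟫ := by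
  refine Finset.sum_congr rfl fun K _ => ?_
  simp_rw [inner_eq_sum]
  rw [integral_finsetSum, integral_finsetSum]
  · exact Finset.sum_congr rfl fun i _ =>
      l2Proj_inner (memLp_isPoly_cell K) (MemLp.cell hΩ (hV i) K) (hr K i)
  · exact fun i _ => (MemLp.cell hΩ (hV i) K).integrable_mul
      (memLp_cell K (hr K i).continuous.continuousOn)
  · exact fun i _ => integrableOn_cell K
      ((memV_cellProjVec V K i).continuous.mul (hr K i).continuous).continuousOn

theorem cellIntegrable_inner (hΩ : IsConvexPolytopeDomain Ω) {V : Pt (m + 1) → Pt (m + 1)}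
    (hV : ∀ i, MemLp (fun x => V x i) 2 (volume.restrict Ω))
    {r : T.Cell → Pt (m + 1) → Pt (m + 1)} (hr : T.MemV k r) :
    CellIntegrable fun K x => ⟪V x, r K x⟫ := fun K => by
  simp_rw [inner_eq_sum]
  exact integrable_finsetSum _ fun i _ => (MemLp.cell hΩ (hV i) K).integrable_mul
      (memLp_cell K (hr K i).continuous.continuousOn)

/-- The elementwise gradient of a discrete function. -/
noncomputable def gradCell (w : T.Cell → Pt (m + 1) → ℝ) : T.Cell → Pt (m + 1) → Pt (m + 1) :=
  fun K x => WithLp.toLp 2 fun i => fderiv ℝ (w K) x (unitVec i)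

theorem memV_gradCell {w : T.Cell → Pt (m + 1) → ℝ} (hw : T.MemW k w) : T.MemV k (gradCell w) :=
  fun K i => (hw K).fderiv (unitVec i)

theorem fderiv_eq_inner_gradCell (w : T.Cell → Pt (m + 1) → ℝ) (K : T.Cell) (x v : Pt (m + 1)) :
    fderiv ℝ (w K) x v = ⟪v, gradCell w K x⟫ := by
  rw [inner_eq_sum, fderiv_eq_sum]; rfl

theorem cellInt_weakGradient (hΩ : IsConvexPolytopeDomain Ω)
    {y : Pt (m + 1) → ℝ} (hy : ContinuousOn y (closure Ω)) {G : Pt (m + 1) → Pt (m + 1)}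
    (hG : HasWeakGradient Ω y G) (hGL : ∀ i, MemLp (fun x => G x i) 2 (volume.restrict Ω))
    {r : T.Cell → Pt (m + 1) → Pt (m + 1)} (hr : T.MemV k r) :
    T.cellInt (fun K x => y x * divCell r K x + ⟪G x, r K x⟫)
      = T.bdryInt fun F x => y x * ⟪r F.cell x, F.normal⟫ := by
  rw [cellInt, bdryInt, sum_halfFace]
  refine Finset.sum_congr rfl fun K _ => ?_
  have h := integral_cell_weakGradient hΩ K hy hG hGL (r := fun i x => r K x i)
    fun i => (hr K i).contDiff
  simp_rw [inner_eq_sum, divCell_eq hr, mul_comm (y _)]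
  rw [h]
  refine Finset.sum_congr rfl fun v _ => ?_
  rw [← integral_finsetSum]
  · congr 1; ext x
    rw [Finset.sum_mul]
    exact Finset.sum_congr rfl fun i _ => by rw [oppFace_cell]; ring
  · exact fun i _ => integrable_face _ (((hy.mono (face_subset_closure _)).mul
      (hr K i).continuous.continuousOn).mul continuousOn_const)

/-- Integration by parts for the convection of a continuous function with a weak gradient. -/
theorem cellInt_convection_weakGradient (hΩ : IsConvexPolytopeDomain Ω)
    {ζ : Pt (m + 1) → Pt (m + 1)} (hζ : ContinuousOn ζ (closure Ω)) {dζ : Pt (m + 1) → ℝ}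
    (hdζ : HasWeakDiv Ω ζ dζ) (hdζL : MemLp dζ 2 (volume.restrict Ω))
    {y : Pt (m + 1) → ℝ} (hy : ContinuousOn y (closure Ω)) {G : Pt (m + 1) → Pt (m + 1)}
    (hG : HasWeakGradient Ω y G) (hGL : ∀ i, MemLp (fun x => G x i) 2 (volume.restrict Ω))
    {w : T.Cell → Pt (m + 1) → ℝ} (hw : T.MemW k w) {μ : T.Face → Pt (m + 1) → ℝ}
    (hμ : T.MemLambda0 k μ) :
    T.cellInt (fun K x => (dζ x * y x + ⟪ζ x, G x⟫) * w K x + y x * fderiv ℝ (w K) x (ζ x))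
      = T.bdryInt fun F x => (y x * ⟪ζ x, F.normal⟫) * (w F.cell x - μ F.face x) := by
  have hζi : ∀ i, ContinuousOn (fun x => ζ x i) (closure Ω) := fun i =>
    (EuclideanSpace.proj i : Pt (m + 1) →L[ℝ] ℝ).continuous.comp_continuousOn hζ
  have key : T.cellInt (fun K x => (dζ x * y x + ⟪ζ x, G x⟫) * w K x
        + y x * fderiv ℝ (w K) x (ζ x))
      = T.bdryInt fun F x => (y x * ⟪ζ x, F.normal⟫) * w F.cell x := by
    rw [cellInt, bdryInt, sum_halfFace]
    refine Finset.sum_congr rfl fun K _ => ?_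
    have h := integral_cell_convection hΩ K hζ hdζ hdζL hy hG hGL (hw K).contDiff
    have hc : ∀ i, Continuous fun x => fderiv ℝ (w K) x (unitVec i) := fun i =>
      ((hw K).contDiff.continuous_fderiv (by simp)).clm_apply continuous_const
    have i1 : ∀ i, IntegrableOn (fun x => (y x * ζ x i) * fderiv ℝ (w K) x (unitVec i))
        K.carrier := fun i => integrableOn_cell K (((continuousOn_cell hy K).mul
          (continuousOn_cell (hζi i) K)).mul (hc i).continuousOn)
    have hwL := memLp_cell K (hw K).continuous.continuousOn
    have i2 : IntegrableOn (fun x => (dζ x * y x + ∑ i, G x i * ζ x i) * w K x) K.carrier := by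
      simp_rw [add_mul, Finset.sum_mul, mul_assoc]
      refine Integrable.add ?_ (integrable_finsetSum _ fun i _ => ?_)
      · exact (MemLp.cell hΩ hdζL K).integrable_mul (memLp_cell K
          ((continuousOn_cell hy K).mul (hw K).continuous.continuousOn))
      · exact (MemLp.cell hΩ (hGL i) K).integrable_mul (memLp_cell K
          ((continuousOn_cell (hζi i) K).mul (hw K).continuous.continuousOn))
    have e1 : ∀ x, (dζ x * y x + ⟪ζ x, G x⟫) * w K x + y x * fderiv ℝ (w K) x (ζ x)
        = (dζ x * y x + ∑ i, G x i * ζ x i) * w K x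
          + ∑ i, (y x * ζ x i) * fderiv ℝ (w K) x (unitVec i) := fun x => by
      rw [fderiv_eq_sum (fderiv ℝ (w K) x) (ζ x), real_inner_comm, inner_eq_sum, Finset.mul_sum]
      simp_rw [mul_assoc]
    simp_rw [e1]
    rw [integral_add i2 (integrable_finsetSum _ fun i _ => i1 i),
      integral_finsetSum _ fun i _ => i1 i, h]
    refine Finset.sum_congr rfl fun v _ => ?_
    rw [← integral_finsetSum]
    · congr 1; ext x
      rw [inner_eq_sum, Finset.mul_sum, Finset.sum_mul]
      exact Finset.sum_congr rfl fun i _ => by rw [oppFace_cell]; ring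
    · exact fun i _ => integrable_face _ (((hy.mono (face_subset_closure _)).mul
        ((hζi i).mono (face_subset_closure _))).mul
        (continuous_const.mul (hw K).continuous).continuousOn)
  have h0 := sum_integral_normal_mul_eq_zero hΩ (ψ := fun x => y x • ζ x) (hy.smul hζ) hμ
  have h0' : T.bdryInt (fun F x => (y x * ⟪ζ x, F.normal⟫) * μ F.face x) = 0 := by
    rw [← h0]
    refine Finset.sum_congr rfl fun F _ => ?_
    simp only [real_inner_smul_left]
  have nc := (faceCont_of_closure (T := T) hy).mul (faceCont_inner_normal (T := T) hζ)
  have b := bdryInt_comb (T := T)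
    (φ := fun F x => (y x * ⟪ζ x, F.normal⟫) * (w F.cell x - μ F.face x))
    (nc.mul (faceCont_cellTrace hw)) (nc.mul (faceCont_faceTrace hμ))
    FaceCont.zero FaceCont.zero FaceCont.zero FaceCont.zero FaceCont.zero
    1 (-1) 0 0 0 0 0 (fun F x _ => by ring)
  rw [key, b]
  linarith

/-! ### Flux relations -/

theorem FluxRelation.sub {q q' : T.Cell → Pt (m + 1) → Pt (m + 1)}
    {y y' : T.Cell → Pt (m + 1) → ℝ} {yhat yhat' : T.Face → Pt (m + 1) → ℝ}
    (hq : T.MemV k q) (hq' : T.MemV k q') (hy : T.MemW k y) (hy' : T.MemW k y')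
    (hyhat : T.MemLambda0 k yhat) (hyhat' : T.MemLambda0 k yhat')
    (h : T.FluxRelation k q y yhat) (h' : T.FluxRelation k q' y' yhat') :
    T.FluxRelation k (fun K x => q K x - q' K x) (fun K x => y K x - y' K x)
      (fun e x => yhat e x - yhat' e x) := by
  intro r hr
  have h1 := h r hr
  have h2 := h' r hr
  have c := cellInt_comb (T := T)
    (φ := fun K x => ⟪q K x - q' K x, r K x⟫ - (y K x - y' K x) * divCell r K x)
    (cellIntegrable_flux hq hr hy) (cellIntegrable_flux hq' hr hy')
    CellIntegrable.zero CellIntegrable.zero CellIntegrable.zero CellIntegrable.zero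
    1 (-1) 0 0 0 0 (fun K x _ => by rw [inner_sub_left]; ring)
  have b := bdryInt_comb (T := T)
    (φ := fun F x => (yhat F.face x - yhat' F.face x) * ⟪r F.cell x, F.normal⟫)
    ((faceCont_faceTrace hyhat).mul (faceCont_normalTrace hr))
    ((faceCont_faceTrace hyhat').mul (faceCont_normalTrace hr))
    FaceCont.zero FaceCont.zero FaceCont.zero FaceCont.zero FaceCont.zero
    1 (-1) 0 0 0 0 0 (fun F x _ => by ring)
  rw [c, b]
  linarith

/-- The projections of a function and of its negative gradient satisfy the flux relation. -/
theorem fluxRelation_proj (hΩ : IsConvexPolytopeDomain Ω)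
    {y : Pt (m + 1) → ℝ} (hy : ContinuousOn y (closure Ω)) (h0 : ∀ x ∈ frontier Ω, y x = 0)
    {G V : Pt (m + 1) → Pt (m + 1)}
    (hG : HasWeakGradient Ω y G) (hGL : ∀ i, MemLp (fun x => G x i) 2 (volume.restrict Ω))
    (hVL : ∀ i, MemLp (fun x => V x i) 2 (volume.restrict Ω))
    (hVG : ∀ᵐ x ∂volume.restrict Ω, V x + G x = 0) :
    T.FluxRelation k (T.cellProjVec k V) (T.cellProj k y) (T.faceProj k y) := by
  intro r hr
  have hyL := memLp_of_continuousOn_closure hΩ hy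
  have c := cellInt_comb (T := T)
    (φ := fun K x => ⟪T.cellProjVec k V K x, r K x⟫ - T.cellProj k y K x * divCell r K x)
    (φ₁ := fun K x => ⟪T.cellProjVec k V K x, r K x⟫)
    (φ₂ := fun K x => T.cellProj k y K x * divCell r K x)
    (CellIntegrable.of_continuousOn fun K => (((memV_cellProjVec V).continuous K).inner
      (hr.continuous K)).continuousOn)
    (CellIntegrable.of_continuousOn fun K => ((isPoly_cellProj y K).continuous.mul
      (memW_divCell hr K).continuous).continuousOn)
    CellIntegrable.zero CellIntegrable.zero CellIntegrable.zero CellIntegrable.zero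
    1 (-1) 0 0 0 0 (fun K x _ => by ring)
  have i1 : CellIntegrable fun (K : T.Cell) x => y x * divCell r K x :=
    CellIntegrable.memLp_mul hΩ hyL fun K => (memW_divCell hr K).continuous.continuousOn
  have hg := cellInt_weakGradient (T := T) hΩ hy hG hGL hr
  rw [cellInt_add i1 (cellIntegrable_inner hΩ hGL hr)] at hg
  have hVG' : T.cellInt (fun K x => ⟪V x, r K x⟫) = - T.cellInt (fun K x => ⟪G x, r K x⟫) := by
    rw [← neg_one_mul, ← cellInt_const_mul]
    refine Finset.sum_congr rfl fun K _ => integral_congr_ae ?_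
    filter_upwards [ae_mono (restrict_cell_le hΩ K) hVG] with x hx
    rw [eq_neg_of_add_eq_zero_left hx, inner_neg_left]; ring
  -- As r, div r and r · n are polynomials of degree at most k, all three projections may be
  -- dropped; integration by parts for y remains.
  rw [c, cellInt_inner_cellProjVec hΩ hVL hr, cellInt_cellProj_mul hΩ hyL (memW_divCell hr),
    bdryInt_faceProj_mul hy h0, ← hg, hVG']
  · ring
  · intro F
    simp_rw [inner_eq_sum]
    exact IsPoly.sum _ fun i _ => (hr F.cell i).mul_const _

end Triangulation

end HDG

/-! ### Discrete equations and consistency in terms of the forms -/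

namespace HDG

namespace Triangulation

variable {m k : ℕ} {Ω : Set (Pt (m + 1))} {T : Triangulation Ω}

/-! ### The equations of the method in terms of the forms -/

section Method

variable {β : ℝ} {ζ : Pt (m + 1) → Pt (m + 1)} {dζ γ f g : Pt (m + 1) → ℝ}
  {τ₁ : T.HalfFace → ℝ} {τ₂ : T.HalfFace → Pt (m + 1) → ℝ} {C₁ Cstar : ℝ}
  {qh ph : T.Cell → Pt (m + 1) → Pt (m + 1)} {yh sh : T.Cell → Pt (m + 1) → ℝ}
  {yhat phat : T.Face → Pt (m + 1) → ℝ}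

theorem fluxRelation_of_eq (hβ : 0 < β) (hq : T.MemV k qh) (hy : T.MemW k yh)
    (h : ∀ r, T.MemV k r →
      Real.sqrt β * T.innerCellVec qh r - Real.sqrt β * T.innerCell yh (divCell r)
        + Real.sqrt β * T.innerBdry (faceTrace yhat) (normalTrace r) = 0) :
    T.FluxRelation k qh yh yhat := by
  intro r hr
  have h1 := h r hr
  rw [innerCellVec_eq, innerCell_eq, innerBdry_eq] at h1
  have c := cellInt_comb (T := T)
    (φ := fun K x => ⟪qh K x, r K x⟫ - yh K x * divCell r K x)
    (φ₁ := fun K x => ⟪qh K x, r K x⟫) (φ₂ := fun K x => yh K x * divCell r K x)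
    (CellIntegrable.of_continuousOn fun K => ((hq.continuous K).inner
      (hr.continuous K)).continuousOn)
    (CellIntegrable.of_continuousOn fun K => ((hy K).continuous.mul
      (memW_divCell hr K).continuous).continuousOn)
    CellIntegrable.zero CellIntegrable.zero CellIntegrable.zero CellIntegrable.zero
    1 (-1) 0 0 0 0 (fun K x _ => by ring)
  rw [c]
  simp only [faceTrace, normalTrace] at h1
  have hb := (Real.sqrt_pos.2 hβ).ne'
  refine mul_left_cancel₀ hb ?_
  linarith

/-- The equation tested with w and the transmission condition tested with μ are added; integrating
div qh against w by parts turns the sum into the form. -/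
theorem stateForm_hdg (hΩ : IsConvexPolytopeDomain Ω) (hζ : ContinuousOn ζ (closure Ω))
    (hdζ : MemLp dζ 2 (volume.restrict Ω)) (hγ : MemLp γ 2 (volume.restrict Ω))
    (H : T.IsHDGSolution k β ζ dζ γ f g τ₁ τ₂ qh yh yhat ph sh phat)
    {w : T.Cell → Pt (m + 1) → ℝ} (hw : T.MemW k w) {μ : T.Face → Pt (m + 1) → ℝ}
    (hμ : T.MemLambda0 k μ) :
    Real.sqrt β * T.stateForm ζ dζ γ τ₁ qh yh yhat w μ - T.cellInt (fun K x => sh K x * w K x)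
      = T.cellInt fun K x => g x * w K x := by
  have h1 := H.eq_state w hw
  have h2 := H.eq_yhat μ hμ
  simp only [innerCell_eq, innerBdry_eq, faceTrace, normalTrace, cellTrace, zetaN, zetaGrad]
    at h1 h2
  have h3 := cellInt_div_mul H.mem_qh hw
  have iw : ∀ K, Continuous (w K) := fun K => (hw K).continuous
  have iy : ∀ K, Continuous (yh K) := fun K => (H.mem_yh K).continuous
  have i0 := cellIntegrable_div_mul H.mem_qh hw
  have i1 : CellIntegrable fun K x => divCell qh K x * w K x :=
    CellIntegrable.of_continuousOn fun K =>
      ((memW_divCell H.mem_qh K).continuous.mul (iw K)).continuousOn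
  have i2 : CellIntegrable fun K x => yh K x * fderiv ℝ (w K) x (ζ x) :=
    CellIntegrable.of_continuousOn fun K => (iy K).continuousOn.mul
      (continuousOn_fderiv_apply hw K (continuousOn_cell hζ K))
  have i3 : CellIntegrable fun K x => (γ x - dζ x) * yh K x * w K x := by
    simp_rw [mul_assoc]
    exact CellIntegrable.memLp_mul hΩ (hγ.sub hdζ) fun K => ((iy K).mul (iw K)).continuousOn
  have c := cellInt_comb (T := T)
    (φ := fun K x => (γ x - dζ x) * (yh K x * w K x)
      - (fderiv ℝ (w K) x (qh K x) + yh K x * fderiv ℝ (w K) x (ζ x)))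
    i0 i1 i2 i3 CellIntegrable.zero CellIntegrable.zero (-1) 1 (-1) 1 0 0
    (fun K x _ => by ring)
  have nq := faceCont_normalTrace H.mem_qh
  have tw := faceCont_cellTrace hw
  have tμ := faceCont_faceTrace hμ
  have ty := (faceCont_const τ₁).mul (faceCont_cellTrace H.mem_yh)
  have tz := ((faceCont_inner_normal (T := T) hζ).sub (faceCont_const τ₁)).mul
    (faceCont_faceTrace H.mem_yhat)
  have b := bdryInt_comb (T := T) (φ := fun F x => (⟪qh F.cell x, F.normal⟫ + τ₁ F * yh F.cell x
      + (⟪ζ x, F.normal⟫ - τ₁ F) * yhat F.face x) * (w F.cell x - μ F.face x))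
    (nq.mul tw) (nq.mul tμ) (ty.mul tw) (ty.mul tμ) (tz.mul tw) (tz.mul tμ) FaceCont.zero
    1 (-1) 1 (-1) 1 (-1) 0 (fun F x _ => by ring)
  rw [stateForm, c, b]
  linear_combination h1 + h2 - Real.sqrt β * h3

/-- As for the state, after τ₂ has been eliminated by τ₂ = τ₁ - ζ · n. This relation holds only at
points of the faces, hence the congruences of boundary integrals. -/
theorem adjointForm_hdg (hΩ : IsConvexPolytopeDomain Ω) (hζ : ContinuousOn ζ (closure Ω))
    (hγ : MemLp γ 2 (volume.restrict Ω)) (hτ : T.StabilizerAssumption ζ C₁ Cstar τ₁ τ₂)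
    (H : T.IsHDGSolution k β ζ dζ γ f g τ₁ τ₂ qh yh yhat ph sh phat)
    {w : T.Cell → Pt (m + 1) → ℝ} (hw : T.MemW k w) {μ : T.Face → Pt (m + 1) → ℝ}
    (hμ : T.MemLambda0 k μ) :
    Real.sqrt β * T.adjointForm ζ γ τ₁ ph sh phat w μ + T.cellInt (fun K x => yh K x * w K x)
      = T.cellInt fun K x => f x * w K x := by
  have h1 := H.eq_adjoint w hw
  have h2 := H.eq_phat μ hμ
  have r1 : ∀ F, ∀ x ∈ F.face.carrier, τ₂ F x = τ₁ F - ⟪ζ x, F.normal⟫ := fun F x hx => by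
    rw [hτ.rel F x hx, zetaN]; ring
  have r2 : ∀ F, ∀ x ∈ F.face.carrier, τ₂ F x + ⟪ζ x, F.normal⟫ = τ₁ F := fun F x hx => by
    rw [r1 F x hx]; ring
  have r3 : ∀ F, ∀ x ∈ F.face.carrier, ⟪ζ x, F.normal⟫ + τ₂ F x = τ₁ F := fun F x hx => by
    rw [r1 F x hx]; ring
  simp only [innerCell_eq, innerBdry_eq, faceTrace, normalTrace, cellTrace, zetaN, zetaGrad]
    at h1 h2
  rw [bdryInt_congr (T := T) (φ := fun F x => τ₂ F x * sh F.cell x * w F.cell x)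
      (ψ := fun F x => (τ₁ F - ⟪ζ x, F.normal⟫) * sh F.cell x * w F.cell x)
      fun F x hx => by rw [r1 F x hx],
    bdryInt_congr (T := T)
      (φ := fun F x => (τ₂ F x + ⟪ζ x, F.normal⟫) * phat F.face x * w F.cell x)
      (ψ := fun F x => τ₁ F * phat F.face x * w F.cell x)
      fun F x hx => by rw [r2 F x hx]] at h1
  rw [bdryInt_congr (T := T) (φ := fun F x => τ₂ F x * sh F.cell x * μ F.face x)
      (ψ := fun F x => (τ₁ F - ⟪ζ x, F.normal⟫) * sh F.cell x * μ F.face x)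
      fun F x hx => by rw [r1 F x hx],
    bdryInt_congr (T := T)
      (φ := fun F x => (⟪ζ x, F.normal⟫ + τ₂ F x) * phat F.face x * μ F.face x)
      (ψ := fun F x => τ₁ F * phat F.face x * μ F.face x)
      fun F x hx => by rw [r3 F x hx]] at h2
  have h3 := cellInt_div_mul H.mem_ph hw
  have iw : ∀ K, Continuous (w K) := fun K => (hw K).continuous
  have iy : ∀ K, Continuous (sh K) := fun K => (H.mem_sh K).continuous
  have i0 := cellIntegrable_div_mul H.mem_ph hw
  have i1 : CellIntegrable fun K x => divCell ph K x * w K x :=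
    CellIntegrable.of_continuousOn fun K =>
      ((memW_divCell H.mem_ph K).continuous.mul (iw K)).continuousOn
  have i2 : CellIntegrable fun K x => sh K x * fderiv ℝ (w K) x (ζ x) :=
    CellIntegrable.of_continuousOn fun K => (iy K).continuousOn.mul
      (continuousOn_fderiv_apply hw K (continuousOn_cell hζ K))
  have i3 : CellIntegrable fun K x => γ x * sh K x * w K x := by
    simp_rw [mul_assoc]
    exact CellIntegrable.memLp_mul hΩ hγ fun K => ((iy K).mul (iw K)).continuousOn
  have c := cellInt_comb (T := T)
    (φ := fun K x => γ x * (sh K x * w K x)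
      - (fderiv ℝ (w K) x (ph K x) - sh K x * fderiv ℝ (w K) x (ζ x)))
    i0 i1 i2 i3 CellIntegrable.zero CellIntegrable.zero (-1) 1 1 1 0 0
    (fun K x _ => by ring)
  have nq := faceCont_normalTrace H.mem_ph
  have tw := faceCont_cellTrace hw
  have tμ := faceCont_faceTrace hμ
  have ty := ((faceCont_const τ₁).sub (faceCont_inner_normal (T := T) hζ)).mul
    (faceCont_cellTrace H.mem_sh)
  have tz := (faceCont_const τ₁).mul (faceCont_faceTrace H.mem_phat)
  have b := bdryInt_comb (T := T) (φ := fun F x => (⟪ph F.cell x, F.normal⟫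
      + (τ₁ F - ⟪ζ x, F.normal⟫) * sh F.cell x - τ₁ F * phat F.face x) *
      (w F.cell x - μ F.face x))
    (nq.mul tw) (nq.mul tμ) (ty.mul tw) (ty.mul tμ) (tz.mul tw) (tz.mul tμ) FaceCont.zero
    1 (-1) 1 (-1) (-1) 1 0 (fun F x _ => by ring)
  rw [adjointForm, c, b]
  linear_combination h1 + h2 - Real.sqrt β * h3

end Method

/-! ### Consistency -/

/-- The failure of the projected flux `V` with divergence `d` to satisfy the discrete equations. -/
noncomputable def fluxDefect (T : Triangulation Ω) (k : ℕ) (V : Pt (m + 1) → Pt (m + 1))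
    (d : Pt (m + 1) → ℝ) (w : T.Cell → Pt (m + 1) → ℝ) (μ : T.Face → Pt (m + 1) → ℝ) : ℝ :=
  T.cellInt (fun K x => d x * w K x + fderiv ℝ (w K) x (V x))
    - T.bdryInt fun F x => ⟪T.cellProjVec k V F.cell x, F.normal⟫ * (w F.cell x - μ F.face x)

/-- The terms in which the projection errors of a scalar function `u` enter the discrete
equations. -/
noncomputable def scalarDefect (T : Triangulation Ω) (k : ℕ) (ζ : Pt (m + 1) → Pt (m + 1))
    (c : Pt (m + 1) → ℝ) (e : ℝ) (a a' : T.HalfFace → Pt (m + 1) → ℝ) (u : Pt (m + 1) → ℝ)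
    (w : T.Cell → Pt (m + 1) → ℝ) (μ : T.Face → Pt (m + 1) → ℝ) : ℝ :=
  T.cellInt (fun K x => c x * (u x - T.cellProj k u K x) * w K x)
    + e * T.cellInt (fun K x => (u x - T.cellProj k u K x) * fderiv ℝ (w K) x (ζ x))
    + T.bdryInt (fun F x => a F x * (u x - T.cellProj k u F.cell x) *
        (w F.cell x - μ F.face x))
    + T.bdryInt (fun F x => a' F x * (u x - T.faceProj k u F.face x) *
        (w F.cell x - μ F.face x))

section Consistency

variable {ζ : Pt (m + 1) → Pt (m + 1)} {dζ γ c : Pt (m + 1) → ℝ} {τ : T.HalfFace → ℝ}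
  {V : Pt (m + 1) → Pt (m + 1)} {u d : Pt (m + 1) → ℝ}
  {w : T.Cell → Pt (m + 1) → ℝ} {μ : T.Face → Pt (m + 1) → ℝ}

theorem cellIntegrable_memLp_mul (hΩ : IsConvexPolytopeDomain Ω)
    (hd : MemLp d 2 (volume.restrict Ω)) (hw : T.MemW k w) :
    CellIntegrable fun K x => d x * w K x :=
  CellIntegrable.memLp_mul hΩ hd fun K => (hw K).continuous.continuousOn

theorem cellIntegrable_fderiv (hΩ : IsConvexPolytopeDomain Ω)
    (hV : ∀ i, MemLp (fun x => V x i) 2 (volume.restrict Ω)) (hw : T.MemW k w) :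
    CellIntegrable fun K x => fderiv ℝ (w K) x (V x) := by
  simp_rw [fderiv_eq_inner_gradCell]
  exact cellIntegrable_inner hΩ hV (memV_gradCell hw)

theorem cellInt_fderiv_cellProjVec (hΩ : IsConvexPolytopeDomain Ω)
    (hV : ∀ i, MemLp (fun x => V x i) 2 (volume.restrict Ω)) (hw : T.MemW k w) :
    T.cellInt (fun K x => fderiv ℝ (w K) x (T.cellProjVec k V K x))
      = T.cellInt fun K x => fderiv ℝ (w K) x (V x) := by
  simp_rw [fderiv_eq_inner_gradCell]
  exact cellInt_inner_cellProjVec hΩ hV (memV_gradCell hw)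

theorem cellIntegrable_reaction (hΩ : IsConvexPolytopeDomain Ω)
    (hc : MemLp c 2 (volume.restrict Ω)) (hu : ContinuousOn u (closure Ω)) (hw : T.MemW k w) :
    CellIntegrable fun K x => c x * (u x - T.cellProj k u K x) * w K x := by
  simp_rw [mul_assoc]
  exact CellIntegrable.memLp_mul hΩ hc fun K => ((continuousOn_cell hu K).sub
    (isPoly_cellProj u K).continuous.continuousOn).mul (hw K).continuous.continuousOn

theorem cellIntegrable_sub_mul_fderiv (hζ : ContinuousOn ζ (closure Ω))
    (hu : ContinuousOn u (closure Ω)) (hw : T.MemW k w) :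
    CellIntegrable fun K x => (u x - T.cellProj k u K x) * fderiv ℝ (w K) x (ζ x) :=
  CellIntegrable.of_continuousOn fun K => ((continuousOn_cell hu K).sub
    (isPoly_cellProj u K).continuous.continuousOn).mul
    (continuousOn_fderiv_apply hw K (continuousOn_cell hζ K))

theorem faceCont_defect {a : T.HalfFace → Pt (m + 1) → ℝ} (ha : FaceCont a)
    (hu : ContinuousOn u (closure Ω)) (hw : T.MemW k w) (hμ : T.MemLambda0 k μ) :
    FaceCont fun F x => a F x * (u x - T.cellProj k u F.cell x) *
        (w F.cell x - μ F.face x) :=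
  (ha.mul ((faceCont_of_closure hu).sub (faceCont_cellTrace (isPoly_cellProj u)))).mul
    ((faceCont_cellTrace hw).sub (faceCont_faceTrace hμ))

theorem faceCont_defect_face {a : T.HalfFace → Pt (m + 1) → ℝ} (ha : FaceCont a)
    (hu : ContinuousOn u (closure Ω)) (hw : T.MemW k w) (hμ : T.MemLambda0 k μ) :
    FaceCont fun F x => a F x * (u x - T.faceProj k u F.face x) *
        (w F.cell x - μ F.face x) :=
  (ha.mul ((faceCont_of_closure hu).sub (faceCont_faceTrace (memLambda0_faceProj u)))).mul
    ((faceCont_cellTrace hw).sub (faceCont_faceTrace hμ))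

/-- The discrete state equation for the projections of the exact solution. -/
theorem stateForm_proj (hΩ : IsConvexPolytopeDomain Ω) (hζ : ContinuousOn ζ (closure Ω))
    (hdiv : HasWeakDiv Ω ζ dζ) (hdζ : MemLp dζ 2 (volume.restrict Ω))
    (hγ : MemLp γ 2 (volume.restrict Ω)) (hu : ContinuousOn u (closure Ω))
    {G : Pt (m + 1) → Pt (m + 1)} (hG : HasWeakGradient Ω u G)
    (hGL : ∀ i, MemLp (fun x => G x i) 2 (volume.restrict Ω))
    (hVL : ∀ i, MemLp (fun x => V x i) 2 (volume.restrict Ω))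
    (hdL : MemLp d 2 (volume.restrict Ω)) (hw : T.MemW k w) (hμ : T.MemLambda0 k μ) :
    T.stateForm ζ dζ γ τ (T.cellProjVec k V) (T.cellProj k u) (T.faceProj k u) w μ
      = T.cellInt (fun K x => (d x + ⟪ζ x, G x⟫ + γ x * u x) * w K x)
        - T.fluxDefect k V d w μ
        - T.scalarDefect k ζ (fun x => γ x - dζ x) (-1) (fun F _ => τ F)
          (fun F x => ⟪ζ x, F.normal⟫ - τ F) u w μ := by
  have h1 := cellInt_convection_weakGradient hΩ hζ hdiv hdζ hu hG hGL hw hμ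
  -- The elementwise gradient of w lies in V_h, so the projected flux may be exchanged for the flux
  -- itself.
  have h2 := cellInt_fderiv_cellProjVec hΩ hVL hw
  have hζi : ∀ i, ContinuousOn (fun x => ζ x i) (closure Ω) := fun i =>
    (EuclideanSpace.proj i : Pt (m + 1) →L[ℝ] ℝ).continuous.comp_continuousOn hζ
  have j1 := cellIntegrable_memLp_mul (T := T) hΩ hdL hw
  have j2 := cellIntegrable_fderiv (T := T) hΩ hVL hw
  have j3 : CellIntegrable fun (K : T.Cell) x => ⟪ζ x, G x⟫ * w K x := fun K => by
    simp_rw [fun x => real_inner_comm (G x) (ζ x), inner_eq_sum, Finset.sum_mul, mul_assoc]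
    exact integrable_finsetSum _ fun i _ => (MemLp.cell hΩ (hGL i) K).integrable_mul (memLp_cell K
      ((continuousOn_cell (hζi i) K).mul (hw K).continuous.continuousOn))
  have juw : ∀ K : T.Cell, ContinuousOn (fun x => u x * w K x) K.carrier := fun K =>
    (continuousOn_cell hu K).mul (hw K).continuous.continuousOn
  have j4 := CellIntegrable.memLp_mul (T := T) hΩ hγ juw
  have j5 := CellIntegrable.memLp_mul (T := T) hΩ hdζ juw
  have j6 : CellIntegrable fun (K : T.Cell) x => u x * fderiv ℝ (w K) x (ζ x) :=
    CellIntegrable.of_continuousOn fun K => (continuousOn_cell hu K).mul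
      (continuousOn_fderiv_apply hw K (continuousOn_cell hζ K))
  have j7 := cellIntegrable_reaction (T := T) hΩ (hγ.sub hdζ) hu hw
  have j8 := cellIntegrable_sub_mul_fderiv (T := T) hζ hu hw
  have j9 := cellIntegrable_fderiv (T := T) (V := V) hΩ hVL hw
  have j10 : CellIntegrable fun (K : T.Cell) x => fderiv ℝ (w K) x (T.cellProjVec k V K x) :=
    CellIntegrable.of_continuousOn fun K =>
      continuousOn_fderiv_apply hw K ((memV_cellProjVec V).continuous K).continuousOn
  have c1 := cellInt_comb (T := T) (φ := fun K x =>
      (dζ x * u x + ⟪ζ x, G x⟫) * w K x + u x * fderiv ℝ (w K) x (ζ x))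
    j5 j3 j6 CellIntegrable.zero CellIntegrable.zero CellIntegrable.zero 1 1 1 0 0 0
    (fun K x _ => by ring)
  have c2 := cellInt_comb (T := T) (φ := fun K x => (d x + ⟪ζ x, G x⟫ + γ x * u x) * w K x)
    j1 j3 j4 CellIntegrable.zero CellIntegrable.zero CellIntegrable.zero 1 1 1 0 0 0
    (fun K x _ => by ring)
  have c3 := cellInt_add j1 j2
  have c4 := cellInt_comb (T := T) (φ := fun K x => (γ x - dζ x) * (T.cellProj k u K x * w K x)
      - (fderiv ℝ (w K) x (T.cellProjVec k V K x) + T.cellProj k u K x * fderiv ℝ (w K) x (ζ x)))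
    j4 j5 j7 j10 j6 j8 1 (-1) (-1) (-1) (-1) 1 (fun K x _ => by simp only [Pi.sub_apply]; ring)
  have nc := faceCont_inner_normal (T := T) hζ
  have tw := (faceCont_cellTrace hw).sub (faceCont_faceTrace hμ)
  have b := bdryInt_comb (T := T) (φ := fun F x => (⟪T.cellProjVec k V F.cell x, F.normal⟫
      + τ F * T.cellProj k u F.cell x
      + (⟪ζ x, F.normal⟫ - τ F) * T.faceProj k u F.face x) * (w F.cell x - μ F.face x))
    ((faceCont_normalTrace (memV_cellProjVec (T := T) V)).mul tw)
    (((faceCont_of_closure hu).mul nc).mul tw)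
    (faceCont_defect (faceCont_const τ) hu hw hμ)
    (faceCont_defect_face (nc.sub (faceCont_const τ)) hu hw hμ)
    FaceCont.zero FaceCont.zero FaceCont.zero
    1 1 (-1) (-1) 0 0 0 (fun F x _ => by ring)
  simp only [Pi.sub_apply] at c4
  rw [stateForm, fluxDefect, scalarDefect, c2, c3, c4, b]
  rw [c1] at h1
  linear_combination -h2 - h1

/-- The discrete adjoint equation for the projections of the exact solution. -/
theorem adjointForm_proj (hΩ : IsConvexPolytopeDomain Ω) (hζ : ContinuousOn ζ (closure Ω))
    (hγ : MemLp γ 2 (volume.restrict Ω)) (hu : ContinuousOn u (closure Ω))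
    {du : Pt (m + 1) → ℝ} (hdu : HasWeakDiv Ω (fun x => u x • ζ x) du)
    (hduL : MemLp du 2 (volume.restrict Ω))
    (hVL : ∀ i, MemLp (fun x => V x i) 2 (volume.restrict Ω))
    (hdL : MemLp d 2 (volume.restrict Ω)) (hw : T.MemW k w) (hμ : T.MemLambda0 k μ) :
    T.adjointForm ζ γ τ (T.cellProjVec k V) (T.cellProj k u) (T.faceProj k u) w μ
      = T.cellInt (fun K x => (d x - du x + γ x * u x) * w K x)
        - T.fluxDefect k V d w μ
        - T.scalarDefect k ζ γ 1 (fun F x => τ F - ⟪ζ x, F.normal⟫) (fun F _ => - τ F) u w μ := by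
  have h1 := cellInt_weakDiv hΩ (V := fun x => u x • ζ x) (hu.smul hζ) hdu hduL hw
  -- This permits replacing w by w - μ in the convective face term.
  have h0 := sum_integral_normal_mul_eq_zero hΩ (ψ := fun x => u x • ζ x) (hu.smul hζ) hμ
  have h0' : T.bdryInt (fun F x => (u x * ⟪ζ x, F.normal⟫) * μ F.face x) = 0 := by
    rw [← h0]
    refine Finset.sum_congr rfl fun F _ => ?_
    simp only [real_inner_smul_left]
  have h2 := cellInt_fderiv_cellProjVec hΩ hVL hw
  have j1 := cellIntegrable_memLp_mul (T := T) hΩ hdL hw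
  have j2 := cellIntegrable_fderiv (T := T) hΩ hVL hw
  have j3 := cellIntegrable_memLp_mul (T := T) hΩ hduL hw
  have juw : ∀ K : T.Cell, ContinuousOn (fun x => u x * w K x) K.carrier := fun K =>
    (continuousOn_cell hu K).mul (hw K).continuous.continuousOn
  have j4 := CellIntegrable.memLp_mul (T := T) hΩ hγ juw
  have j6 : CellIntegrable fun (K : T.Cell) x => u x * fderiv ℝ (w K) x (ζ x) :=
    CellIntegrable.of_continuousOn fun K => (continuousOn_cell hu K).mul
      (continuousOn_fderiv_apply hw K (continuousOn_cell hζ K))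
  have j7 := cellIntegrable_reaction (T := T) hΩ hγ hu hw
  have j8 := cellIntegrable_sub_mul_fderiv (T := T) hζ hu hw
  have j10 : CellIntegrable fun (K : T.Cell) x => fderiv ℝ (w K) x (T.cellProjVec k V K x) :=
    CellIntegrable.of_continuousOn fun K =>
      continuousOn_fderiv_apply hw K ((memV_cellProjVec V).continuous K).continuousOn
  have c1 := cellInt_comb (T := T) (φ := fun K x =>
      du x * w K x + fderiv ℝ (w K) x (u x • ζ x))
    j3 j6 CellIntegrable.zero CellIntegrable.zero CellIntegrable.zero CellIntegrable.zero
    1 1 0 0 0 0 (fun K x _ => by rw [map_smul, smul_eq_mul]; ring)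
  have c2 := cellInt_comb (T := T) (φ := fun K x => (d x - du x + γ x * u x) * w K x)
    j1 j3 j4 CellIntegrable.zero CellIntegrable.zero CellIntegrable.zero 1 (-1) 1 0 0 0
    (fun K x _ => by ring)
  have c3 := cellInt_add j1 j2
  have c4 := cellInt_comb (T := T) (φ := fun K x => γ x * (T.cellProj k u K x * w K x)
      - (fderiv ℝ (w K) x (T.cellProjVec k V K x) - T.cellProj k u K x * fderiv ℝ (w K) x (ζ x)))
    j4 j7 j10 j6 j8 CellIntegrable.zero 1 (-1) (-1) 1 (-1) 0 (fun K x _ => by ring)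
  have nc := faceCont_inner_normal (T := T) hζ
  have tw := (faceCont_cellTrace hw).sub (faceCont_faceTrace hμ)
  have uc := (faceCont_of_closure (T := T) hu).mul nc
  have tτ : FaceCont fun (F : T.HalfFace) (_ : Pt (m + 1)) => - τ F := faceCont_const fun F => - τ F
  have b := bdryInt_comb (T := T) (φ := fun F x => (⟪T.cellProjVec k V F.cell x, F.normal⟫
      + (τ F - ⟪ζ x, F.normal⟫) * T.cellProj k u F.cell x
      - τ F * T.faceProj k u F.face x) * (w F.cell x - μ F.face x))
    ((faceCont_normalTrace (memV_cellProjVec (T := T) V)).mul tw)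
    (uc.mul (faceCont_cellTrace hw)) (uc.mul (faceCont_faceTrace hμ))
    (faceCont_defect ((faceCont_const τ).sub nc) hu hw hμ)
    (faceCont_defect_face tτ hu hw hμ)
    FaceCont.zero FaceCont.zero
    1 (-1) 1 (-1) (-1) 0 0 (fun F x _ => by ring)
  simp only [real_inner_smul_left] at h1
  rw [adjointForm, fluxDefect, scalarDefect, c2, c3, c4, b]
  rw [c1] at h1
  linear_combination -h2 + h1 + h0'

end Consistency

end Triangulation

end HDG

/-! ### Estimates of the residuals -/

namespace HDG

theorem norm_le_sum_abs {n : ℕ} (v : Pt n) : ‖v‖ ≤ ∑ i, |v i| := by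
  have h := (EuclideanSpace.basisFun (Fin n) ℝ).sum_repr v
  calc ‖v‖ = ‖∑ i, (EuclideanSpace.basisFun (Fin n) ℝ).repr v i • EuclideanSpace.basisFun (Fin n) ℝ i‖ := by
        rw [h]
    _ ≤ _ := norm_sum_le _ _
    _ = _ := Finset.sum_congr rfl fun i _ => by simp [norm_smul]

/-- A vector field with components in `W^{1,∞}` that is continuous up to the boundary is Lipschitz
continuous. -/
theorem exists_lipschitz_vec {n : ℕ} {Ω : Set (Pt n)} (hΩ : IsConvexPolytopeDomain Ω)
    {ζ : Pt n → Pt n} (hζ : ∀ i, MemW1inf Ω (fun x => ζ x i)) (hζc : ContinuousOn ζ (closure Ω)) :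
    ∃ L : ℝ, 0 ≤ L ∧ ∀ x ∈ closure Ω, ∀ y ∈ closure Ω, ‖ζ x - ζ y‖ ≤ L * ‖x - y‖ := by
  choose L hL0 hL using fun i => exists_lipschitz hΩ (hζ i)
    ((EuclideanSpace.proj i : Pt n →L[ℝ] ℝ).continuous.comp_continuousOn hζc)
  refine ⟨∑ i, L i, Finset.sum_nonneg fun i _ => hL0 i, fun x hx y hy => ?_⟩
  refine (norm_le_sum_abs _).trans ?_
  rw [Finset.sum_mul]
  exact Finset.sum_le_sum fun i _ => hL i x hx y hy

namespace Triangulation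

variable {m k : ℕ} {Ω : Set (Pt (m + 1))} {T : Triangulation Ω}

theorem meshSize_le_diam (hΩ : IsConvexPolytopeDomain Ω) (T : Triangulation Ω) :
    T.meshSize ≤ Metric.diam (closure Ω) :=
  Real.iSup_le (fun K => Metric.diam_mono (cell_subset_closure K)
    hΩ.isCompact_closure.isBounded) Metric.diam_nonneg

theorem cellInt_nonneg {φ : T.Cell → Pt (m + 1) → ℝ} (h : ∀ K x, 0 ≤ φ K x) : 0 ≤ T.cellInt φ :=
  Finset.sum_nonneg fun K _ => integral_nonneg (h K)

theorem bdryInt_nonneg {φ : T.HalfFace → Pt (m + 1) → ℝ} (h : ∀ F, ∀ x ∈ F.face.carrier, 0 ≤ φ F x) :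
    0 ≤ T.bdryInt φ :=
  Finset.sum_nonneg fun F _ => integral_nonneg_of_ae
    ((ae_faceMeasure F).mono fun x hx => h F x hx)

theorem cellInt_mono_ae {φ ψ : T.Cell → Pt (m + 1) → ℝ} (hφ : CellIntegrable φ)
    (hψ : CellIntegrable ψ) (h : ∀ K, ∀ᵐ x ∂volume.restrict K.carrier, φ K x ≤ ψ K x) :
    T.cellInt φ ≤ T.cellInt ψ :=
  Finset.sum_le_sum fun K _ => integral_mono_ae (hφ K) (hψ K) (h K)

theorem bdryInt_mono {φ ψ : T.HalfFace → Pt (m + 1) → ℝ} (hφ : FaceCont φ)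
    (hψ : FaceCont ψ) (h : ∀ F, ∀ x ∈ F.face.carrier, φ F x ≤ ψ F x) :
    T.bdryInt φ ≤ T.bdryInt ψ :=
  Finset.sum_le_sum fun F _ => integral_mono_ae (integrable_face F (hφ F)) (integrable_face F (hψ F))
    ((ae_faceMeasure F).mono fun x hx => h F x hx)

theorem sq_cellInt_mul_le {φ ψ : T.Cell → Pt (m + 1) → ℝ}
    (hφ : ∀ K, MemLp (φ K) 2 (volume.restrict K.carrier))
    (hψ : ∀ K, MemLp (ψ K) 2 (volume.restrict K.carrier)) :
    T.cellInt (fun K x => φ K x * ψ K x) ^ 2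
      ≤ T.cellInt (fun K x => φ K x ^ 2) * T.cellInt (fun K x => ψ K x ^ 2) :=
  sum_integral_mul_sq_le (fun K : T.Cell => volume.restrict K.carrier) hφ hψ

theorem sq_bdryInt_mul_le {φ ψ : T.HalfFace → Pt (m + 1) → ℝ} (hφ : FaceCont φ)
    (hψ : FaceCont ψ) :
    T.bdryInt (fun F x => φ F x * ψ F x) ^ 2
      ≤ T.bdryInt (fun F x => φ F x ^ 2) * T.bdryInt (fun F x => ψ F x ^ 2) :=
  sum_integral_mul_sq_le (fun F : T.HalfFace => faceMeasure F) (fun F => memLp_face F (hφ F) 2)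
    fun F => memLp_face F (hψ F) 2

theorem seminormSq_nonneg {n : ℕ} (Ω : Set (Pt n)) (j : ℕ) (u : Pt n → ℝ) :
    0 ≤ seminormSq Ω j u :=
  Finset.sum_nonneg fun _ _ => integral_nonneg fun _ => sq_nonneg _

theorem exists_fluxDefect_sq_le (m k : ℕ) {σ : ℝ} (hσ : 0 < σ) : ∃ C : ℝ, 0 < C ∧
    ∀ {Ω : Set (Pt (m + 1))} (_ : IsConvexPolytopeDomain Ω) (T : Triangulation Ω),
      T.ShapeRegular σ → ∀ (V : Pt (m + 1) → Pt (m + 1)) (d : Pt (m + 1) → ℝ),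
      MemHVec Ω (k + 1) V → HasWeakDiv Ω V d → MemLp d 2 (volume.restrict Ω) →
      ∀ (w : T.Cell → Pt (m + 1) → ℝ) (μ : T.Face → Pt (m + 1) → ℝ), T.MemW k w →
      T.MemLambda0 k μ →
      T.fluxDefect k V d w μ ^ 2 ≤ C * T.meshSize ^ (2 * k + 1)
        * (∑ i, seminormSq Ω (k + 1) fun x => V x i)
        * T.bdryInt (fun F x => (w F.cell x - μ F.face x) ^ 2) := by
  obtain ⟨C, hC, H⟩ := exists_flux_consistency m k hσ
  refine ⟨C, hC, fun {Ω} hΩ T hT V d hV hd hdL w μ hw hμ => ?_⟩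
  refine le_of_eq_of_le ?_ (H hΩ T hT V d hV hd w μ hw hμ)
  rw [fluxDefect]
  congr 2
  refine Finset.sum_congr rfl fun K _ => ?_
  have i1 : ∀ i, IntegrableOn (fun x => V x i * fderiv ℝ (w K) x (unitVec i)) K.carrier := fun i =>
    (MemLp.cell hΩ (hV i).1 K).integrable_mul
      (memLp_cell K ((hw K).fderiv (unitVec i)).continuous.continuousOn)
  simp_rw [fun x => fderiv_eq_sum (fderiv ℝ (w K) x) (V x)]
  rw [integral_add (cellIntegrable_memLp_mul hΩ hdL hw K) (integrable_finsetSum _ fun i _ => i1 i),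
    integral_finsetSum _ fun i _ => i1 i]

/-- Orthogonality allows to gain a power of the mesh size in the convective term. -/
theorem sq_cellInt_sub_mul_fderiv_le (hΩ : IsConvexPolytopeDomain Ω) {C : ℝ}
    (H : ∀ (K : T.Cell) (u : Pt (m + 1) → ℝ), IsPoly k u →
      Metric.diam K.carrier ^ 2 * ∫ x in K.carrier, ‖fderiv ℝ u x‖ ^ 2
        ≤ C * ∫ x in K.carrier, u x ^ 2)
    {ζ : Pt (m + 1) → Pt (m + 1)} (hζ : ContinuousOn ζ (closure Ω)) {L : ℝ}
    (hL : ∀ x ∈ closure Ω, ∀ y ∈ closure Ω, ‖ζ x - ζ y‖ ≤ L * ‖x - y‖)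
    {u : Pt (m + 1) → ℝ} (hu : ContinuousOn u (closure Ω)) {w : T.Cell → Pt (m + 1) → ℝ}
    (hw : T.MemW k w) :
    T.cellInt (fun K x => (u x - T.cellProj k u K x) * fderiv ℝ (w K) x (ζ x)) ^ 2
      ≤ T.cellInt (fun K x => (u x - T.cellProj k u K x) ^ 2)
        * (L ^ 2 * C * T.cellInt (fun K x => w K x ^ 2)) := by
  have hδ : ∀ K : T.Cell, ContinuousOn (fun x => u x - T.cellProj k u K x) K.carrier := fun K =>
    (continuousOn_cell hu K).sub (isPoly_cellProj u K).continuous.continuousOn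
  have hne : ∀ K : T.Cell, ∃ z, z ∈ K.carrier := fun K => by
    obtain ⟨v, hv, -⟩ := exists_two_vertices K
    exact ⟨v, subset_convexHull ℝ _ hv⟩
  choose z hz using hne
  have hζz : ∀ K : T.Cell, ContinuousOn (fun x => ζ x - ζ (z K)) K.carrier := fun K =>
    (continuousOn_cell hζ K).sub continuousOn_const
  -- The derivative of w K in the fixed direction ζ (z K) is a polynomial of degree at most k, hence
  -- orthogonal to the projection error. Only the variation of ζ over the element enters.
  have e1 : T.cellInt (fun K x => (u x - T.cellProj k u K x) * fderiv ℝ (w K) x (ζ x))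
      = T.cellInt fun K x => (u x - T.cellProj k u K x) * fderiv ℝ (w K) x (ζ x - ζ (z K)) := by
    refine Finset.sum_congr rfl fun K _ => ?_
    have h0 := l2Proj_orthogonal (memLp_isPoly_cell K) (memLp_cell K (continuousOn_cell hu K))
      ((hw K).fderiv (ζ (z K)))
    change ∫ x in K.carrier, (u x - T.cellProj k u K x) * fderiv ℝ (w K) x (ζ (z K)) = 0 at h0
    have e2 : ∀ x, (u x - T.cellProj k u K x) * fderiv ℝ (w K) x (ζ x - ζ (z K))
        = (u x - T.cellProj k u K x) * fderiv ℝ (w K) x (ζ x)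
          - (u x - T.cellProj k u K x) * fderiv ℝ (w K) x (ζ (z K)) := fun x => by
      rw [map_sub]; ring
    simp_rw [e2]
    rw [integral_sub, h0, sub_zero]
    · exact integrableOn_cell K ((hδ K).mul (continuousOn_fderiv_apply hw K (continuousOn_cell hζ K)))
    · exact integrableOn_cell K ((hδ K).mul (continuousOn_fderiv_apply hw K continuousOn_const))
  rw [e1]
  have hg : ∀ K : T.Cell, ContinuousOn (fun x => fderiv ℝ (w K) x (ζ x - ζ (z K))) K.carrier :=
    fun K => continuousOn_fderiv_apply hw K (hζz K)
  refine (sq_cellInt_mul_le (fun K => memLp_cell K (hδ K)) fun K => memLp_cell K (hg K)).trans ?_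
  refine mul_le_mul_of_nonneg_left ?_ (cellInt_nonneg fun _ _ => sq_nonneg _)
  rw [cellInt, cellInt, Finset.mul_sum]
  refine Finset.sum_le_sum fun K _ => ?_
  -- The Lipschitz bound supplies the factor diam K that the inverse inequality consumes.
  have hb : ∀ x ∈ K.carrier, fderiv ℝ (w K) x (ζ x - ζ (z K)) ^ 2
      ≤ L ^ 2 * Metric.diam K.carrier ^ 2 * ‖fderiv ℝ (w K) x‖ ^ 2 := by
    intro x hx
    have h1 : ‖ζ x - ζ (z K)‖ ≤ |L| * Metric.diam K.carrier := by
      refine (hL x (cell_subset_closure K hx) _ (cell_subset_closure K (hz K))).trans ?_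
      refine mul_le_mul (le_abs_self L) ?_ (norm_nonneg _) (abs_nonneg _)
      rw [← dist_eq_norm]
      exact Metric.dist_le_diam_of_mem (isCompact_cell K).isBounded hx (hz K)
    have h2 := ((fderiv ℝ (w K) x).le_opNorm (ζ x - ζ (z K))).trans
      (mul_le_mul_of_nonneg_left h1 (norm_nonneg _))
    rw [Real.norm_eq_abs] at h2
    calc _ = |fderiv ℝ (w K) x (ζ x - ζ (z K))| ^ 2 := (sq_abs _).symm
      _ ≤ (‖fderiv ℝ (w K) x‖ * (|L| * Metric.diam K.carrier)) ^ 2 :=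
        pow_le_pow_left₀ (abs_nonneg _) h2 2
      _ = _ := by rw [mul_pow, mul_pow, sq_abs]; ring
  have hc : Continuous fun x => ‖fderiv ℝ (w K) x‖ ^ 2 :=
    ((hw K).contDiff.continuous_fderiv (by simp)).norm.pow 2
  calc ∫ x in K.carrier, fderiv ℝ (w K) x (ζ x - ζ (z K)) ^ 2
      ≤ ∫ x in K.carrier, L ^ 2 * Metric.diam K.carrier ^ 2 * ‖fderiv ℝ (w K) x‖ ^ 2 :=
        setIntegral_mono_on (integrableOn_cell K ((hg K).pow 2))
          (integrableOn_cell K (continuous_const.mul hc).continuousOn)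
          (isCompact_cell K).measurableSet hb
    _ = L ^ 2 * (Metric.diam K.carrier ^ 2 * ∫ x in K.carrier, ‖fderiv ℝ (w K) x‖ ^ 2) := by
        rw [integral_const_mul]; ring
    _ ≤ L ^ 2 * (C * ∫ x in K.carrier, w K x ^ 2) :=
        mul_le_mul_of_nonneg_left (H K _ (hw K)) (sq_nonneg L)
    _ = _ := by ring

theorem sq_cellInt_bdd_mul_le {c : Pt (m + 1) → ℝ} (hΩ : IsConvexPolytopeDomain Ω)
    (hc : AEStronglyMeasurable c (volume.restrict Ω)) {M : ℝ}
    (hM : ∀ᵐ x ∂volume.restrict Ω, |c x| ≤ M)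
    {φ ψ : T.Cell → Pt (m + 1) → ℝ} (hφ : ∀ K, ContinuousOn (φ K) K.carrier)
    (hψ : ∀ K, ContinuousOn (ψ K) K.carrier) :
    T.cellInt (fun K x => c x * φ K x * ψ K x) ^ 2
      ≤ M ^ 2 * T.cellInt (fun K x => φ K x ^ 2) * T.cellInt (fun K x => ψ K x ^ 2) := by
  have h1 : ∀ K : T.Cell, MemLp (fun x => c x * φ K x) 2 (volume.restrict K.carrier) := fun K => by
    have := MemLp.mul_bdd (memLp_cell K (hφ K)) (hc.mono_measure (restrict_cell_le hΩ K))
      (ae_mono (restrict_cell_le hΩ K) hM)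
    simpa only [mul_comm] using this
  refine (sq_cellInt_mul_le h1 fun K => memLp_cell K (hψ K)).trans ?_
  refine mul_le_mul_of_nonneg_right ?_ (cellInt_nonneg fun _ _ => sq_nonneg _)
  rw [← cellInt_const_mul]
  refine cellInt_mono_ae (fun K => (h1 K).integrable_sq)
    (CellIntegrable.of_continuousOn fun K => continuousOn_const.mul ((hφ K).pow 2)) fun K => ?_
  filter_upwards [ae_mono (restrict_cell_le hΩ K) hM] with x hx
  rw [mul_pow]
  exact mul_le_mul_of_nonneg_right (sq_le_sq' (neg_le_of_abs_le hx) (le_of_abs_le hx)) (sq_nonneg _)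

theorem sq_bdryInt_bdd_mul_le {a φ ψ : T.HalfFace → Pt (m + 1) → ℝ} (ha : FaceCont a) {A : ℝ}
    (hA : ∀ F, ∀ x ∈ F.face.carrier, |a F x| ≤ A) (hφ : FaceCont φ) (hψ : FaceCont ψ) :
    T.bdryInt (fun F x => a F x * φ F x * ψ F x) ^ 2
      ≤ A ^ 2 * T.bdryInt (fun F x => φ F x ^ 2) * T.bdryInt (fun F x => ψ F x ^ 2) := by
  refine (sq_bdryInt_mul_le (ha.mul hφ) hψ).trans ?_
  refine mul_le_mul_of_nonneg_right ?_ (bdryInt_nonneg fun _ _ _ => sq_nonneg _)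
  rw [← bdryInt_const_mul]
  refine bdryInt_mono (fun F => ((ha F).mul (hφ F)).pow 2)
    (fun F => continuousOn_const.mul ((hφ F).pow 2)) fun F x hx => ?_
  rw [mul_pow]
  exact mul_le_mul_of_nonneg_right (sq_le_sq' (neg_le_of_abs_le (hA F x hx))
    (le_of_abs_le (hA F x hx))) (sq_nonneg _)

theorem bdryInt_sub_faceProj_le {u : Pt (m + 1) → ℝ} (hu : ContinuousOn u (closure Ω))
    (h0 : ∀ x ∈ frontier Ω, u x = 0) :
    T.bdryInt (fun F x => (u x - T.faceProj k u F.face x) ^ 2)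
      ≤ T.bdryInt (fun F x => (u x - T.cellProj k u F.cell x) ^ 2) :=
  Finset.sum_le_sum fun F _ => integral_sub_faceProj_le hu h0 F (isPoly_cellProj u F.cell)

/-- The squared L² projection error is of order h ^ (2 * k + 2); in the two volume terms one power
of h is estimated by the diameter of Ω, so that they match the face terms. The sign e and the
coefficients are left free in order to cover the state and the adjoint residual at once. -/
theorem exists_scalarDefect_sq_le (k : ℕ) {σ : ℝ} (hσ : 0 < σ) (hΩ : IsConvexPolytopeDomain Ω)
    {ζ : Pt (m + 1) → Pt (m + 1)} (hζ : ContinuousOn ζ (closure Ω)) {L : ℝ}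
    (hL : ∀ x ∈ closure Ω, ∀ y ∈ closure Ω, ‖ζ x - ζ y‖ ≤ L * ‖x - y‖) (M A : ℝ) :
    ∃ C : ℝ, 0 < C ∧ ∀ T : Triangulation Ω, T.ShapeRegular σ →
      ∀ (c : Pt (m + 1) → ℝ) (e : ℝ) (a a' : T.HalfFace → Pt (m + 1) → ℝ),
      AEStronglyMeasurable c (volume.restrict Ω) → (∀ᵐ x ∂volume.restrict Ω, |c x| ≤ M) →
      e ^ 2 = 1 → FaceCont a → (∀ F, ∀ x ∈ F.face.carrier, |a F x| ≤ A) →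
      FaceCont a' → (∀ F, ∀ x ∈ F.face.carrier, |a' F x| ≤ A) →
      ∀ u : Pt (m + 1) → ℝ, MemH Ω (k + 1) u → ContinuousOn u (closure Ω) →
      (∀ x ∈ frontier Ω, u x = 0) →
      ∀ (w : T.Cell → Pt (m + 1) → ℝ) (μ : T.Face → Pt (m + 1) → ℝ), T.MemW k w →
      T.MemLambda0 k μ →
      T.scalarDefect k ζ c e a a' u w μ ^ 2 ≤ C * T.meshSize ^ (2 * k + 1)
        * seminormSq Ω (k + 1) u * (T.cellInt (fun K x => w K x ^ 2)
          + T.bdryInt (fun F x => (w F.cell x - μ F.face x) ^ 2)) := by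
  obtain ⟨Ci, hCi, Hi⟩ := exists_inverse m k hσ
  obtain ⟨Cb, hCb, Hb⟩ := exists_sum_trace_sub_cellProj_le m k hσ
  set D := Metric.diam (closure Ω) with hD
  have hD0 : 0 ≤ D := Metric.diam_nonneg
  set A0 : ℝ := 2 * ((m + 2) * 2 ^ (m + 1)) with hA0
  have hA0p : 0 < A0 := by positivity
  -- The factor 4 comes from squaring a sum of four terms, the factor 2 counts the face terms, and 1
  -- is added for positivity.
  refine ⟨4 * (A0 * D * (M ^ 2 + L ^ 2 * Ci) + 2 * A ^ 2 * Cb) + 1, by positivity,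
    fun T hT c e a a' hc hM he ha hA ha' hA' u hu huc h0 w μ hw hμ => ?_⟩
  set h := T.meshSize with hh
  have hh0 : 0 ≤ h := T.meshSize_nonneg
  set S := seminormSq Ω (k + 1) u with hS
  have hS0 : 0 ≤ S := seminormSq_nonneg _ _ _
  have hδ : ∀ K : T.Cell, ContinuousOn (fun x => u x - T.cellProj k u K x) K.carrier := fun K =>
    (continuousOn_cell huc K).sub (isPoly_cellProj u K).continuous.continuousOn
  have tδ : FaceCont fun (F : T.HalfFace) x => u x - T.cellProj k u F.cell x :=
    (faceCont_of_closure huc).sub (faceCont_cellTrace (isPoly_cellProj u))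
  have tδ' : FaceCont fun (F : T.HalfFace) x => u x - T.faceProj k u F.face x :=
    (faceCont_of_closure huc).sub (faceCont_faceTrace (memLambda0_faceProj u))
  have tw := (faceCont_cellTrace hw).sub (faceCont_faceTrace hμ)
  have q1 := sq_cellInt_bdd_mul_le hΩ hc hM hδ fun K => (hw K).continuous.continuousOn
  have q2 := sq_cellInt_sub_mul_fderiv_le hΩ (fun K u hu => Hi T hT K u hu) hζ hL huc hw
  have q3 := sq_bdryInt_bdd_mul_le ha hA tδ tw
  have q4 := sq_bdryInt_bdd_mul_le ha' hA' tδ' tw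
  have E0 := sum_integral_sub_cellProj_le hΩ hσ hT hu
  have Eb := Hb hΩ T hT u hu huc
  have Ef := bdryInt_sub_faceProj_le (T := T) (k := k) huc h0
  rw [scalarDefect]
  set t1 := T.cellInt (fun K x => c x * (u x - T.cellProj k u K x) * w K x)
  set t2 := T.cellInt (fun K x => (u x - T.cellProj k u K x) * fderiv ℝ (w K) x (ζ x))
  set t3 := T.bdryInt (fun F x => a F x * (u x - T.cellProj k u F.cell x) *
        (w F.cell x - μ F.face x))
  set t4 := T.bdryInt (fun F x => a' F x * (u x - T.faceProj k u F.face x) *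
        (w F.cell x - μ F.face x))
  change T.cellInt (fun K x => (u x - T.cellProj k u K x) ^ 2) ≤ _ at E0
  change T.bdryInt (fun F x => (u x - T.cellProj k u F.cell x) ^ 2) ≤ _ at Eb
  set e0 := T.cellInt (fun K x => (u x - T.cellProj k u K x) ^ 2)
  set eb := T.bdryInt (fun F x => (u x - T.cellProj k u F.cell x) ^ 2)
  set ef := T.bdryInt (fun F x => (u x - T.faceProj k u F.face x) ^ 2)
  set W := T.cellInt (fun K x => w K x ^ 2) with hW
  set J := T.bdryInt (fun F x => (w F.cell x - μ F.face x) ^ 2) with hJ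
  have hW0 : 0 ≤ W := cellInt_nonneg fun _ _ => sq_nonneg _
  have hJ0 : 0 ≤ J := bdryInt_nonneg fun _ _ _ => sq_nonneg _
  set N := h ^ (2 * k + 1) * S with hN
  have hN0 : 0 ≤ N := mul_nonneg (pow_nonneg hh0 _) hS0
  have E0' : e0 ≤ A0 * D * N := by
    refine E0.trans ?_
    have : h ^ (2 * (k + 1)) = h * h ^ (2 * k + 1) := by ring
    rw [this, hN]
    have h5 : h ≤ D := meshSize_le_diam hΩ T
    have h6 : h * N ≤ D * N := mul_le_mul_of_nonneg_right h5 hN0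
    calc _ = A0 * (h * N) := by rw [hN]; ring
      _ ≤ A0 * (D * N) := mul_le_mul_of_nonneg_left h6 hA0p.le
      _ = _ := by rw [hN]; ring
  have Eb' : eb ≤ Cb * N := Eb.trans_eq (by rw [hN]; ring)
  have Ef' : ef ≤ Cb * N := Ef.trans Eb'
  have p1 : t1 ^ 2 ≤ M ^ 2 * (A0 * D * N) * W := q1.trans (by gcongr)
  have p2 : t2 ^ 2 ≤ A0 * D * N * (L ^ 2 * Ci * W) := q2.trans (by gcongr)
  have p3 : t3 ^ 2 ≤ A ^ 2 * (Cb * N) * J := q3.trans (by gcongr)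
  have p4 : t4 ^ 2 ≤ A ^ 2 * (Cb * N) * J := q4.trans (by gcongr)
  have s1 : (t1 + e * t2 + t3 + t4) ^ 2 ≤ 4 * (t1 ^ 2 + t2 ^ 2 + t3 ^ 2 + t4 ^ 2) := by
    have : t2 ^ 2 = (e * t2) ^ 2 := by rw [mul_pow, he, one_mul]
    rw [this]
    nlinarith [sq_nonneg (t1 - e * t2), sq_nonneg (t1 - t3), sq_nonneg (t1 - t4),
      sq_nonneg (e * t2 - t3), sq_nonneg (e * t2 - t4), sq_nonneg (t3 - t4)]
  refine s1.trans ?_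
  have r1 : 0 ≤ A0 * D * (M ^ 2 + L ^ 2 * Ci) * N * J := by positivity
  have r2 : 0 ≤ A ^ 2 * Cb * N * W := by positivity
  have r3 : 0 ≤ N * (W + J) := by positivity
  have r4 : (4 * (A0 * D * (M ^ 2 + L ^ 2 * Ci) + 2 * A ^ 2 * Cb) + 1) * h ^ (2 * k + 1) * S * (W + J)
      = 4 * (A0 * D * (M ^ 2 + L ^ 2 * Ci) * N * W + 2 * A ^ 2 * Cb * N * J
        + A0 * D * (M ^ 2 + L ^ 2 * Ci) * N * J + 2 * (A ^ 2 * Cb * N * W)) + N * (W + J) := by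
    rw [hN]; ring
  rw [r4]
  linarith

end Triangulation

end HDG

/-! ### Absorption argument, error equations and coercivity -/

namespace HDG

/-- The absorption argument: `E` is the energy of the projected errors, `X` the part of it that
controls the residuals `R₁, …, R₄`. -/
theorem energy_add_le_of_residual_le {b c M E G S X R₁ R₂ R₃ R₄ : ℝ} (hb : 0 < b) (hc : 0 < c)
    (hc1 : c ≤ 1) (hM : 0 ≤ M) (hX : 0 ≤ X) (hE : E = R₁ + R₂) (hS : S = b * (R₃ - R₄))
    (h₁ : R₁ ^ 2 ≤ M * X) (h₂ : R₂ ^ 2 ≤ M * X) (h₃ : R₃ ^ 2 ≤ M * X) (h₄ : R₄ ^ 2 ≤ M * X)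
    (hXE : c * X ≤ E) (hGE : c * G ≤ E) : b * G + S ≤ 8 * M / c ^ 2 * b := by
  have hE0 : 0 ≤ E := (mul_nonneg hc.le hX).trans hXE
  have h5 : E ^ 2 ≤ 4 * (M * X) := by
    rw [hE]; nlinarith [sq_nonneg (R₁ - R₂)]
  -- Combine E ^ 2 ≤ 4 M X with c X ≤ E and divide by E; the case E = 0 is separate.
  have h6 : c * E ≤ 4 * M := by
    rcases hE0.eq_or_lt with h | h
    · rw [← h]; linarith
    · refine le_of_mul_le_mul_right ?_ h
      calc c * E * E = c * E ^ 2 := by ring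
        _ ≤ c * (4 * (M * X)) := mul_le_mul_of_nonneg_left h5 hc.le
        _ = 4 * M * (c * X) := by ring
        _ ≤ 4 * M * E := mul_le_mul_of_nonneg_left hXE (by linarith)
  have h7 : c * (c * G) ≤ 4 * M := (mul_le_mul_of_nonneg_left hGE hc.le).trans h6
  have h8 : G ≤ 4 * M / c ^ 2 := by
    rw [le_div_iff₀ (by positivity)]; linarith
  have h9 : c * (c * X) ≤ 4 * M := (mul_le_mul_of_nonneg_left hXE hc.le).trans h6
  -- The bound of the energy also bounds X, and hence the residuals of the crossed tests.
  have h10 : (c * (R₃ - R₄)) ^ 2 ≤ (4 * M) ^ 2 := by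
    have h11 : (R₃ - R₄) ^ 2 ≤ 4 * (M * X) := by nlinarith [sq_nonneg (R₃ + R₄)]
    calc (c * (R₃ - R₄)) ^ 2 = c ^ 2 * (R₃ - R₄) ^ 2 := by ring
      _ ≤ c ^ 2 * (4 * (M * X)) := mul_le_mul_of_nonneg_left h11 (sq_nonneg c)
      _ = 4 * M * (c * (c * X)) := by ring
      _ ≤ 4 * M * (4 * M) := mul_le_mul_of_nonneg_left h9 (by linarith)
      _ = _ := by ring
  have h11 : c * (R₃ - R₄) ≤ 4 * M := abs_le_of_sq_le_sq' h10 (by linarith) |>.2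
  have h12 : R₃ - R₄ ≤ 4 * M / c ^ 2 := by
    rw [le_div_iff₀ (by positivity)]
    calc (R₃ - R₄) * c ^ 2 = c * (c * (R₃ - R₄)) := by ring
      _ ≤ c * (4 * M) := mul_le_mul_of_nonneg_left h11 hc.le
      _ ≤ 1 * (4 * M) := mul_le_mul_of_nonneg_right hc1 (by linarith)
      _ = _ := one_mul _
  rw [hS]
  calc b * G + b * (R₃ - R₄) ≤ b * (4 * M / c ^ 2) + b * (4 * M / c ^ 2) := by gcongr
    _ = _ := by ring

namespace Triangulation

variable {m k : ℕ} {Ω : Set (Pt (m + 1))} {T : Triangulation Ω}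

section ErrorEquations

variable {β : ℝ} {ζ : Pt (m + 1) → Pt (m + 1)} {dζ γ f g : Pt (m + 1) → ℝ}
  {τ₁ : T.HalfFace → ℝ} {τ₂ : T.HalfFace → Pt (m + 1) → ℝ} {C₁ Cstar : ℝ}
  {qh ph : T.Cell → Pt (m + 1) → Pt (m + 1)} {yh sh : T.Cell → Pt (m + 1) → ℝ}
  {yhat phat : T.Face → Pt (m + 1) → ℝ}
  {q q' : T.Cell → Pt (m + 1) → Pt (m + 1)} {y y' w : T.Cell → Pt (m + 1) → ℝ}
  {yf yf' μ : T.Face → Pt (m + 1) → ℝ}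

theorem MemV.sub (hq : T.MemV k q) (hq' : T.MemV k q') : T.MemV k fun K x => q K x - q' K x :=
  fun K i => (hq K i).sub (hq' K i)

theorem MemW.sub (hy : T.MemW k y) (hy' : T.MemW k y') : T.MemW k fun K x => y K x - y' K x :=
  fun K => (hy K).sub (hy' K)

theorem MemLambda0.sub (hy : T.MemLambda0 k yf) (hy' : T.MemLambda0 k yf') :
    T.MemLambda0 k fun e x => yf e x - yf' e x :=
  ⟨fun e => (hy.1 e).sub (hy'.1 e), fun e he x hx => by
    show yf e x - yf' e x = 0
    rw [hy.2 e he x hx, hy'.2 e he x hx, sub_zero]⟩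

theorem faceCont_adjoint {s : T.Cell → Pt (m + 1) → ℝ} {shat : T.Face → Pt (m + 1) → ℝ}
    (hζ : ContinuousOn ζ (closure Ω)) (hq : T.MemV k q) (hy : T.MemW k y)
    (hyf : T.MemLambda0 k yf) (hs : T.MemW k s) (hshat : T.MemLambda0 k shat) :
    FaceCont fun F x => (⟪q F.cell x, F.normal⟫ + (τ₁ F - ⟪ζ x, F.normal⟫) * y F.cell x
      - τ₁ F * yf F.face x) * (s F.cell x - shat F.face x) :=
  (((faceCont_normalTrace hq).add (((faceCont_const τ₁).sub (faceCont_inner_normal hζ)).mul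
    (faceCont_cellTrace hy))).sub ((faceCont_const τ₁).mul (faceCont_faceTrace hyf))).mul
    ((faceCont_cellTrace hs).sub (faceCont_faceTrace hshat))

theorem stateForm_sub (hΩ : IsConvexPolytopeDomain Ω) (hζ : ContinuousOn ζ (closure Ω))
    (hdζ : MemLp dζ 2 (volume.restrict Ω)) (hγ : MemLp γ 2 (volume.restrict Ω))
    (hq : T.MemV k q) (hq' : T.MemV k q') (hy : T.MemW k y) (hy' : T.MemW k y')
    (hyf : T.MemLambda0 k yf) (hyf' : T.MemLambda0 k yf') (hw : T.MemW k w)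
    (hμ : T.MemLambda0 k μ) :
    T.stateForm ζ dζ γ τ₁ (fun K x => q K x - q' K x) (fun K x => y K x - y' K x)
        (fun e x => yf e x - yf' e x) w μ
      = T.stateForm ζ dζ γ τ₁ q y yf w μ - T.stateForm ζ dζ γ τ₁ q' y' yf' w μ := by
  have c := cellInt_comb (T := T) (φ := fun K x => (γ x - dζ x) * ((y K x - y' K x) * w K x)
      - (fderiv ℝ (w K) x (q K x - q' K x) + (y K x - y' K x) * fderiv ℝ (w K) x (ζ x)))
    (cellIntegrable_state hΩ hζ hdζ hγ hq hy hw) (cellIntegrable_state hΩ hζ hdζ hγ hq' hy' hw)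
    CellIntegrable.zero CellIntegrable.zero CellIntegrable.zero CellIntegrable.zero
    1 (-1) 0 0 0 0 (fun K x _ => by rw [map_sub]; ring)
  have b := bdryInt_comb (T := T) (φ := fun F x => (⟪q F.cell x - q' F.cell x, F.normal⟫
      + τ₁ F * (y F.cell x - y' F.cell x)
      + (⟪ζ x, F.normal⟫ - τ₁ F) * (yf F.face x - yf' F.face x)) * (w F.cell x - μ F.face x))
    (faceCont_state (τ := τ₁) hζ hq hy hyf hw hμ) (faceCont_state (τ := τ₁) hζ hq' hy' hyf' hw hμ)
    FaceCont.zero FaceCont.zero FaceCont.zero FaceCont.zero FaceCont.zero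
    1 (-1) 0 0 0 0 0 (fun F x _ => by rw [inner_sub_left]; ring)
  rw [stateForm, c, b, stateForm, stateForm]
  ring

theorem adjointForm_sub (hΩ : IsConvexPolytopeDomain Ω) (hζ : ContinuousOn ζ (closure Ω))
    (hγ : MemLp γ 2 (volume.restrict Ω))
    (hq : T.MemV k q) (hq' : T.MemV k q') (hy : T.MemW k y) (hy' : T.MemW k y')
    (hyf : T.MemLambda0 k yf) (hyf' : T.MemLambda0 k yf') (hw : T.MemW k w)
    (hμ : T.MemLambda0 k μ) :
    T.adjointForm ζ γ τ₁ (fun K x => q K x - q' K x) (fun K x => y K x - y' K x)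
        (fun e x => yf e x - yf' e x) w μ
      = T.adjointForm ζ γ τ₁ q y yf w μ - T.adjointForm ζ γ τ₁ q' y' yf' w μ := by
  have c := cellInt_comb (T := T) (φ := fun K x => γ x * ((y K x - y' K x) * w K x)
      - (fderiv ℝ (w K) x (q K x - q' K x) - (y K x - y' K x) * fderiv ℝ (w K) x (ζ x)))
    (cellIntegrable_adjoint hΩ hζ hγ hq hy hw) (cellIntegrable_adjoint hΩ hζ hγ hq' hy' hw)
    CellIntegrable.zero CellIntegrable.zero CellIntegrable.zero CellIntegrable.zero
    1 (-1) 0 0 0 0 (fun K x _ => by rw [map_sub]; ring)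
  have b := bdryInt_comb (T := T) (φ := fun F x => (⟪q F.cell x - q' F.cell x, F.normal⟫
      + (τ₁ F - ⟪ζ x, F.normal⟫) * (y F.cell x - y' F.cell x)
      - τ₁ F * (yf F.face x - yf' F.face x)) * (w F.cell x - μ F.face x))
    (faceCont_adjoint (τ₁ := τ₁) hζ hq hy hyf hw hμ)
    (faceCont_adjoint (τ₁ := τ₁) hζ hq' hy' hyf' hw hμ)
    FaceCont.zero FaceCont.zero FaceCont.zero FaceCont.zero FaceCont.zero
    1 (-1) 0 0 0 0 0 (fun F x _ => by rw [inner_sub_left]; ring)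
  rw [adjointForm, c, b, adjointForm, adjointForm]
  ring

theorem cellInt_proj_sub_mul (hΩ : IsConvexPolytopeDomain Ω) {u : Pt (m + 1) → ℝ}
    (hu : MemLp u 2 (volume.restrict Ω)) (hy : T.MemW k y) (hw : T.MemW k w) :
    T.cellInt (fun K x => (T.cellProj k u K x - y K x) * w K x)
      = T.cellInt (fun K x => u x * w K x) - T.cellInt fun K x => y K x * w K x := by
  have i : ∀ {v : T.Cell → Pt (m + 1) → ℝ}, T.MemW k v → CellIntegrable fun K x => v K x * w K x :=
    fun hv => CellIntegrable.of_continuousOn fun K =>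
      ((hv K).continuous.mul (hw K).continuous).continuousOn
  rw [← cellInt_cellProj_mul hΩ hu hw,
    cellInt_comb (T := T) (φ := fun K x => (T.cellProj k u K x - y K x) * w K x)
      (i (isPoly_cellProj u)) (i hy)
      CellIntegrable.zero CellIntegrable.zero CellIntegrable.zero CellIntegrable.zero
      1 (-1) 0 0 0 0 (fun K x _ => by ring)]
  ring

variable {qv pv : Pt (m + 1) → Pt (m + 1)} {yv pe d du : Pt (m + 1) → ℝ}

/-- The projected exact solution satisfies the discrete equation up to the two defects, and
subtracting the discrete solution leaves only these. The coupling term stays on the left because it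
is to cancel against that of the adjoint equation. -/
theorem state_error_eq (hΩ : IsConvexPolytopeDomain Ω) (hζ : ContinuousOn ζ (closure Ω))
    (hdiv : HasWeakDiv Ω ζ dζ) (hdζ : MemLp dζ 2 (volume.restrict Ω))
    (hγ : MemLp γ 2 (volume.restrict Ω)) (hy : ContinuousOn yv (closure Ω))
    (hp : MemLp pe 2 (volume.restrict Ω)) (hg : MemLp g 2 (volume.restrict Ω))
    {G : Pt (m + 1) → Pt (m + 1)} (hG : HasWeakGradient Ω yv G)
    (hGL : ∀ i, MemLp (fun x => G x i) 2 (volume.restrict Ω))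
    (hVL : ∀ i, MemLp (fun x => qv x i) 2 (volume.restrict Ω))
    (hdL : MemLp d 2 (volume.restrict Ω))
    (heq : ∀ᵐ x ∂volume.restrict Ω,
      Real.sqrt β * (d x + ⟪ζ x, G x⟫ + γ x * yv x) - pe x = g x)
    (H : T.IsHDGSolution k β ζ dζ γ f g τ₁ τ₂ qh yh yhat ph sh phat)
    (hw : T.MemW k w) (hμ : T.MemLambda0 k μ) :
    Real.sqrt β * T.stateForm ζ dζ γ τ₁ (fun K x => T.cellProjVec k qv K x - qh K x)
        (fun K x => T.cellProj k yv K x - yh K x) (fun e x => T.faceProj k yv e x - yhat e x) w μ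
        - T.cellInt (fun K x => (T.cellProj k pe K x - sh K x) * w K x)
      = - Real.sqrt β * (T.fluxDefect k qv d w μ
        + T.scalarDefect k ζ (fun x => γ x - dζ x) (-1) (fun F _ => τ₁ F)
          (fun F x => ⟪ζ x, F.normal⟫ - τ₁ F) yv w μ) := by
  have h1 := stateForm_hdg hΩ hζ hdζ hγ H hw hμ
  have h2 := stateForm_proj (τ := τ₁) hΩ hζ hdiv hdζ hγ hy hG hGL hVL hdL hw hμ
  have h3 : Real.sqrt β * T.cellInt (fun K x => (d x + ⟪ζ x, G x⟫ + γ x * yv x) * w K x)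
      = T.cellInt (fun K x => g x * w K x) + T.cellInt fun K x => pe x * w K x := by
    rw [← cellInt_const_mul, ← cellInt_add (cellIntegrable_memLp_mul hΩ hg hw)
      (cellIntegrable_memLp_mul hΩ hp hw)]
    have := cellInt_congr_ae (T := T) hΩ
      (f := fun x => Real.sqrt β * (d x + ⟪ζ x, G x⟫ + γ x * yv x)) (g := fun x => g x + pe x)
      (heq.mono fun x hx => by simp only [← hx]; ring) w
    simpa only [add_mul, mul_assoc] using this
  rw [stateForm_sub hΩ hζ hdζ hγ (memV_cellProjVec qv) H.mem_qh (isPoly_cellProj yv) H.mem_yh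
    (memLambda0_faceProj yv) H.mem_yhat hw hμ, cellInt_proj_sub_mul hΩ hp H.mem_sh hw, h2]
  linear_combination h3 - h1

theorem adjoint_error_eq (hΩ : IsConvexPolytopeDomain Ω) (hζ : ContinuousOn ζ (closure Ω))
    (hγ : MemLp γ 2 (volume.restrict Ω)) (hτ : T.StabilizerAssumption ζ C₁ Cstar τ₁ τ₂)
    (hp : ContinuousOn pe (closure Ω))
    (hy : MemLp yv 2 (volume.restrict Ω)) (hf : MemLp f 2 (volume.restrict Ω))
    (hdu : HasWeakDiv Ω (fun x => pe x • ζ x) du) (hduL : MemLp du 2 (volume.restrict Ω))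
    (hVL : ∀ i, MemLp (fun x => pv x i) 2 (volume.restrict Ω))
    (hdL : MemLp d 2 (volume.restrict Ω))
    (heq : ∀ᵐ x ∂volume.restrict Ω, Real.sqrt β * (d x - du x + γ x * pe x) + yv x = f x)
    (H : T.IsHDGSolution k β ζ dζ γ f g τ₁ τ₂ qh yh yhat ph sh phat)
    (hw : T.MemW k w) (hμ : T.MemLambda0 k μ) :
    Real.sqrt β * T.adjointForm ζ γ τ₁ (fun K x => T.cellProjVec k pv K x - ph K x)
        (fun K x => T.cellProj k pe K x - sh K x) (fun e x => T.faceProj k pe e x - phat e x) w μ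
        + T.cellInt (fun K x => (T.cellProj k yv K x - yh K x) * w K x)
      = - Real.sqrt β * (T.fluxDefect k pv d w μ
        + T.scalarDefect k ζ γ 1 (fun F x => τ₁ F - ⟪ζ x, F.normal⟫) (fun F _ => - τ₁ F)
          pe w μ) := by
  have h1 := adjointForm_hdg hΩ hζ hγ hτ H hw hμ
  have h2 := adjointForm_proj (τ := τ₁) hΩ hζ hγ hp hdu hduL hVL hdL hw hμ
  have h3 : Real.sqrt β * T.cellInt (fun K x => (d x - du x + γ x * pe x) * w K x)
      = T.cellInt (fun K x => f x * w K x) - T.cellInt fun K x => yv x * w K x := by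
    rw [← cellInt_const_mul, eq_sub_iff_add_eq, ← cellInt_add ?_
      (cellIntegrable_memLp_mul hΩ hy hw)]
    · refine Eq.trans ?_ (cellInt_congr_ae (T := T) hΩ
        (f := fun x => Real.sqrt β * (d x - du x + γ x * pe x) + yv x) (g := f) heq w)
      exact cellInt_congr fun K x _ => by ring
    -- Integrability of the weighted left-hand side is read off from the equation, which equates it
    -- with f - yv.
    · have hF : MemLp (fun x => f x - yv x) 2 (volume.restrict Ω) := hf.sub hy
      intro K
      refine (cellIntegrable_memLp_mul hΩ hF hw K).congr ?_
      filter_upwards [ae_mono (restrict_cell_le hΩ K) heq] with x hx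
      rw [← hx]; ring
  rw [adjointForm_sub hΩ hζ hγ (memV_cellProjVec pv) H.mem_ph (isPoly_cellProj pe) H.mem_sh
    (memLambda0_faceProj pe) H.mem_phat hw hμ, cellInt_proj_sub_mul hΩ hy H.mem_yh hw, h2]
  linear_combination h3 - h1

/-- Coercivity of the energy. -/
theorem energy_coercive (hΩ : IsConvexPolytopeDomain Ω) (hζ : ContinuousOn ζ (closure Ω))
    (hdζ : MemLp dζ 2 (volume.restrict Ω)) (hγ : MemLp γ 2 (volume.restrict Ω))
    {c γ₀ c₀ : ℝ} (hc : 0 ≤ c) (hc1 : c ≤ 1) (hcγ : c ≤ γ₀) (hcc : c ≤ c₀)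
    (hcoer : ∀ᵐ x ∂volume.restrict Ω, γ₀ ≤ γ x - 1 / 2 * dζ x)
    (hτ : ∀ F : T.HalfFace, ∀ x ∈ F.face.carrier, c₀ ≤ τ₁ F - 1 / 2 * ⟪ζ x, F.normal⟫)
    (hq : T.MemV k q) (hy : T.MemW k y) (hyf : T.MemLambda0 k yf) :
    c * (T.cellInt (fun K x => ⟪q K x, q K x⟫) + T.cellInt (fun K x => y K x ^ 2)
        + T.bdryInt fun F x => (τ₁ F - 1 / 2 * ⟪ζ x, F.normal⟫) * (y F.cell x - yf F.face x) ^ 2)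
      ≤ T.cellInt (fun K x => ⟪q K x, q K x⟫ + (γ x - 1 / 2 * dζ x) * (y K x * y K x))
        + T.bdryInt (fun F x => (τ₁ F - 1 / 2 * ⟪ζ x, F.normal⟫) *
          ((y F.cell x - yf F.face x) * (y F.cell x - yf F.face x))) ∧
    c * (T.cellInt (fun K x => y K x ^ 2)
        + T.bdryInt fun F x => (y F.cell x - yf F.face x) ^ 2)
      ≤ T.cellInt (fun K x => ⟪q K x, q K x⟫ + (γ x - 1 / 2 * dζ x) * (y K x * y K x))
        + T.bdryInt (fun F x => (τ₁ F - 1 / 2 * ⟪ζ x, F.normal⟫) *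
          ((y F.cell x - yf F.face x) * (y F.cell x - yf F.face x))) := by
  have iq : CellIntegrable fun K x => ⟪q K x, q K x⟫ :=
    CellIntegrable.of_continuousOn fun K => ((hq.continuous K).inner (hq.continuous K)).continuousOn
  have iy : CellIntegrable fun K x => y K x ^ 2 :=
    CellIntegrable.of_continuousOn fun K => ((hy K).continuous.pow 2).continuousOn
  have iE := cellIntegrable_energy (T := T) hΩ hdζ hγ hq hy
  have fj := (faceCont_cellTrace hy).sub (faceCont_faceTrace hyf)
  have fj2 : FaceCont fun F x => (y F.cell x - yf F.face x) ^ 2 := fun F => (fj F).pow 2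
  have fE := faceCont_energy (τ := τ₁) hζ hy hyf
  have hq0 : 0 ≤ T.cellInt fun K x => ⟪q K x, q K x⟫ := cellInt_nonneg fun _ _ => real_inner_self_nonneg
  have e1 : T.cellInt (fun K x => ⟪q K x, q K x⟫) + c * T.cellInt (fun K x => y K x ^ 2)
      ≤ T.cellInt (fun K x => ⟪q K x, q K x⟫ + (γ x - 1 / 2 * dζ x) * (y K x * y K x)) := by
    rw [← cellInt_const_mul, ← cellInt_add iq (iy.const_mul c)]
    refine cellInt_mono_ae (iq.add (iy.const_mul c)) iE fun K => ?_
    filter_upwards [ae_mono (restrict_cell_le hΩ K) hcoer] with x hx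
    rw [← sq]
    exact add_le_add le_rfl (mul_le_mul_of_nonneg_right (hcγ.trans hx) (sq_nonneg _))
  have e2 : T.bdryInt (fun F x => (τ₁ F - 1 / 2 * ⟪ζ x, F.normal⟫) *
      ((y F.cell x - yf F.face x) * (y F.cell x - yf F.face x)))
      = T.bdryInt (fun F x => (τ₁ F - 1 / 2 * ⟪ζ x, F.normal⟫) *
        (y F.cell x - yf F.face x) ^ 2) := bdryInt_congr fun F x _ => by rw [← sq]
  have e3 : c * T.bdryInt (fun F x => (y F.cell x - yf F.face x) ^ 2)
      ≤ T.bdryInt (fun F x => (τ₁ F - 1 / 2 * ⟪ζ x, F.normal⟫) *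
      ((y F.cell x - yf F.face x) * (y F.cell x - yf F.face x))) := by
    rw [← bdryInt_const_mul]
    refine bdryInt_mono (fj2.const_mul c) fE fun F x hx => ?_
    rw [← sq]
    exact mul_le_mul_of_nonneg_right (hcc.trans (hτ F x hx)) (sq_nonneg _)
  rw [← e2]
  have e4 : 0 ≤ T.bdryInt (fun F x => (τ₁ F - 1 / 2 * ⟪ζ x, F.normal⟫) *
      ((y F.cell x - yf F.face x) * (y F.cell x - yf F.face x))) :=
    (mul_nonneg hc (bdryInt_nonneg fun _ _ _ => sq_nonneg _)).trans e3
  have e5 := mul_le_mul_of_nonneg_right hc1 hq0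
  have e6 := mul_le_mul_of_nonneg_right hc1 e4
  constructor
  · rw [mul_add, mul_add]; linarith
  · rw [mul_add]; linarith

end ErrorEquations

end Triangulation

end HDG

/-! ### From projected errors to the energy norm -/

namespace HDG

/-- The sum of the squared seminorms of the solution. -/
noncomputable def dataSq {n : ℕ} (Ω : Set (Pt n)) (j : ℕ) (qv : Pt n → Pt n) (y : Pt n → ℝ)
    (pv : Pt n → Pt n) (p : Pt n → ℝ) : ℝ :=
  seminormSq Ω j p + (∑ i, seminormSq Ω j fun x => pv x i) + seminormSq Ω j y
    + ∑ i, seminormSq Ω j fun x => qv x i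

/-- Passage from squares to norms by √(a + b) ≤ √a + √b, where √β and h ^ (2 * k + 1) are recognised
as the squares of β ^ (1 / 4) and h ^ (k + 1 / 2). -/
theorem sqrt_error_le {β h C X₁ X₂ X₃ X₄ : ℝ} (k : ℕ) (hβ : 0 ≤ β) (hh : 0 ≤ h) (hC : 0 ≤ C)
    (h₁ : 0 ≤ X₁) (h₂ : 0 ≤ X₂) (h₃ : 0 ≤ X₃) (h₄ : 0 ≤ X₄) :
    Real.sqrt (C * (Real.sqrt β * h ^ (2 * k + 1) + h ^ (2 * (k + 1))) * (X₁ + X₂ + X₃ + X₄))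
      ≤ Real.sqrt C * (β ^ (1 / 4 : ℝ) * h ^ ((k : ℝ) + 1 / 2) + h ^ (k + 1))
        * (Real.sqrt X₁ + Real.sqrt X₂ + Real.sqrt X₃ + Real.sqrt X₄) := by
  have a1 : (β ^ (1 / 4 : ℝ)) ^ 2 = Real.sqrt β := by
    rw [← Real.rpow_natCast, ← Real.rpow_mul hβ, Real.sqrt_eq_rpow]; norm_num
  have a2 : (h ^ ((k : ℝ) + 1 / 2)) ^ 2 = h ^ (2 * k + 1) := by
    rw [← Real.rpow_natCast, ← Real.rpow_mul hh, ← Real.rpow_natCast]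
    congr 1; push_cast; ring
  set s := β ^ (1 / 4 : ℝ) * h ^ ((k : ℝ) + 1 / 2) with hs
  have hs0 : 0 ≤ s := mul_nonneg (Real.rpow_nonneg hβ _) (Real.rpow_nonneg hh _)
  have hs2 : s ^ 2 = Real.sqrt β * h ^ (2 * k + 1) := by rw [hs, mul_pow, a1, a2]
  have ht : (0 : ℝ) ≤ h ^ (k + 1) := pow_nonneg hh _
  have hN : X₁ + X₂ + X₃ + X₄
      ≤ (Real.sqrt X₁ + Real.sqrt X₂ + Real.sqrt X₃ + Real.sqrt X₄) ^ 2 := by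
    have i1 := Real.sqrt_nonneg X₁
    have i2 := Real.sqrt_nonneg X₂
    have i3 := Real.sqrt_nonneg X₃
    have i4 := Real.sqrt_nonneg X₄
    have e1 := Real.sq_sqrt h₁
    have e2 := Real.sq_sqrt h₂
    have e3 := Real.sq_sqrt h₃
    have e4 := Real.sq_sqrt h₄
    have j1 := mul_nonneg i1 i2
    have j2 := mul_nonneg (add_nonneg i1 i2) i3
    have j3 := mul_nonneg (add_nonneg (add_nonneg i1 i2) i3) i4
    nlinarith
  refine Real.sqrt_le_iff.2 ⟨by positivity, ?_⟩
  rw [mul_pow, mul_pow, Real.sq_sqrt hC]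
  have h5 : Real.sqrt β * h ^ (2 * k + 1) + h ^ (2 * (k + 1)) ≤ (s + h ^ (k + 1)) ^ 2 := by
    rw [← hs2, show h ^ (2 * (k + 1)) = (h ^ (k + 1)) ^ 2 by ring]
    nlinarith [mul_nonneg hs0 ht]
  gcongr

namespace Triangulation

variable {m k : ℕ} {Ω : Set (Pt (m + 1))} {T : Triangulation Ω}

theorem cellInt_sub_cellProjVec_le (hΩ : IsConvexPolytopeDomain Ω) {σ : ℝ} (hσ : 0 < σ)
    (hT : T.ShapeRegular σ) {V : Pt (m + 1) → Pt (m + 1)} (hV : MemHVec Ω (k + 1) V) :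
    T.cellInt (fun K x => ⟪V x - T.cellProjVec k V K x, V x - T.cellProjVec k V K x⟫)
      ≤ 2 * ((m + 2) * 2 ^ (m + 1)) * T.meshSize ^ (2 * (k + 1))
        * ∑ i, seminormSq Ω (k + 1) fun x => V x i := by
  have i1 : ∀ (K : T.Cell) (i : Fin (m + 1)),
      IntegrableOn (fun x => (V x i - T.cellProj k (fun z => V z i) K x) ^ 2) K.carrier :=
    fun K i => ((MemLp.cell hΩ (hV i).1 K).sub
      (memLp_isPoly_cell K _ (isPoly_cellProj (fun z => V z i) K))).integrable_sq
  have e1 : T.cellInt (fun K x => ⟪V x - T.cellProjVec k V K x, V x - T.cellProjVec k V K x⟫)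
      = ∑ i, ∑ K : T.Cell, ∫ x in K.carrier,
        (V x i - T.cellProj k (fun z => V z i) K x) ^ 2 := by
    rw [cellInt, Finset.sum_comm]
    refine Finset.sum_congr rfl fun K _ => ?_
    rw [← integral_finsetSum _ fun i _ => i1 K i]
    refine integral_congr_ae (Filter.Eventually.of_forall fun x => ?_)
    simp only [inner_eq_sum, ← sq]
    rfl
  rw [e1, Finset.mul_sum]
  exact Finset.sum_le_sum fun i _ => sum_integral_sub_cellProj_le hΩ hσ hT (hV i)

/-- The energy norm of the error is controlled by the energy of the projected error and by the
projection errors. -/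
theorem energyNorm_le (hΩ : IsConvexPolytopeDomain Ω) {β : ℝ} {ζ : Pt (m + 1) → Pt (m + 1)}
    (hζ : ContinuousOn ζ (closure Ω)) {τ : T.HalfFace → ℝ} {A : ℝ} (hA0 : 0 ≤ A)
    (hA : ∀ F : T.HalfFace, ∀ x ∈ F.face.carrier, |τ F - 1 / 2 * ⟪ζ x, F.normal⟫| ≤ A)
    (h0 : ∀ F : T.HalfFace, ∀ x ∈ F.face.carrier, 0 ≤ τ F - 1 / 2 * ⟪ζ x, F.normal⟫)
    {V : Pt (m + 1) → Pt (m + 1)} (hV : ∀ i, MemLp (fun x => V x i) 2 (volume.restrict Ω))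
    {u : Pt (m + 1) → ℝ} (hu : ContinuousOn u (closure Ω)) (hu0 : ∀ x ∈ frontier Ω, u x = 0)
    {qh : T.Cell → Pt (m + 1) → Pt (m + 1)} {yh : T.Cell → Pt (m + 1) → ℝ}
    {yhat : T.Face → Pt (m + 1) → ℝ} (hqh : T.MemV k qh) (hyh : T.MemW k yh)
    (hyhat : T.MemLambda0 k yhat) :
    T.energyNorm β ζ τ (fun K x => V x - qh K x) (fun K x => u x - yh K x)
        (fun e x => u x - yhat e x)
      ≤ Real.sqrt (2 * (Real.sqrt β * (T.cellInt (fun K x => ⟪T.cellProjVec k V K x - qh K x,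
            T.cellProjVec k V K x - qh K x⟫)
          + T.cellInt (fun K x => (T.cellProj k u K x - yh K x) ^ 2)
          + T.bdryInt fun F x => (τ F - 1 / 2 * ⟪ζ x, F.normal⟫)
            * (T.cellProj k u F.cell x - yh F.cell x
              - (T.faceProj k u F.face x - yhat F.face x)) ^ 2)
          + T.cellInt (fun K x => (T.cellProj k u K x - yh K x) ^ 2))
        + (2 * Real.sqrt β * (T.cellInt (fun K x => ⟪V x - T.cellProjVec k V K x,
            V x - T.cellProjVec k V K x⟫)
          + T.cellInt (fun K x => (u x - T.cellProj k u K x) ^ 2)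
          + 4 * A * T.bdryInt fun F x => (u x - T.cellProj k u F.cell x) ^ 2)
          + 2 * T.cellInt (fun K x => (u x - T.cellProj k u K x) ^ 2))) := by
  have hVP := memV_cellProjVec (T := T) (k := k) V
  have hδ : ∀ K : T.Cell, ContinuousOn (fun x => u x - T.cellProj k u K x) K.carrier := fun K =>
    (continuousOn_cell hu K).sub (isPoly_cellProj u K).continuous.continuousOn
  have hε := (isPoly_cellProj (T := T) (k := k) u).sub hyh
  have iδ : CellIntegrable fun (K : T.Cell) x => (u x - T.cellProj k u K x) ^ 2 :=
    CellIntegrable.of_continuousOn fun K => (hδ K).pow 2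
  have iε : CellIntegrable fun (K : T.Cell) x => (T.cellProj k u K x - yh K x) ^ 2 :=
    CellIntegrable.of_continuousOn fun K => ((hε K).continuous.pow 2).continuousOn
  have iV : ∀ {r : T.Cell → Pt (m + 1) → Pt (m + 1)}, T.MemV k r → CellIntegrable fun K x =>
      ⟪V x - r K x, V x - r K x⟫ := fun hr K => by
    simp_rw [inner_eq_sum]
    refine integrable_finsetSum _ fun i _ => ?_
    have h1 := (MemLp.cell hΩ (hV i) K).sub (memLp_isPoly_cell K _ (hr K i))
    exact h1.integrable_mul h1
  have iP : CellIntegrable fun (K : T.Cell) x => ⟪T.cellProjVec k V K x - qh K x,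
      T.cellProjVec k V K x - qh K x⟫ :=
    CellIntegrable.of_continuousOn fun K => (((hVP.sub hqh).continuous K).inner
      ((hVP.sub hqh).continuous K)).continuousOn
  have b1 : T.cellInt (fun K x => ⟪V x - qh K x, V x - qh K x⟫)
      ≤ 2 * T.cellInt (fun K x => ⟪T.cellProjVec k V K x - qh K x,
          T.cellProjVec k V K x - qh K x⟫)
        + 2 * T.cellInt (fun K x => ⟪V x - T.cellProjVec k V K x,
          V x - T.cellProjVec k V K x⟫) := by
    rw [← cellInt_const_mul, ← cellInt_const_mul,
      ← cellInt_add (iP.const_mul 2) ((iV hVP).const_mul 2)]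
    refine cellInt_mono_ae (iV hqh) ((iP.const_mul 2).add ((iV hVP).const_mul 2)) fun K =>
      Filter.Eventually.of_forall fun x => ?_
    have h1 : V x - qh K x = (T.cellProjVec k V K x - qh K x) + (V x - T.cellProjVec k V K x) := by
      abel
    simp only [real_inner_self_eq_norm_sq]
    rw [h1]
    have h2 := norm_add_le (T.cellProjVec k V K x - qh K x) (V x - T.cellProjVec k V K x)
    have h3 := pow_le_pow_left₀ (norm_nonneg _) h2 2
    nlinarith [sq_nonneg (‖T.cellProjVec k V K x - qh K x‖ - ‖V x - T.cellProjVec k V K x‖)]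
  have b2 : T.cellInt (fun K x => (u x - yh K x) * (u x - yh K x))
      ≤ 2 * T.cellInt (fun K x => (T.cellProj k u K x - yh K x) ^ 2)
        + 2 * T.cellInt (fun K x => (u x - T.cellProj k u K x) ^ 2) := by
    rw [← cellInt_const_mul, ← cellInt_const_mul,
      ← cellInt_add (iε.const_mul 2) (iδ.const_mul 2)]
    refine cellInt_mono_ae ?_ ((iε.const_mul 2).add (iδ.const_mul 2)) fun K =>
      Filter.Eventually.of_forall fun x => ?_
    · exact CellIntegrable.of_continuousOn fun K =>
        ((continuousOn_cell hu K).sub (hyh K).continuous.continuousOn).mul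
          ((continuousOn_cell hu K).sub (hyh K).continuous.continuousOn)
    · show (u x - yh K x) * (u x - yh K x) ≤ 2 * (T.cellProj k u K x - yh K x) ^ 2
        + 2 * (u x - T.cellProj k u K x) ^ 2
      nlinarith [sq_nonneg ((T.cellProj k u K x - yh K x) - (u x - T.cellProj k u K x))]
  have fδ : FaceCont fun (F : T.HalfFace) x => (u x - T.cellProj k u F.cell x) ^ 2 := fun F =>
    (((faceCont_of_closure hu).sub (faceCont_cellTrace (isPoly_cellProj u))) F).pow 2
  have fδ' : FaceCont fun (F : T.HalfFace) x => (u x - T.faceProj k u F.face x) ^ 2 := fun F =>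
    (((faceCont_of_closure hu).sub (faceCont_faceTrace (memLambda0_faceProj u))) F).pow 2
  have fw : FaceCont fun (F : T.HalfFace) x => τ F - 1 / 2 * ⟪ζ x, F.normal⟫ :=
    (faceCont_const τ).sub ((faceCont_inner_normal hζ).const_mul (1 / 2))
  have fj : FaceCont fun (F : T.HalfFace) x => (τ F - 1 / 2 * ⟪ζ x, F.normal⟫)
      * (T.cellProj k u F.cell x - yh F.cell x - (T.faceProj k u F.face x - yhat F.face x)) ^ 2 :=
    fw.mul fun F => (((faceCont_cellTrace hε).sub
      (faceCont_faceTrace ((memLambda0_faceProj u).sub hyhat))) F).pow 2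
  -- The exact value cancels in the jump, which is the jump of the projected errors plus the
  -- difference of the element and face projection errors. On that difference the weight is
  -- estimated by A, and squaring the two sums produces the factor 4.
  have b3 : T.bdryInt (fun F x => (|τ F - 1 / 2 * ⟪ζ x, F.normal⟫|
        * ((u x - yh F.cell x) - (u x - yhat F.face x)))
        * ((u x - yh F.cell x) - (u x - yhat F.face x)))
      ≤ 2 * T.bdryInt (fun F x => (τ F - 1 / 2 * ⟪ζ x, F.normal⟫)
            * (T.cellProj k u F.cell x - yh F.cell x
              - (T.faceProj k u F.face x - yhat F.face x)) ^ 2)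
        + 4 * A * T.bdryInt (fun F x => (u x - T.cellProj k u F.cell x) ^ 2)
        + 4 * A * T.bdryInt (fun F x => (u x - T.faceProj k u F.face x) ^ 2) := by
    rw [← bdryInt_const_mul, ← bdryInt_const_mul, ← bdryInt_const_mul,
      ← bdryInt_add (fj.const_mul 2) (fδ.const_mul (4 * A)),
      ← bdryInt_add ((fj.const_mul 2).add (fδ.const_mul (4 * A))) (fδ'.const_mul (4 * A))]
    refine bdryInt_mono ?_ (((fj.const_mul 2).add (fδ.const_mul (4 * A))).add
      (fδ'.const_mul (4 * A))) fun F x hx => ?_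
    · have ft := (((faceCont_of_closure (T := T) hu).sub (faceCont_cellTrace hyh)).sub
        ((faceCont_of_closure hu).sub (faceCont_faceTrace hyhat)))
      exact FaceCont.mul (FaceCont.mul (fun F => (fw F).abs) ft) ft
    · have h1 := h0 F x hx
      have h2 := hA F x hx
      rw [abs_of_nonneg h1] at h2 ⊢
      set θ := τ F - 1 / 2 * ⟪ζ x, F.normal⟫
      set a := T.cellProj k u F.cell x
      set b := T.faceProj k u F.face x
      have h3 : ((u x - yh F.cell x) - (u x - yhat F.face x)) ^ 2
          ≤ 2 * (a - yh F.cell x - (b - yhat F.face x)) ^ 2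
            + (4 * (u x - a) ^ 2 + 4 * (u x - b) ^ 2) := by
        have h4 : (u x - yh F.cell x) - (u x - yhat F.face x)
          = (a - yh F.cell x - (b - yhat F.face x)) + ((u x - a) - (u x - b)) := by ring
        rw [h4]
        generalize a - yh F.cell x - (b - yhat F.face x) = s
        nlinarith [sq_nonneg (s - ((u x - a) - (u x - b))), sq_nonneg ((u x - a) + (u x - b))]
      have h5 := mul_le_mul_of_nonneg_left h3 h1
      have h6 : θ * (4 * (u x - a) ^ 2 + 4 * (u x - b) ^ 2)
          ≤ A * (4 * (u x - a) ^ 2 + 4 * (u x - b) ^ 2) :=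
        mul_le_mul_of_nonneg_right h2 (by positivity)
      linarith
  -- The face projection error is absorbed by the trace of the element projection error, so one
  -- trace estimate suffices.
  have b4 := bdryInt_sub_faceProj_le (T := T) (k := k) hu hu0
  have b5 := mul_le_mul_of_nonneg_left b4 (by positivity : (0 : ℝ) ≤ 4 * A)
  have b6 := b3.trans (add_le_add le_rfl b5)
  rw [energyNorm]
  refine Real.sqrt_le_sqrt ?_
  rw [innerCellVec_eq, innerCell_eq, innerBdry_eq]
  simp only [cellTrace, faceTrace, zetaN]
  have hb := Real.sqrt_nonneg β
  have b7 := mul_le_mul_of_nonneg_left (add_le_add (add_le_add b1 b2) b6) hb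
  linarith

end Triangulation

end HDG

/-! ### The bound for the projected errors -/

namespace HDG

namespace Triangulation

variable {m : ℕ} {Ω : Set (Pt (m + 1))}

/-- The estimate of the projected errors. -/
theorem exists_projected_error_le (k : ℕ) (hΩ : IsConvexPolytopeDomain Ω)
    {ζ : Pt (m + 1) → Pt (m + 1)} (hζ : ∀ i, MemW1inf Ω (fun x => ζ x i))
    (hζc : ContinuousOn ζ (closure Ω)) {dζ : Pt (m + 1) → ℝ} (hdiv : HasWeakDiv Ω ζ dζ)
    {γ : Pt (m + 1) → ℝ} (hγ : MemW1inf Ω γ) {γ₀ : ℝ} (hγ₀ : 0 < γ₀)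
    (hcoer : ∀ᵐ x ∂volume.restrict Ω, γ₀ ≤ γ x - 1 / 2 * dζ x)
    {σ c₀ : ℝ} (hσ : 0 < σ) (hc₀ : 0 < c₀) (A : ℝ) :
    ∃ C : ℝ, 0 < C ∧ ∀ β : ℝ, 0 < β → ∀ T : Triangulation Ω, T.ShapeRegular σ →
      ∀ (τ₁ : T.HalfFace → ℝ) (τ₂ : T.HalfFace → Pt (m + 1) → ℝ) (C₁ Cstar : ℝ),
      T.StabilizerAssumption ζ C₁ Cstar τ₁ τ₂ →
      (∀ F : T.HalfFace, ∀ x ∈ F.face.carrier, c₀ ≤ τ₁ F - 1 / 2 * T.zetaN ζ F x) →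
      (∀ F : T.HalfFace, τ₁ F ≤ A) →
      (∀ F : T.HalfFace, ∀ x ∈ F.face.carrier, |⟪ζ x, F.normal⟫ - τ₁ F| ≤ A) →
      ∀ f g : Pt (m + 1) → ℝ, MemLp f 2 (volume.restrict Ω) → MemLp g 2 (volume.restrict Ω) →
      ∀ (qv : Pt (m + 1) → Pt (m + 1)) (y : Pt (m + 1) → ℝ) (pv : Pt (m + 1) → Pt (m + 1))
        (p : Pt (m + 1) → ℝ), SolvesOptimalitySystem Ω β ζ γ f g qv y pv p →
      MemHVec Ω (k + 1) qv → MemH Ω (k + 1) y → MemHVec Ω (k + 1) pv → MemH Ω (k + 1) p →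
      ∀ (qh : T.Cell → Pt (m + 1) → Pt (m + 1)) (yh : T.Cell → Pt (m + 1) → ℝ)
        (yhat : T.Face → Pt (m + 1) → ℝ) (ph : T.Cell → Pt (m + 1) → Pt (m + 1))
        (sh : T.Cell → Pt (m + 1) → ℝ) (phat : T.Face → Pt (m + 1) → ℝ),
      T.IsHDGSolution k β ζ dζ γ f g τ₁ τ₂ qh yh yhat ph sh phat →
      Real.sqrt β *
        ((T.cellInt (fun K x => ⟪T.cellProjVec k qv K x - qh K x, T.cellProjVec k qv K x - qh K x⟫)
          + T.cellInt (fun K x => (T.cellProj k y K x - yh K x) ^ 2)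
          + T.bdryInt (fun F x => (τ₁ F - 1 / 2 * ⟪ζ x, F.normal⟫) *
            (T.cellProj k y F.cell x - yh F.cell x
              - (T.faceProj k y F.face x - yhat F.face x)) ^ 2))
        + (T.cellInt (fun K x => ⟪T.cellProjVec k pv K x - ph K x,
            T.cellProjVec k pv K x - ph K x⟫)
          + T.cellInt (fun K x => (T.cellProj k p K x - sh K x) ^ 2)
          + T.bdryInt (fun F x => (τ₁ F - 1 / 2 * ⟪ζ x, F.normal⟫) *
            (T.cellProj k p F.cell x - sh F.cell x
              - (T.faceProj k p F.face x - phat F.face x)) ^ 2)))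
        + (T.cellInt (fun K x => (T.cellProj k y K x - yh K x) ^ 2)
          + T.cellInt (fun K x => (T.cellProj k p K x - sh K x) ^ 2))
      ≤ C * (Real.sqrt β * T.meshSize ^ (2 * k + 1)) * dataSq Ω (k + 1) qv y pv p := by
  haveI := hΩ.isFiniteMeasure
  obtain ⟨L, -, hL⟩ := exists_lipschitz_vec hΩ hζ hζc
  have hdζ := HasWeakDiv.memLp_top hΩ.isOpen hζ hdiv
  obtain ⟨Mγ, hMγ0, hMγ⟩ := MemLp.ae_bdd hγ.1
  obtain ⟨Mζ, hMζ0, hMζ⟩ := MemLp.ae_bdd hdζ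
  have hγ2 : MemLp γ 2 (volume.restrict Ω) := hγ.1.mono_exponent le_top
  have hdζ2 : MemLp dζ 2 (volume.restrict Ω) := hdζ.mono_exponent le_top
  obtain ⟨CF, hCF, HF⟩ := exists_fluxDefect_sq_le m k hσ
  obtain ⟨CS, hCS, HS⟩ := exists_scalarDefect_sq_le k hσ hΩ hζc hL (Mγ + Mζ) A
  -- A common lower bound for the coefficients of the flux, scalar and jump terms of the energy.
  set c := min 1 (min γ₀ c₀) with hc
  have hcp : 0 < c := lt_min one_pos (lt_min hγ₀ hc₀)
  have hc1 : c ≤ 1 := min_le_left _ _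
  have hcγ : c ≤ γ₀ := (min_le_right _ _).trans (min_le_left _ _)
  have hcc : c ≤ c₀ := (min_le_right _ _).trans (min_le_right _ _)
  -- The factor 2 * (CF + CS) bounds the squared sum of both defects; the rest is the constant of
  -- `energy_add_le_of_residual_le`.
  refine ⟨8 * (2 * (CF + CS)) / c ^ 2, by positivity, ?_⟩
  intro β hβ T hT τ₁ τ₂ C₁ Cstar hτ hτc hτA hzA f g hf hg qv y pv p hs hqv hy hpv hp
    qh yh yhat ph sh phat H
  have hb : 0 < Real.sqrt β := Real.sqrt_pos.2 hβ
  obtain ⟨Gp, hGp, hpG⟩ := hs.adjoint_flux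
  obtain ⟨dp, du, hdp, hdu, hpeq⟩ := hs.adjoint_eq
  obtain ⟨Gy, dq, hGy, hdq, hqG, hyeq⟩ := hs.state_eq
  have hGyL := HasWeakGradient.memLp hΩ.isOpen hy hGy
  have hGpL := HasWeakGradient.memLp hΩ.isOpen hp hGp
  have hdqL := HasWeakDiv.memLp hΩ.isOpen hqv hdq
  have hdpL := HasWeakDiv.memLp hΩ.isOpen hpv hdp
  have hqL := fun i => (hqv i).1
  have hpL := fun i => (hpv i).1
  -- The adjoint equation expresses the weak divergence of p ζ by square integrable functions, so no
  -- product rule is needed.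
  have hduL : MemLp du 2 (volume.restrict Ω) := by
    have h1 : MemLp (fun x => dp x + p x * γ x - (Real.sqrt β)⁻¹ * (f x - y x)) 2
        (volume.restrict Ω) :=
      (hdpL.add (MemLp.mul_bdd hp.1 hγ2.aestronglyMeasurable hMγ)).sub
        ((hf.sub hy.1).const_mul _)
    refine h1.ae_eq (hpeq.mono fun x hx => ?_)
    simp only [← hx]
    field_simp
    ring
  -- the projected errors
  have mq := (memV_cellProjVec (T := T) (k := k) qv).sub H.mem_qh
  have mp := (memV_cellProjVec (T := T) (k := k) pv).sub H.mem_ph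
  have my := (isPoly_cellProj (T := T) (k := k) y).sub H.mem_yh
  have ms := (isPoly_cellProj (T := T) (k := k) p).sub H.mem_sh
  have myf := (memLambda0_faceProj (T := T) (k := k) y).sub H.mem_yhat
  have msf := (memLambda0_faceProj (T := T) (k := k) p).sub H.mem_phat
  have fy := (fluxRelation_proj (T := T) (k := k) hΩ hs.state_continuous hs.state_boundary hGy hGyL
    hqL hqG).sub (memV_cellProjVec qv) H.mem_qh (isPoly_cellProj y) H.mem_yh
    (memLambda0_faceProj y) H.mem_yhat (fluxRelation_of_eq hβ H.mem_qh H.mem_yh H.eq_q)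
  have fs := (fluxRelation_proj (T := T) (k := k) hΩ hs.adjoint_continuous hs.adjoint_boundary hGp
    hGpL hpL hpG).sub (memV_cellProjVec pv) H.mem_ph (isPoly_cellProj p) H.mem_sh
    (memLambda0_faceProj p) H.mem_phat (fluxRelation_of_eq hβ H.mem_ph H.mem_sh H.eq_p)
  have eqS := fun (w : T.Cell → Pt (m + 1) → ℝ) (μ : T.Face → Pt (m + 1) → ℝ) (hw : T.MemW k w)
    (hμ : T.MemLambda0 k μ) => state_error_eq (T := T) hΩ hζc hdiv hdζ2 hγ2 hs.state_continuous hp.1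
      hg hGy hGyL hqL hdqL hyeq H hw hμ
  have eqA := fun (w : T.Cell → Pt (m + 1) → ℝ) (μ : T.Face → Pt (m + 1) → ℝ) (hw : T.MemW k w)
    (hμ : T.MemLambda0 k μ) => adjoint_error_eq (T := T) hΩ hζc hγ2 hτ hs.adjoint_continuous hy.1 hf
      hdu hduL hpL hdpL hpeq H hw hμ
  -- residual bounds
  have nc := faceCont_inner_normal (T := T) hζc
  have tc := faceCont_const (T := T) (m := m) τ₁
  have tτ : FaceCont fun (F : T.HalfFace) (_ : Pt (m + 1)) => - τ₁ F := faceCont_const fun F => - τ₁ F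
  have hτA' : ∀ F : T.HalfFace, |τ₁ F| ≤ A := fun F => by
    rw [abs_of_pos (hτ.pos F)]; exact hτA F
  have hh0 := T.meshSize_nonneg
  set N := dataSq Ω (k + 1) qv y pv p with hN
  have s1 := seminormSq_nonneg Ω (k + 1) p
  have s2 : 0 ≤ ∑ i, seminormSq Ω (k + 1) fun x => pv x i :=
    Finset.sum_nonneg fun i _ => seminormSq_nonneg _ _ _
  have s3 := seminormSq_nonneg Ω (k + 1) y
  have s4 : 0 ≤ ∑ i, seminormSq Ω (k + 1) fun x => qv x i :=
    Finset.sum_nonneg fun i _ => seminormSq_nonneg _ _ _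
  have hbd : ∀ {r₁ r₂ a₁ a₂ W J : ℝ}, 0 ≤ W → 0 ≤ J → a₁ ≤ N → a₂ ≤ N →
      r₁ ^ 2 ≤ CF * T.meshSize ^ (2 * k + 1) * a₁ * J →
      r₂ ^ 2 ≤ CS * T.meshSize ^ (2 * k + 1) * a₂ * (W + J) →
      (- (r₁ + r₂)) ^ 2 ≤ 2 * (CF + CS) * T.meshSize ^ (2 * k + 1) * N * (W + J) := by
    intro r₁ r₂ a₁ a₂ W J hW hJ h1 h2 h3 h4
    have hN0 : 0 ≤ N := by rw [hN, dataSq]; positivity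
    have e1 : CF * T.meshSize ^ (2 * k + 1) * a₁ * J
        ≤ CF * T.meshSize ^ (2 * k + 1) * N * (W + J) := by
      have := le_add_of_nonneg_left (a := J) hW
      gcongr
    have e2 : CS * T.meshSize ^ (2 * k + 1) * a₂ * (W + J)
        ≤ CS * T.meshSize ^ (2 * k + 1) * N * (W + J) := by gcongr
    have e3 : 2 * (CF + CS) * T.meshSize ^ (2 * k + 1) * N * (W + J)
        = 2 * (CF * T.meshSize ^ (2 * k + 1) * N * (W + J)
          + CS * T.meshSize ^ (2 * k + 1) * N * (W + J)) := by ring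
    rw [e3]
    nlinarith [sq_nonneg (r₁ - r₂)]
  have cw0 : ∀ w : T.Cell → Pt (m + 1) → ℝ, 0 ≤ T.cellInt (fun K x => w K x ^ 2) := fun w =>
    cellInt_nonneg fun _ _ => sq_nonneg _
  have jw0 : ∀ (w : T.Cell → Pt (m + 1) → ℝ) (μ : T.Face → Pt (m + 1) → ℝ),
      0 ≤ T.bdryInt (fun F x => (w F.cell x - μ F.face x) ^ 2) := fun w μ =>
    bdryInt_nonneg fun _ _ _ => sq_nonneg _
  have bS := fun (w : T.Cell → Pt (m + 1) → ℝ) (μ : T.Face → Pt (m + 1) → ℝ) (hw : T.MemW k w)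
    (hμ : T.MemLambda0 k μ) => hbd (cw0 w) (jw0 w μ)
      (by rw [hN, dataSq]; linarith) (by rw [hN, dataSq]; linarith)
      (HF hΩ T hT qv dq hqv hdq hdqL w μ hw hμ)
      (HS T hT (fun x => γ x - dζ x) (-1) (fun F _ => τ₁ F) (fun F x => ⟪ζ x, F.normal⟫ - τ₁ F)
        (hγ2.aestronglyMeasurable.sub hdζ2.aestronglyMeasurable)
        (by filter_upwards [hMγ, hMζ] with x h1 h2
            exact (abs_sub _ _).trans (add_le_add h1 h2))
        (by norm_num) tc (fun F _ _ => hτA' F) (nc.sub tc) hzA y hy hs.state_continuous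
        hs.state_boundary w μ hw hμ)
  have bA := fun (w : T.Cell → Pt (m + 1) → ℝ) (μ : T.Face → Pt (m + 1) → ℝ) (hw : T.MemW k w)
    (hμ : T.MemLambda0 k μ) => hbd (cw0 w) (jw0 w μ)
      (by rw [hN, dataSq]; linarith) (by rw [hN, dataSq]; linarith)
      (HF hΩ T hT pv dp hpv hdp hdpL w μ hw hμ)
      (HS T hT γ 1 (fun F x => τ₁ F - ⟪ζ x, F.normal⟫) (fun F _ => - τ₁ F)
        hγ2.aestronglyMeasurable
        (by filter_upwards [hMγ] with x h1
            linarith)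
        (by norm_num) (tc.sub nc) (fun F x hx => by rw [abs_sub_comm]; exact hzA F x hx) tτ
        (fun F _ _ => by rw [abs_neg]; exact hτA' F) p hp hs.adjoint_continuous
        hs.adjoint_boundary w μ hw hμ)
  -- energy identities
  have E1 := stateForm_self (τ := τ₁) hΩ hζc hdiv hdζ2 hγ2 mq my myf fy
  have E2 := adjointForm_self (τ := τ₁) hΩ hζc hdiv hdζ2 hγ2 mp ms msf fs
  have E3 := adjointForm_eq_stateForm (τ := τ₁) hΩ hζc hdiv hdζ2 hγ2 mq my myf fy mp ms msf fs
  -- In the sum of the diagonal tests q1 and q2 the coupling terms cancel. In the difference of the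
  -- crossed tests q3 and q4 the forms cancel by E3, which leaves the two squared L² norms.
  have q1 := eqS _ _ my myf
  have q2 := eqA _ _ ms msf
  have q3 := eqA _ _ my myf
  have q4 := eqS _ _ ms msf
  obtain ⟨k1, k2⟩ := energy_coercive (T := T) hΩ hζc hdζ2 hγ2 hcp.le hc1 hcγ hcc hcoer hτc mq my myf
  obtain ⟨k3, k4⟩ := energy_coercive (T := T) hΩ hζc hdζ2 hγ2 hcp.le hc1 hcγ hcc hcoer hτc mp ms msf
  have r1 := bS _ _ my myf
  have r2 := bA _ _ ms msf
  have r3 := bA _ _ my myf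
  have r4 := bS _ _ ms msf
  have com : T.cellInt (fun K x => (T.cellProj k p K x - sh K x) * (T.cellProj k y K x - yh K x))
      = T.cellInt fun K x => (T.cellProj k y K x - yh K x) * (T.cellProj k p K x - sh K x) :=
    cellInt_congr fun K x _ => mul_comm _ _
  simp only [← sq] at q3 q4
  rw [E1, com] at q1
  rw [E2] at q2
  rw [E3] at q3
  have z1 := cw0 fun K x => T.cellProj k y K x - yh K x
  have z2 := cw0 fun K x => T.cellProj k p K x - sh K x
  have z3 := jw0 (fun K x => T.cellProj k y K x - yh K x) fun e x => T.faceProj k y e x - yhat e x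
  have z4 := jw0 (fun K x => T.cellProj k p K x - sh K x) fun e x => T.faceProj k p e x - phat e x
  have hM0 : 0 ≤ 2 * (CF + CS) * T.meshSize ^ (2 * k + 1) * N := by
    have : 0 ≤ N := by rw [hN, dataSq]; positivity
    positivity
  -- Each residual is controlled by the part of X that belongs to its test function, hence by the
  -- whole of X.
  have fin := energy_add_le_of_residual_le hb hcp hc1 hM0
    (add_nonneg (add_nonneg z1 z3) (add_nonneg z2 z4))
    (E := (T.cellInt (fun K x => ⟪T.cellProjVec k qv K x - qh K x, T.cellProjVec k qv K x - qh K x⟫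
          + (γ x - 1 / 2 * dζ x) * ((T.cellProj k y K x - yh K x) * (T.cellProj k y K x - yh K x)))
        + T.bdryInt (fun F x => (τ₁ F - 1 / 2 * ⟪ζ x, F.normal⟫) *
          ((T.cellProj k y F.cell x - yh F.cell x - (T.faceProj k y F.face x - yhat F.face x)) *
          (T.cellProj k y F.cell x - yh F.cell x - (T.faceProj k y F.face x - yhat F.face x)))))
      + (T.cellInt (fun K x => ⟪T.cellProjVec k pv K x - ph K x, T.cellProjVec k pv K x - ph K x⟫
          + (γ x - 1 / 2 * dζ x) * ((T.cellProj k p K x - sh K x) * (T.cellProj k p K x - sh K x)))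
        + T.bdryInt (fun F x => (τ₁ F - 1 / 2 * ⟪ζ x, F.normal⟫) *
          ((T.cellProj k p F.cell x - sh F.cell x - (T.faceProj k p F.face x - phat F.face x)) *
          (T.cellProj k p F.cell x - sh F.cell x - (T.faceProj k p F.face x - phat F.face x))))))
    (S := T.cellInt (fun K x => (T.cellProj k y K x - yh K x) ^ 2)
      + T.cellInt (fun K x => (T.cellProj k p K x - sh K x) ^ 2))
    (mul_left_cancel₀ hb.ne' (by linear_combination q1 + q2))
    (by linear_combination q3 - q4)
    (r1.trans (mul_le_mul_of_nonneg_left (le_add_of_nonneg_right (add_nonneg z2 z4)) hM0))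
    (r2.trans (mul_le_mul_of_nonneg_left (le_add_of_nonneg_left (add_nonneg z1 z3)) hM0))
    (r3.trans (mul_le_mul_of_nonneg_left (le_add_of_nonneg_right (add_nonneg z2 z4)) hM0))
    (r4.trans (mul_le_mul_of_nonneg_left (le_add_of_nonneg_left (add_nonneg z1 z3)) hM0))
    (by rw [mul_add]; exact add_le_add k2 k4)
    (by rw [mul_add]; exact add_le_add k1 k3)
  exact fin.trans_eq (by ring)

end Triangulation

end HDG

/-! ### The error estimate -/

namespace HDG

namespace Triangulation

variable {m : ℕ} {Ω : Set (Pt (m + 1))}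

/-- The error estimate of the method, in any dimension. -/
theorem exists_error_le (hΩ : IsConvexPolytopeDomain Ω)
    {ζ : Pt (m + 1) → Pt (m + 1)} (hζ : ∀ i, MemW1inf Ω (fun x => ζ x i))
    (hζc : ContinuousOn ζ (closure Ω)) {dζ : Pt (m + 1) → ℝ} (hdiv : HasWeakDiv Ω ζ dζ)
    {γ : Pt (m + 1) → ℝ} (hγ : MemW1inf Ω γ) {γ₀ : ℝ} (hγ₀ : 0 < γ₀)
    (hcoer : ∀ᵐ x ∂volume.restrict Ω, γ₀ ≤ γ x - 1 / 2 * dζ x) (k : ℕ)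
    {σ C₁ Cstar c₀ : ℝ} (hσ : 0 < σ) (hC₁ : 0 < C₁) (hc₀ : 0 < c₀) :
    ∃ C : ℝ, 0 < C ∧ ∀ β : ℝ, 0 < β → ∀ T : Triangulation Ω, T.ShapeRegular σ →
      ∀ (τ₁ : T.HalfFace → ℝ) (τ₂ : T.HalfFace → Pt (m + 1) → ℝ),
      T.StabilizerAssumption ζ C₁ Cstar τ₁ τ₂ →
      (∀ F : T.HalfFace, ∀ x ∈ F.face.carrier, c₀ ≤ τ₁ F - 1 / 2 * T.zetaN ζ F x) →
      ∀ f g : Pt (m + 1) → ℝ, MemLp f 2 (volume.restrict Ω) → MemLp g 2 (volume.restrict Ω) →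
      ∀ (qv : Pt (m + 1) → Pt (m + 1)) (y : Pt (m + 1) → ℝ) (pv : Pt (m + 1) → Pt (m + 1))
        (p : Pt (m + 1) → ℝ), SolvesOptimalitySystem Ω β ζ γ f g qv y pv p →
      MemHVec Ω (k + 1) qv → MemH Ω (k + 1) y → MemHVec Ω (k + 1) pv → MemH Ω (k + 1) p →
      ∀ (qh : T.Cell → Pt (m + 1) → Pt (m + 1)) (yh : T.Cell → Pt (m + 1) → ℝ)
        (yhat : T.Face → Pt (m + 1) → ℝ) (ph : T.Cell → Pt (m + 1) → Pt (m + 1))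
        (sh : T.Cell → Pt (m + 1) → ℝ) (phat : T.Face → Pt (m + 1) → ℝ),
      T.IsHDGSolution k β ζ dζ γ f g τ₁ τ₂ qh yh yhat ph sh phat →
      T.energyNorm β ζ τ₁ (fun K x => qv x - qh K x) (fun K x => y x - yh K x)
          (fun e x => y x - yhat e x)
        + T.energyNorm β ζ τ₁ (fun K x => pv x - ph K x) (fun K x => p x - sh K x)
          (fun e x => p x - phat e x)
      ≤ C * (β ^ (1 / 4 : ℝ) * T.meshSize ^ ((k : ℝ) + 1 / 2) + T.meshSize ^ (k + 1))
        * (seminormH Ω (k + 1) p + seminormHVec Ω (k + 1) pv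
          + seminormH Ω (k + 1) y + seminormHVec Ω (k + 1) qv) := by
  obtain ⟨Z, hZ⟩ := hΩ.isCompact_closure.exists_bound_of_continuousOn hζc
  have hZ0 : 0 ≤ Z := by
    obtain ⟨x, hx⟩ := hΩ.nonempty
    exact (norm_nonneg _).trans (hZ x (subset_closure hx))
  -- One bound for τ₁, for ζ · n - τ₁ and for the weight τ₁ - 1/2 ζ · n, since Z bounds |ζ|.
  set A := C₁ + Z with hAd
  have hA0 : 0 ≤ A := add_nonneg hC₁.le hZ0
  obtain ⟨C, hC, HP⟩ := exists_projected_error_le k hΩ hζ hζc hdiv hγ hγ₀ hcoer hσ hc₀ A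
  obtain ⟨Cb, hCb, HB⟩ := exists_sum_trace_sub_cellProj_le m k hσ
  set D := Metric.diam (closure Ω) with hD
  have hD0 : 0 ≤ D := Metric.diam_nonneg
  set A0 : ℝ := 2 * ((m + 2) * 2 ^ (m + 1)) with hA0d
  have hA0p : 0 < A0 := by positivity
  -- The summands account for the projected errors, for the projection errors weighted with √β, and
  -- for the unweighted L² projection error, which alone produces h ^ (2 * (k + 1)) without √β.
  set B := 2 * C + 2 * (A0 * D + 4 * A * Cb) + 2 * A0 with hB
  have hBp : 0 < B := by positivity
  refine ⟨2 * Real.sqrt B, by positivity, ?_⟩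
  intro β hβ T hT τ₁ τ₂ hτ hτc f g hf hg qv y pv p hs hqv hy hpv hp qh yh yhat ph sh phat H
  have hn : ∀ F : T.HalfFace, ∀ x ∈ F.face.carrier, |⟪ζ x, F.normal⟫| ≤ Z := fun F x hx => by
    refine (abs_real_inner_le_norm _ _).trans ?_
    rw [norm_normal, mul_one]
    exact hZ x (face_subset_closure F hx)
  have hab : ∀ F : T.HalfFace, |τ₁ F| ≤ C₁ := fun F => by
    rw [abs_of_pos (hτ.pos F)]; exact hτ.le F
  have hw : ∀ F : T.HalfFace, ∀ x ∈ F.face.carrier, |τ₁ F - 1 / 2 * ⟪ζ x, F.normal⟫| ≤ A := by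
    intro F x hx
    refine (abs_sub _ _).trans (add_le_add (hab F) ?_)
    rw [abs_mul, abs_of_pos (by norm_num : (0 : ℝ) < 1 / 2)]
    linarith [hn F x hx, abs_nonneg ⟪ζ x, F.normal⟫]
  have hw0 : ∀ F : T.HalfFace, ∀ x ∈ F.face.carrier, 0 ≤ τ₁ F - 1 / 2 * ⟪ζ x, F.normal⟫ :=
    fun F x hx => hc₀.le.trans (hτc F x hx)
  have key := HP β hβ T hT τ₁ τ₂ C₁ Cstar hτ hτc
    (fun F => (hτ.le F).trans (le_add_of_nonneg_right hZ0))
    (fun F x hx => (abs_sub _ _).trans (by rw [add_comm]; exact add_le_add (hab F) (hn F x hx)))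
    f g hf hg qv y pv p hs hqv hy hpv hp qh yh yhat ph sh phat H
  have hb : 0 ≤ Real.sqrt β := Real.sqrt_nonneg β
  have hh0 := T.meshSize_nonneg
  have hhD : T.meshSize ≤ D := meshSize_le_diam hΩ T
  set N := dataSq Ω (k + 1) qv y pv p with hN
  have s1 := seminormSq_nonneg Ω (k + 1) p
  have s2 : 0 ≤ ∑ i, seminormSq Ω (k + 1) fun x => pv x i :=
    Finset.sum_nonneg fun i _ => seminormSq_nonneg _ _ _
  have s3 := seminormSq_nonneg Ω (k + 1) y
  have s4 : 0 ≤ ∑ i, seminormSq Ω (k + 1) fun x => qv x i :=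
    Finset.sum_nonneg fun i _ => seminormSq_nonneg _ _ _
  have jn : ∀ (u : Pt (m + 1) → ℝ) (w : T.Cell → Pt (m + 1) → ℝ) (μ : T.Face → Pt (m + 1) → ℝ),
      0 ≤ T.bdryInt fun F x => (τ₁ F - 1 / 2 * ⟪ζ x, F.normal⟫)
        * (T.cellProj k u F.cell x - w F.cell x - (T.faceProj k u F.face x - μ F.face x)) ^ 2 :=
    fun u w μ => bdryInt_nonneg fun F x hx => mul_nonneg (hw0 F x hx) (sq_nonneg _)
  have qn : ∀ r : T.Cell → Pt (m + 1) → Pt (m + 1), 0 ≤ T.cellInt fun K x => ⟪r K x, r K x⟫ :=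
    fun r => cellInt_nonneg fun _ _ => real_inner_self_nonneg
  have cn : ∀ w : T.Cell → Pt (m + 1) → ℝ, 0 ≤ T.cellInt fun K x => w K x ^ 2 :=
    fun w => cellInt_nonneg fun _ _ => sq_nonneg _
  -- the two error norms are treated alike
  have main : ∀ {Q S J Q' S' J' X Y : ℝ}, Real.sqrt β * (Q + S + J) + S
        ≤ C * (Real.sqrt β * T.meshSize ^ (2 * k + 1)) * N →
      X + Y ≤ N → 0 ≤ X → 0 ≤ Y →
      Q' ≤ A0 * T.meshSize ^ (2 * (k + 1)) * X → S' ≤ A0 * T.meshSize ^ (2 * (k + 1)) * Y →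
      J' ≤ Cb * T.meshSize ^ (2 * k + 1) * Y →
      2 * (Real.sqrt β * (Q + S + J) + S)
        + (2 * Real.sqrt β * (Q' + S' + 4 * A * J') + 2 * S')
      ≤ B * (Real.sqrt β * T.meshSize ^ (2 * k + 1) + T.meshSize ^ (2 * (k + 1))) * N := by
    intro Q S J Q' S' J' X Y h1 hXY hX hY h2 h3 h4
    have hN0 : 0 ≤ N := (add_nonneg hX hY).trans hXY
    have hYN : Y ≤ N := by linarith
    have h5 : Q' + S' ≤ A0 * D * (T.meshSize ^ (2 * k + 1) * N) := by
      calc Q' + S' ≤ A0 * T.meshSize ^ (2 * (k + 1)) * (X + Y) := by linarith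
        _ ≤ A0 * T.meshSize ^ (2 * (k + 1)) * N := by gcongr
        _ = A0 * T.meshSize * (T.meshSize ^ (2 * k + 1) * N) := by ring
        _ ≤ _ := by gcongr
    have h6 : S' ≤ A0 * (T.meshSize ^ (2 * (k + 1)) * N) :=
      (h3.trans (by gcongr)).trans_eq (mul_assoc A0 (T.meshSize ^ (2 * (k + 1))) N)
    have h7 : J' ≤ Cb * (T.meshSize ^ (2 * k + 1) * N) :=
      (h4.trans (by gcongr)).trans_eq (mul_assoc Cb (T.meshSize ^ (2 * k + 1)) N)
    have h8 : 2 * Real.sqrt β * (Q' + S' + 4 * A * J')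
        ≤ 2 * Real.sqrt β * (A0 * D * (T.meshSize ^ (2 * k + 1) * N)
          + 4 * A * (Cb * (T.meshSize ^ (2 * k + 1) * N))) := by gcongr
    have h9 : 0 ≤ Real.sqrt β * T.meshSize ^ (2 * k + 1) * N := by positivity
    have h10 : 0 ≤ T.meshSize ^ (2 * (k + 1)) * N := by positivity
    have h11 : 0 ≤ (2 * C + 2 * (A0 * D + 4 * A * Cb)) * (T.meshSize ^ (2 * (k + 1)) * N) := by
      positivity
    have h12 : 0 ≤ 2 * A0 * (Real.sqrt β * T.meshSize ^ (2 * k + 1) * N) := by positivity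
    have h13 : B * (Real.sqrt β * T.meshSize ^ (2 * k + 1) + T.meshSize ^ (2 * (k + 1))) * N
        = 2 * (C * (Real.sqrt β * T.meshSize ^ (2 * k + 1)) * N)
          + 2 * Real.sqrt β * (A0 * D * (T.meshSize ^ (2 * k + 1) * N)
          + 4 * A * (Cb * (T.meshSize ^ (2 * k + 1) * N)))
          + 2 * (A0 * (T.meshSize ^ (2 * (k + 1)) * N))
          + ((2 * C + 2 * (A0 * D + 4 * A * Cb)) * (T.meshSize ^ (2 * (k + 1)) * N)
            + 2 * A0 * (Real.sqrt β * T.meshSize ^ (2 * k + 1) * N)) := by rw [hB]; ring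
    rw [h13]
    linarith
  have t1 := (energyNorm_le (k := k) (β := β) hΩ hζc hA0 hw hw0 (fun i => (hqv i).1)
    hs.state_continuous hs.state_boundary H.mem_qh H.mem_yh H.mem_yhat).trans
    (Real.sqrt_le_sqrt (main (by
        have a1 := qn fun K x => T.cellProjVec k pv K x - ph K x
        have a2 := cn fun K x => T.cellProj k p K x - sh K x
        have a3 := mul_nonneg hb (add_nonneg (add_nonneg a1 a2) (jn p sh phat))
        linarith)
      (by rw [hN, dataSq]; linarith) s4 s3
      (cellInt_sub_cellProjVec_le hΩ hσ hT hqv) (sum_integral_sub_cellProj_le hΩ hσ hT hy)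
      (HB hΩ T hT y hy hs.state_continuous)))
  have t2 := (energyNorm_le (k := k) (β := β) hΩ hζc hA0 hw hw0 (fun i => (hpv i).1)
    hs.adjoint_continuous hs.adjoint_boundary H.mem_ph H.mem_sh H.mem_phat).trans
    (Real.sqrt_le_sqrt (main (by
        have a1 := qn fun K x => T.cellProjVec k qv K x - qh K x
        have a2 := cn fun K x => T.cellProj k y K x - yh K x
        have a3 := mul_nonneg hb (add_nonneg (add_nonneg a1 a2) (jn y yh yhat))
        linarith)
      (by rw [hN, dataSq]; linarith) s2 s1
      (cellInt_sub_cellProjVec_le hΩ hσ hT hpv) (sum_integral_sub_cellProj_le hΩ hσ hT hp)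
      (HB hΩ T hT p hp hs.adjoint_continuous)))
  have t3 := sqrt_error_le k hβ.le hh0 hBp.le s1 s2 s3 s4
  rw [← dataSq, ← hN] at t3
  have t4 := add_le_add (t1.trans t3) (t2.trans t3)
  refine t4.trans_eq ?_
  rw [seminormH, seminormH, seminormHVec, seminormHVec]
  ring

end Triangulation

end HDG

theorem mainTheorem1 (n : ℕ) (hn : n = 2 ∨ n = 3)
    (Ω : Set (HDG.Pt n)) (hΩ : HDG.IsConvexPolytopeDomain Ω)
    (ζ : HDG.Pt n → HDG.Pt n) (hζ : ∀ i, HDG.MemW1inf Ω (fun x => ζ x i))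
    (hζc : ContinuousOn ζ (closure Ω))
    (divζ : HDG.Pt n → ℝ) (hdivζ : HDG.HasWeakDiv Ω ζ divζ)
    (γ : HDG.Pt n → ℝ) (hγ : HDG.MemW1inf Ω γ)
    (hγnonneg : ∀ᵐ x ∂volume.restrict Ω, 0 ≤ γ x)
    (γ₀ : ℝ) (hγ₀ : 0 < γ₀)
    (hcoer : ∀ᵐ x ∂volume.restrict Ω, γ₀ ≤ γ x - 1 / 2 * divζ x)
    (k : ℕ)
    (σ ρ C₁ Cstar c₀ : ℝ) (hσ : 0 < σ) (hρ : 0 < ρ) (hC₁ : 0 < C₁) (hCstar : 0 < Cstar)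
    (hc₀ : 0 < c₀) :
    ∃ C : ℝ, 0 < C ∧
      ∀ β : ℝ, 0 < β →
      ∀ T : HDG.Triangulation Ω, T.ShapeRegular σ → T.QuasiUniform ρ →
      ∀ (τ₁ : T.HalfFace → ℝ) (τ₂ : T.HalfFace → HDG.Pt n → ℝ),
        T.StabilizerAssumption ζ C₁ Cstar τ₁ τ₂ →
        (∀ F : T.HalfFace, ∀ x ∈ F.face.carrier, c₀ ≤ τ₁ F - 1 / 2 * T.zetaN ζ F x) →
      ∀ f g : HDG.Pt n → ℝ,
        MemLp f 2 (volume.restrict Ω) → MemLp g 2 (volume.restrict Ω) →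
      ∀ (qv : HDG.Pt n → HDG.Pt n) (y : HDG.Pt n → ℝ)
        (pv : HDG.Pt n → HDG.Pt n) (p : HDG.Pt n → ℝ),
        HDG.SolvesOptimalitySystem Ω β ζ γ f g qv y pv p →
        HDG.MemHVec Ω (k + 1) qv → HDG.MemH Ω (k + 1) y →
        HDG.MemHVec Ω (k + 1) pv → HDG.MemH Ω (k + 1) p →
      ∀ (qh : T.Cell → HDG.Pt n → HDG.Pt n) (yh : T.Cell → HDG.Pt n → ℝ)
        (yhat : T.Face → HDG.Pt n → ℝ)
        (ph : T.Cell → HDG.Pt n → HDG.Pt n) (sh : T.Cell → HDG.Pt n → ℝ)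
        (phat : T.Face → HDG.Pt n → ℝ),
        T.IsHDGSolution k β ζ divζ γ f g τ₁ τ₂ qh yh yhat ph sh phat →
        T.energyNorm β ζ τ₁ (fun K x => qv x - qh K x) (fun K x => y x - yh K x)
            (fun e x => y x - yhat e x)
          + T.energyNorm β ζ τ₁ (fun K x => pv x - ph K x) (fun K x => p x - sh K x)
            (fun e x => p x - phat e x)
        ≤ C * (β ^ (1 / 4 : ℝ) * T.meshSize ^ ((k : ℝ) + 1 / 2) + T.meshSize ^ (k + 1))
          * (HDG.seminormH Ω (k + 1) p + HDG.seminormHVec Ω (k + 1) pv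
            + HDG.seminormH Ω (k + 1) y + HDG.seminormHVec Ω (k + 1) qv) := by
  -- The geometry is set up in dimension m + 1, so that faces have dimension m.
  obtain ⟨m, rfl⟩ : ∃ m, n = m + 1 := ⟨n - 1, by omega⟩
  obtain ⟨C, hC, H⟩ := HDG.Triangulation.exists_error_le (Cstar := Cstar) hΩ hζ hζc hdivζ hγ hγ₀
    hcoer k hσ hC₁ hc₀
  exact ⟨C, hC, fun β hβ T hT _ => H β hβ T hT⟩
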